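/- **Setting.** Let $\Omega=(a,b)$ with $a<b$, let $0<T<\infty$, let $m_0\ge 5$ be an integer, and let $\psi_0:[a,b]\to\mathbb C$, $\phi_0,\phi_1:[a,b]\to\mathbb R$ be independent of $\varepsilon$. For every $\varepsilon\in(0,1]$ let $(\psi,\phi)=(\psi^\varepsilon,\phi^\varepsilon)$, $\psi$ complex and $\phi$ real, be a solution on $[0,T]$ of the Klein–Gordon–Schrödinger system $$ i\partial_t\psi+\partial_{xx}\psi+\phi\psi=0,\qquad \varepsilon^2\partial_{tt}\phi-\partial_{xx}\phi+\tfrac1{\varepsilon^2}\phi-|\psi|^2=0\qquad\text{in }\Omega, $$ with $\psi(\cdot,0)=\psi_0$, $\phi(\cdot,0)=\phi_0$, $\partial_t\phi(\cdot,0)=\varepsilon^{-2}\phi_1$ and periodic boundary conditions for $\psi,\phi,\partial_x\psi,\partial_x\phi$. Let $H^m_{\rm per}(\Omega)=\{u\in H^m(\Omega): u^{(k)}(a)=u^{(k)}(b),\ 0\le k\le m-1\}$ and $\|u\|_{H^m}^2=\sum_{k\le m}\|u^{(k)}\|_{L^2(\Omega)}^2$. Assumption (A): for every $\varepsilon\in(0,1]$,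 $\psi\in C([0,T];H^{m_0}_{\rm per})$ and $\phi\in C^1([0,T];H^{m_0}_{\rm per})$, and $$C_\psi:=\sup_{0<\varepsilon\le1}\|\psi\|_{L^\infty([0,T];H^{m_0})}<\infty,\qquad C_\phi:=\sup_{0<\varepsilon\le1}\max\{\|\phi\|_{L^\infty([0,T];H^{m_0})},\ \varepsilon^2\|\partial_t\phi\|_{L^\infty([0,T];H^{m_0})}\}<\infty.$$ **Numerical method.** Let $N\ge2$ be even, $h=(b-a)/N$, $x_j=a+jh$ $(0\le j\le N)$, $\tau>0$, $t_n=n\tau$, $\mu_l=2\pi l/(b-a)$. Below $l$ runs through $-N/2,\dots,N/2-1$; for a grid vector $\mathbf v=(v_0,\dots,v_N)$ with $v_0=v_N$ put $\widetilde{\mathbf v}_l=\frac1N\sum_{j=0}^{N-1}v_je^{-i\mu_l(x_j-a)}$ and $(I_N\mathbf v)(x)=\sum_l\widetilde{\mathbf v}_le^{i\mu_l(x-a)}$. Products, conjugates and moduli of grid vectors are taken componentwise. Put $\omega_l=\varepsilon^{-2}\sqrt{1+\varepsilon^2\mu_l^2}$, $\lambda_l^\pm=-\varepsilon^{-2}(1\pm\sqrt{1+\varepsilon^2\mu_l^2})$,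 $$a_l(s)=\frac{\lambda_l^+e^{is\lambda_l^-}-\lambda_l^-e^{is\lambda_l^+}}{\lambda_l^+-\lambda_l^-},\quad p_l=\int_0^\tau\frac{\sin(\omega_l(\tau-\theta))}{\varepsilon^2\omega_l}d\theta,\quad q_l=\int_0^\tau\theta\,\frac{\sin(\omega_l(\tau-\theta))}{\varepsilon^2\omega_l}d\theta,$$ $$p_l'=\int_0^\tau\frac{\cos(\omega_l(\tau-\theta))}{\varepsilon^2}d\theta,\quad q_l'=\int_0^\tau\theta\,\frac{\cos(\omega_l(\tau-\theta))}{\varepsilon^2}d\theta,$$ $$c_l^\pm=ie^{-i\mu_l^2\tau}\int_0^\tau e^{i(\mu_l^2\pm\varepsilon^{-2})\theta}d\theta,\qquad d_l^\pm=ie^{-i\mu_l^2\tau}\int_0^\tau\theta\, e^{i(\mu_l^2\pm\varepsilon^{-2})\theta}d\theta.$$ The multiscale time integrator Fourier pseudospectral (MTI-FP) method starts from $\Phi^0_j=\phi_0(x_j)$, $\dot\Phi^0_j=\varepsilon^{-2}\phi_1(x_j)$, $\Psi^0_j=\psi_0(x_j)$. Given $(\Phi^n,\dot\Phi^n,\Psi^n)$,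 put $\mathbf v^{n,0}=\frac12(\Phi^n-i\varepsilon^2\dot\Phi^n)$ and define grid vectors $\dot\Psi^n,\mathbf v^{n,1},\dot{\mathbf v}^{n,1},\mathbf r^{n,1},\dot{\mathbf r}^{n,1},\Psi^{n+1}$ by their discrete Fourier coefficients $$\widetilde{(\dot\Psi^n)}_l=-i\tfrac{\sin(\mu_l^2\tau)}{\tau}\widetilde{(\Psi^n)}_l+i\widetilde{(\Phi^n\Psi^n)}_l,\quad \widetilde{(\mathbf v^{n,1})}_l=a_l(\tau)\widetilde{(\mathbf v^{n,0})}_l,\quad \widetilde{(\dot{\mathbf v}^{n,1})}_l=a_l'(\tau)\widetilde{(\mathbf v^{n,0})}_l,$$ $$\widetilde{(\mathbf r^{n,1})}_l=p_l\widetilde{(|\Psi^n|^2)}_l+2q_l\widetilde{(\mathrm{Re}(\overline{\Psi^n}\dot\Psi^n))}_l,\quad \widetilde{(\dot{\mathbf r}^{n,1})}_l=p_l'\widetilde{(|\Psi^n|^2)}_l+2q_l'\widetilde{(\mathrm{Re}(\overline{\Psi^n}\dot\Psi^n))}_l,$$ $$\widetilde{(\Psi^{n+1})}_l=e^{-i\mu_l^2\tau}\widetilde{(\Psi^n)}_l+c_l^+\widetilde{(\mathbf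 v^{n,0}\Psi^n)}_l+d_l^+\widetilde{(\mathbf v^{n,0}\dot\Psi^n)}_l+c_l^-\widetilde{(\overline{\mathbf v^{n,0}}\Psi^n)}_l+d_l^-\widetilde{(\overline{\mathbf v^{n,0}}\dot\Psi^n)}_l,$$ and set $$\Phi^{n+1}=e^{i\tau/\varepsilon^2}\mathbf v^{n,1}+e^{-i\tau/\varepsilon^2}\overline{\mathbf v^{n,1}}+\mathbf r^{n,1},\quad \dot\Phi^{n+1}=e^{i\tau/\varepsilon^2}\bigl(\dot{\mathbf v}^{n,1}+\tfrac{i}{\varepsilon^2}\mathbf v^{n,1}\bigr)+e^{-i\tau/\varepsilon^2}\bigl(\overline{\dot{\mathbf v}^{n,1}}-\tfrac{i}{\varepsilon^2}\overline{\mathbf v^{n,1}}\bigr)+\dot{\mathbf r}^{n,1}.$$ **Multiscale interpolation.** For $n\ge0$, $0\le s\le\tau$ put $$\mathbf\Psi(t_n+s)=\tfrac{\tau-s}\tau\Psi^n+\tfrac s\tau\Psi^{n+1},\qquad \mathbf\Phi(t_n+s)=e^{is/\varepsilon^2}\bigl(\tfrac{\tau-s}\tau\mathbf v^{n,0}+\tfrac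 s\tau\mathbf v^{n,1}\bigr)+\text{c.c.}+\tfrac s\tau\mathbf r^{n,1},$$ where c.c. is the complex conjugate of the preceding term. **Theorem.** Under assumption (A) there are constants $0<h_0<1$, $0<\tau_0<1$ and $C>0$, independent of $\varepsilon,h,\tau$, such that for all $0<\varepsilon\le1$, all $h=(b-a)/N\le h_0$ ($N$ positive and even) and all $0<\tau\le\tau_0$ the following holds. (i) (The bounds at the time levels, with the same $h_0,\tau_0$.) For all $n\ge0$ with $n\tau\le T$, the sum $$\|\psi(\cdot,t_n)-I_N\Psi^n\|_{H^1}+\|\phi(\cdot,t_n)-I_N\Phi^n\|_{H^1}+\varepsilon^2\|\partial_t\phi(\cdot,t_n)-I_N\dot\Phi^n\|_{H^1}$$ is at most $C(h^{m_0-1}+\tau^2/\varepsilon^2)$ and at most $C(h^{m_0-1}+\varepsilon^2)$, and $\|I_N\Psi^n\|_{H^1}\le C_\psi+1$, $\|I_N\Phi^n\|_{H^1}\le C_\phi+1$, $\|I_N\dot\Phi^n\|_{H^1}\le\varepsilon^{-2}(C_\phi+1)$. (ii) $\mathbf\Psi(t)$ and $\mathbf\Phi(t)$ are well defined for every $t\ge0$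 (at each $t_{n+1}$ the two formulas agree). (iii) For every $t\in[0,T]$, each of the errors $e=\|\psi(\cdot,t)-(I_N\mathbf\Psi)(\cdot,t)\|_{H^1}$ and $e=\|\phi(\cdot,t)-(I_N\mathbf\Phi)(\cdot,t)\|_{H^1}$ satisfies $$e\le C\Bigl(h^{m_0-1}+\frac{\tau^2}{\varepsilon^2}\Bigr),\qquad e\le C\bigl(h^{m_0-1}+\tau+\varepsilon^2\bigr),$$ and consequently $$e\le C\Bigl(h^{m_0-1}+\tau+\max_{0<\epsilon\le1}\min\{\tau^2/\epsilon^2,\epsilon^2\}\Bigr),\qquad e\le C\bigl(h^{m_0-1}+\tau\bigr).$$ -/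

import Mathlib

open Set Filter Topology MeasureTheory
open scoped ENNReal ContDiff ComplexConjugate

noncomputable section

namespace KGS

/-! ### Sobolev spaces on the interval `(a,b)` -/

/-- `g` is the weak derivative of `u` on `(a,b)`: integration by parts holds against every
smooth real test function with compact support in `(a,b)`. -/
def IsWeakDeriv (a b : ℝ) (u g : ℝ → ℂ) : Prop :=
  ∀ η : ℝ → ℝ, ContDiff ℝ ∞ η → HasCompactSupport η → tsupport η ⊆ Ioo a b →
    ∫ x in Ioo a b, deriv η x • u x = -∫ x in Ioo a b, η x • g x

/-- `w 0 = u, w 1, …, w m` all lie in `L²(a,b)` and each is the weak derivative of the previous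
one, i.e. `w k = u^{(k)}` for `k ≤ m`. -/
structure IsWeakJet (a b : ℝ) (m : ℕ) (u : ℝ → ℂ) (w : ℕ → ℝ → ℂ) : Prop where
  zero : w 0 = u
  memLp : ∀ k ≤ m, MemLp (w k) 2 (volume.restrict (Ioo a b))
  weak : ∀ k < m, IsWeakDeriv a b (w k) (w (k + 1))

/-- The norm `‖u‖_{H^m(a,b)} = (∑_{k ≤ m} ‖u^{(k)}‖²_{L²(a,b)})^{1/2}`, with values in `[0,∞]`.
Weak derivatives are unique almost everywhere, so the infimum is over one single value if
`u ∈ H^m(a,b)`; it is `∞` if `u ∉ H^m(a,b)`. -/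
def hNorm (a b : ℝ) (m : ℕ) (u : ℝ → ℂ) : ℝ≥0∞ :=
  ⨅ (w : ℕ → ℝ → ℂ) (_ : IsWeakJet a b m u w),
    (∑ k ∈ Finset.range (m + 1),
      (eLpNorm (w k) 2 (volume.restrict (Ioo a b))) ^ 2) ^ (1 / 2 : ℝ)

/-- `u ∈ H^m_per(a,b)`: `u ∈ H^m(a,b)` and `u^{(k)}(a) = u^{(k)}(b)` for `k = 0,…,m-1`, where
`u, u', …, u^{(m-1)}` are the representatives that are continuous on `[a,b]`. -/
def MemHper (a b : ℝ) (m : ℕ) (u : ℝ → ℂ) : Prop :=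
  ∃ w : ℕ → ℝ → ℂ, IsWeakJet a b m u w ∧
    ∀ k < m, ContinuousOn (w k) (Icc a b) ∧ w k a = w k b

/-- `u ∈ C([0,T]; H^m_per(a,b))`, where `u t` is the function at time `t`. -/
def ContHper (a b T : ℝ) (m : ℕ) (u : ℝ → ℝ → ℂ) : Prop :=
  ∀ t ∈ Icc 0 T, MemHper a b m (u t) ∧
    Tendsto (fun s => hNorm a b m (fun x => u s x - u t x)) (𝓝[Icc 0 T] t) (𝓝 0)

/-- `u ∈ C¹([0,T]; H^m_per(a,b))` with time derivative `u'`. -/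
def ContDiffHper (a b T : ℝ) (m : ℕ) (u u' : ℝ → ℝ → ℂ) : Prop :=
  ContHper a b T m u ∧ ContHper a b T m u' ∧
    ∀ t ∈ Icc 0 T,
      Tendsto (fun s => hNorm a b m (fun x => (u s x - u t x) / ((s - t : ℝ) : ℂ) - u' t x))
        (𝓝[Icc 0 T \ {t}] t) (𝓝 0)

/-! ### The Klein–Gordon–Schrödinger system with periodic boundary conditions -/

/-- `(ψ,φ)` is a (classical) solution on `[a,b] × [0,T]`, with `φt = ∂_t φ`, of
`i ψ_t + ψ_xx + φ ψ = 0`, `ε² φ_tt - φ_xx + φ / ε² - |ψ|² = 0`,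
with initial values `ψ₀`, `φ₀`, `∂_t φ(·,0) = φ₁ / ε²` and periodic boundary conditions.
First argument of `ψ`, `φ`, `φt`: time; second argument: space. -/
structure IsSolution (a b T ε : ℝ) (ψ₀ : ℝ → ℂ) (φ₀ φ₁ : ℝ → ℝ)
    (ψ : ℝ → ℝ → ℂ) (φ φt : ℝ → ℝ → ℝ) : Prop where
  ψ_smooth : ∀ t ∈ Icc 0 T, ContDiffOn ℝ 2 (ψ t) (Icc a b)
  φ_smooth : ∀ t ∈ Icc 0 T, ContDiffOn ℝ 2 (φ t) (Icc a b)
  schrodinger : ∀ t ∈ Ioo 0 T, ∀ x ∈ Ioo a b, ∃ ψt : ℂ,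
    HasDerivAt (fun s => ψ s x) ψt t ∧
      Complex.I * ψt + iteratedDerivWithin 2 (ψ t) (Icc a b) x + (φ t x : ℂ) * ψ t x = 0
  φ_deriv : ∀ t ∈ Ioo 0 T, ∀ x ∈ Icc a b, HasDerivAt (fun s => φ s x) (φt t x) t
  kleinGordon : ∀ t ∈ Ioo 0 T, ∀ x ∈ Ioo a b, ∃ φtt : ℝ,
    HasDerivAt (fun s => φt s x) φtt t ∧
      ε ^ 2 * φtt - iteratedDerivWithin 2 (φ t) (Icc a b) x + 1 / ε ^ 2 * φ t x
        - ‖ψ t x‖ ^ 2 = 0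
  ψ_init : ∀ x ∈ Icc a b, ψ 0 x = ψ₀ x
  φ_init : ∀ x ∈ Icc a b, φ 0 x = φ₀ x
  φt_init : ∀ x ∈ Icc a b, φt 0 x = 1 / ε ^ 2 * φ₁ x
  ψ_per : ∀ t ∈ Icc 0 T, ψ t a = ψ t b ∧
    derivWithin (ψ t) (Icc a b) a = derivWithin (ψ t) (Icc a b) b
  φ_per : ∀ t ∈ Icc 0 T, φ t a = φ t b ∧
    derivWithin (φ t) (Icc a b) a = derivWithin (φ t) (Icc a b) b

/-- `C_ψ`: the supremum over `0 < ε ≤ 1` of `‖ψ‖_{L^∞([0,T];H^m)}`. -/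
def Cψ (a b T : ℝ) (m : ℕ) (ψ : ℝ → ℝ → ℝ → ℂ) : ℝ≥0∞ :=
  ⨆ ε ∈ Ioc (0 : ℝ) 1, ⨆ t ∈ Icc 0 T, hNorm a b m (ψ ε t)

/-- `C_φ`: the supremum over `0 < ε ≤ 1` of `‖φ‖_{L^∞([0,T];H^m)}` and
`ε² ‖∂_t φ‖_{L^∞([0,T];H^m)}`. -/
def Cφ (a b T : ℝ) (m : ℕ) (φ φt : ℝ → ℝ → ℝ → ℝ) : ℝ≥0∞ :=
  ⨆ ε ∈ Ioc (0 : ℝ) 1, ⨆ t ∈ Icc 0 T,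
    max (hNorm a b m (fun x => (φ ε t x : ℂ)))
      (ENNReal.ofReal (ε ^ 2) * hNorm a b m (fun x => (φt ε t x : ℂ)))

/-- Assumption (A) on a family of solutions indexed by `ε ∈ (0,1]`: regularity for every `ε`, and
bounds that are uniform in `ε`. -/
structure AssumptionA (a b T : ℝ) (m : ℕ) (ψ : ℝ → ℝ → ℝ → ℂ) (φ φt : ℝ → ℝ → ℝ → ℝ) :
    Prop where
  ψ_reg : ∀ ε ∈ Ioc (0 : ℝ) 1, ContHper a b T m (ψ ε)
  φ_reg : ∀ ε ∈ Ioc (0 : ℝ) 1,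
    ContDiffHper a b T m (fun t x => (φ ε t x : ℂ)) (fun t x => (φt ε t x : ℂ))
  ψ_bound : Cψ a b T m ψ < ⊤
  φ_bound : Cφ a b T m φ φt < ⊤

/-! ### Trigonometric interpolation on the uniform grid -/

/-- `μ_l = 2πl/(b-a)`. -/
def μ (a b : ℝ) (l : ℤ) : ℝ := 2 * Real.pi * l / (b - a)

/-- The mesh size `h = (b-a)/N`. -/
def mesh (a b : ℝ) (N : ℕ) : ℝ := (b - a) / N

/-- The grid points `x_j = a + j h`. -/
def gridPt (a b : ℝ) (N : ℕ) (j : Fin (N + 1)) : ℝ := a + (j : ℕ) * mesh a b N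

/-- The modes `l = -N/2, …, N/2 - 1`. -/
def modes (N : ℕ) : Finset ℤ := Finset.Ico (-((N / 2 : ℕ) : ℤ)) ((N / 2 : ℕ) : ℤ)

/-- The discrete Fourier coefficient `ṽ_l = N⁻¹ ∑_{j=0}^{N-1} v_j e^{-iμ_l(x_j-a)}`. -/
def dft (a b : ℝ) (N : ℕ) (v : Fin (N + 1) → ℂ) (l : ℤ) : ℂ :=
  (1 / N : ℂ) * ∑ j : Fin N, v j.castSucc *
    Complex.exp (-(Complex.I * (μ a b l : ℂ) * ((gridPt a b N j.castSucc - a : ℝ) : ℂ)))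

/-- The function `x ↦ ∑_l c_l e^{iμ_l(x-a)}` in `X_N`. -/
def trigPoly (a b : ℝ) (N : ℕ) (c : ℤ → ℂ) (x : ℝ) : ℂ :=
  ∑ l ∈ modes N, c l * Complex.exp (Complex.I * (μ a b l : ℂ) * ((x - a : ℝ) : ℂ))

/-- The trigonometric interpolation operator `I_N`. -/
def interpN (a b : ℝ) (N : ℕ) (v : Fin (N + 1) → ℂ) : ℝ → ℂ :=
  trigPoly a b N (dft a b N v)

/-- The grid function with prescribed discrete Fourier coefficients. -/
def ofCoeff (a b : ℝ) (N : ℕ) (c : ℤ → ℂ) : Fin (N + 1) → ℂ :=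
  fun j => trigPoly a b N c (gridPt a b N j)

/-! ### Coefficients of the scheme -/

/-- `ω_l = ε⁻² √(1 + ε² μ_l²)`. -/
def freq (a b ε : ℝ) (l : ℤ) : ℝ := 1 / ε ^ 2 * √(1 + ε ^ 2 * μ a b l ^ 2)

/-- `λ_l^+ = -ε⁻² (1 + √(1 + ε² μ_l²))`. -/
def lamP (a b ε : ℝ) (l : ℤ) : ℝ := -(1 / ε ^ 2) * (1 + √(1 + ε ^ 2 * μ a b l ^ 2))

/-- `λ_l^- = -ε⁻² (1 - √(1 + ε² μ_l²))`. -/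
def lamM (a b ε : ℝ) (l : ℤ) : ℝ := -(1 / ε ^ 2) * (1 - √(1 + ε ^ 2 * μ a b l ^ 2))

/-- `a_l(s) = (λ_l^+ e^{isλ_l^-} - λ_l^- e^{isλ_l^+}) / (λ_l^+ - λ_l^-)`. -/
def coefA (a b ε : ℝ) (l : ℤ) (s : ℝ) : ℂ :=
  ((lamP a b ε l : ℂ) * Complex.exp (Complex.I * s * lamM a b ε l)
    - (lamM a b ε l : ℂ) * Complex.exp (Complex.I * s * lamP a b ε l))
    / ((lamP a b ε l : ℂ) - lamM a b ε l)

/-- `a_l'(s) = i λ_l^+ λ_l^- (e^{isλ_l^-} - e^{isλ_l^+}) / (λ_l^+ - λ_l^-)`. -/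
def coefA' (a b ε : ℝ) (l : ℤ) (s : ℝ) : ℂ :=
  Complex.I * lamP a b ε l * lamM a b ε l *
    ((Complex.exp (Complex.I * s * lamM a b ε l) - Complex.exp (Complex.I * s * lamP a b ε l))
      / ((lamP a b ε l : ℂ) - lamM a b ε l))

/-- `p_l(τ)`. -/
def coefP (a b ε : ℝ) (l : ℤ) (τ : ℝ) : ℝ :=
  ∫ θ in (0 : ℝ)..τ, Real.sin (freq a b ε l * (τ - θ)) / (ε ^ 2 * freq a b ε l)

/-- `q_l(τ)`. -/
def coefQ (a b ε : ℝ) (l : ℤ) (τ : ℝ) : ℝ :=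
  ∫ θ in (0 : ℝ)..τ, θ * (Real.sin (freq a b ε l * (τ - θ)) / (ε ^ 2 * freq a b ε l))

/-- `p_l'(τ)`. -/
def coefP' (a b ε : ℝ) (l : ℤ) (τ : ℝ) : ℝ :=
  ∫ θ in (0 : ℝ)..τ, Real.cos (freq a b ε l * (τ - θ)) / ε ^ 2

/-- `q_l'(τ)`. -/
def coefQ' (a b ε : ℝ) (l : ℤ) (τ : ℝ) : ℝ :=
  ∫ θ in (0 : ℝ)..τ, θ * (Real.cos (freq a b ε l * (τ - θ)) / ε ^ 2)

/-- `c_l^±(τ)`, with `σ = ±1`. -/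
def coefC (a b ε σ : ℝ) (l : ℤ) (τ : ℝ) : ℂ :=
  Complex.I * Complex.exp (-(Complex.I * ((μ a b l ^ 2 * τ : ℝ) : ℂ))) *
    ∫ θ in (0 : ℝ)..τ, Complex.exp (Complex.I * (((μ a b l ^ 2 + σ / ε ^ 2) * θ : ℝ) : ℂ))

/-- `d_l^±(τ)`, with `σ = ±1`. -/
def coefD (a b ε σ : ℝ) (l : ℤ) (τ : ℝ) : ℂ :=
  Complex.I * Complex.exp (-(Complex.I * ((μ a b l ^ 2 * τ : ℝ) : ℂ))) *
    ∫ θ in (0 : ℝ)..τ,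
      (θ : ℂ) * Complex.exp (Complex.I * (((μ a b l ^ 2 + σ / ε ^ 2) * θ : ℝ) : ℂ))

/-! ### The MTI-FP method -/

/-- The numerical data `(Φ^n, Φ̇^n, Ψ^n)` at one time level. -/
structure Level (N : ℕ) where
  Φ : Fin (N + 1) → ℂ
  Φdot : Fin (N + 1) → ℂ
  Ψ : Fin (N + 1) → ℂ

section Step

variable (a b ε τ : ℝ) (N : ℕ) (L : Level N)

/-- `v_j^{n,0} = (φ_j^n - i ε² φ̇_j^n) / 2`. -/
def v0 : Fin (N + 1) → ℂ := fun j => 1 / 2 * (L.Φ j - Complex.I * (ε : ℂ) ^ 2 * L.Φdot j)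

/-- `Ψ̇^n`, whose coefficients are `-i (sin(μ_l² τ)/τ) (Ψ^n)~_l + i (Φ^n Ψ^n)~_l`. -/
def psiDot : Fin (N + 1) → ℂ := ofCoeff a b N fun l =>
  -(Complex.I * ((Real.sin (μ a b l ^ 2 * τ) / τ : ℝ) : ℂ) * dft a b N L.Ψ l)
    + Complex.I * dft a b N (fun j => L.Φ j * L.Ψ j) l

/-- `v^{n,1}`. -/
def v1 : Fin (N + 1) → ℂ := ofCoeff a b N fun l =>
  coefA a b ε l τ * dft a b N (v0 ε N L) l

/-- `v̇^{n,1}`. -/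
def v1dot : Fin (N + 1) → ℂ := ofCoeff a b N fun l =>
  coefA' a b ε l τ * dft a b N (v0 ε N L) l

/-- The grid function `|Ψ^n|²`. -/
def rho : Fin (N + 1) → ℂ := fun j => ((‖L.Ψ j‖ ^ 2 : ℝ) : ℂ)

/-- The grid function `Re (conj Ψ^n · Ψ̇^n)`. -/
def rhoDot : Fin (N + 1) → ℂ := fun j => (((conj (L.Ψ j) * psiDot a b τ N L j).re : ℝ) : ℂ)

/-- `r^{n,1}`. -/
def r1 : Fin (N + 1) → ℂ := ofCoeff a b N fun l =>
  (coefP a b ε l τ : ℂ) * dft a b N (rho N L) l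
    + 2 * (coefQ a b ε l τ : ℂ) * dft a b N (rhoDot a b τ N L) l

/-- `ṙ^{n,1}`. -/
def r1dot : Fin (N + 1) → ℂ := ofCoeff a b N fun l =>
  (coefP' a b ε l τ : ℂ) * dft a b N (rho N L) l
    + 2 * (coefQ' a b ε l τ : ℂ) * dft a b N (rhoDot a b τ N L) l

/-- `Ψ^{n+1}`. -/
def psiNext : Fin (N + 1) → ℂ := ofCoeff a b N fun l =>
  Complex.exp (-(Complex.I * ((μ a b l ^ 2 * τ : ℝ) : ℂ))) * dft a b N L.Ψ l
    + coefC a b ε 1 l τ * dft a b N (fun j => v0 ε N L j * L.Ψ j) l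
    + coefD a b ε 1 l τ * dft a b N (fun j => v0 ε N L j * psiDot a b τ N L j) l
    + coefC a b ε (-1) l τ * dft a b N (fun j => conj (v0 ε N L j) * L.Ψ j) l
    + coefD a b ε (-1) l τ * dft a b N (fun j => conj (v0 ε N L j) * psiDot a b τ N L j) l

/-- The phase `e^{is/ε²}`. -/
def phase (s : ℝ) : ℂ := Complex.exp (Complex.I * ((s / ε ^ 2 : ℝ) : ℂ))

/-- One time step of the MTI-FP method. -/
def step : Level N where
  Φ := fun j => phase ε τ * v1 a b ε τ N L j + conj (phase ε τ) * conj (v1 a b ε τ N L j)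
    + r1 a b ε τ N L j
  Φdot := fun j =>
    phase ε τ * (v1dot a b ε τ N L j + Complex.I / (ε : ℂ) ^ 2 * v1 a b ε τ N L j)
    + conj (phase ε τ) *
      (conj (v1dot a b ε τ N L j) - Complex.I / (ε : ℂ) ^ 2 * conj (v1 a b ε τ N L j))
    + r1dot a b ε τ N L j
  Ψ := psiNext a b ε τ N L

/-- `(τ-s)/τ ψ_j^n + s/τ ψ_j^{n+1}`. -/
def localPsi (s : ℝ) : Fin (N + 1) → ℂ := fun j =>
  (((τ - s) / τ : ℝ) : ℂ) * L.Ψ j + ((s / τ : ℝ) : ℂ) * psiNext a b ε τ N L j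

/-- Linear interpolation of `v_j^{n,0}`, `v_j^{n,1}`. -/
def localV (s : ℝ) : Fin (N + 1) → ℂ := fun j =>
  (((τ - s) / τ : ℝ) : ℂ) * v0 ε N L j + ((s / τ : ℝ) : ℂ) * v1 a b ε τ N L j

/-- Linear interpolation of `0`, `r_j^{n,1}`. -/
def localR (s : ℝ) : Fin (N + 1) → ℂ := fun j =>
  ((s / τ : ℝ) : ℂ) * r1 a b ε τ N L j

/-- `e^{is/ε²} (I_τ v_j^n)(s) + c.c. + (I_τ r_j^n)(s)`. -/
def localPhi (s : ℝ) : Fin (N + 1) → ℂ := fun j =>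
  phase ε s * localV a b ε τ N L s j + conj (phase ε s * localV a b ε τ N L s j)
    + localR a b ε τ N L s j

end Step

/-- The initial level: `φ_j^0 = φ₀(x_j)`, `φ̇_j^0 = ε⁻² φ₁(x_j)`, `ψ_j^0 = ψ₀(x_j)`. -/
def initLevel (a b ε : ℝ) (N : ℕ) (ψ₀ : ℝ → ℂ) (φ₀ φ₁ : ℝ → ℝ) : Level N where
  Φ := fun j => (φ₀ (gridPt a b N j) : ℂ)
  Φdot := fun j => ((1 / ε ^ 2 * φ₁ (gridPt a b N j) : ℝ) : ℂ)
  Ψ := fun j => ψ₀ (gridPt a b N j)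

/-- The numerical solution `(Φ^n, Φ̇^n, Ψ^n)`, `n ≥ 0`, of the MTI-FP method. -/
def num (a b ε τ : ℝ) (N : ℕ) (ψ₀ : ℝ → ℂ) (φ₀ φ₁ : ℝ → ℝ) : ℕ → Level N
  | 0 => initLevel a b ε N ψ₀ φ₀ φ₁
  | n + 1 => step a b ε τ N (num a b ε τ N ψ₀ φ₀ φ₁ n)

/-! ### The multiscale interpolation in time -/

/-- `Ψ(t) = localPsi` of level `n` at `s`, where `t = nτ + s`, `n = ⌊t/τ⌋`. -/
def Psi (a b ε τ : ℝ) (N : ℕ) (ψ₀ : ℝ → ℂ) (φ₀ φ₁ : ℝ → ℝ) (t : ℝ) : Fin (N + 1) → ℂ :=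
  localPsi a b ε τ N (num a b ε τ N ψ₀ φ₀ φ₁ ⌊t / τ⌋₊) (t - ⌊t / τ⌋₊ * τ)

/-- `Φ(t) = localPhi` of level `n` at `s`, where `t = nτ + s`, `n = ⌊t/τ⌋`. -/
def Phi (a b ε τ : ℝ) (N : ℕ) (ψ₀ : ℝ → ℂ) (φ₀ φ₁ : ℝ → ℝ) (t : ℝ) : Fin (N + 1) → ℂ :=
  localPhi a b ε τ N (num a b ε τ N ψ₀ φ₀ φ₁ ⌊t / τ⌋₊) (t - ⌊t / τ⌋₊ * τ)

/-- `max_{0 < e ≤ 1} min {τ²/e², e²}`. -/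
def maxMin (τ : ℝ) : ℝ := sSup ((fun e : ℝ => min (τ ^ 2 / e ^ 2) (e ^ 2)) '' Ioc 0 1)

/-! ### Errors -/

/-- `‖e_ψ^n‖_{H¹} + ‖e_φ^n‖_{H¹} + ε² ‖ė_φ^n‖_{H¹}` at the time level `t_n = nτ`, where `L` is the
numerical solution at this level. -/
def levelErr (a b ε τ : ℝ) (N n : ℕ) (ψ : ℝ → ℝ → ℂ) (φ φt : ℝ → ℝ → ℝ) (L : Level N) : ℝ≥0∞ :=
  hNorm a b 1 (fun x => ψ (n * τ) x - interpN a b N L.Ψ x)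
    + hNorm a b 1 (fun x => (φ (n * τ) x : ℂ) - interpN a b N L.Φ x)
    + ENNReal.ofReal (ε ^ 2) *
      hNorm a b 1 (fun x => (φt (n * τ) x : ℂ) - interpN a b N L.Φdot x)

/-- `‖ψ(·,t) - (I_N Ψ)(·,t)‖_{H¹}`. -/
def errPsi (a b ε τ : ℝ) (N : ℕ) (ψ₀ : ℝ → ℂ) (φ₀ φ₁ : ℝ → ℝ) (ψ : ℝ → ℝ → ℂ) (t : ℝ) : ℝ≥0∞ :=
  hNorm a b 1 (fun x => ψ t x - interpN a b N (Psi a b ε τ N ψ₀ φ₀ φ₁ t) x)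

/-- `‖φ(·,t) - (I_N Φ)(·,t)‖_{H¹}`. -/
def errPhi (a b ε τ : ℝ) (N : ℕ) (ψ₀ : ℝ → ℂ) (φ₀ φ₁ : ℝ → ℝ) (φ : ℝ → ℝ → ℝ) (t : ℝ) : ℝ≥0∞ :=
  hNorm a b 1 (fun x => (φ t x : ℂ) - interpN a b N (Phi a b ε τ N ψ₀ φ₀ φ₁ t) x)

end KGS

end

noncomputable section

namespace KGS

/-! ### Weighted `ℓ²` norms of families indexed by an abelian group -/

/-! In Fourier variables the equations become ordinary differential equations and the scheme becomes
a recursion, for families of coefficients on an abelian group of frequencies: `ℤ` for functions on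
the interval, `ZMod N` for grid vectors. Sobolev norms become weighted ℓ² norms, and since the sum
of ρ⁻² converges, h^s with s ≥ 1 is a convolution algebra (`Freq.hs_conv_le`), with a constant that
serves every grid. Products on the grid are exactly cyclic convolutions (`gridDft_mul`). Hence the
truncated coefficients of the exact solution satisfy the grid equations up to an aliasing defect of
size η = h^(m₀-1) in h¹ (`SpectralData.exactData`).

One step of the scheme is Duhamel's formula, integrated exactly, with the wave amplitude frozen and
ψ replaced by a linear polynomial in time (`gridCoeff_psiNext`, `zed_step`). The right unknown for
the Klein–Gordon part is ζ = ε²ωφ - iε²∂ₜφ. It solves ζ' = iωζ - ig, so its free flow is a rotation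
of each mode, isometric in every h^s, and it controls both φ and ε²∂ₜφ without loss in ε.

The local error is estimated twice. Taylor expansion gives a residual of size τ²/ε², because φ moves
at speed ε⁻² while the amplitude multiplier `amp` stays within min(τ, τ²/ε²)ρ² of 1. Alternatively
the residual is a fast phase times a slow factor that vanishes at the start of the step and has a
bounded derivative; one integration by parts in time then gains ε² for every τ
(`sn_sub_le_of_kg_osc`, `sn_sub_le_of_schrodinger_osc`). The local error is therefore of size τ(η +
min(τ²/ε², ε²)) (`ExactData.local_psi`, `ExactData.local_z`). A step is Lipschitz in the data with
constant 1 + O(τ); the filter sin(μ²τ)/τ is bounded by 1/τ, which removes any restriction coupling τ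
to h. Summation over the steps gives the bounds at the time levels (`ExactData.close_of_numSeq`).
Since min(τ²/ε², ε²) ≤ τ, the error stays below 1 for small h and τ, uniformly in ε, and the
numerical solution never leaves the ball where the Lipschitz constants hold.

Between the levels the solution and the interpolant are compared through their expansions at the
last level, which adds min(τ²/ε², τ) (`ExactData.interp_psi`, `ExactData.interp_phi`). Parseval's
identity returns to H¹: modes beyond N/2 contribute h^(m₀-1), the others the error of the
coefficients (`hNorm_sub_interpN_le`).

One step needs more regularity than is assumed: the initial error in ζ costs an extra derivative of
φ₀. It is gained from the solution with ε = 1, whose Klein–Gordon equation turns the time-uniform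
bounds into h^(m₀+1) regularity at time 0 (`SpectralData.hs_succ_lt_top`); φ₀ is the same for all ε.
-/

lemma ENNReal.sq_tsum_mul_le {ι : Type*} (x y : ι → ℝ≥0∞) :
    (∑' i, x i * y i) ^ 2 ≤ (∑' i, x i ^ 2) * ∑' i, y i ^ 2 := by
  have key : ∑' i, x i * y i ≤ (∑' i, x i ^ 2) ^ (1 / 2 : ℝ) * (∑' i, y i ^ 2) ^ (1 / 2 : ℝ) := by
    refine ENNReal.summable.tsum_le_of_sum_le fun s => ?_
    refine (ENNReal.inner_le_Lp_mul_Lq s x y Real.HolderConjugate.two_two).trans ?_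
    simp only [ENNReal.rpow_two]
    gcongr <;> exact ENNReal.sum_le_tsum s
  calc (∑' i, x i * y i) ^ 2
      ≤ ((∑' i, x i ^ 2) ^ (1 / 2 : ℝ) * (∑' i, y i ^ 2) ^ (1 / 2 : ℝ)) ^ 2 := by gcongr
    _ = _ := by
      rw [mul_pow, ← ENNReal.rpow_two, ← ENNReal.rpow_two, ← ENNReal.rpow_mul, ← ENNReal.rpow_mul]
      norm_num

lemma ENNReal.add_sq_le (x y : ℝ≥0∞) : (x + y) ^ 2 ≤ 2 * (x ^ 2 + y ^ 2) := by
  have h := ENNReal.rpow_add_le_mul_rpow_add_rpow x y one_le_two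
  norm_num at h
  exact h

/-- Young's inequality `‖x * y‖₂ ≤ ‖x‖₁ ‖y‖₂` for the convolution on an abelian group. -/
lemma ENNReal.young {G : Type*} [AddCommGroup G] (x y : G → ℝ≥0∞) :
    ∑' l, (∑' k, x k * y (l - k)) ^ 2 ≤ (∑' k, x k) ^ 2 * ∑' l, y l ^ 2 := by
  have h1 : ∀ l, (∑' k, x k * y (l - k)) ^ 2 ≤ (∑' k, x k) * ∑' k, x k * y (l - k) ^ 2 := by
    intro l
    -- Cauchy–Schwarz with `x` split into two square roots, one of which stays with `y`.
    have := ENNReal.sq_tsum_mul_le (fun k => x k ^ (1 / 2 : ℝ))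
      (fun k => x k ^ (1 / 2 : ℝ) * y (l - k))
    have e : ∀ k, (x k ^ (1 / 2 : ℝ)) ^ 2 = x k := by
      intro k; rw [← ENNReal.rpow_two, ← ENNReal.rpow_mul]; norm_num
    simpa only [← mul_assoc, ← sq, e, mul_pow] using this
  calc ∑' l, (∑' k, x k * y (l - k)) ^ 2
      ≤ ∑' l, (∑' k, x k) * ∑' k, x k * y (l - k) ^ 2 := ENNReal.tsum_le_tsum h1
    _ = (∑' k, x k) * ∑' k, ∑' l, x k * y (l - k) ^ 2 := by
      rw [ENNReal.tsum_mul_left, ENNReal.tsum_comm]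
    _ = _ := by
      have : ∀ k, ∑' l, x k * y (l - k) ^ 2 = x k * ∑' l, y l ^ 2 := by
        intro k
        rw [ENNReal.tsum_mul_left]
        congr 1
        exact (Equiv.subRight k).tsum_eq (fun l => y l ^ 2)
      simp only [this, ENNReal.tsum_mul_right]
      ring

/-- A length function `μ ≥ 0` on an abelian group of frequencies. -/
structure Freq (G : Type*) [AddCommGroup G] where
  /-- the length -/
  μ : G → ℝ
  nonneg : ∀ k, 0 ≤ μ k
  neg : ∀ k, μ (-k) = μ k
  add_le : ∀ k l, μ (k + l) ≤ μ k + μ l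

/-- The convolution of two families. -/
def conv {G : Type*} [AddCommGroup G] (c d : G → ℂ) (l : G) : ℂ := ∑' k, c k * d (l - k)

/-- The involution `c ↦ conj c(-·)`, which represents complex conjugation. -/
def J {G : Type*} [AddCommGroup G] (c : G → ℂ) (l : G) : ℂ := conj (c (-l))

namespace Freq

variable {G : Type*} [AddCommGroup G] (F : Freq G)

/-- The weight `√(1 + μ²)`. -/
def ρ (l : G) : ℝ := √(1 + F.μ l ^ 2)

lemma sq_rho (l : G) : F.ρ l ^ 2 = 1 + F.μ l ^ 2 := Real.sq_sqrt (by positivity)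

lemma one_le_rho (l : G) : 1 ≤ F.ρ l := Real.one_le_sqrt.mpr (by nlinarith [sq_nonneg (F.μ l)])

lemma rho_pos (l : G) : 0 < F.ρ l := zero_lt_one.trans_le (F.one_le_rho l)

lemma mu_sq_le (l : G) : F.μ l ^ 2 ≤ F.ρ l ^ 2 := by rw [sq_rho]; linarith

lemma mu_le (l : G) : F.μ l ≤ F.ρ l :=
  (abs_le_of_sq_le_sq' (F.mu_sq_le l) (F.rho_pos l).le).2

lemma rho_neg (l : G) : F.ρ (-l) = F.ρ l := by simp [ρ, F.neg]

lemma rho_add_le (k l : G) : F.ρ (k + l) ≤ F.ρ k + F.ρ l := by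
  refine Real.sqrt_le_iff.mpr ⟨add_nonneg (F.rho_pos k).le (F.rho_pos l).le, ?_⟩
  have h1 := F.add_le k l
  have h2 := F.mu_le k
  have h3 := F.mu_le l
  have h4 := F.nonneg k
  have h5 := F.nonneg l
  have h6 := F.nonneg (k + l)
  have : F.μ (k + l) ^ 2 ≤ (F.μ k + F.μ l) ^ 2 := by gcongr
  have : F.μ k * F.μ l ≤ F.ρ k * F.ρ l := mul_le_mul h2 h3 h5 (F.rho_pos k).le
  nlinarith [F.sq_rho k, F.sq_rho l]

/-- The square of the `h^s` norm of a family, with values in `[0,∞]`. -/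
def hs (s : ℕ) (c : G → ℂ) : ℝ≥0∞ := ∑' l, (ENNReal.ofReal (F.ρ l ^ s) * ‖c l‖ₑ) ^ 2

lemma hs_mono {s t : ℕ} (h : s ≤ t) (c : G → ℂ) : F.hs s c ≤ F.hs t c := by
  refine ENNReal.tsum_le_tsum fun l => ?_
  gcongr
  exact F.one_le_rho l

/-- Cauchy–Schwarz against ρ⁻¹: the embedding of h¹ into ℓ¹, which in dimension one holds because
the sum of ρ⁻² is finite. -/
lemma sq_tsum_enorm_le {κ : ℝ≥0∞} (hκ : ∑' l, ENNReal.ofReal ((F.ρ l)⁻¹) ^ 2 ≤ κ) (c : G → ℂ) :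
    (∑' l, ‖c l‖ₑ) ^ 2 ≤ κ * F.hs 1 c := by
  have := ENNReal.sq_tsum_mul_le (fun l => ENNReal.ofReal ((F.ρ l)⁻¹))
    (fun l => ENNReal.ofReal (F.ρ l ^ 1) * ‖c l‖ₑ)
  have e : ∀ l, ENNReal.ofReal ((F.ρ l)⁻¹) * (ENNReal.ofReal (F.ρ l ^ 1) * ‖c l‖ₑ) = ‖c l‖ₑ := by
    intro l
    rw [← mul_assoc, ← ENNReal.ofReal_mul (inv_nonneg.mpr (F.rho_pos l).le), pow_one,
      inv_mul_cancel₀ (F.rho_pos l).ne']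
    simp
  simp only [e] at this
  exact this.trans (by unfold hs; gcongr)

/-- The weight is subadditive, so ρ(l)^s is at most 2^s(ρ(k)^s + ρ(l-k)^s): the weight falls on one
factor at a time. Young's inequality keeps that factor in ℓ² and asks only for ℓ¹ of the other,
which h¹ controls. -/
lemma hs_conv_le {κ : ℝ≥0∞} (hκ : ∑' l, ENNReal.ofReal ((F.ρ l)⁻¹) ^ 2 ≤ κ) {s : ℕ} (hs : 1 ≤ s)
    (c d : G → ℂ) : F.hs s (conv c d) ≤ 4 * 4 ^ s * κ * F.hs s c * F.hs s d := by
  set X : G → ℝ≥0∞ := fun l => ENNReal.ofReal (F.ρ l ^ s) * ‖c l‖ₑ with hX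
  set Y : G → ℝ≥0∞ := fun l => ENNReal.ofReal (F.ρ l ^ s) * ‖d l‖ₑ with hY
  have hpt : ∀ l, ENNReal.ofReal (F.ρ l ^ s) * ‖conv c d l‖ₑ ≤
      2 ^ s * (∑' k, ‖d k‖ₑ * X (l - k) + ∑' k, ‖c k‖ₑ * Y (l - k)) := by
    intro l
    have hw : ∀ k, ENNReal.ofReal (F.ρ l ^ s) ≤
        2 ^ s * (ENNReal.ofReal (F.ρ k ^ s) + ENNReal.ofReal (F.ρ (l - k) ^ s)) := by
      intro k
      have h1 := F.rho_add_le k (l - k)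
      rw [add_sub_cancel] at h1
      have h2 : F.ρ l ^ s ≤ 2 ^ s * (F.ρ k ^ s + F.ρ (l - k) ^ s) := by
        calc F.ρ l ^ s ≤ (F.ρ k + F.ρ (l - k)) ^ s := by
              gcongr; exact (F.rho_pos l).le
          _ ≤ 2 ^ (s - 1) * (F.ρ k ^ s + F.ρ (l - k) ^ s) :=
              add_pow_le (F.rho_pos k).le (F.rho_pos _).le s
          _ ≤ _ := by
              have := F.rho_pos k
              have := F.rho_pos (l - k)
              gcongr
              · norm_num
              · omega
      have e : (2 : ℝ≥0∞) ^ s = ENNReal.ofReal (2 ^ s) := by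
        rw [ENNReal.ofReal_pow (by norm_num)]; norm_num
      rw [e, ← ENNReal.ofReal_add (pow_nonneg (F.rho_pos _).le _) (pow_nonneg (F.rho_pos _).le _),
        ← ENNReal.ofReal_mul (by positivity)]
      exact ENNReal.ofReal_le_ofReal h2
    calc ENNReal.ofReal (F.ρ l ^ s) * ‖conv c d l‖ₑ
        ≤ ENNReal.ofReal (F.ρ l ^ s) * ∑' k, ‖c k‖ₑ * ‖d (l - k)‖ₑ := by
          gcongr
          refine (enorm_tsum_le_tsum_enorm).trans ?_
          simp only [enorm_mul]; rfl
      _ = ∑' k, ENNReal.ofReal (F.ρ l ^ s) * (‖c k‖ₑ * ‖d (l - k)‖ₑ) :=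
          ENNReal.tsum_mul_left.symm
      _ ≤ ∑' k, 2 ^ s * (X k * ‖d (l - k)‖ₑ + ‖c k‖ₑ * Y (l - k)) := by
          refine ENNReal.tsum_le_tsum fun k => ?_
          refine (mul_le_mul_left (hw k) _).trans (le_of_eq ?_)
          simp only [hX, hY]; ring
      _ = 2 ^ s * (∑' k, X k * ‖d (l - k)‖ₑ + ∑' k, ‖c k‖ₑ * Y (l - k)) := by
          rw [ENNReal.tsum_mul_left, ENNReal.tsum_add]
      _ = _ := by
          congr 2
          -- The reflection k ↦ l - k brings the term with the weight on `c` into the form of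
          -- Young's inequality.
          rw [← (Equiv.subLeft l).tsum_eq (fun k => X k * ‖d (l - k)‖ₑ)]
          simp [mul_comm]
  calc F.hs s (conv c d)
      ≤ ∑' l, (2 ^ s * (∑' k, ‖d k‖ₑ * X (l - k) + ∑' k, ‖c k‖ₑ * Y (l - k))) ^ 2 :=
        ENNReal.tsum_le_tsum fun l => pow_le_pow_left' (hpt l) 2
    _ ≤ ∑' l, 4 ^ s * (2 * ((∑' k, ‖d k‖ₑ * X (l - k)) ^ 2 + (∑' k, ‖c k‖ₑ * Y (l - k)) ^ 2)) := by
        refine ENNReal.tsum_le_tsum fun l => ?_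
        rw [mul_pow, ← pow_mul, mul_comm s 2, pow_mul]
        norm_num only
        gcongr
        exact ENNReal.add_sq_le _ _
    _ ≤ 4 ^ s * (2 * ((∑' k, ‖d k‖ₑ) ^ 2 * F.hs s c + (∑' k, ‖c k‖ₑ) ^ 2 * F.hs s d)) := by
        rw [ENNReal.tsum_mul_left, ENNReal.tsum_mul_left, ENNReal.tsum_add]
        gcongr
        · exact ENNReal.young _ _
        · exact ENNReal.young _ _
    _ ≤ 4 ^ s * (2 * ((κ * F.hs s d) * F.hs s c + (κ * F.hs s c) * F.hs s d)) := by
        gcongr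
        · exact (F.sq_tsum_enorm_le hκ d).trans (by gcongr; exact F.hs_mono hs d)
        · exact (F.sq_tsum_enorm_le hκ c).trans (by gcongr; exact F.hs_mono hs c)
    _ = _ := by ring

end Freq

/-! ### Finite families -/

section algebra

variable {G : Type*} [AddCommGroup G]

lemma J_J (c : G → ℂ) : J (J c) = c := by ext l; simp [J]

lemma J_add (c d : G → ℂ) : J (c + d) = J c + J d := by ext l; simp [J]

lemma J_sub (c d : G → ℂ) : J (c - d) = J c - J d := by ext l; simp [J]

lemma J_smul (a : ℂ) (c : G → ℂ) : J (a • c) = conj a • J c := by ext l; simp [J]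

lemma conv_comm (c d : G → ℂ) : conv c d = conv d c := by
  ext l
  unfold conv
  rw [← (Equiv.subLeft l).tsum_eq]
  simp [mul_comm]

lemma J_conv (c d : G → ℂ) : J (conv c d) = conv (J c) (J d) := by
  ext l
  simp only [J, conv, Complex.conj_tsum]
  rw [← (Equiv.neg G).tsum_eq]
  simp [neg_add_eq_sub]

variable [Fintype G]

lemma conv_apply (c d : G → ℂ) (l : G) : conv c d l = ∑ k, c k * d (l - k) := tsum_fintype _

lemma conv_add (c d e : G → ℂ) : conv c (d + e) = conv c d + conv c e := by
  ext l; simp [conv_apply, mul_add, Finset.sum_add_distrib]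

lemma add_conv (c d e : G → ℂ) : conv (c + d) e = conv c e + conv d e := by
  ext l; simp [conv_apply, add_mul, Finset.sum_add_distrib]

lemma conv_sub (c d e : G → ℂ) : conv c (d - e) = conv c d - conv c e := by
  ext l; simp [conv_apply, mul_sub, Finset.sum_sub_distrib]

lemma sub_conv (c d e : G → ℂ) : conv (c - d) e = conv c e - conv d e := by
  ext l; simp [conv_apply, sub_mul, Finset.sum_sub_distrib]

lemma smul_conv (a : ℂ) (c d : G → ℂ) : conv (a • c) d = a • conv c d := by
  ext l; simp [conv_apply, Finset.mul_sum, mul_assoc]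

lemma conv_smul (a : ℂ) (c d : G → ℂ) : conv c (a • d) = a • conv c d := by
  rw [conv_comm, smul_conv, conv_comm]

lemma hasDerivAt_conv {c d : ℝ → G → ℂ} {c' d' : G → ℂ} {t : ℝ}
    (hc : ∀ l, HasDerivAt (fun t => c t l) (c' l) t)
    (hd : ∀ l, HasDerivAt (fun t => d t l) (d' l) t) (l : G) :
    HasDerivAt (fun t => conv (c t) (d t) l) (conv c' (d t) l + conv (c t) d' l) t := by
  simp only [conv_apply, ← Finset.sum_add_distrib]
  exact HasDerivAt.fun_sum fun k _ => (hc k).mul (hd (l - k))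

lemma continuousOn_conv {c d : ℝ → G → ℂ} {s : Set ℝ}
    (hc : ∀ l, ContinuousOn (fun t => c t l) s)
    (hd : ∀ l, ContinuousOn (fun t => d t l) s) (l : G) :
    ContinuousOn (fun t => conv (c t) (d t) l) s := by
  simp only [conv_apply]
  exact continuousOn_finsetSum _ fun k _ => (hc k).mul (hd (l - k))

end algebra

/-! ### Weighted norms of finite families -/

namespace Freq

variable {G : Type*} [AddCommGroup G] [Fintype G] (F : Freq G)

/-- The `h^s` norm of a finite family. -/
def sn (s : ℕ) (c : G → ℂ) : ℝ := √(∑ l, (F.ρ l ^ s * ‖c l‖) ^ 2)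

lemma sn_eq_norm (s : ℕ) (c : G → ℂ) :
    F.sn s c = ‖WithLp.toLp 2 (fun l => (F.ρ l ^ s : ℂ) * c l)‖ := by
  simp [sn, EuclideanSpace.norm_eq, abs_of_pos (F.rho_pos _)]

lemma sn_nonneg (s : ℕ) (c : G → ℂ) : 0 ≤ F.sn s c := Real.sqrt_nonneg _

lemma sq_sn (s : ℕ) (c : G → ℂ) : F.sn s c ^ 2 = ∑ l, (F.ρ l ^ s * ‖c l‖) ^ 2 :=
  Real.sq_sqrt (Finset.sum_nonneg fun _ _ => sq_nonneg _)

lemma sn_add_le (s : ℕ) (c d : G → ℂ) : F.sn s (c + d) ≤ F.sn s c + F.sn s d := by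
  simp only [sn_eq_norm]
  refine le_trans (le_of_eq ?_) (norm_add_le _ _)
  congr 1
  ext l
  simp [mul_add]

lemma sn_neg (s : ℕ) (c : G → ℂ) : F.sn s (-c) = F.sn s c := by simp [sn]

lemma sn_zero (s : ℕ) : F.sn s 0 = 0 := by simp [sn]

lemma sn_sub_le (s : ℕ) (c d : G → ℂ) : F.sn s (c - d) ≤ F.sn s c + F.sn s d := by
  rw [sub_eq_add_neg, ← F.sn_neg s d]; exact F.sn_add_le s c (-d)

lemma sn_sub_comm (s : ℕ) (c d : G → ℂ) : F.sn s (c - d) = F.sn s (d - c) := by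
  rw [← F.sn_neg, neg_sub]

lemma sn_smul (s : ℕ) (a : ℂ) (c : G → ℂ) : F.sn s (a • c) = ‖a‖ * F.sn s c := by
  rw [sn, sn, ← Real.sqrt_sq (norm_nonneg a), ← Real.sqrt_mul (sq_nonneg _), Finset.mul_sum]
  simp only [Pi.smul_apply, smul_eq_mul, norm_mul]
  congr 1
  exact Finset.sum_congr rfl fun l _ => by ring

/-- A Fourier multiplier that grows like ρ^k costs k derivatives. All losses of regularity in the
error analysis are counted through this bound. -/
lemma sn_mul_le {s k : ℕ} {B : ℝ} (hB : 0 ≤ B) {m : G → ℂ} (hm : ∀ l, ‖m l‖ ≤ B * F.ρ l ^ k)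
    (c : G → ℂ) : F.sn s (m * c) ≤ B * F.sn (s + k) c := by
  rw [sn, sn, ← Real.sqrt_sq hB, ← Real.sqrt_mul (sq_nonneg _), Finset.mul_sum]
  refine Real.sqrt_le_sqrt (Finset.sum_le_sum fun l _ => ?_)
  rw [← mul_pow]
  have := F.rho_pos l
  refine pow_le_pow_left₀ (by positivity) ?_ 2
  calc F.ρ l ^ s * ‖(m * c) l‖ = F.ρ l ^ s * (‖m l‖ * ‖c l‖) := by simp
    _ ≤ F.ρ l ^ s * (B * F.ρ l ^ k * ‖c l‖) := by gcongr; exact hm l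
    _ = _ := by ring

lemma sn_mul_le_of_le {s : ℕ} {B : ℝ} (hB : 0 ≤ B) {m : G → ℂ} (hm : ∀ l, ‖m l‖ ≤ B)
    (c : G → ℂ) : F.sn s (m * c) ≤ B * F.sn s c :=
  F.sn_mul_le (k := 0) hB (by simpa using hm) c

lemma sn_mul_le_of_le_one {s : ℕ} {m : G → ℂ} (hm : ∀ l, ‖m l‖ ≤ 1) (c : G → ℂ) :
    F.sn s (m * c) ≤ F.sn s c := by simpa using F.sn_mul_le_of_le (s := s) zero_le_one hm c

lemma sn_le_of_le {s t : ℕ} {c d : G → ℂ} (h : ∀ l, F.ρ l ^ s * ‖c l‖ ≤ F.ρ l ^ t * ‖d l‖) :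
    F.sn s c ≤ F.sn t d := by
  refine Real.sqrt_le_sqrt (Finset.sum_le_sum fun l _ => ?_)
  have := F.rho_pos l
  exact pow_le_pow_left₀ (by positivity) (h l) 2

lemma sn_eq_of_norm_eq {s : ℕ} {c d : G → ℂ} (h : ∀ l, ‖c l‖ = ‖d l‖) : F.sn s c = F.sn s d := by
  simp [sn, h]

lemma sn_mono {s t : ℕ} (h : s ≤ t) (c : G → ℂ) : F.sn s c ≤ F.sn t c :=
  F.sn_le_of_le fun l => by gcongr; exact F.one_le_rho l

lemma sn_J (s : ℕ) (c : G → ℂ) : F.sn s (J c) = F.sn s c := by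
  unfold sn
  congr 1
  rw [← Equiv.sum_comp (Equiv.neg G) fun l => (F.ρ l ^ s * ‖c l‖) ^ 2]
  simp [J, F.rho_neg]

lemma hs_eq_ofReal (s : ℕ) (c : G → ℂ) : F.hs s c = ENNReal.ofReal (F.sn s c ^ 2) := by
  rw [sq_sn, ENNReal.ofReal_sum_of_nonneg fun _ _ => sq_nonneg _, hs, tsum_fintype]
  refine Finset.sum_congr rfl fun l _ => ?_
  have := F.rho_pos l
  rw [ENNReal.ofReal_pow (mul_nonneg (pow_nonneg this.le _) (norm_nonneg _)), ENNReal.ofReal_mul (pow_nonneg this.le _), ofReal_norm]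

/-- The constant involves only `s` and a bound of the sum of ρ⁻². That sum is bounded uniformly over
the grids, and so is the algebra constant. -/
lemma sn_conv_le {κ : ℝ} (hκ : 0 ≤ κ)
    (h : ∑' l, ENNReal.ofReal ((F.ρ l)⁻¹) ^ 2 ≤ ENNReal.ofReal κ) {s : ℕ} (hs : 1 ≤ s)
    (c d : G → ℂ) : F.sn s (conv c d) ≤ √(4 * 4 ^ s * κ) * F.sn s c * F.sn s d := by
  have h1 := F.hs_conv_le h hs c d
  simp only [hs_eq_ofReal] at h1
  have e : (4 * 4 ^ s : ℝ≥0∞) = ENNReal.ofReal (4 * 4 ^ s) := by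
    rw [ENNReal.ofReal_mul (by norm_num), ENNReal.ofReal_pow (by norm_num)]; norm_num
  rw [e, ← ENNReal.ofReal_mul (by positivity), ← ENNReal.ofReal_mul (by positivity),
    ← ENNReal.ofReal_mul (by positivity), ENNReal.ofReal_le_ofReal_iff (by positivity)] at h1
  refine (abs_le_of_sq_le_sq' ?_ (by have := F.sn_nonneg s c; have := F.sn_nonneg s d; positivity)).2
  rw [mul_pow, mul_pow, Real.sq_sqrt (by positivity)]
  exact h1

/-- Mean value inequality in the `h^s` norm. -/
lemma sn_sub_le_of_hasDerivAt {s : ℕ} {f f' : ℝ → G → ℂ} {τ B : ℝ} (hτ : 0 ≤ τ)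
    (hc : ∀ l, ContinuousOn (fun t => f t l) (Icc 0 τ))
    (hd : ∀ t ∈ Ioo 0 τ, ∀ l, HasDerivAt (fun t => f t l) (f' t l) t)
    (hB : ∀ t ∈ Ioo 0 τ, F.sn s (f' t) ≤ B) : F.sn s (f τ - f 0) ≤ B * τ := by
  rcases hτ.eq_or_lt with rfl | hτ
  · simp [sn]
  -- Pairing with the increment Δ itself reduces the vector-valued statement to the scalar mean
  -- value theorem: the real part of ⟨Δ, L (f t)⟩ increases by exactly ‖Δ‖², and Cauchy–Schwarz
  -- bounds its derivative by ‖Δ‖ B.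
  let L : (G → ℂ) → EuclideanSpace ℂ G := fun c => WithLp.toLp 2 (fun l => (F.ρ l ^ s : ℂ) * c l)
  set Δ := L (f τ - f 0) with hΔ
  have hL : ∀ c, F.sn s c = ‖L c‖ := F.sn_eq_norm s
  have hin : ∀ c, (inner ℂ Δ (L c)).re = ∑ l, (conj (Δ l) * ((F.ρ l ^ s : ℂ) * c l)).re := by
    intro c
    simp [L, PiLp.inner_apply, mul_comm]
  have hcont : ContinuousOn (fun t => (inner ℂ Δ (L (f t))).re) (Icc 0 τ) := by
    simp only [hin]
    refine continuousOn_finsetSum _ fun l _ => ?_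
    exact Complex.continuous_re.comp_continuousOn
      (continuousOn_const.mul (continuousOn_const.mul (hc l)))
  have hder : ∀ t ∈ Ioo 0 τ, HasDerivAt (fun t => (inner ℂ Δ (L (f t))).re)
      (inner ℂ Δ (L (f' t))).re t := by
    intro t ht
    simp only [hin]
    refine HasDerivAt.fun_sum fun l _ => ?_
    have h := ((hd t ht l).const_mul (F.ρ l ^ s : ℂ)).const_mul (conj (Δ l))
    exact (Complex.reCLM.hasFDerivAt.comp_hasDerivAt t h)
  obtain ⟨ξ, hξ, h⟩ := exists_hasDerivAt_eq_slope _ _ hτ hcont hder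
  have h2 : (inner ℂ Δ (L (f τ))).re - (inner ℂ Δ (L (f 0))).re = ‖Δ‖ ^ 2 := by
    have e : L (f τ) - L (f 0) = Δ := by ext l; simp [L, hΔ, mul_sub]
    rw [← Complex.sub_re, ← inner_sub_right, e, ← inner_self_eq_norm_sq (𝕜 := ℂ)]
    rfl
  rw [h2, sub_zero, eq_div_iff hτ.ne'] at h
  have h3 : (inner ℂ Δ (L (f' ξ))).re ≤ ‖Δ‖ * B :=
    (Complex.re_le_norm _).trans ((norm_inner_le_norm _ _).trans
      (by gcongr; rw [← hL]; exact hB ξ hξ))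
  rw [hL]
  rcases (norm_nonneg Δ).eq_or_lt with h0 | h0
  · rw [← hΔ, ← h0]
    have : 0 ≤ B := (F.sn_nonneg _ _).trans (hB ξ hξ)
    positivity
  · have : ‖Δ‖ * ‖Δ‖ ≤ ‖Δ‖ * (B * τ) := by nlinarith
    exact le_of_mul_le_mul_left this h0

end Freq

/-! ### Oscillatory factors -/

/-- `e^{ix}`. -/
def osc (x : ℝ) : ℂ := Complex.exp (Complex.I * (x : ℂ))

lemma phase_eq (ε s : ℝ) : phase ε s = osc (s / ε ^ 2) := rfl

@[simp] lemma norm_osc (x : ℝ) : ‖osc x‖ = 1 := by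
  rw [osc, mul_comm]; exact Complex.norm_exp_ofReal_mul_I x

@[simp] lemma osc_zero : osc 0 = 1 := by simp [osc]

lemma osc_add (x y : ℝ) : osc (x + y) = osc x * osc y := by
  simp [osc, mul_add, Complex.exp_add]

lemma conj_osc (x : ℝ) : conj (osc x) = osc (-x) := by
  rw [osc, osc, ← Complex.exp_conj]; simp

lemma osc_mul_osc_neg (x : ℝ) : osc x * osc (-x) = 1 := by rw [← osc_add]; simp

lemma osc_eq (x : ℝ) : osc x = (Real.cos x : ℂ) + Complex.I * (Real.sin x : ℂ) := by
  rw [osc, mul_comm, Complex.exp_mul_I, Complex.ofReal_cos, Complex.ofReal_sin]; ring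

lemma osc_neg_eq (x : ℝ) : osc (-x) = (Real.cos x : ℂ) - Complex.I * (Real.sin x : ℂ) := by
  rw [osc_eq]; simp [sub_eq_add_neg]

lemma hasDerivAt_osc (c t : ℝ) :
    HasDerivAt (fun t => osc (c * t)) (Complex.I * c * osc (c * t)) t := by
  have h1 : HasDerivAt (fun t : ℝ => ((c * t : ℝ) : ℂ)) (c : ℂ) t := by
    have := ((hasDerivAt_id t).const_mul c).ofReal_comp
    simpa using this
  have h2 := (h1.const_mul Complex.I).cexp
  exact h2.congr_deriv (by unfold osc; ring)

lemma continuous_osc : Continuous osc := by unfold osc; fun_prop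

lemma norm_osc_sub_one_le (x : ℝ) : ‖osc x - 1‖ ≤ |x| := by
  have := Real.norm_exp_I_mul_ofReal_sub_one_le (x := x)
  simpa [osc] using this

/-- A quadratic bound on the whole line, since it is applied at μ²τ, which need not be small. The
cubic bound would cost six derivatives in place of four. -/
lemma abs_sub_sin_le (x : ℝ) : |x - Real.sin x| ≤ 2 * x ^ 2 := by
  wlog hx : 0 ≤ x generalizing x
  · have := this (-x) (by linarith)
    rw [Real.sin_neg] at this
    rw [← abs_neg]; convert this using 2 <;> ring
  have h1 : Real.sin x ≤ x := Real.sin_le hx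
  rw [abs_of_nonneg (by linarith)]
  rcases hx.eq_or_lt with rfl | hx
  · simp
  rcases le_or_gt x 1 with h | h
  · have h2 := Real.sin_gt_sub_cube hx
    nlinarith [sq_nonneg x]
  · nlinarith [Real.neg_one_le_sin x]

/-! ### The scheme in Fourier variables -/

namespace Freq

variable {G : Type*} [AddCommGroup G] (F : Freq G)

/-- The frequency `ω = ε⁻² √(1 + ε² μ²)`. -/
def om (ε : ℝ) (l : G) : ℝ := 1 / ε ^ 2 * √(1 + ε ^ 2 * F.μ l ^ 2)

lemma om_neg (ε : ℝ) (l : G) : F.om ε (-l) = F.om ε l := by simp [om, F.neg]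

variable {ε : ℝ}

lemma sq_om (hε : 0 < ε) (l : G) : F.om ε l ^ 2 = (1 / ε ^ 2) ^ 2 + F.μ l ^ 2 / ε ^ 2 := by
  rw [om, mul_pow, Real.sq_sqrt (by positivity)]; field_simp

lemma eps_sq_mul_om (hε : 0 < ε) (l : G) : ε ^ 2 * F.om ε l = √(1 + ε ^ 2 * F.μ l ^ 2) := by
  rw [om]; field_simp

lemma one_le_eps_sq_mul_om (hε : 0 < ε) (l : G) : 1 ≤ ε ^ 2 * F.om ε l := by
  rw [F.eps_sq_mul_om hε]; exact Real.one_le_sqrt.mpr (by nlinarith [sq_nonneg (ε * F.μ l)])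

lemma eps_sq_mul_om_le (hε : 0 < ε) (hε1 : ε ≤ 1) (l : G) : ε ^ 2 * F.om ε l ≤ F.ρ l := by
  rw [F.eps_sq_mul_om hε]
  refine Real.sqrt_le_sqrt ?_
  have : ε ^ 2 ≤ 1 := pow_le_one₀ hε.le hε1
  nlinarith [sq_nonneg (F.μ l)]

lemma om_pos (hε : 0 < ε) (l : G) : 0 < F.om ε l := by
  have := F.one_le_eps_sq_mul_om hε l
  by_contra h
  push Not at h
  nlinarith [sq_nonneg ε, mul_nonneg (sq_nonneg ε) (neg_nonneg.mpr h)]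

lemma inv_om_le (hε : 0 < ε) (l : G) : (F.om ε l)⁻¹ ≤ ε ^ 2 := by
  rw [inv_le_iff_one_le_mul₀ (F.om_pos hε l)]; exact F.one_le_eps_sq_mul_om hε l

/-- The amplitude multiplier `e^{-iθ/ε²} (cos ωθ + i (ε² ω)⁻¹ sin ωθ)`. -/
def amp (ε : ℝ) (θ : ℝ) (l : G) : ℂ :=
  osc (-(1 / ε ^ 2) * θ) * ((Real.cos (F.om ε l * θ) : ℂ) +
    Complex.I * ((ε ^ 2 * F.om ε l)⁻¹ : ℝ) * (Real.sin (F.om ε l * θ) : ℂ))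

lemma amp_zero (l : G) : F.amp ε 0 l = 1 := by simp [amp]

lemma amp_neg (θ : ℝ) (l : G) : F.amp ε θ (-l) = F.amp ε θ l := by simp [amp, F.om_neg]

/-- The derivative of `amp`. -/
def ampDeriv (ε : ℝ) (θ : ℝ) (l : G) : ℂ :=
  -(osc (-(1 / ε ^ 2) * θ) * (F.μ l ^ 2 * (ε ^ 2 * F.om ε l)⁻¹ * Real.sin (F.om ε l * θ) : ℝ))

/-- The terms of size ε⁻² cancel, because ω² - ε⁻⁴ = μ²/ε². What remains is of size μ², so the
amplitude is slow although ω is at least ε⁻². -/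
lemma hasDerivAt_amp (hε : 0 < ε) (θ : ℝ) (l : G) :
    HasDerivAt (fun θ => F.amp ε θ l) (F.ampDeriv ε θ l) θ := by
  have hω := F.om_pos hε l
  have hid : HasDerivAt (fun θ => F.om ε l * θ) (F.om ε l) θ := by
    simpa using (hasDerivAt_id θ).const_mul (F.om ε l)
  have h1 := (hid.cos.ofReal_comp).fun_add
    ((hid.sin.ofReal_comp).const_mul (Complex.I * (((ε ^ 2 * F.om ε l)⁻¹ : ℝ) : ℂ)))
  refine ((hasDerivAt_osc (-(1 / ε ^ 2)) θ).fun_mul h1).congr_deriv ?_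
  have h2 : ((F.om ε l : ℂ)) ^ 2 = (1 / (ε : ℂ) ^ 2) ^ 2 + (F.μ l : ℂ) ^ 2 / (ε : ℂ) ^ 2 := by
    exact_mod_cast congrArg (fun x : ℝ => (x : ℂ)) (F.sq_om hε l)
  have h3 : ((F.om ε l : ℂ)) ≠ 0 := by exact_mod_cast hω.ne'
  have h4 : ((ε : ℂ)) ≠ 0 := by exact_mod_cast hε.ne'
  have h5 : (F.μ l : ℂ) ^ 2 = ((F.om ε l : ℂ)) ^ 2 * (ε : ℂ) ^ 2 - 1 / (ε : ℂ) ^ 2 := by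
    rw [h2]; field_simp; ring
  rw [ampDeriv]
  push_cast
  rw [h5]
  field_simp
  linear_combination (-(osc (-(θ / ε ^ 2)) * Complex.sin ((F.om ε l) * θ))) * Complex.I_sq

/-- Apart from a phase, the real part is a cosine and the imaginary part a sine shrunk by (ε²ω)⁻¹ ≤
1. -/
lemma norm_amp_le (hε : 0 < ε) (θ : ℝ) (l : G) : ‖F.amp ε θ l‖ ≤ 1 := by
  rw [amp, norm_mul, norm_osc, one_mul]
  have h1 := F.one_le_eps_sq_mul_om hε l
  have h2 : (ε ^ 2 * F.om ε l)⁻¹ ≤ 1 := inv_le_one_of_one_le₀ h1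
  have h3 : 0 ≤ (ε ^ 2 * F.om ε l)⁻¹ := by positivity
  have e : ((Real.cos (F.om ε l * θ) : ℂ) +
      Complex.I * ((ε ^ 2 * F.om ε l)⁻¹ : ℝ) * (Real.sin (F.om ε l * θ) : ℂ)) =
      ⟨Real.cos (F.om ε l * θ), (ε ^ 2 * F.om ε l)⁻¹ * Real.sin (F.om ε l * θ)⟩ := by
    rw [Complex.mk_eq_add_mul_I]; push_cast; ring
  rw [e, Complex.norm_def, Real.sqrt_le_one, Complex.normSq_mk]
  have h4 := Real.sin_sq_add_cos_sq (F.om ε l * θ)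
  have h5 : (ε ^ 2 * F.om ε l)⁻¹ ^ 2 ≤ 1 := pow_le_one₀ h3 h2
  nlinarith [mul_nonneg (sub_nonneg.mpr h5) (sq_nonneg (Real.sin (F.om ε l * θ)))]

/-- Bounding the sine by 1 gives an estimate uniform in ε; bounding it by its argument gives one
that vanishes at θ = 0 but pays ε⁻². These two estimates are the origin of the two convergence
regimes. -/
lemma norm_ampDeriv_le (hε : 0 < ε) {θ : ℝ} (hθ : 0 ≤ θ) (l : G) :
    ‖F.ampDeriv ε θ l‖ ≤ 1 * F.ρ l ^ 2 ∧ ‖F.ampDeriv ε θ l‖ ≤ θ / ε ^ 2 * F.ρ l ^ 2 := by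
  have h1 := F.one_le_eps_sq_mul_om hε l
  have hω := F.om_pos hε l
  have h2 : (ε ^ 2 * F.om ε l)⁻¹ ≤ 1 := inv_le_one_of_one_le₀ h1
  have h3 : 0 ≤ (ε ^ 2 * F.om ε l)⁻¹ := by positivity
  have e : ‖F.ampDeriv ε θ l‖ = F.μ l ^ 2 * ((ε ^ 2 * F.om ε l)⁻¹ * |Real.sin (F.om ε l * θ)|) := by
    rw [ampDeriv, norm_neg, norm_mul, norm_osc, one_mul, Complex.norm_real, Real.norm_eq_abs,
      abs_mul, abs_mul, abs_of_nonneg h3, abs_of_nonneg (sq_nonneg _)]; ring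
  have h4 : (ε ^ 2 * F.om ε l)⁻¹ * |Real.sin (F.om ε l * θ)| ≤ 1 :=
    mul_le_one₀ h2 (abs_nonneg _) (Real.abs_sin_le_one _)
  have h5 : (ε ^ 2 * F.om ε l)⁻¹ * |Real.sin (F.om ε l * θ)| ≤ θ / ε ^ 2 := by
    have : |Real.sin (F.om ε l * θ)| ≤ F.om ε l * θ :=
      (Real.abs_sin_le_abs (x := F.om ε l * θ)).trans_eq (abs_of_nonneg (by positivity))
    calc _ ≤ (ε ^ 2 * F.om ε l)⁻¹ * (F.om ε l * θ) := by gcongr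
      _ = θ / ε ^ 2 := by field_simp
  have h6 := F.mu_sq_le l
  rw [e]
  constructor
  · rw [mul_comm (1 : ℝ)]; gcongr
  · rw [mul_comm (θ / ε ^ 2)]; gcongr

lemma norm_amp_sub_one_le (hε : 0 < ε) {θ : ℝ} (hθ : 0 ≤ θ) (l : G) :
    ‖F.amp ε θ l - 1‖ ≤ θ * F.ρ l ^ 2 ∧ ‖F.amp ε θ l - 1‖ ≤ θ ^ 2 / ε ^ 2 * F.ρ l ^ 2 := by
  have key : ∀ C, (∀ t ∈ Ico 0 θ, ‖F.ampDeriv ε t l‖ ≤ C) → ‖F.amp ε θ l - 1‖ ≤ C * θ := by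
    intro C hC
    have := norm_image_sub_le_of_norm_deriv_le_segment' (f := fun θ => F.amp ε θ l) (a := 0) (b := θ)
      (fun t _ => (F.hasDerivAt_amp hε t l).hasDerivWithinAt) hC θ (right_mem_Icc.mpr hθ)
    simpa [F.amp_zero] using this
  constructor
  · refine (key (1 * F.ρ l ^ 2) fun t ht => (F.norm_ampDeriv_le hε ht.1 l).1).trans_eq (by ring)
  · refine (key (θ / ε ^ 2 * F.ρ l ^ 2) fun t ht => ?_).trans_eq (by ring)
    refine (F.norm_ampDeriv_le hε ht.1 l).2.trans ?_
    have := ht.2.le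
    gcongr

end Freq

/-! ### One step of the scheme, and the exact solution, on a finite group of frequencies -/

section scheme

variable {G : Type*} [AddCommGroup G] (F : Freq G) (ε τ : ℝ)

/-- `½ (Φ - i ε² Φ̇)`. -/
def vInit (Φ D : G → ℂ) : G → ℂ := (1 / 2 : ℂ) • (Φ - (Complex.I * (ε : ℂ) ^ 2) • D)

/-- The filtered time derivative of `Ψ`. -/
def psiD (Φ Ψ : G → ℂ) (l : G) : ℂ :=
  -(Complex.I * ((Real.sin (F.μ l ^ 2 * τ) / τ : ℝ) : ℂ) * Ψ l) + Complex.I * conv Φ Ψ l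

/-- The force `(e^{is/ε²} v + c.c.) (Ψ + s Ψ')`. -/
def force (v Ψ Ψ' : G → ℂ) (s : ℝ) : G → ℂ :=
  conv (osc (1 / ε ^ 2 * s) • v + osc (-(1 / ε ^ 2) * s) • J v) (Ψ + (s : ℂ) • Ψ')

/-- The linearised density `|Ψ|² + 2 s Re (conj Ψ Ψ')`. -/
def src (Ψ Ψ' : G → ℂ) (s : ℝ) : G → ℂ :=
  conv Ψ (J Ψ) + (s : ℂ) • (conv Ψ' (J Ψ) + conv Ψ (J Ψ'))

/-- The step for `Ψ`. -/
def stepPsi (v Ψ Ψ' : G → ℂ) (l : G) : ℂ :=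
  osc (-(F.μ l ^ 2 * τ)) *
    (Ψ l + Complex.I * ∫ s in (0 : ℝ)..τ, osc (F.μ l ^ 2 * s) * force ε v Ψ Ψ' s l)

/-- The complex Klein–Gordon variable `ε² ω Φ - i ε² Φ̇`. -/
def zed (Φ D : G → ℂ) (l : G) : ℂ :=
  ((ε ^ 2 * F.om ε l : ℝ) : ℂ) * Φ l - Complex.I * (ε : ℂ) ^ 2 * D l

/-- The step for the complex Klein–Gordon variable. -/
def stepZ (ζ Ψ Ψ' : G → ℂ) (l : G) : ℂ :=
  osc (F.om ε l * τ) *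
    (ζ l - Complex.I * ∫ s in (0 : ℝ)..τ, osc (-F.om ε l * s) * src Ψ Ψ' s l)

/-- The Fourier coefficients of a solution, projected to a finite set of frequencies. -/
structure ExactData [Fintype G] (T B η : ℝ) (w p q f g : ℝ → G → ℂ) : Prop where
  cont_w : ∀ l, ContinuousOn (fun t => w t l) (Icc 0 T)
  cont_p : ∀ l, ContinuousOn (fun t => p t l) (Icc 0 T)
  cont_q : ∀ l, ContinuousOn (fun t => q t l) (Icc 0 T)
  deriv_w : ∀ t ∈ Ioo 0 T, ∀ l, HasDerivAt (fun t => w t l)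
    (-(Complex.I * (F.μ l : ℂ) ^ 2 * w t l) + Complex.I * f t l) t
  deriv_p : ∀ t ∈ Ioo 0 T, ∀ l, HasDerivAt (fun t => p t l) (q t l) t
  deriv_q : ∀ t ∈ Ioo 0 T, ∀ l, HasDerivAt (fun t => q t l)
    (-((F.om ε l : ℂ) ^ 2 * p t l) + g t l / (ε : ℂ) ^ 2) t
  real_p : ∀ t ∈ Icc 0 T, J (p t) = p t
  real_q : ∀ t ∈ Icc 0 T, J (q t) = q t
  bound_w : ∀ t ∈ Icc 0 T, F.sn 5 (w t) ≤ B
  bound_p : ∀ t ∈ Icc 0 T, F.sn 5 (p t) ≤ B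
  bound_q : ∀ t ∈ Icc 0 T, ε ^ 2 * F.sn 5 (q t) ≤ B
  bound_f : ∀ t ∈ Ioo 0 T, F.sn 3 (f t) ≤ B
  alias_f : ∀ t ∈ Ioo 0 T, F.sn 1 (f t - conv (p t) (w t)) ≤ B * η
  alias_g : ∀ t ∈ Ioo 0 T, F.sn 1 (g t - conv (w t) (J (w t))) ≤ B * η

/-- The convolution is bounded on `h¹` and `h³`. -/
structure IsAlg [Fintype G] (B : ℝ) : Prop where
  one_le : 1 ≤ B
  one : ∀ c d, F.sn 1 (conv c d) ≤ B * F.sn 1 c * F.sn 1 d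
  three : ∀ c d, F.sn 3 (conv c d) ≤ B * F.sn 3 c * F.sn 3 d

end scheme

set_option linter.unusedSectionVars false

/-! ### A priori estimates for the exact coefficients on one time step -/

/-- The multiplier `i μ²`. -/
def lam {G : Type*} [AddCommGroup G] (F : Freq G) (l : G) : ℂ := Complex.I * (F.μ l : ℂ) ^ 2

lemma norm_lam_le {G : Type*} [AddCommGroup G] (F : Freq G) (l : G) :
    ‖lam F l‖ ≤ 1 * F.ρ l ^ 2 := by
  rw [lam, norm_mul, Complex.norm_I, one_mul, norm_pow, Complex.norm_real, Real.norm_eq_abs, sq_abs,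
    one_mul]
  exact F.mu_sq_le l

section estimates

variable {G : Type*} [AddCommGroup G] [Fintype G] {F : Freq G}

lemma IsAlg.pos {B : ℝ} (hB : IsAlg F B) : 0 < B := zero_lt_one.trans_le hB.one_le

lemma IsAlg.one_le_of {B : ℝ} (hB : IsAlg F B) {c d : G → ℂ} {x y : ℝ} (hc : F.sn 1 c ≤ x)
    (hd : F.sn 1 d ≤ y) : F.sn 1 (conv c d) ≤ B * x * y := by
  have := hB.pos
  have := F.sn_nonneg 1 c
  have := F.sn_nonneg 1 d
  have := this.trans hd
  have : 0 ≤ x := (F.sn_nonneg 1 c).trans hc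
  refine (hB.one c d).trans ?_
  gcongr

lemma IsAlg.three_le_of {B : ℝ} (hB : IsAlg F B) {c d : G → ℂ} {x y : ℝ} (hc : F.sn 3 c ≤ x)
    (hd : F.sn 3 d ≤ y) : F.sn 3 (conv c d) ≤ B * x * y := by
  have := hB.pos
  have := F.sn_nonneg 3 c
  have := F.sn_nonneg 3 d
  have := this.trans hd
  have : 0 ≤ x := (F.sn_nonneg 3 c).trans hc
  refine (hB.three c d).trans ?_
  gcongr

lemma sn_add_le_of {s : ℕ} {c d : G → ℂ} {x y : ℝ} (hc : F.sn s c ≤ x) (hd : F.sn s d ≤ y) :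
    F.sn s (c + d) ≤ x + y := (F.sn_add_le s c d).trans (add_le_add hc hd)

lemma sn_sub_le_of {s : ℕ} {c d : G → ℂ} {x y : ℝ} (hc : F.sn s c ≤ x) (hd : F.sn s d ≤ y) :
    F.sn s (c - d) ≤ x + y := (F.sn_sub_le s c d).trans (add_le_add hc hd)

lemma sn_lam_mul_le (s : ℕ) (c : G → ℂ) : F.sn s (lam F * c) ≤ F.sn (s + 2) c := by
  simpa using F.sn_mul_le (s := s) zero_le_one (norm_lam_le F) c

lemma sn_I_smul (s : ℕ) (c : G → ℂ) : F.sn s (Complex.I • c) = F.sn s c := by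
  rw [F.sn_smul]; simp

lemma sn_osc_smul (s : ℕ) (x : ℝ) (c : G → ℂ) : F.sn s (osc x • c) = F.sn s c := by
  rw [F.sn_smul]; simp

lemma sn_real_smul (s : ℕ) {x : ℝ} (hx : 0 ≤ x) (c : G → ℂ) :
    F.sn s ((x : ℂ) • c) = x * F.sn s c := by
  rw [F.sn_smul]; simp [abs_of_nonneg hx]

lemma sn_half_smul_le {s : ℕ} {c d : G → ℂ} {x : ℝ} (hc : F.sn s c ≤ x) (hd : F.sn s d ≤ x) :
    F.sn s ((1 / 2 : ℂ) • (c + d)) ≤ x := by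
  rw [F.sn_smul]
  have := F.sn_add_le s c d
  norm_num
  linarith

variable {ε : ℝ}

lemma sn_vInit_le (hε : 0 < ε) {s : ℕ} {Φ D : G → ℂ} {x : ℝ} (h1 : F.sn s Φ ≤ x)
    (h2 : ε ^ 2 * F.sn s D ≤ x) : F.sn s (vInit ε Φ D) ≤ x := by
  rw [vInit, sub_eq_add_neg]
  refine sn_half_smul_le h1 ?_
  rw [F.sn_neg, F.sn_smul]
  simpa [abs_of_pos hε] using h2

lemma J_vInit (Φ D : G → ℂ) (h1 : J Φ = Φ) (h2 : J D = D) :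
    J (vInit ε Φ D) = (1 / 2 : ℂ) • (Φ + (Complex.I * (ε : ℂ) ^ 2) • D) := by
  rw [vInit, J_smul, J_sub, J_smul, h1, h2]
  simp [sub_eq_add_neg, Complex.conj_ofNat]

lemma vInit_add_J (Φ D : G → ℂ) (h1 : J Φ = Φ) (h2 : J D = D) :
    vInit ε Φ D + J (vInit ε Φ D) = Φ := by
  rw [J_vInit Φ D h1 h2, vInit]
  ext l; simp; ring

lemma J_zed (Φ D : G → ℂ) (h1 : J Φ = Φ) (h2 : J D = D) (l : G) :
    J (zed F ε Φ D) l = ((ε ^ 2 * F.om ε l : ℝ) : ℂ) * Φ l + Complex.I * (ε : ℂ) ^ 2 * D l := by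
  have e1 := congrFun h1 l
  have e2 := congrFun h2 l
  simp only [J] at e1 e2
  simp only [J, zed, map_sub, map_mul, F.om_neg, e1, e2, Complex.conj_ofReal, Complex.conj_I,
    map_pow]
  ring

/-- The first variable is controlled by the complex Klein–Gordon variable. -/
lemma sn_fst_le (hε : 0 < ε) {s : ℕ} {Φ D : G → ℂ} (h1 : J Φ = Φ) (h2 : J D = D) :
    F.sn s Φ ≤ F.sn s (zed F ε Φ D) := by
  have e : ∀ l, ‖Φ l‖ ≤ ‖((1 / 2 : ℂ) • (zed F ε Φ D + J (zed F ε Φ D))) l‖ := by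
    intro l
    have h3 : ((1 / 2 : ℂ) • (zed F ε Φ D + J (zed F ε Φ D))) l
        = ((ε ^ 2 * F.om ε l : ℝ) : ℂ) * Φ l := by
      rw [Pi.smul_apply, Pi.add_apply, J_zed Φ D h1 h2, zed, smul_eq_mul]; ring
    have := F.one_le_eps_sq_mul_om hε l
    rw [h3, norm_mul, Complex.norm_real, Real.norm_eq_abs, abs_of_pos (by linarith)]
    exact le_mul_of_one_le_left (norm_nonneg _) this
  refine (F.sn_le_of_le (t := s) fun l => ?_).trans (sn_half_smul_le le_rfl (F.sn_J s _).le)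
  have := F.rho_pos l
  gcongr
  exact e l

/-- The second variable is controlled by the complex Klein–Gordon variable. -/
lemma sn_snd_le {s : ℕ} {Φ D : G → ℂ} (h1 : J Φ = Φ) (h2 : J D = D) :
    ε ^ 2 * F.sn s D ≤ F.sn s (zed F ε Φ D) := by
  have e : ((ε ^ 2 : ℝ) : ℂ) • D =
      Complex.I • (1 / 2 : ℂ) • (zed F ε Φ D + -J (zed F ε Φ D)) := by
    ext l
    rw [Pi.smul_apply, Pi.smul_apply, Pi.smul_apply, Pi.add_apply, Pi.neg_apply,
      J_zed Φ D h1 h2, zed]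
    simp only [smul_eq_mul]
    push_cast
    linear_combination ((ε : ℂ) ^ 2 * D l) * Complex.I_sq
  rw [← sn_real_smul s (sq_nonneg ε), e, sn_I_smul]
  exact sn_half_smul_le le_rfl (by rw [F.sn_neg, F.sn_J])

lemma zed_sub (Φ D Φ' D' : G → ℂ) : zed F ε Φ D - zed F ε Φ' D' = zed F ε (Φ - Φ') (D - D') := by
  ext l; simp [zed]; ring

variable {T B η : ℝ} {w p q f g : ℝ → G → ℂ}

/-- Mean value inequality on `[0,θ] ⊆ [0,T]`. -/
lemma sn_sub_le_of_subset {s : ℕ} {c c' : ℝ → G → ℂ} {θ C : ℝ} (hθ : θ ∈ Icc 0 T)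
    (hc : ∀ l, ContinuousOn (fun t => c t l) (Icc 0 T))
    (hd : ∀ t ∈ Ioo 0 T, ∀ l, HasDerivAt (fun t => c t l) (c' t l) t)
    (hC : ∀ t ∈ Ioo 0 T, t ≤ θ → F.sn s (c' t) ≤ C) : F.sn s (c θ - c 0) ≤ C * θ :=
  F.sn_sub_le_of_hasDerivAt hθ.1 (fun l => (hc l).mono (Icc_subset_Icc_right hθ.2))
    (fun t ht => hd t ⟨ht.1, ht.2.trans_le hθ.2⟩)
    (fun t ht => hC t ⟨ht.1, ht.2.trans_le hθ.2⟩ ht.2.le)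

namespace ExactData

variable (h : ExactData F ε T B η w p q f g)
include h

/-- The system is autonomous, so every time step may be treated as one that starts at time 0. -/
lemma shift {t₀ : ℝ} (ht₀ : 0 ≤ t₀) : ExactData F ε (T - t₀) B η (fun t => w (t₀ + t))
    (fun t => p (t₀ + t)) (fun t => q (t₀ + t)) (fun t => f (t₀ + t)) (fun t => g (t₀ + t)) :=
  have h1 : ∀ t ∈ Icc 0 (T - t₀), t₀ + t ∈ Icc 0 T := fun t ht =>
    ⟨by linarith [ht.1], by linarith [ht.2]⟩
  have h2 : ∀ t ∈ Ioo 0 (T - t₀), t₀ + t ∈ Ioo 0 T := fun t ht =>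
    ⟨by linarith [ht.1], by linarith [ht.2]⟩
  have hc : ContinuousOn (fun t => t₀ + t) (Icc 0 (T - t₀)) := by fun_prop
  { cont_w := fun l => (h.cont_w l).comp hc h1
    cont_p := fun l => (h.cont_p l).comp hc h1
    cont_q := fun l => (h.cont_q l).comp hc h1
    deriv_w := fun t ht l => (h.deriv_w _ (h2 t ht) l).comp_const_add t₀ t
    deriv_p := fun t ht l => (h.deriv_p _ (h2 t ht) l).comp_const_add t₀ t
    deriv_q := fun t ht l => (h.deriv_q _ (h2 t ht) l).comp_const_add t₀ t
    real_p := fun t ht => h.real_p _ (h1 t ht)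
    real_q := fun t ht => h.real_q _ (h1 t ht)
    bound_w := fun t ht => h.bound_w _ (h1 t ht)
    bound_p := fun t ht => h.bound_p _ (h1 t ht)
    bound_q := fun t ht => h.bound_q _ (h1 t ht)
    bound_f := fun t ht => h.bound_f _ (h2 t ht)
    alias_f := fun t ht => h.alias_f _ (h2 t ht)
    alias_g := fun t ht => h.alias_g _ (h2 t ht) }

lemma bound_w_le {s : ℕ} (hs : s ≤ 5) {t : ℝ} (ht : t ∈ Icc 0 T) : F.sn s (w t) ≤ B :=
  (F.sn_mono hs _).trans (h.bound_w t ht)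

lemma bound_p_le {s : ℕ} (hs : s ≤ 5) {t : ℝ} (ht : t ∈ Icc 0 T) : F.sn s (p t) ≤ B :=
  (F.sn_mono hs _).trans (h.bound_p t ht)

lemma bound_q_le {s : ℕ} (hs : s ≤ 5) {t : ℝ} (ht : t ∈ Icc 0 T) : ε ^ 2 * F.sn s (q t) ≤ B :=
  (by gcongr; exact F.sn_mono hs _ : ε ^ 2 * F.sn s (q t) ≤ ε ^ 2 * F.sn 5 (q t)).trans
    (h.bound_q t ht)

lemma bound_vInit (hε : 0 < ε) {s : ℕ} (hs : s ≤ 5) {t : ℝ} (ht : t ∈ Icc 0 T) :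
    F.sn s (vInit ε (p t) (q t)) ≤ B :=
  sn_vInit_le hε (h.bound_p_le hs ht) (h.bound_q_le hs ht)

/-- The Schrödinger operator spends two of the five derivatives. -/
lemma bound_deriv_w {t : ℝ} (ht : t ∈ Ioo 0 T) :
    F.sn 3 (-(lam F * w t) + Complex.I • f t) ≤ 2 * B := by
  have h1 : F.sn 3 (-(lam F * w t)) ≤ B := by
    rw [F.sn_neg]; exact (sn_lam_mul_le 3 _).trans (h.bound_w t (Ioo_subset_Icc_self ht))
  have h2 : F.sn 3 (Complex.I • f t) ≤ B := by rw [sn_I_smul]; exact h.bound_f t ht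
  linarith [sn_add_le_of h1 h2]

lemma lip_w {θ : ℝ} (hθ : θ ∈ Icc 0 T) : F.sn 3 (w θ - w 0) ≤ 2 * B * θ :=
  sn_sub_le_of_subset hθ h.cont_w (c' := fun t => -(lam F * w t) + Complex.I • f t)
    (fun t ht l => h.deriv_w t ht l) (fun _ ht _ => h.bound_deriv_w ht)

lemma lip_w_one {θ : ℝ} (hθ : θ ∈ Icc 0 T) : F.sn 1 (w θ - w 0) ≤ 2 * B * θ :=
  (F.sn_mono (by norm_num) _).trans (h.lip_w hθ)

/-- Only ε²∂ₜφ is bounded uniformly. This factor ε⁻² is the one that appears in τ²/ε². -/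
lemma lip_p (hε : 0 < ε) {θ : ℝ} (hθ : θ ∈ Icc 0 T) : F.sn 1 (p θ - p 0) ≤ B / ε ^ 2 * θ :=
  sn_sub_le_of_subset hθ h.cont_p h.deriv_p fun t ht _ => by
    rw [le_div_iff₀' (by positivity)]
    exact h.bound_q_le (by norm_num) (Ioo_subset_Icc_self ht)

variable (hB : IsAlg F B) (hε : 0 < ε) (hε1 : ε ≤ 1) (hη : 0 ≤ η) (hη1 : η ≤ 1)
include hB

/-- First order Taylor expansion of `w`. -/
lemma taylor_w (hε : 0 < ε) (hε1 : ε ≤ 1) {θ : ℝ} (hθ : θ ∈ Icc 0 T) :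
    F.sn 1 (w θ - w 0 - (θ : ℂ) • (-(lam F * w 0) + Complex.I • conv (p 0) (w 0)))
      ≤ (5 * B ^ 3 * (θ / ε ^ 2) + B * η) * θ := by
  have hB1 := hB.one_le
  have h0 : (0 : ℝ) ∈ Icc 0 T := ⟨le_rfl, hθ.1.trans hθ.2⟩
  set e := -(lam F * w 0) + Complex.I • conv (p 0) (w 0) with he
  -- The mean value inequality is applied to the Taylor remainder itself: its derivative is the
  -- increment of the right-hand side of the equation since time 0, plus the aliasing defect.
  have key := sn_sub_le_of_subset (F := F) (s := 1) (c := fun t => w t - (t : ℂ) • e)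
    (c' := fun t => -(lam F * w t) + Complex.I • f t - e) hθ (C := 5 * B ^ 3 * (θ / ε ^ 2) + B * η)
    (fun l => (h.cont_w l).sub (by simp only [Pi.smul_apply, smul_eq_mul]; fun_prop))
    (fun t ht l => by
      have h1 : HasDerivAt (fun t : ℝ => (t : ℂ) * e l) (e l) t := by
        simpa using (hasDerivAt_id t).ofReal_comp.mul_const (e l)
      exact (h.deriv_w t ht l).sub h1) ?_
  · convert key using 2
    ext l; simp; ring
  · intro t ht htθ
    have ht' := Ioo_subset_Icc_self ht
    have e1 : -(lam F * w t) + Complex.I • f t - e = -(lam F * (w t - w 0)) +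
        (Complex.I • (f t - conv (p t) (w t)) +
          Complex.I • (conv (p t - p 0) (w t) + conv (p 0) (w t - w 0))) := by
      rw [he, sub_conv, conv_sub]; ext l; simp; ring
    have b1 : F.sn 1 (-(lam F * (w t - w 0))) ≤ 2 * B * t := by
      rw [F.sn_neg]; exact (sn_lam_mul_le 1 _).trans (h.lip_w ht')
    have b2 : F.sn 1 (Complex.I • (f t - conv (p t) (w t))) ≤ B * η := by
      rw [sn_I_smul]; exact h.alias_f t ht
    have b3 : F.sn 1 (Complex.I • (conv (p t - p 0) (w t) + conv (p 0) (w t - w 0))) ≤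
        B * (B / ε ^ 2 * t) * B + B * B * (2 * B * t) := by
      rw [sn_I_smul]
      exact sn_add_le_of (hB.one_le_of (h.lip_p hε ht') (h.bound_w_le (by norm_num) ht'))
        (hB.one_le_of (h.bound_p_le (by norm_num) h0) (h.lip_w_one ht'))
    rw [e1]
    refine (sn_add_le_of b1 (sn_add_le_of b2 b3)).trans ?_
    have h3 : t ≤ θ / ε ^ 2 := htθ.trans (le_div_self hθ.1 (by positivity)
      (pow_le_one₀ hε.le hε1))
    have h4 : t / ε ^ 2 ≤ θ / ε ^ 2 := by gcongr
    have h5 : B ≤ B ^ 3 := le_self_pow₀ hB1 (by norm_num)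
    have hB0 := hB.pos
    have h6 := ht.1.le
    have : 0 ≤ θ / ε ^ 2 := h6.trans h3
    calc 2 * B * t + (B * η + (B * (B / ε ^ 2 * t) * B + B * B * (2 * B * t)))
        = 2 * B * t + (B * η + (B ^ 3 * (t / ε ^ 2) + 2 * B ^ 3 * t)) := by ring
      _ ≤ 2 * B ^ 3 * (θ / ε ^ 2) + (B * η + (B ^ 3 * (θ / ε ^ 2) + 2 * B ^ 3 * (θ / ε ^ 2))) := by
          gcongr
      _ = _ := by ring

omit hB in
lemma psiD_eq (τ : ℝ) : psiD F τ (p 0) (w 0) =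
    -((fun l => Complex.I * ((Real.sin (F.μ l ^ 2 * τ) / τ : ℝ) : ℂ)) * w 0) +
      Complex.I • conv (p 0) (w 0) := by
  ext l; simp [psiD]

/-- Since |sin x| ≤ |x|, the filtered multiplier is no larger than μ² and the bound does not see τ.
-/
lemma bound_psiD {τ : ℝ} (hτ : 0 < τ) (hT : 0 ≤ T) : F.sn 3 (psiD F τ (p 0) (w 0)) ≤ 2 * B ^ 3 := by
  have h0 : (0 : ℝ) ∈ Icc 0 T := ⟨le_rfl, hT⟩
  rw [h.psiD_eq]
  have b1 : F.sn 3 (-((fun l => Complex.I * ((Real.sin (F.μ l ^ 2 * τ) / τ : ℝ) : ℂ)) * w 0)) ≤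
      1 * B := by
    rw [F.sn_neg]
    refine (F.sn_mul_le (k := 2) zero_le_one (fun l => ?_) _).trans ?_
    · rw [norm_mul, Complex.norm_I, one_mul, Complex.norm_real, Real.norm_eq_abs, abs_div,
        abs_of_pos hτ, one_mul, div_le_iff₀ hτ]
      refine (Real.abs_sin_le_abs).trans ?_
      rw [abs_of_nonneg (by positivity)]
      exact mul_le_mul_of_nonneg_right (F.mu_sq_le l) hτ.le
    · rw [one_mul, one_mul]; exact h.bound_w 0 h0
  have b2 : F.sn 3 (Complex.I • conv (p 0) (w 0)) ≤ B * B * B := by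
    rw [sn_I_smul]
    exact hB.three_le_of (h.bound_p_le (by norm_num) h0) (h.bound_w_le (by norm_num) h0)
  refine (sn_add_le_of b1 b2).trans ?_
  have h5 : B ≤ B ^ 3 := le_self_pow₀ hB.one_le (by norm_num)
  nlinarith

/-- First order Taylor expansion of `w` with the filtered derivative. -/
lemma taylor_w_filter (hε : 0 < ε) (hε1 : ε ≤ 1) (hη : 0 ≤ η) {τ θ : ℝ} (hτ : 0 < τ) (hτ1 : τ ≤ 1)
    (hθ : θ ∈ Icc 0 T) (hθτ : θ ≤ τ) :
    F.sn 1 (w θ - (w 0 + (θ : ℂ) • psiD F τ (p 0) (w 0))) ≤ 7 * B ^ 3 * (τ ^ 2 / ε ^ 2 + η) := by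
  have hB1 := hB.one_le
  have hB0 := hB.pos
  have h0 : (0 : ℝ) ∈ Icc 0 T := ⟨le_rfl, hθ.1.trans hθ.2⟩
  -- The filter replaces μ² by sin(μ²τ)/τ, an error of at most 2τμ⁴. Measured in h¹ this uses all
  -- five derivatives.
  have e : w θ - (w 0 + (θ : ℂ) • psiD F τ (p 0) (w 0)) =
      (w θ - w 0 - (θ : ℂ) • (-(lam F * w 0) + Complex.I • conv (p 0) (w 0))) - (θ : ℂ) •
        ((fun l => Complex.I * ((F.μ l ^ 2 - Real.sin (F.μ l ^ 2 * τ) / τ : ℝ) : ℂ)) * w 0) := by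
    rw [h.psiD_eq]; ext l; simp [lam]; ring
  have b1 := h.taylor_w hB hε hε1 hθ
  have b2 : F.sn 1 ((θ : ℂ) • ((fun l =>
      Complex.I * ((F.μ l ^ 2 - Real.sin (F.μ l ^ 2 * τ) / τ : ℝ) : ℂ)) * w 0)) ≤
      θ * (2 * τ * B) := by
    rw [sn_real_smul _ hθ.1]
    refine mul_le_mul_of_nonneg_left ?_ hθ.1
    refine (F.sn_mul_le (k := 4) (by positivity : 0 ≤ 2 * τ) (fun l => ?_) _).trans ?_
    · rw [norm_mul, Complex.norm_I, one_mul, Complex.norm_real, Real.norm_eq_abs]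
      have e2 : F.μ l ^ 2 - Real.sin (F.μ l ^ 2 * τ) / τ =
        (F.μ l ^ 2 * τ - Real.sin (F.μ l ^ 2 * τ)) / τ := by field_simp
      rw [e2, abs_div, abs_of_pos hτ, div_le_iff₀ hτ]
      refine (abs_sub_sin_le _).trans ?_
      have : (F.μ l ^ 2) ^ 2 ≤ (F.ρ l ^ 2) ^ 2 :=
        pow_le_pow_left₀ (sq_nonneg _) (F.mu_sq_le l) 2
      calc 2 * (F.μ l ^ 2 * τ) ^ 2 = 2 * τ * (F.μ l ^ 2) ^ 2 * τ := by ring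
        _ ≤ 2 * τ * (F.ρ l ^ 2) ^ 2 * τ := by gcongr
        _ = _ := by ring
    · gcongr; exact h.bound_w 0 h0
  rw [e]
  refine (sn_sub_le_of b1 b2).trans ?_
  have h5 : B ≤ B ^ 3 := le_self_pow₀ hB1 (by norm_num)
  have hε2 : ε ^ 2 ≤ 1 := pow_le_one₀ hε.le hε1
  have h6 : τ ^ 2 ≤ τ ^ 2 / ε ^ 2 := le_div_self (by positivity) (by positivity) hε2
  have h7 : θ ^ 2 / ε ^ 2 ≤ τ ^ 2 / ε ^ 2 := by have := hθ.1; gcongr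
  have h8 : θ * τ ≤ τ ^ 2 / ε ^ 2 := le_trans (by nlinarith) h6
  have h9 : η * θ ≤ η := mul_le_of_le_one_right hη (hθτ.trans hτ1)
  have h10 : 0 ≤ θ * τ := mul_nonneg hθ.1 hτ.le
  have h11 : 0 ≤ η * θ := mul_nonneg hη hθ.1
  calc (5 * B ^ 3 * (θ / ε ^ 2) + B * η) * θ + θ * (2 * τ * B)
      = 5 * B ^ 3 * (θ ^ 2 / ε ^ 2) + B * (η * θ) + 2 * B * (θ * τ) := by ring
    _ ≤ 5 * B ^ 3 * (τ ^ 2 / ε ^ 2) + B ^ 3 * η + 2 * B ^ 3 * (τ ^ 2 / ε ^ 2) := by gcongr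
    _ ≤ 5 * B ^ 3 * (τ ^ 2 / ε ^ 2) + 7 * B ^ 3 * η + 2 * B ^ 3 * (τ ^ 2 / ε ^ 2) := by
        have : B ^ 3 * η ≤ 7 * B ^ 3 * η := by nlinarith [mul_nonneg (pow_nonneg hB0.le 3) hη]
        gcongr
    _ = _ := by ring

end ExactData

end estimates

set_option linter.unusedSectionVars false

/-! ### Oscillatory integrals -/

section oscillatory

variable {G : Type*} [AddCommGroup G] [Fintype G] {F : Freq G} {ε : ℝ}

lemma hasDerivAt_J {c : ℝ → G → ℂ} {c' : G → ℂ} {t : ℝ}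
    (h : ∀ l, HasDerivAt (fun t => c t l) (c' l) t) (l : G) :
    HasDerivAt (fun t => J (c t) l) (J c' l) t :=
  Complex.conjCLE.hasFDerivAt.comp_hasDerivAt t (h (-l))

lemma continuousOn_J {c : ℝ → G → ℂ} {s : Set ℝ}
    (h : ∀ l, ContinuousOn (fun t => c t l) s) (l : G) :
    ContinuousOn (fun t => J (c t) l) s :=
  Complex.continuous_conj.comp_continuousOn (h (-l))

lemma sn_osc_mul (s : ℕ) (x : G → ℝ) (c : G → ℂ) : F.sn s ((fun l => osc (x l)) * c) = F.sn s c :=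
  F.sn_eq_of_norm_eq fun l => by simp

/-- Integration by parts against the Klein–Gordon phase. -/
lemma sn_sub_le_of_kg_osc (hε : 0 < ε) {Z E K K' : ℝ → G → ℂ} {θ e c : ℝ} (hθ : 0 ≤ θ)
    (hZ : ∀ l, ContinuousOn (fun t => Z t l) (Icc 0 θ))
    (hZ' : ∀ t ∈ Ioo 0 θ, ∀ l, HasDerivAt (fun t => Z t l)
      (-(Complex.I * (osc (-F.om ε l * t) * (E t l + K t l)))) t)
    (hK : ∀ l, ContinuousOn (fun t => K t l) (Icc 0 θ))
    (hK' : ∀ t ∈ Ioo 0 θ, ∀ l, HasDerivAt (fun t => K t l) (K' t l) t)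
    (hE : ∀ t ∈ Ioo 0 θ, F.sn 1 (E t) ≤ e) (hc : ∀ t ∈ Ioo 0 θ, F.sn 1 (K' t) ≤ c) :
    F.sn 1 (Z θ - Z 0) ≤ (e + ε ^ 2 * c) * θ + ε ^ 2 * (F.sn 1 (K θ) + F.sn 1 (K 0)) := by
  -- A primitive of -i e^(-iωt), of size ω⁻¹ ≤ ε². Subtracting `m * K` from `Z` trades the
  -- oscillating term `K` for `K'` with the gain ε²; the rough part `E` is never differentiated.
  let m : ℝ → G → ℂ := fun t l => ((F.om ε l)⁻¹ : ℝ) * osc (-F.om ε l * t)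
  have hm : ∀ t l, ‖m t l‖ ≤ ε ^ 2 := fun t l => by
    have := F.om_pos hε l
    simp only [m, norm_mul, norm_osc, mul_one, Complex.norm_real, Real.norm_eq_abs]
    rw [abs_of_pos (by positivity)]
    exact F.inv_om_le hε l
  have hmK : ∀ t (d : G → ℂ), F.sn 1 (m t * d) ≤ ε ^ 2 * F.sn 1 d := fun t d =>
    F.sn_mul_le_of_le (sq_nonneg ε) (hm t) d
  have hmd : ∀ t l, HasDerivAt (fun t => m t l) (-(Complex.I * osc (-F.om ε l * t))) t := by
    intro t l
    have h1 : ((F.om ε l : ℝ) : ℂ) ≠ 0 := by exact_mod_cast (F.om_pos hε l).ne'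
    refine ((hasDerivAt_osc (-F.om ε l) t).const_mul (((F.om ε l)⁻¹ : ℝ) : ℂ)).congr_deriv ?_
    push_cast
    field_simp
  have key := F.sn_sub_le_of_hasDerivAt (s := 1) (f := fun t => Z t - m t * K t)
    (f' := fun t => (fun l => -Complex.I * osc (-F.om ε l * t)) * E t - m t * K' t)
    (B := e + ε ^ 2 * c) hθ
    (fun l => (hZ l).sub (ContinuousOn.mul
      (fun t _ => (hmd t l).continuousAt.continuousWithinAt) (hK l)))
    (fun t ht l => ((hZ' t ht l).sub ((hmd t l).mul (hK' t ht l))).congr_deriv (by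
      simp only [Pi.sub_apply, Pi.mul_apply]; ring))
    (fun t ht => by
      refine sn_sub_le_of ?_ ((hmK t _).trans (by gcongr; exact hc t ht))
      exact (F.sn_mul_le_of_le_one (by simp) _).trans (hE t ht))
  have e1 : Z θ - Z 0 = (fun t => Z t - m t * K t) θ - (fun t => Z t - m t * K t) 0
      + (m θ * K θ - m 0 * K 0) := by simp only; ring
  rw [e1]
  refine (sn_add_le_of key (sn_sub_le_of (hmK θ _) (hmK 0 _))).trans_eq (by ring)

/-- Integration by parts against the phases `e^{± iθ/ε²}` in the Schrödinger equation. -/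
lemma sn_sub_le_of_schrodinger_osc (hε : 0 < ε) {H E : ℝ → G → ℂ} {X X' Y Y' : ℝ → G → ℂ}
    {θ e c : ℝ} (hθ : 0 ≤ θ)
    (hH : ∀ l, ContinuousOn (fun t => H t l) (Icc 0 θ))
    (hH' : ∀ t ∈ Ioo 0 θ, ∀ l, HasDerivAt (fun t => H t l)
      (Complex.I * (osc (F.μ l ^ 2 * t) * (E t l + (osc (1 / ε ^ 2 * t) * X t l
        + osc (-(1 / ε ^ 2) * t) * Y t l)))) t)
    (hX : ∀ l, ContinuousOn (fun t => X t l) (Icc 0 θ))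
    (hX' : ∀ t ∈ Ioo 0 θ, ∀ l, HasDerivAt (fun t => X t l) (X' t l) t)
    (hY : ∀ l, ContinuousOn (fun t => Y t l) (Icc 0 θ))
    (hY' : ∀ t ∈ Ioo 0 θ, ∀ l, HasDerivAt (fun t => Y t l) (Y' t l) t)
    (hE : ∀ t ∈ Ioo 0 θ, F.sn 1 (E t) ≤ e)
    (hX3 : ∀ t ∈ Ioo 0 θ, F.sn 3 (X t) ≤ c) (hX1 : ∀ t ∈ Ioo 0 θ, F.sn 1 (X' t) ≤ c)
    (hY3 : ∀ t ∈ Ioo 0 θ, F.sn 3 (Y t) ≤ c) (hY1 : ∀ t ∈ Ioo 0 θ, F.sn 1 (Y' t) ≤ c)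
    (hX0 : X 0 = 0) (hY0 : Y 0 = 0) :
    F.sn 1 (H θ - H 0) ≤ (e + 4 * (ε ^ 2 * c)) * θ + ε ^ 2 * (F.sn 1 (X θ) + F.sn 1 (Y θ)) := by
  let m : ℝ → ℝ → G → ℂ := fun σ t l => osc ((F.μ l ^ 2 + σ) * t)
  have hmK : ∀ σ t (d : G → ℂ), F.sn 1 (m σ t * d) = F.sn 1 d := fun σ t d =>
    sn_osc_mul 1 _ d
  have hmd : ∀ σ t l, HasDerivAt (fun t => m σ t l)
      (Complex.I * ((F.μ l ^ 2 + σ : ℝ) : ℂ) * m σ t l) t := fun σ t l => hasDerivAt_osc _ t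
  have hm : ∀ σ t l, m σ t l = osc (F.μ l ^ 2 * t) * osc (σ * t) := fun σ t l => by
    simp only [m]; rw [← osc_add]; congr 1; ring
  have hε' : (ε : ℂ) ≠ 0 := by exact_mod_cast hε.ne'
  -- The full phases μ² ± ε⁻² may vanish, so dividing by them is impossible. Only e^(±it/ε²) is
  -- integrated, with the factor ±ε², while e^(iμ²t) is left to be differentiated. The resulting
  -- term μ²X is the reason for the h³ bounds on `X` and `Y`.
  let P : ℝ → G → ℂ := fun t =>
    ((ε ^ 2 : ℝ) : ℂ) • (m (1 / ε ^ 2) t * X t - m (-(1 / ε ^ 2)) t * Y t)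
  have hPn : ∀ t, F.sn 1 (P t) ≤ ε ^ 2 * (F.sn 1 (X t) + F.sn 1 (Y t)) := fun t => by
    simp only [P]
    rw [sn_real_smul _ (sq_nonneg ε)]
    gcongr
    exact sn_sub_le_of (hmK _ _ _).le (hmK _ _ _).le
  have key := F.sn_sub_le_of_hasDerivAt (s := 1) (f := fun t => H t - P t)
    (f' := fun t => Complex.I • ((fun l => osc (F.μ l ^ 2 * t)) * E t) - ((ε ^ 2 : ℝ) : ℂ) •
      (m (1 / ε ^ 2) t * (lam F * X t + X' t) - m (-(1 / ε ^ 2)) t * (lam F * Y t + Y' t)))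
    (B := e + 4 * (ε ^ 2 * c)) hθ
    (fun l => (hH l).sub (ContinuousOn.const_smul (ContinuousOn.sub
      (ContinuousOn.mul (fun t _ => (hmd _ t l).continuousAt.continuousWithinAt) (hX l))
      (ContinuousOn.mul (fun t _ => (hmd _ t l).continuousAt.continuousWithinAt) (hY l))) _))
    (fun t ht l => ((hH' t ht l).sub ((((hmd _ t l).fun_mul (hX' t ht l)).fun_sub
      ((hmd _ t l).fun_mul (hY' t ht l))).const_mul ((ε ^ 2 : ℝ) : ℂ))).congr_deriv (by
      simp only [Pi.sub_apply, Pi.mul_apply, Pi.smul_apply, Pi.add_apply, smul_eq_mul, hm, lam]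
      push_cast
      field_simp
      ring))
    (fun t ht => by
      have b1 : F.sn 1 (Complex.I • ((fun l => osc (F.μ l ^ 2 * t)) * E t)) ≤ e := by
        rw [sn_I_smul, sn_osc_mul]; exact hE t ht
      have b2 : F.sn 1 (lam F * X t + X' t) ≤ c + c :=
        sn_add_le_of ((sn_lam_mul_le 1 _).trans (hX3 t ht)) (hX1 t ht)
      have b3 : F.sn 1 (lam F * Y t + Y' t) ≤ c + c :=
        sn_add_le_of ((sn_lam_mul_le 1 _).trans (hY3 t ht)) (hY1 t ht)
      refine (sn_sub_le_of b1 (y := ε ^ 2 * ((c + c) + (c + c))) ?_).trans_eq (by ring)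
      rw [sn_real_smul _ (sq_nonneg ε)]
      gcongr
      refine sn_sub_le_of ?_ ?_
      · rw [hmK]; exact b2
      · rw [hmK]; exact b3)
  have e1 : H θ - H 0 = (fun t => H t - P t) θ - (fun t => H t - P t) 0 + P θ := by
    have : P 0 = 0 := by simp [P, hX0, hY0]
    simp only [this]; ring
  rw [e1]
  exact sn_add_le_of key (hPn θ)

end oscillatory

/-! ### The Klein–Gordon remainder -/

section remainder

variable {G : Type*} [AddCommGroup G] [Fintype G] {F : Freq G} {ε T B η : ℝ}
  {w p q f g : ℝ → G → ℂ}

/-- `φ(θ)` minus the free Klein–Gordon evolution of the data at time `0`. -/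
def kgRem (F : Freq G) (ε : ℝ) (p q : ℝ → G → ℂ) (θ : ℝ) : G → ℂ :=
  p θ - (osc (1 / ε ^ 2 * θ) • (F.amp ε θ * vInit ε (p 0) (q 0))
    + osc (-(1 / ε ^ 2) * θ) • J (F.amp ε θ * vInit ε (p 0) (q 0)))

/-- The same in the complex Klein–Gordon variable. -/
def zRem (F : Freq G) (ε : ℝ) (p q : ℝ → G → ℂ) (θ : ℝ) : G → ℂ :=
  zed F ε (p θ) (q θ) - (fun l => osc (F.om ε l * θ)) * zed F ε (p 0) (q 0)

lemma osc_mul_amp (θ : ℝ) (l : G) : osc (1 / ε ^ 2 * θ) * F.amp ε θ l =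
    (Real.cos (F.om ε l * θ) : ℂ) +
      Complex.I * ((ε ^ 2 * F.om ε l)⁻¹ : ℝ) * (Real.sin (F.om ε l * θ) : ℂ) := by
  rw [Freq.amp, ← mul_assoc, neg_mul, osc_mul_osc_neg, one_mul]

/-- The phase contained in `amp` cancels e^(iθ/ε²), and adding the conjugate leaves the usual cosine
and sine propagators. -/
lemma free_eq (hε : 0 < ε) {Φ D : G → ℂ} (h1 : J Φ = Φ) (h2 : J D = D) (θ : ℝ) (l : G) :
    (osc (1 / ε ^ 2 * θ) • (F.amp ε θ * vInit ε Φ D)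
      + osc (-(1 / ε ^ 2) * θ) • J (F.amp ε θ * vInit ε Φ D)) l =
    (Real.cos (F.om ε l * θ) : ℂ) * Φ l +
      (Real.sin (F.om ε l * θ) : ℂ) * ((F.om ε l)⁻¹ : ℝ) * D l := by
  have e1 : J (F.amp ε θ * vInit ε Φ D) l = conj (F.amp ε θ l) * J (vInit ε Φ D) l := by
    simp [J, F.amp_neg]
  have e2 : osc (-(1 / ε ^ 2) * θ) * conj (F.amp ε θ l) = (Real.cos (F.om ε l * θ) : ℂ) -
      Complex.I * ((ε ^ 2 * F.om ε l)⁻¹ : ℝ) * (Real.sin (F.om ε l * θ) : ℂ) := by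
    have := congrArg conj (osc_mul_amp (F := F) (ε := ε) θ l)
    rw [map_mul, conj_osc, ← neg_mul] at this
    rw [this]
    simp only [map_add, map_mul, Complex.conj_ofReal, Complex.conj_I]
    ring
  rw [Pi.add_apply, Pi.smul_apply, Pi.smul_apply, e1, smul_eq_mul, smul_eq_mul, ← mul_assoc, e2,
    J_vInit Φ D h1 h2, Pi.mul_apply, ← mul_assoc, osc_mul_amp, vInit]
  simp only [Pi.smul_apply, Pi.add_apply, Pi.sub_apply, smul_eq_mul]
  have h3 : ((F.om ε l : ℝ) : ℂ) ≠ 0 := by exact_mod_cast (F.om_pos hε l).ne'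
  have hε' : (ε : ℂ) ≠ 0 := by exact_mod_cast hε.ne'
  push_cast
  field_simp
  linear_combination (-2 * ε ^ 2 * Complex.sin (F.om ε l * θ) * D l) * Complex.I_sq

namespace ExactData

variable (h : ExactData F ε T B η w p q f g)
include h

lemma kgRem_eq (hε : 0 < ε) (hT : 0 ≤ T) (θ : ℝ) (l : G) :
    kgRem F ε p q θ l = p θ l - ((Real.cos (F.om ε l * θ) : ℂ) * p 0 l +
      (Real.sin (F.om ε l * θ) : ℂ) * ((F.om ε l)⁻¹ : ℝ) * q 0 l) := by
  have h0 : (0 : ℝ) ∈ Icc 0 T := ⟨le_rfl, hT⟩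
  rw [kgRem, Pi.sub_apply, free_eq hε (h.real_p 0 h0) (h.real_q 0 h0)]

lemma J_zRem (θ : ℝ) (l : G) : J (zRem F ε p q θ) l =
    J (zed F ε (p θ) (q θ)) l - osc (-(F.om ε l * θ)) * J (zed F ε (p 0) (q 0)) l := by
  simp [zRem, J, F.om_neg, conj_osc]

/-- With respect to the involution `J`, the real part of the complex remainder carries the remainder
of φ and the imaginary part that of ∂ₜφ. As ε²ω ≥ 1, the passage from `zRem` to `kgRem` loses
nothing. -/
lemma om_mul_kgRem (hε : 0 < ε) {θ : ℝ} (hθ : θ ∈ Icc 0 T) (l : G) :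
    ((ε ^ 2 * F.om ε l : ℝ) : ℂ) * kgRem F ε p q θ l =
      ((1 / 2 : ℂ) • (zRem F ε p q θ + J (zRem F ε p q θ))) l := by
  have h0 : (0 : ℝ) ∈ Icc 0 T := ⟨le_rfl, hθ.1.trans hθ.2⟩
  rw [h.kgRem_eq hε h0.2, Pi.smul_apply, Pi.add_apply, h.J_zRem,
    J_zed _ _ (h.real_p 0 h0) (h.real_q 0 h0), J_zed _ _ (h.real_p θ hθ) (h.real_q θ hθ),
    osc_neg_eq]
  simp only [zRem, zed, Pi.sub_apply, Pi.mul_apply, osc_eq, smul_eq_mul]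
  have h3 : ((F.om ε l : ℝ) : ℂ) ≠ 0 := by exact_mod_cast (F.om_pos hε l).ne'
  push_cast
  field_simp
  linear_combination (-2 * ε ^ 2 * Complex.sin (F.om ε l * θ) * q 0 l) * Complex.I_sq

lemma sn_kgRem_le_zRem (hε : 0 < ε) {θ : ℝ} (hθ : θ ∈ Icc 0 T) :
    F.sn 1 (kgRem F ε p q θ) ≤ F.sn 1 (zRem F ε p q θ) := by
  refine (F.sn_le_of_le (t := 1) (d := (1 / 2 : ℂ) • (zRem F ε p q θ + J (zRem F ε p q θ)))
    fun l => ?_).trans (sn_half_smul_le le_rfl (F.sn_J 1 _).le)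
  have := F.rho_pos l
  rw [← h.om_mul_kgRem hε hθ, norm_mul, Complex.norm_real, Real.norm_eq_abs]
  have h1 := F.one_le_eps_sq_mul_om hε l
  rw [abs_of_pos (by linarith)]
  gcongr
  exact le_mul_of_one_le_left (norm_nonneg _) h1

/-- The complex remainder contains ε²∂ₜφ; recovering ∂ₜφ from it costs ε⁻². -/
lemma hasDerivAt_kgRem (hε : 0 < ε) {θ : ℝ} (hθ : θ ∈ Ioo 0 T) (l : G) :
    HasDerivAt (fun θ => kgRem F ε p q θ l) ((((1 / ε ^ 2 : ℝ) : ℂ) • Complex.I • (1 / 2 : ℂ) •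
      (zRem F ε p q θ + -J (zRem F ε p q θ))) l) θ := by
  have hθ' := Ioo_subset_Icc_self hθ
  have h0 : (0 : ℝ) ∈ Icc 0 T := ⟨le_rfl, hθ'.1.trans hθ'.2⟩
  have hid : HasDerivAt (fun θ => F.om ε l * θ) (F.om ε l) θ := by
    simpa using (hasDerivAt_id θ).const_mul (F.om ε l)
  have h1 := (h.deriv_p θ hθ l).fun_sub (((hid.cos.ofReal_comp).mul_const (p 0 l)).fun_add
    (((hid.sin.ofReal_comp).mul_const (((F.om ε l)⁻¹ : ℝ) : ℂ)).mul_const (q 0 l)))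
  rw [show (fun θ => kgRem F ε p q θ l) = _ from funext fun θ => h.kgRem_eq hε h0.2 θ l]
  refine h1.congr_deriv ?_
  simp only [Pi.smul_apply, Pi.add_apply, Pi.neg_apply, h.J_zRem]
  rw [J_zed _ _ (h.real_p 0 h0) (h.real_q 0 h0), J_zed _ _ (h.real_p θ hθ') (h.real_q θ hθ'),
    osc_neg_eq]
  simp only [zRem, zed, Pi.sub_apply, Pi.mul_apply, osc_eq, smul_eq_mul]
  have h3 : ((F.om ε l : ℝ) : ℂ) ≠ 0 := by exact_mod_cast (F.om_pos hε l).ne'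
  have hε' : (ε : ℂ) ≠ 0 := by exact_mod_cast hε.ne'
  push_cast
  field_simp
  linear_combination (2 * (q θ l - Complex.cos (F.om ε l * θ) * q 0 l +
    Complex.sin (F.om ε l * θ) * p 0 l * F.om ε l)) * Complex.I_sq

/-- The second order equation factors as ζ' = iωζ - ig. Undoing the rotation leaves only the source,
without a factor ε⁻². -/
lemma hasDerivAt_osc_zed (hε : 0 < ε) {t : ℝ} (ht : t ∈ Ioo 0 T) (l : G) :
    HasDerivAt (fun t => osc (-F.om ε l * t) * zed F ε (p t) (q t) l)
      (-(Complex.I * (osc (-F.om ε l * t) * g t l))) t := by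
  have hε' : (ε : ℂ) ≠ 0 := by exact_mod_cast hε.ne'
  have h1 := ((h.deriv_p t ht l).const_mul ((ε ^ 2 * F.om ε l : ℝ) : ℂ)).fun_sub
    ((h.deriv_q t ht l).const_mul (Complex.I * (ε : ℂ) ^ 2))
  refine ((hasDerivAt_osc (-F.om ε l) t).fun_mul h1).congr_deriv ?_
  push_cast
  field_simp
  linear_combination (osc (-(F.om ε l * t)) * F.om ε l * ε ^ 2 * q t l) * Complex.I_sq

lemma continuousOn_osc_zed (l : G) :
    ContinuousOn (fun t => osc (-F.om ε l * t) * zed F ε (p t) (q t) l) (Icc 0 T) :=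
  ContinuousOn.mul (fun t _ => (hasDerivAt_osc _ t).continuousAt.continuousWithinAt)
    ((continuousOn_const.mul (h.cont_p l)).sub (continuousOn_const.mul (h.cont_q l)))

lemma sn_zRem_eq (θ : ℝ) : F.sn 1 (zRem F ε p q θ) = F.sn 1
    ((fun l => osc (-F.om ε l * θ) * zed F ε (p θ) (q θ) l) -
      (fun l => osc (-F.om ε l * 0) * zed F ε (p 0) (q 0) l)) := by
  rw [← sn_osc_mul 1 (fun l => -F.om ε l * θ)]
  congr 1
  ext l
  simp only [zRem, Pi.mul_apply, Pi.sub_apply, mul_zero, osc_zero, one_mul, mul_sub, neg_mul]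
  rw [← mul_assoc, ← osc_add]
  simp

variable (hB : IsAlg F B)
include hB

lemma bound_g (hη1 : η ≤ 1) {t : ℝ} (ht : t ∈ Ioo 0 T) : F.sn 1 (g t) ≤ 2 * B ^ 3 := by
  have hw := h.bound_w_le (s := 1) (by norm_num) (Ioo_subset_Icc_self ht)
  have b := sn_add_le_of (h.alias_g t ht) (hB.one_le_of hw ((F.sn_J 1 _).trans_le hw))
  rw [sub_add_cancel] at b
  have h5 : B ≤ B ^ 3 := le_self_pow₀ hB.one_le (by norm_num)
  nlinarith [hB.pos]

lemma sn_zRem_le (hε : 0 < ε) (hη1 : η ≤ 1) {θ : ℝ} (hθ : θ ∈ Icc 0 T) :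
    F.sn 1 (zRem F ε p q θ) ≤ 2 * B ^ 3 * θ := by
  rw [h.sn_zRem_eq]
  exact sn_sub_le_of_subset (c := fun t l => osc (-F.om ε l * t) * zed F ε (p t) (q t) l)
    (c' := fun t => -(Complex.I • ((fun l => osc (-F.om ε l * t)) * g t))) hθ
    h.continuousOn_osc_zed (fun t ht l => h.hasDerivAt_osc_zed hε ht l) fun t ht _ => by
      rw [F.sn_neg, sn_I_smul, sn_osc_mul]; exact h.bound_g hB hη1 ht

/-- The first rate is that of the complex remainder. For the second one the remainder, which is zero
at time 0, is integrated once more from its derivative, of size θ/ε². -/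
lemma sn_kgRem_le (hε : 0 < ε) (hη1 : η ≤ 1) {θ : ℝ} (hθ : θ ∈ Icc 0 T) :
    F.sn 1 (kgRem F ε p q θ) ≤ 2 * B ^ 3 * θ ∧
      F.sn 1 (kgRem F ε p q θ) ≤ 2 * B ^ 3 * (θ ^ 2 / ε ^ 2) := by
  refine ⟨(h.sn_kgRem_le_zRem hε hθ).trans (h.sn_zRem_le hB hε hη1 hθ), ?_⟩
  have h0 : (0 : ℝ) ∈ Icc 0 T := ⟨le_rfl, hθ.1.trans hθ.2⟩
  have hB0 := hB.pos
  have hz : kgRem F ε p q 0 = 0 := by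
    ext l; rw [h.kgRem_eq hε h0.2]; simp
  have key := sn_sub_le_of_subset (F := F) (s := 1) (c := kgRem F ε p q) (C := 2 * B ^ 3 * θ / ε ^ 2)
    hθ (fun l => ?_) (fun t ht l => h.hasDerivAt_kgRem hε ht l) fun t ht htθ => ?_
  · rw [hz, sub_zero] at key
    exact key.trans_eq (by ring)
  · simp only [h.kgRem_eq hε h0.2]
    exact (h.cont_p l).sub (by fun_prop)
  · rw [sn_real_smul _ (by positivity), sn_I_smul]
    have := h.sn_zRem_le hB hε hη1 (Ioo_subset_Icc_self ht)
    have b : F.sn 1 ((1 / 2 : ℂ) • (zRem F ε p q t + -J (zRem F ε p q t))) ≤ 2 * B ^ 3 * t :=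
      sn_half_smul_le this (by rw [F.sn_neg, F.sn_J]; exact this)
    calc 1 / ε ^ 2 * _ ≤ 1 / ε ^ 2 * (2 * B ^ 3 * θ) := by gcongr; exact b.trans (by gcongr)
      _ = _ := by ring

lemma hasDerivAt_density {t : ℝ} (ht : t ∈ Ioo 0 T) (l : G) :
    HasDerivAt (fun t => conv (w t) (J (w t)) l)
      ((conv (-(lam F * w t) + Complex.I • f t) (J (w t)) +
        conv (w t) (J (-(lam F * w t) + Complex.I • f t))) l) t :=
  hasDerivAt_conv (fun l => h.deriv_w t ht l) (hasDerivAt_J fun l => h.deriv_w t ht l) l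

lemma bound_density_deriv {t : ℝ} (ht : t ∈ Ioo 0 T) :
    F.sn 1 (conv (-(lam F * w t) + Complex.I • f t) (J (w t)) +
        conv (w t) (J (-(lam F * w t) + Complex.I • f t))) ≤ 4 * B ^ 3 := by
  have h1 := h.bound_w_le (s := 1) (by norm_num) (Ioo_subset_Icc_self ht)
  have h2 := (F.sn_mono (s := 1) (by norm_num) _).trans (h.bound_deriv_w ht)
  exact (sn_add_le_of (hB.one_le_of h2 ((F.sn_J 1 _).trans_le h1))
    (hB.one_le_of h1 ((F.sn_J 1 _).trans_le h2))).trans_eq (by ring)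

/-- The density |ψ|² has a bounded time derivative, so its integral against e^(-iωt) is of size ε².
The aliasing defect has no such regularity and is estimated directly. -/
lemma sn_kgRem_le_eps (hε : 0 < ε) (hη : 0 ≤ η) {θ : ℝ} (hθ : θ ∈ Icc 0 T) (hθ1 : θ ≤ 1) :
    F.sn 1 (kgRem F ε p q θ) ≤ 6 * B ^ 3 * (η + ε ^ 2) := by
  refine (h.sn_kgRem_le_zRem hε hθ).trans ?_
  rw [h.sn_zRem_eq]
  have hs1 : Icc 0 θ ⊆ Icc 0 T := Icc_subset_Icc_right hθ.2
  have hs2 : Ioo 0 θ ⊆ Ioo 0 T := Ioo_subset_Ioo_right hθ.2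
  have h0 : (0 : ℝ) ∈ Icc 0 T := ⟨le_rfl, hθ.1.trans hθ.2⟩
  have hγ : ∀ t ∈ Icc 0 T, F.sn 1 (conv (w t) (J (w t))) ≤ B ^ 3 := fun t ht => by
    have hw := h.bound_w_le (s := 1) (by norm_num) ht
    exact (hB.one_le_of hw ((F.sn_J 1 _).trans_le hw)).trans_eq (by ring)
  have key := sn_sub_le_of_kg_osc (F := F) hε (e := B * η) (c := 4 * B ^ 3)
    (Z := fun t l => osc (-F.om ε l * t) * zed F ε (p t) (q t) l)
    (E := fun t => g t - conv (w t) (J (w t))) (K := fun t => conv (w t) (J (w t))) hθ.1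
    (fun l => (h.continuousOn_osc_zed l).mono hs1)
    (fun t ht l => (h.hasDerivAt_osc_zed hε (hs2 ht) l).congr_deriv (by simp))
    (fun l => (continuousOn_conv h.cont_w (continuousOn_J h.cont_w) l).mono hs1)
    (fun t ht l => h.hasDerivAt_density hB (hs2 ht) l)
    (fun t ht => h.alias_g t (hs2 ht)) (fun t ht => h.bound_density_deriv hB (hs2 ht))
  refine key.trans ?_
  have h5 : B ≤ B ^ 3 := le_self_pow₀ hB.one_le (by norm_num)
  have hB0 := hB.pos
  have h1 := hγ θ hθ
  have h2 := hγ 0 h0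
  have h3 := hθ.1
  calc _ ≤ (B ^ 3 * η + ε ^ 2 * (4 * B ^ 3)) * 1 + ε ^ 2 * (B ^ 3 + B ^ 3) := by gcongr
    _ ≤ 6 * B ^ 3 * (η + ε ^ 2) := by nlinarith [mul_nonneg (pow_nonneg hB0.le 3) hη]

end ExactData

end remainder

set_option linter.unusedSectionVars false

/-! ### Local errors -/

section local_error

variable {G : Type*} [AddCommGroup G] [Fintype G] {F : Freq G} {ε T B η : ℝ}
  {w p q f g : ℝ → G → ℂ}

/-- An amplitude that varies slowly on `[0,T]`, with derivative `X'`. -/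
structure IsSlow (F : Freq G) (ε T B : ℝ) (X X' : ℝ → G → ℂ) : Prop where
  cont : ∀ l, ContinuousOn (fun t => X t l) (Icc 0 T)
  deriv : ∀ t ∈ Ioo 0 T, ∀ l, HasDerivAt (fun t => X t l) (X' t l) t
  three : ∀ t ∈ Icc 0 T, F.sn 3 (X t) ≤ B
  bound_deriv : ∀ t ∈ Ioo 0 T, F.sn 1 (X' t) ≤ B
  sub : ∀ t ∈ Icc 0 T, F.sn 1 (X t - X 0) ≤ t ^ 2 / ε ^ 2 * B
  sub' : ∀ t ∈ Icc 0 T, F.sn 1 (X t - X 0) ≤ t * B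

lemma IsSlow.J {X X' : ℝ → G → ℂ} (h : IsSlow F ε T B X X') :
    IsSlow F ε T B (fun t => J (X t)) (fun t => J (X' t)) where
  cont := continuousOn_J h.cont
  deriv := fun t ht => hasDerivAt_J (h.deriv t ht)
  three := fun t ht => (F.sn_J 3 _).trans_le (h.three t ht)
  bound_deriv := fun t ht => (F.sn_J 1 _).trans_le (h.bound_deriv t ht)
  sub := fun t ht => by rw [← J_sub, F.sn_J]; exact h.sub t ht
  sub' := fun t ht => by rw [← J_sub, F.sn_J]; exact h.sub' t ht

/-- The two derivatives between the h³ bound of `V` and the h¹ bounds of the increments pay for the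
factor ρ² in the estimates of `amp`. -/
lemma isSlow_amp_mul (hε : 0 < ε) {V : G → ℂ} (hV : F.sn 3 V ≤ B) :
    IsSlow F ε T B (fun t => F.amp ε t * V) (fun t => F.ampDeriv ε t * V) where
  cont := fun l t _ =>
    ((F.hasDerivAt_amp hε t l).mul_const (V l)).continuousAt.continuousWithinAt
  deriv := fun t _ l => (F.hasDerivAt_amp hε t l).mul_const (V l)
  three := fun t _ => (F.sn_mul_le_of_le_one (F.norm_amp_le hε t) _).trans hV
  bound_deriv := fun t ht => by
    refine (F.sn_mul_le zero_le_one (fun l => (F.norm_ampDeriv_le hε ht.1.le l).1) _).trans ?_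
    rwa [one_mul]
  sub := fun t ht => by
    have e : F.amp ε t * V - F.amp ε 0 * V = (fun l => F.amp ε t l - 1) * V := by
      ext l; simp [F.amp_zero, sub_mul]
    rw [e]
    refine (F.sn_mul_le (k := 2) (by positivity)
      (fun l => (F.norm_amp_sub_one_le hε ht.1 l).2) _).trans ?_
    gcongr
  sub' := fun t ht => by
    have e : F.amp ε t * V - F.amp ε 0 * V = (fun l => F.amp ε t l - 1) * V := by
      ext l; simp [F.amp_zero, sub_mul]
    rw [e]
    refine (F.sn_mul_le (k := 2) ht.1 (fun l => (F.norm_amp_sub_one_le hε ht.1 l).1) _).trans ?_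
    have := ht.1
    gcongr

/-- The residual of a product of an amplitude with `w`. -/
def prodRes (X w : ℝ → G → ℂ) (d : G → ℂ) (t : ℝ) : G → ℂ :=
  conv (X t) (w t) - conv (X 0) (w 0 + (t : ℂ) • d)

lemma hasDerivAt_ofReal_smul (d : G → ℂ) (t : ℝ) (l : G) :
    HasDerivAt (fun t : ℝ => ((t : ℂ) • d) l) (d l) t := by
  simpa using (hasDerivAt_id t).ofReal_comp.mul_const (d l)

lemma continuousOn_ofReal_smul (d : G → ℂ) (s : Set ℝ) (l : G) :
    ContinuousOn (fun t : ℝ => ((t : ℂ) • d) l) s := fun t _ =>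
  (hasDerivAt_ofReal_smul d t l).continuousAt.continuousWithinAt

namespace ExactData

variable (h : ExactData F ε T B η w p q f g) (hB : IsAlg F B)
include h hB

section prod

variable {X X' : ℝ → G → ℂ} (hX : IsSlow F ε T B X X')
include hX

lemma continuousOn_prodRes (d : G → ℂ) (l : G) :
    ContinuousOn (fun t => prodRes X w d t l) (Icc 0 T) :=
  (continuousOn_conv hX.cont h.cont_w l).sub
    (continuousOn_conv (c := fun _ => X 0) (d := fun t => w 0 + (t : ℂ) • d)
      (fun _ => continuousOn_const) (fun l => continuousOn_const.add (continuousOn_ofReal_smul d _ l)) l)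

lemma hasDerivAt_prodRes (d : G → ℂ) {t : ℝ} (ht : t ∈ Ioo 0 T) (l : G) :
    HasDerivAt (fun t => prodRes X w d t l) ((conv (X' t) (w t) +
      conv (X t) (-(lam F * w t) + Complex.I • f t) - conv (X 0) d) l) t := by
  have h1 := hasDerivAt_conv (fun l => hX.deriv t ht l) (fun l => h.deriv_w t ht l) l
  have h2 := hasDerivAt_conv (fun l => hasDerivAt_const t (X 0 l))
    (fun l => (hasDerivAt_const t (w 0 l)).add (hasDerivAt_ofReal_smul d t l)) l
  refine (h1.sub h2).congr_deriv ?_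
  simp only [Pi.sub_apply, Pi.add_apply, zero_add]
  congr 1
  have : conv (fun _ : G => (0 : ℂ)) (w 0 + (t : ℂ) • d) l = 0 := by simp [conv_apply]
  rw [show (fun l => w 0 l + ((t : ℂ) • d) l) = w 0 + (t : ℂ) • d from rfl]
  rw [this, zero_add]

lemma sn_prodRes_deriv_le {d : G → ℂ} (hd : F.sn 3 d ≤ 2 * B ^ 3) {t : ℝ} (ht : t ∈ Ioo 0 T) :
    F.sn 1 (conv (X' t) (w t) + conv (X t) (-(lam F * w t) + Complex.I • f t) - conv (X 0) d)
      ≤ 5 * B ^ 5 := by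
  have ht' := Ioo_subset_Icc_self ht
  have h0 : (0 : ℝ) ∈ Icc 0 T := ⟨le_rfl, ht'.1.trans ht'.2⟩
  have m : (1 : ℕ) ≤ 3 := by norm_num
  have b1 := hB.one_le_of (hX.bound_deriv t ht) (h.bound_w_le (s := 1) (by norm_num) ht')
  have b2 := hB.one_le_of ((F.sn_mono m _).trans (hX.three t ht'))
    ((F.sn_mono m _).trans (h.bound_deriv_w ht))
  have b3 := hB.one_le_of ((F.sn_mono m _).trans (hX.three 0 h0)) ((F.sn_mono m _).trans hd)
  refine (sn_sub_le_of (sn_add_le_of b1 b2) b3).trans ?_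
  have : B ^ 3 ≤ B ^ 5 := pow_le_pow_right₀ hB.one_le (by norm_num)
  calc _ = 3 * B ^ 3 + 2 * B ^ 5 := by ring
    _ ≤ _ := by linarith

omit h hB hX in
lemma prodRes_zero (d : G → ℂ) : prodRes X w d 0 = 0 := by simp [prodRes]

lemma sn_prodRes_le {d : G → ℂ} (hd : F.sn 3 d ≤ 2 * B ^ 3) {t : ℝ} (ht : t ∈ Icc 0 T) :
    F.sn 1 (prodRes X w d t) ≤ 5 * B ^ 5 * t := by
  have := sn_sub_le_of_subset (s := 1) ht (h.continuousOn_prodRes hB hX d)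
    (fun t ht l => h.hasDerivAt_prodRes hB hX d ht l)
    (fun t ht _ => h.sn_prodRes_deriv_le hB hX hd ht)
  rwa [prodRes_zero, sub_zero] at this

/-- Integration by parts in the Schrödinger phase lets μ² act on the residual, so it must be bounded
in h³, although without any smallness. -/
lemma sn_three_prodRes_le {d : G → ℂ} (hd : F.sn 3 d ≤ 2 * B ^ 3) {t : ℝ} (ht : t ∈ Icc 0 T)
    (ht1 : t ≤ 1) : F.sn 3 (prodRes X w d t) ≤ 5 * B ^ 5 := by
  have h0 : (0 : ℝ) ∈ Icc 0 T := ⟨le_rfl, ht.1.trans ht.2⟩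
  have b1 := hB.three_le_of (hX.three t ht) (h.bound_w_le (s := 3) (by norm_num) ht)
  have b2 : F.sn 3 (w 0 + (t : ℂ) • d) ≤ B + 1 * (2 * B ^ 3) := by
    refine sn_add_le_of (h.bound_w_le (by norm_num) h0) ?_
    rw [sn_real_smul _ ht.1]
    exact mul_le_mul ht1 hd (F.sn_nonneg _ _) zero_le_one
  refine (sn_sub_le_of b1 (hB.three_le_of (hX.three 0 h0) b2)).trans ?_
  have : B ^ 3 ≤ B ^ 5 := pow_le_pow_right₀ hB.one_le (by norm_num)
  have : 0 ≤ B ^ 5 := pow_nonneg hB.pos.le 5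
  calc _ = 2 * B ^ 3 + 2 * B ^ 5 := by ring
    _ ≤ _ := by linarith

/-- The residual splits into the drift of the amplitude, of size t²/ε², and the Taylor remainder of
`w` with the filtered derivative. -/
lemma sn_prodRes_le_sq (hε : 0 < ε) (hε1 : ε ≤ 1) (hη : 0 ≤ η) {τ t : ℝ} (hτ : 0 < τ) (hτ1 : τ ≤ 1)
    (ht : t ∈ Icc 0 T) (htτ : t ≤ τ) :
    F.sn 1 (prodRes X w (psiD F τ (p 0) (w 0)) t) ≤ 8 * B ^ 5 * (τ ^ 2 / ε ^ 2 + η) := by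
  have h0 : (0 : ℝ) ∈ Icc 0 T := ⟨le_rfl, ht.1.trans ht.2⟩
  have e : prodRes X w (psiD F τ (p 0) (w 0)) t = conv (X t - X 0) (w t) +
      conv (X 0) (w t - (w 0 + (t : ℂ) • psiD F τ (p 0) (w 0))) := by
    rw [prodRes, sub_conv, conv_sub]; abel
  have b1 := hB.one_le_of (hX.sub t ht) (h.bound_w_le (s := 1) (by norm_num) ht)
  have b2 := hB.one_le_of ((F.sn_mono (s := 1) (by norm_num) _).trans (hX.three 0 h0))
    (h.taylor_w_filter hB hε hε1 hη hτ hτ1 ht htτ)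
  rw [e]
  refine (sn_add_le_of b1 b2).trans ?_
  have h1 : t ^ 2 / ε ^ 2 ≤ τ ^ 2 / ε ^ 2 := by have := ht.1; gcongr
  have h2 : B ^ 3 ≤ B ^ 5 := pow_le_pow_right₀ hB.one_le (by norm_num)
  have hB0 := hB.pos
  calc B * (t ^ 2 / ε ^ 2 * B) * B + B * B * (7 * B ^ 3 * (τ ^ 2 / ε ^ 2 + η))
      = B ^ 3 * (t ^ 2 / ε ^ 2) + 7 * B ^ 5 * (τ ^ 2 / ε ^ 2 + η) := by ring
    _ ≤ B ^ 5 * (τ ^ 2 / ε ^ 2) + 7 * B ^ 5 * (τ ^ 2 / ε ^ 2 + η) := by gcongr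
    _ ≤ B ^ 5 * (τ ^ 2 / ε ^ 2 + η) + 7 * B ^ 5 * (τ ^ 2 / ε ^ 2 + η) := by
        gcongr; linarith
    _ = _ := by ring

end prod

omit h hB in
lemma continuous_force (v Ψ Ψ' : G → ℂ) (l : G) : Continuous (fun s => force ε v Ψ Ψ' s l) := by
  simp only [force, conv_apply, Pi.add_apply, Pi.smul_apply, smul_eq_mul]
  have := continuous_osc
  fun_prop

omit h hB in
lemma continuous_src (Ψ Ψ' : G → ℂ) (l : G) : Continuous (fun s => src Ψ Ψ' s l) := by
  simp only [src, Pi.add_apply, Pi.smul_apply, smul_eq_mul]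
  fun_prop

/-- Local error of one step for `Ψ`. -/
lemma local_psi (hε : 0 < ε) (hε1 : ε ≤ 1) (hη : 0 ≤ η) (hη1 : η ≤ 1) {τ S : ℝ} (hτ : 0 < τ)
    (hτ1 : τ ≤ 1) (hτT : τ ≤ T) (v Ψ Ψ' : G → ℂ)
    (hS : ∀ s ∈ Ioo 0 τ, F.sn 1 (force ε (vInit ε (p 0) (q 0)) (w 0) (psiD F τ (p 0) (w 0)) s -
      force ε v Ψ Ψ' s) ≤ S) :
    F.sn 1 (w τ - stepPsi F ε τ v Ψ Ψ') ≤
      F.sn 1 (w 0 - Ψ) + τ * (S + 40 * B ^ 5 * (η + min (τ ^ 2 / ε ^ 2) (ε ^ 2))) := by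
  have hT : 0 ≤ T := hτ.le.trans hτT
  have h0 : (0 : ℝ) ∈ Icc 0 T := ⟨le_rfl, hT⟩
  have hI : Icc 0 τ ⊆ Icc 0 T := Icc_subset_Icc_right hτT
  have hO : Ioo 0 τ ⊆ Ioo 0 T := Ioo_subset_Ioo_right hτT
  have hB0 := hB.pos
  set d := psiD F τ (p 0) (w 0) with hd_def
  have hd : F.sn 3 d ≤ 2 * B ^ 3 := h.bound_psiD hB hτ hT
  set V := vInit ε (p 0) (q 0) with hV
  have hX : IsSlow F ε T B _ _ := isSlow_amp_mul hε (h.bound_vInit hε (s := 3) (by norm_num) h0)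
  have hY := hX.J
  rw [← hV] at hX hY
  set X : ℝ → G → ℂ := prodRes (fun t => F.amp ε t * V) w d with hXd
  set Y : ℝ → G → ℂ := prodRes (fun t => J (F.amp ε t * V)) w d with hYd
  -- Everything that is not a fast phase times a slow factor: aliasing, the part of φ created by its
  -- source within the step, and the effect of inexact data, bounded by `S`.
  let E : ℝ → G → ℂ := fun t => (f t - conv (p t) (w t)) + conv (kgRem F ε p q t) (w t) +
    (force ε V (w 0) d t - force ε v Ψ Ψ' t)
  -- The local error in the interaction picture. Its increment over the step, together with the
  -- initial error, is the error after the step up to a unimodular factor.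
  let H : ℝ → G → ℂ := fun t l => osc (F.μ l ^ 2 * t) * w t l -
    Complex.I * ∫ s in (0 : ℝ)..t, osc (F.μ l ^ 2 * s) * force ε v Ψ Ψ' s l
  have hint : ∀ l, Continuous fun s => osc (F.μ l ^ 2 * s) * force ε v Ψ Ψ' s l := fun l =>
    (continuous_osc.comp (by fun_prop)).mul (continuous_force v Ψ Ψ' l)
  have hintd : ∀ l t, HasDerivAt
      (fun t => ∫ s in (0 : ℝ)..t, osc (F.μ l ^ 2 * s) * force ε v Ψ Ψ' s l)
      (osc (F.μ l ^ 2 * t) * force ε v Ψ Ψ' t l) t := fun l t =>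
    intervalIntegral.integral_hasDerivAt_right ((hint l).intervalIntegrable _ _)
      (hint l).stronglyMeasurable.stronglyMeasurableAtFilter (hint l).continuousAt
  have hH : ∀ l, ContinuousOn (fun t => H t l) (Icc 0 τ) := fun l =>
    (ContinuousOn.mul (fun t _ => (hasDerivAt_osc _ t).continuousAt.continuousWithinAt)
      ((h.cont_w l).mono hI)).sub
      (continuousOn_const.mul fun t _ => (hintd l t).continuousAt.continuousWithinAt)
  have hsplit : ∀ t l, f t l - force ε v Ψ Ψ' t l =
      E t l + (osc (1 / ε ^ 2 * t) * X t l + osc (-(1 / ε ^ 2) * t) * Y t l) := by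
    intro t l
    have e1 : p t = kgRem F ε p q t + (osc (1 / ε ^ 2 * t) • (F.amp ε t * V)
        + osc (-(1 / ε ^ 2) * t) • J (F.amp ε t * V)) := by rw [kgRem]; abel
    have e2 : (F.amp ε 0 * V) = V := by ext l; simp [F.amp_zero]
    simp only [E, hXd, hYd, prodRes, Pi.add_apply, Pi.sub_apply, e2]
    rw [show conv (p t) (w t) = _ from congrArg (conv · (w t)) e1]
    simp only [force, add_conv, smul_conv, Pi.add_apply, Pi.smul_apply, smul_eq_mul]
    ring
  have hH' : ∀ t ∈ Ioo 0 τ, ∀ l, HasDerivAt (fun t => H t l)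
      (Complex.I * (osc (F.μ l ^ 2 * t) * (E t l + (osc (1 / ε ^ 2 * t) * X t l
        + osc (-(1 / ε ^ 2) * t) * Y t l)))) t := by
    intro t ht l
    refine (((hasDerivAt_osc _ t).fun_mul (h.deriv_w t (hO ht) l)).fun_sub
      ((hintd l t).const_mul Complex.I)).congr_deriv ?_
    rw [← hsplit]
    push_cast
    ring
  have hE : ∀ r, (∀ t ∈ Ioo 0 τ, F.sn 1 (kgRem F ε p q t) ≤ r) → ∀ t ∈ Ioo 0 τ,
      F.sn 1 (E t) ≤ B * η + B * r * B + S := fun r hr t ht =>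
    sn_add_le_of (sn_add_le_of (h.alias_f t (hO ht)) (hB.one_le_of (hr t ht)
      (h.bound_w_le (by norm_num) (hI (Ioo_subset_Icc_self ht))))) (hS t ht)
  have hfin : F.sn 1 (w τ - stepPsi F ε τ v Ψ Ψ') ≤ F.sn 1 (w 0 - Ψ) + F.sn 1 (H τ - H 0) := by
    have e : (fun l => osc (F.μ l ^ 2 * τ)) * (w τ - stepPsi F ε τ v Ψ Ψ') =
        (w 0 - Ψ) + (H τ - H 0) := by
      ext l
      simp only [Pi.mul_apply, Pi.sub_apply, Pi.add_apply, stepPsi, H, mul_sub,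
        ← mul_assoc (osc (F.μ l ^ 2 * τ)) (osc (-(F.μ l ^ 2 * τ))), osc_mul_osc_neg]
      simp
      ring
    rw [← sn_osc_mul 1 fun l => F.μ l ^ 2 * τ, e]
    exact F.sn_add_le _ _ _
  refine hfin.trans (add_le_add le_rfl ?_)
  have p3 : B ^ 3 ≤ B ^ 5 := pow_le_pow_right₀ hB.one_le (by norm_num)
  have p1 : B ≤ B ^ 5 := le_self_pow₀ hB.one_le (by norm_num)
  have p0 : 0 ≤ B ^ 5 := by positivity
  -- Both arguments of the minimum are proved separately: the first with a pointwise bound of the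
  -- residual, the second with integration by parts.
  rw [← min_add_add_left]
  rcases le_total (η + τ ^ 2 / ε ^ 2) (η + ε ^ 2) with hle | hle
  · rw [min_eq_left hle]
    have hr : ∀ t ∈ Ioo 0 τ, F.sn 1 (kgRem F ε p q t) ≤ 2 * B ^ 3 * (τ ^ 2 / ε ^ 2) :=
      fun t ht => ((h.sn_kgRem_le hB hε hη1 (hI (Ioo_subset_Icc_self ht))).2).trans (by
        have := ht.1.le; have := ht.2.le; gcongr)
    have key := F.sn_sub_le_of_hasDerivAt (s := 1) hτ.le hH hH'
      (B := S + 40 * B ^ 5 * (η + τ ^ 2 / ε ^ 2)) fun t ht => by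
        have htT := hI (Ioo_subset_Icc_self ht)
        have e : (fun l => Complex.I * (osc (F.μ l ^ 2 * t) * (E t l + (osc (1 / ε ^ 2 * t) * X t l
            + osc (-(1 / ε ^ 2) * t) * Y t l)))) = Complex.I • ((fun l => osc (F.μ l ^ 2 * t)) *
            (E t + (osc (1 / ε ^ 2 * t) • X t + osc (-(1 / ε ^ 2) * t) • Y t))) := by
          ext l; simp
        rw [e, sn_I_smul, sn_osc_mul]
        refine (sn_add_le_of (hE _ hr t ht) (sn_add_le_of
          ((sn_osc_smul _ _ _).trans_le (h.sn_prodRes_le_sq hB hX hε hε1 hη hτ hτ1 htT ht.2.le))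
          ((sn_osc_smul _ _ _).trans_le
            (h.sn_prodRes_le_sq hB hY hε hε1 hη hτ hτ1 htT ht.2.le)))).trans ?_
        have : 0 ≤ τ ^ 2 / ε ^ 2 := by positivity
        have : B * η ≤ B ^ 5 * η := by gcongr
        nlinarith [mul_nonneg p0 hη, mul_nonneg p0 ‹0 ≤ τ ^ 2 / ε ^ 2›]
    exact key.trans_eq (mul_comm _ _)
  · rw [min_eq_right hle]
    have hr : ∀ t ∈ Ioo 0 τ, F.sn 1 (kgRem F ε p q t) ≤ 6 * B ^ 3 * (η + ε ^ 2) :=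
      fun t ht => h.sn_kgRem_le_eps hB hε hη (hI (Ioo_subset_Icc_self ht)) (ht.2.le.trans hτ1)
    -- The amplitude residuals vanish at the start and are Lipschitz, so the boundary term is of
    -- size ε²τ and not merely ε²; the factor τ is needed for the sum over the steps.
    have key := sn_sub_le_of_schrodinger_osc (F := F) hε (c := 5 * B ^ 5) hτ.le hH hH'
      (fun l => (h.continuousOn_prodRes hB hX d l).mono hI)
      (fun t ht l => h.hasDerivAt_prodRes hB hX d (hO ht) l)
      (fun l => (h.continuousOn_prodRes hB hY d l).mono hI)
      (fun t ht l => h.hasDerivAt_prodRes hB hY d (hO ht) l)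
      (hE _ hr)
      (fun t ht => h.sn_three_prodRes_le hB hX hd (hI (Ioo_subset_Icc_self ht)) (ht.2.le.trans hτ1))
      (fun t ht => h.sn_prodRes_deriv_le hB hX hd (hO ht))
      (fun t ht => h.sn_three_prodRes_le hB hY hd (hI (Ioo_subset_Icc_self ht)) (ht.2.le.trans hτ1))
      (fun t ht => h.sn_prodRes_deriv_le hB hY hd (hO ht)) (prodRes_zero _) (prodRes_zero _)
    refine key.trans ?_
    have hτm : τ ∈ Icc 0 T := ⟨hτ.le, hτT⟩
    have b1 := h.sn_prodRes_le hB hX hd hτm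
    have b2 := h.sn_prodRes_le hB hY hd hτm
    have hη' : B * η ≤ B ^ 5 * η := by gcongr
    calc _ ≤ (B * η + B * (6 * B ^ 3 * (η + ε ^ 2)) * B + S + 4 * (ε ^ 2 * (5 * B ^ 5))) * τ +
          ε ^ 2 * (5 * B ^ 5 * τ + 5 * B ^ 5 * τ) := by gcongr
      _ = τ * (S + (B * η + 6 * B ^ 5 * (η + ε ^ 2) + 30 * B ^ 5 * ε ^ 2)) := by ring
      _ ≤ _ := by
        gcongr
        nlinarith [mul_nonneg p0 hη, mul_nonneg p0 (sq_nonneg ε)]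

/-- Local error of one step for the complex Klein–Gordon variable. -/
lemma local_z (hε : 0 < ε) (hε1 : ε ≤ 1) (hη : 0 ≤ η) {τ S : ℝ} (hτ : 0 < τ)
    (hτ1 : τ ≤ 1) (hτT : τ ≤ T) (ζ Ψ Ψ' : G → ℂ)
    (hS : ∀ s ∈ Ioo 0 τ, F.sn 1 (src (w 0) (psiD F τ (p 0) (w 0)) s - src Ψ Ψ' s) ≤ S) :
    F.sn 1 (zed F ε (p τ) (q τ) - stepZ F ε τ ζ Ψ Ψ') ≤
      F.sn 1 (zed F ε (p 0) (q 0) - ζ) +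
        τ * (S + 40 * B ^ 7 * (η + min (τ ^ 2 / ε ^ 2) (ε ^ 2))) := by
  have hT : 0 ≤ T := hτ.le.trans hτT
  have h0 : (0 : ℝ) ∈ Icc 0 T := ⟨le_rfl, hT⟩
  have hI : Icc 0 τ ⊆ Icc 0 T := Icc_subset_Icc_right hτT
  have hO : Ioo 0 τ ⊆ Ioo 0 T := Ioo_subset_Ioo_right hτT
  have hB0 := hB.pos
  have m13 : (1 : ℕ) ≤ 3 := by norm_num
  set d := psiD F τ (p 0) (w 0) with hd_def
  have hd : F.sn 1 d ≤ 2 * B ^ 3 := (F.sn_mono m13 _).trans (h.bound_psiD hB hτ hT)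
  let E : ℝ → G → ℂ := fun t => (g t - conv (w t) (J (w t))) + (src (w 0) d t - src Ψ Ψ' t)
  -- The error of linearising the density. It vanishes at time 0 and has a bounded derivative, as
  -- both regimes require.
  let K : ℝ → G → ℂ := fun t => conv (w t) (J (w t)) - src (w 0) d t
  let K' : ℝ → G → ℂ := fun t => (conv (-(lam F * w t) + Complex.I • f t) (J (w t)) +
        conv (w t) (J (-(lam F * w t) + Complex.I • f t))) - (conv d (J (w 0)) + conv (w 0) (J d))
  let Z : ℝ → G → ℂ := fun t l => osc (-F.om ε l * t) * zed F ε (p t) (q t) l +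
    Complex.I * ∫ s in (0 : ℝ)..t, osc (-F.om ε l * s) * src Ψ Ψ' s l
  have hint : ∀ l, Continuous fun s => osc (-F.om ε l * s) * src Ψ Ψ' s l := fun l =>
    (continuous_osc.comp (by fun_prop)).mul (continuous_src Ψ Ψ' l)
  have hintd : ∀ l t, HasDerivAt
      (fun t => ∫ s in (0 : ℝ)..t, osc (-F.om ε l * s) * src Ψ Ψ' s l)
      (osc (-F.om ε l * t) * src Ψ Ψ' t l) t := fun l t =>
    intervalIntegral.integral_hasDerivAt_right ((hint l).intervalIntegrable _ _)
      (hint l).stronglyMeasurable.stronglyMeasurableAtFilter (hint l).continuousAt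
  have hZ : ∀ l, ContinuousOn (fun t => Z t l) (Icc 0 τ) := fun l =>
    ((h.continuousOn_osc_zed l).mono hI).add
      (continuousOn_const.mul fun t _ => (hintd l t).continuousAt.continuousWithinAt)
  have hZ' : ∀ t ∈ Ioo 0 τ, ∀ l, HasDerivAt (fun t => Z t l)
      (-(Complex.I * (osc (-F.om ε l * t) * (E t l + K t l)))) t := by
    intro t ht l
    refine ((h.hasDerivAt_osc_zed hε (hO ht) l).fun_add
      ((hintd l t).const_mul Complex.I)).congr_deriv ?_
    simp only [E, K, Pi.add_apply, Pi.sub_apply]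
    ring
  have hKc : ∀ l, ContinuousOn (fun t => K t l) (Icc 0 τ) := fun l =>
    ((continuousOn_conv h.cont_w (continuousOn_J h.cont_w) l).mono hI).sub
      (continuous_src _ _ l).continuousOn
  have hK' : ∀ t ∈ Ioo 0 τ, ∀ l, HasDerivAt (fun t => K t l) (K' t l) t := fun t ht l =>
    ((h.hasDerivAt_density hB (hO ht) l).sub ((hasDerivAt_const t _).add
      (hasDerivAt_ofReal_smul _ t l))).congr_deriv (by simp [K'])
  have hE : ∀ t ∈ Ioo 0 τ, F.sn 1 (E t) ≤ B * η + S := fun t ht =>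
    sn_add_le_of (h.alias_g t (hO ht)) (hS t ht)
  have hw0 := h.bound_w_le (s := 1) (by norm_num) h0
  have hJw0 := (F.sn_J 1 (w 0)).trans_le hw0
  have hJd := (F.sn_J 1 d).trans_le hd
  have hK'b : ∀ t ∈ Ioo 0 τ, F.sn 1 (K' t) ≤ 8 * B ^ 7 := fun t ht => by
    refine (sn_sub_le_of (h.bound_density_deriv hB (hO ht)) (sn_add_le_of
      (hB.one_le_of hd hJw0) (hB.one_le_of hw0 hJd))).trans ?_
    have : B ^ 3 ≤ B ^ 7 := pow_le_pow_right₀ hB.one_le (by norm_num)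
    have : B ^ 5 ≤ B ^ 7 := pow_le_pow_right₀ hB.one_le (by norm_num)
    calc _ = 4 * B ^ 3 + 4 * B ^ 5 := by ring
      _ ≤ _ := by linarith
  have hK0 : K 0 = 0 := by simp [K, src]
  have hKb := F.sn_sub_le_of_hasDerivAt (s := 1) hτ.le hKc hK' hK'b
  rw [hK0, sub_zero] at hKb
  have hfin : F.sn 1 (zed F ε (p τ) (q τ) - stepZ F ε τ ζ Ψ Ψ') ≤
      F.sn 1 (zed F ε (p 0) (q 0) - ζ) + F.sn 1 (Z τ - Z 0) := by
    have e : (fun l => osc (-F.om ε l * τ)) * (zed F ε (p τ) (q τ) - stepZ F ε τ ζ Ψ Ψ') =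
        (zed F ε (p 0) (q 0) - ζ) + (Z τ - Z 0) := by
      ext l
      simp only [Pi.mul_apply, Pi.sub_apply, Pi.add_apply, stepZ, Z, neg_mul, mul_zero, osc_zero,
        one_mul, neg_zero, intervalIntegral.integral_same, add_zero]
      linear_combination ((Complex.I * ∫ s in (0 : ℝ)..τ, osc (-(F.om ε l * s)) * src Ψ Ψ' s l)
        - ζ l) * osc_mul_osc_neg (F.om ε l * τ)
    rw [← sn_osc_mul 1 fun l => -F.om ε l * τ, e]
    exact F.sn_add_le _ _ _
  refine hfin.trans (add_le_add le_rfl ?_)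
  have p1 : B ≤ B ^ 7 := le_self_pow₀ hB.one_le (by norm_num)
  have p0 : 0 ≤ B ^ 7 := by positivity
  have hη' : B * η ≤ B ^ 7 * η := by gcongr
  rw [← min_add_add_left]
  rcases le_total (η + τ ^ 2 / ε ^ 2) (η + ε ^ 2) with hle | hle
  · rw [min_eq_left hle]
    have key := F.sn_sub_le_of_hasDerivAt (s := 1) hτ.le hZ hZ'
      (B := S + 40 * B ^ 7 * (η + τ ^ 2 / ε ^ 2)) fun t ht => by
        have ht' := Ioo_subset_Icc_self ht
        have htT := hI ht'
        have e : (fun l => -(Complex.I * (osc (-F.om ε l * t) * (E t l + K t l)))) =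
            -(Complex.I • ((fun l => osc (-F.om ε l * t)) * (E t + K t))) := by
          ext l; simp
        rw [e, F.sn_neg, sn_I_smul, sn_osc_mul]
        set y := w 0 + (t : ℂ) • d with hy
        have htd : F.sn 1 ((t : ℂ) • d) ≤ τ * (2 * B ^ 3) := by
          rw [sn_real_smul _ ht.1.le]
          exact mul_le_mul ht.2.le hd (F.sn_nonneg _ _) hτ.le
        have hyb : F.sn 1 y ≤ 3 * B ^ 3 := by
          refine (sn_add_le_of hw0 htd).trans ?_
          have : B ≤ B ^ 3 := le_self_pow₀ hB.one_le (by norm_num)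
          nlinarith [pow_pos hB0 3]
        have hwy := h.taylor_w_filter hB hε hε1 hη hτ hτ1 htT ht.2.le
        rw [← hd_def, ← hy] at hwy
        -- With `y` the linear approximation of `w t`, the last product is the quadratic term left
        -- out of the linearised density, of size τ²; the other two are Taylor remainders.
        have eK : K t = conv (w t - y) (J (w t)) + conv y (J (w t - y)) +
            conv ((t : ℂ) • d) (J ((t : ℂ) • d)) := by
          simp only [K, src, sub_conv, J_sub, conv_sub, hy, J_add, J_smul, add_conv, conv_add,
            smul_conv, conv_smul, Complex.conj_ofReal, smul_add]
          abel
        have bK := sn_add_le_of (sn_add_le_of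
          (hB.one_le_of hwy ((F.sn_J 1 _).trans_le (h.bound_w_le (by norm_num) htT)))
          (hB.one_le_of hyb ((F.sn_J 1 _).trans_le hwy)))
          (hB.one_le_of htd ((F.sn_J 1 _).trans_le htd))
        rw [← eK] at bK
        refine (sn_add_le_of (hE t ht) bK).trans ?_
        have p5 : B ^ 5 ≤ B ^ 7 := pow_le_pow_right₀ hB.one_le (by norm_num)
        have h6 : τ ^ 2 ≤ τ ^ 2 / ε ^ 2 :=
          le_div_self (by positivity) (by positivity) (pow_le_one₀ hε.le hε1)
        have h7 : 0 ≤ τ ^ 2 / ε ^ 2 := by positivity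
        calc _ = B * η + S + (7 * B ^ 5 * (τ ^ 2 / ε ^ 2 + η) + 21 * B ^ 7 * (τ ^ 2 / ε ^ 2 + η)
              + 4 * B ^ 7 * τ ^ 2) := by ring
          _ ≤ B ^ 7 * η + S + (7 * B ^ 7 * (τ ^ 2 / ε ^ 2 + η) + 21 * B ^ 7 * (τ ^ 2 / ε ^ 2 + η)
              + 4 * B ^ 7 * (τ ^ 2 / ε ^ 2)) := by gcongr
          _ ≤ _ := by nlinarith [mul_nonneg p0 hη, mul_nonneg p0 h7]
    exact key.trans_eq (mul_comm _ _)
  · rw [min_eq_right hle]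
    have key := sn_sub_le_of_kg_osc (F := F) hε hτ.le hZ hZ' hKc hK' hE hK'b
    rw [hK0, F.sn_zero, add_zero] at key
    refine key.trans ?_
    calc _ ≤ (B ^ 7 * η + S + ε ^ 2 * (8 * B ^ 7)) * τ + ε ^ 2 * (8 * B ^ 7 * τ) := by gcongr
      _ = τ * (S + (B ^ 7 * η + 16 * B ^ 7 * ε ^ 2)) := by ring
      _ ≤ _ := by
        gcongr
        nlinarith [mul_nonneg p0 hη, mul_nonneg p0 (sq_nonneg ε)]

end ExactData

end local_error

set_option linter.unusedSectionVars false

/-! ### Stability and convergence at the time levels -/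

section stability

variable {G : Type*} [AddCommGroup G] [Fintype G] {F : Freq G} {ε T B η : ℝ}
  {w p q f g : ℝ → G → ℂ}

/-- The error at a time level. -/
def lvlErr (F : Freq G) (ε : ℝ) (p₀ q₀ w₀ Φ D Ψ : G → ℂ) : ℝ :=
  F.sn 1 (w₀ - Ψ) + F.sn 1 (zed F ε p₀ q₀ - zed F ε Φ D)

/-- Numerical data close to the exact data. -/
structure Close (F : Freq G) (ε x : ℝ) (p₀ q₀ w₀ Φ D Ψ : G → ℂ) : Prop where
  real_p : J p₀ = p₀
  real_q : J q₀ = q₀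
  real_Φ : J Φ = Φ
  real_D : J D = D
  err : lvlErr F ε p₀ q₀ w₀ Φ D Ψ ≤ x

namespace Close

variable {x : ℝ} {p₀ q₀ w₀ Φ D Ψ : G → ℂ} (c : Close F ε x p₀ q₀ w₀ Φ D Ψ)
include c

lemma sn_zed : F.sn 1 (zed F ε (p₀ - Φ) (q₀ - D)) ≤ x := by
  rw [← zed_sub]
  exact (le_add_of_nonneg_left (F.sn_nonneg _ _)).trans c.err

lemma sn_w : F.sn 1 (w₀ - Ψ) ≤ x := (le_add_of_nonneg_right (F.sn_nonneg _ _)).trans c.err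

lemma sn_p (hε : 0 < ε) : F.sn 1 (p₀ - Φ) ≤ x :=
  (sn_fst_le hε (by rw [J_sub, c.real_p, c.real_Φ]) (by rw [J_sub, c.real_q, c.real_D])).trans
    c.sn_zed

lemma sn_q : ε ^ 2 * F.sn 1 (q₀ - D) ≤ x :=
  (sn_snd_le (by rw [J_sub, c.real_p, c.real_Φ]) (by rw [J_sub, c.real_q, c.real_D])).trans
    c.sn_zed

lemma sn_v (hε : 0 < ε) : F.sn 1 (vInit ε p₀ q₀ - vInit ε Φ D) ≤ x := by
  have e : vInit ε p₀ q₀ - vInit ε Φ D = vInit ε (p₀ - Φ) (q₀ - D) := by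
    ext l; simp [vInit]; ring
  rw [e]
  exact sn_vInit_le hε (c.sn_p hε) c.sn_q

lemma nonneg : 0 ≤ x := (F.sn_nonneg _ _).trans c.sn_w

omit c in
-- As long as the error is at most 1, the numerical data obey the bounds of the exact data with 2B
-- in place of B.
lemma le_two_mul {a a' : G → ℂ} {B : ℝ} (hB : 1 ≤ B) (hx : x ≤ 1) (h : F.sn 1 (a - a') ≤ x)
    (ha : F.sn 1 a ≤ B) : F.sn 1 a' ≤ 2 * B := by
  have := sn_sub_le_of ha h
  rw [sub_sub_cancel] at this
  linarith

end Close

namespace ExactData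

variable (h : ExactData F ε T B η w p q f g) (hB : IsAlg F B) {x : ℝ} {Φ D Ψ : G → ℂ}
  (c : Close F ε x (p 0) (q 0) (w 0) Φ D Ψ)
include h hB c

/-- Here the filter gives stability. In h¹ the multiplier is bounded by 1/τ, and the derivative is
only used multiplied by s ≤ τ, so neither μ² nor a bound on τ/h² enters. -/
lemma mul_sn_psiD_sub_le (hε : 0 < ε) (hx : x ≤ 1) {τ s : ℝ} (hτ : 0 < τ) (hτ1 : τ ≤ 1) (hT : 0 ≤ T)
    (hsτ : s ≤ τ) :
    s * F.sn 1 (psiD F τ (p 0) (w 0) - psiD F τ Φ Ψ) ≤ 4 * B ^ 2 * x := by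
  have h0 : (0 : ℝ) ∈ Icc 0 T := ⟨le_rfl, hT⟩
  have hB0 := hB.pos
  have hB1 := hB.one_le
  have hw0 := h.bound_w_le (s := 1) (by norm_num) h0
  have hp0 := h.bound_p_le (s := 1) (by norm_num) h0
  have e : psiD F τ (p 0) (w 0) - psiD F τ Φ Ψ =
      -((fun l => Complex.I * ((Real.sin (F.μ l ^ 2 * τ) / τ : ℝ) : ℂ)) * (w 0 - Ψ)) +
      Complex.I • (conv (p 0 - Φ) (w 0) + conv Φ (w 0 - Ψ)) := by
    rw [sub_conv, conv_sub]; ext l; simp [psiD]; ring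
  have b1 : F.sn 1 ((fun l => Complex.I * ((Real.sin (F.μ l ^ 2 * τ) / τ : ℝ) : ℂ)) * (w 0 - Ψ)) ≤
      1 / τ * x := by
    refine (F.sn_mul_le_of_le (by positivity) (fun l => ?_) _).trans
      (mul_le_mul_of_nonneg_left c.sn_w (by positivity))
    rw [norm_mul, Complex.norm_I, one_mul, Complex.norm_real, Real.norm_eq_abs, abs_div,
      abs_of_pos hτ]
    gcongr
    exact Real.abs_sin_le_one _
  have b2 := sn_add_le_of (hB.one_le_of (c.sn_p hε) hw0)
    (hB.one_le_of (Close.le_two_mul hB1 hx (c.sn_p hε) hp0) c.sn_w)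
  have b : F.sn 1 (psiD F τ (p 0) (w 0) - psiD F τ Φ Ψ) ≤ 1 / τ * x + (B * x * B + B * (2 * B) * x) := by
    rw [e]
    refine sn_add_le_of ?_ ?_
    · rw [F.sn_neg]; exact b1
    · rw [sn_I_smul]; exact b2
  have hx0 := c.nonneg
  calc s * F.sn 1 (psiD F τ (p 0) (w 0) - psiD F τ Φ Ψ)
      ≤ τ * (1 / τ * x + (B * x * B + B * (2 * B) * x)) :=
        mul_le_mul hsτ b (F.sn_nonneg _ _) hτ.le
    _ = x + τ * (3 * B ^ 2 * x) := by field_simp; ring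
    _ ≤ B ^ 2 * x + 1 * (3 * B ^ 2 * x) := by
        gcongr
        exact le_mul_of_one_le_left hx0 (one_le_pow₀ hB1)
    _ = _ := by ring

lemma mul_sn_psiD_le (hε : 0 < ε) (hx : x ≤ 1) {τ s : ℝ} (hτ : 0 < τ) (hτ1 : τ ≤ 1) (hT : 0 ≤ T)
    (hs : 0 ≤ s) (hsτ : s ≤ τ) : s * F.sn 1 (psiD F τ Φ Ψ) ≤ 6 * B ^ 3 := by
  have hB0 := hB.pos
  have b1 := h.mul_sn_psiD_sub_le hB c hε hx hτ hτ1 hT hsτ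
  have b2 := (F.sn_mono (s := 1) (by norm_num) _).trans (h.bound_psiD hB hτ hT)
  have b3 := F.sn_sub_le 1 (psiD F τ (p 0) (w 0)) (psiD F τ (p 0) (w 0) - psiD F τ Φ Ψ)
  rw [sub_sub_cancel] at b3
  have p2 : B ^ 2 ≤ B ^ 3 := pow_le_pow_right₀ hB.one_le (by norm_num)
  have hx0 := c.nonneg
  calc s * F.sn 1 (psiD F τ Φ Ψ) ≤ s * (2 * B ^ 3) +
        s * F.sn 1 (psiD F τ (p 0) (w 0) - psiD F τ Φ Ψ) := by
        rw [← mul_add]; gcongr; linarith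
    _ ≤ 1 * (2 * B ^ 3) + 4 * B ^ 3 * 1 := by
        refine add_le_add ?_ (b1.trans (by gcongr))
        gcongr
        linarith
    _ = _ := by ring

/-- Bilinearity: one factor is varied at a time. The increment of `psiD` occurs only with the factor
`s`, where the filter controls it. -/
lemma sn_force_sub_le (hε : 0 < ε) (hx : x ≤ 1) {τ s : ℝ} (hτ : 0 < τ) (hτ1 : τ ≤ 1) (hT : 0 ≤ T)
    (hs : 0 ≤ s) (hsτ : s ≤ τ) :
    F.sn 1 (force ε (vInit ε (p 0) (q 0)) (w 0) (psiD F τ (p 0) (w 0)) s -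
      force ε (vInit ε Φ D) Ψ (psiD F τ Φ Ψ) s) ≤ 26 * B ^ 4 * x := by
  have h0 : (0 : ℝ) ∈ Icc 0 T := ⟨le_rfl, hT⟩
  have hB0 := hB.pos
  have hB1 := hB.one_le
  have hx0 := c.nonneg
  have hw0 := h.bound_w_le (s := 1) (by norm_num) h0
  have hV := h.bound_vInit hε (s := 1) (by norm_num) h0
  have hv := c.sn_v hε
  have hv2 := Close.le_two_mul hB1 hx hv hV
  set V := vInit ε (p 0) (q 0)
  set v := vInit ε Φ D
  set d := psiD F τ (p 0) (w 0) with hd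
  set d' := psiD F τ Φ Ψ
  have e : force ε V (w 0) d s - force ε v Ψ d' s =
      conv (osc (1 / ε ^ 2 * s) • (V - v) + osc (-(1 / ε ^ 2) * s) • J (V - v))
        (w 0 + (s : ℂ) • d) +
      conv (osc (1 / ε ^ 2 * s) • v + osc (-(1 / ε ^ 2) * s) • J v)
        ((w 0 - Ψ) + (s : ℂ) • (d - d')) := by
    simp only [force, J_sub, smul_sub, add_conv, sub_conv, conv_add, conv_sub]
    abel
  have b1 : F.sn 1 (osc (1 / ε ^ 2 * s) • (V - v) + osc (-(1 / ε ^ 2) * s) • J (V - v)) ≤ x + x :=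
    sn_add_le_of ((sn_osc_smul _ _ _).trans_le hv)
      ((sn_osc_smul _ _ _).trans_le ((F.sn_J _ _).trans_le hv))
  have b2 : F.sn 1 (osc (1 / ε ^ 2 * s) • v + osc (-(1 / ε ^ 2) * s) • J v) ≤ 2 * B + 2 * B :=
    sn_add_le_of ((sn_osc_smul _ _ _).trans_le hv2)
      ((sn_osc_smul _ _ _).trans_le ((F.sn_J _ _).trans_le hv2))
  have b3 : F.sn 1 (w 0 + (s : ℂ) • d) ≤ B + 1 * (2 * B ^ 3) := by
    refine sn_add_le_of hw0 ?_
    rw [sn_real_smul _ hs]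
    exact mul_le_mul (hsτ.trans hτ1) ((F.sn_mono (s := 1) (by norm_num) _).trans
      (h.bound_psiD hB hτ hT)) (F.sn_nonneg _ _) zero_le_one
  have b4 : F.sn 1 ((w 0 - Ψ) + (s : ℂ) • (d - d')) ≤ x + 4 * B ^ 2 * x := by
    refine sn_add_le_of c.sn_w ?_
    rw [sn_real_smul _ hs]
    exact h.mul_sn_psiD_sub_le hB c hε hx hτ hτ1 hT hsτ
  rw [e]
  refine (sn_add_le_of (hB.one_le_of b1 b3) (hB.one_le_of b2 b4)).trans ?_
  have p2 : B ^ 2 ≤ B ^ 4 := pow_le_pow_right₀ hB1 (by norm_num)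
  calc _ = 6 * B ^ 2 * x + 20 * B ^ 4 * x := by ring
    _ ≤ 6 * B ^ 4 * x + 20 * B ^ 4 * x := by gcongr
    _ = _ := by ring

lemma sn_src_sub_le (hε : 0 < ε) (hx : x ≤ 1) {τ s : ℝ} (hτ : 0 < τ) (hτ1 : τ ≤ 1) (hT : 0 ≤ T)
    (hs : 0 ≤ s) (hsτ : s ≤ τ) :
    F.sn 1 (src (w 0) (psiD F τ (p 0) (w 0)) s - src Ψ (psiD F τ Φ Ψ) s) ≤ 23 * B ^ 4 * x := by
  have h0 : (0 : ℝ) ∈ Icc 0 T := ⟨le_rfl, hT⟩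
  have hB0 := hB.pos
  have hB1 := hB.one_le
  have hx0 := c.nonneg
  have hw0 := h.bound_w_le (s := 1) (by norm_num) h0
  have hJw0 := (F.sn_J _ _).trans_le hw0
  have hΨ := Close.le_two_mul hB1 hx c.sn_w hw0
  have hJd := (F.sn_J _ _).trans_le c.sn_w
  have b1 : F.sn 1 ((s : ℂ) • (psiD F τ (p 0) (w 0) - psiD F τ Φ Ψ)) ≤ 4 * B ^ 2 * x := by
    rw [sn_real_smul _ hs]
    exact h.mul_sn_psiD_sub_le hB c hε hx hτ hτ1 hT hsτ
  have b2 : F.sn 1 ((s : ℂ) • psiD F τ Φ Ψ) ≤ 6 * B ^ 3 := by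
    rw [sn_real_smul _ hs]
    exact h.mul_sn_psiD_le hB c hε hx hτ hτ1 hT hs hsτ
  have b3 := (F.sn_J _ _).trans_le b1
  have b4 := (F.sn_J _ _).trans_le b2
  set d := psiD F τ (p 0) (w 0) with hd
  set d' := psiD F τ Φ Ψ
  have e : src (w 0) d s - src Ψ d' s =
      (conv (w 0 - Ψ) (J (w 0)) + conv Ψ (J (w 0 - Ψ))) +
      ((conv ((s : ℂ) • (d - d')) (J (w 0)) + conv ((s : ℂ) • d') (J (w 0 - Ψ))) +
      (conv (w 0) (J ((s : ℂ) • (d - d'))) + conv (w 0 - Ψ) (J ((s : ℂ) • d')))) := by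
    simp only [src, J_sub, J_smul, smul_sub, smul_add, sub_conv, conv_sub, smul_conv, conv_smul,
      Complex.conj_ofReal]
    abel
  rw [e]
  refine (sn_add_le_of (sn_add_le_of (hB.one_le_of c.sn_w hJw0) (hB.one_le_of hΨ hJd))
    (sn_add_le_of (sn_add_le_of (hB.one_le_of b1 hJw0) (hB.one_le_of b2 hJd))
      (sn_add_le_of (hB.one_le_of hw0 b3) (hB.one_le_of c.sn_w b4)))).trans ?_
  have p2 : B ^ 2 ≤ B ^ 4 := pow_le_pow_right₀ hB1 (by norm_num)
  calc _ = 3 * B ^ 2 * x + 20 * B ^ 4 * x := by ring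
    _ ≤ 3 * B ^ 4 * x + 20 * B ^ 4 * x := by gcongr
    _ = _ := by ring

/-- Error propagation over one step. -/
lemma one_step (hε : 0 < ε) (hε1 : ε ≤ 1) (hη : 0 ≤ η) (hη1 : η ≤ 1) {τ : ℝ} (hτ : 0 < τ)
    (hτ1 : τ ≤ 1) (hτT : τ ≤ T) (hx : x ≤ 1) :
    F.sn 1 (w τ - stepPsi F ε τ (vInit ε Φ D) Ψ (psiD F τ Φ Ψ)) +
      F.sn 1 (zed F ε (p τ) (q τ) - stepZ F ε τ (zed F ε Φ D) Ψ (psiD F τ Φ Ψ)) ≤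
      (1 + 49 * B ^ 4 * τ) * x +
        τ * (80 * B ^ 7 * (η + min (τ ^ 2 / ε ^ 2) (ε ^ 2))) := by
  have hT : 0 ≤ T := hτ.le.trans hτT
  have b1 := h.local_psi hB hε hε1 hη hη1 hτ hτ1 hτT (vInit ε Φ D) Ψ (psiD F τ Φ Ψ) fun s hs =>
    h.sn_force_sub_le hB c hε hx hτ hτ1 hT hs.1.le hs.2.le
  have b2 := h.local_z hB hε hε1 hη hτ hτ1 hτT (zed F ε Φ D) Ψ (psiD F τ Φ Ψ) fun s hs =>
    h.sn_src_sub_le hB c hε hx hτ hτ1 hT hs.1.le hs.2.le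
  have b3 := c.err
  rw [lvlErr] at b3
  have hδ : 0 ≤ η + min (τ ^ 2 / ε ^ 2) (ε ^ 2) := by positivity
  have p5 : B ^ 5 ≤ B ^ 7 := pow_le_pow_right₀ hB.one_le (by norm_num)
  have : τ * (40 * B ^ 5 * (η + min (τ ^ 2 / ε ^ 2) (ε ^ 2))) ≤
    τ * (40 * B ^ 7 * (η + min (τ ^ 2 / ε ^ 2) (ε ^ 2))) := by gcongr
  linarith

end ExactData

/-- The numerical solution in Fourier variables. -/
structure NumSeq (F : Freq G) (ε τ : ℝ) (Φ D Ψ : ℕ → G → ℂ) : Prop where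
  real_Φ : ∀ n, J (Φ n) = Φ n
  real_D : ∀ n, J (D n) = D n
  psi : ∀ n, Ψ (n + 1) = stepPsi F ε τ (vInit ε (Φ n) (D n)) (Ψ n) (psiD F τ (Φ n) (Ψ n))
  z : ∀ n, zed F ε (Φ (n + 1)) (D (n + 1)) =
    stepZ F ε τ (zed F ε (Φ n) (D n)) (Ψ n) (psiD F τ (Φ n) (Ψ n))

/-- The constant in the error bound at the time levels. -/
def convConst (B T : ℝ) : ℝ := Real.exp (49 * B ^ 4 * T) * (B + T * (80 * B ^ 7))

/-- Convergence at the time levels. -/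
theorem ExactData.close_of_numSeq (h : ExactData F ε T B η w p q f g) (hB : IsAlg F B)
    (hε : 0 < ε) (hε1 : ε ≤ 1) (hη : 0 ≤ η) (hη1 : η ≤ 1) {τ : ℝ} (hτ : 0 < τ) (hτ1 : τ ≤ 1)
    {Φ D Ψ : ℕ → G → ℂ} (hN : NumSeq F ε τ Φ D Ψ)
    (h0 : lvlErr F ε (p 0) (q 0) (w 0) (Φ 0) (D 0) (Ψ 0) ≤ B * η)
    (hsmall : convConst B T * (η + min (τ ^ 2 / ε ^ 2) (ε ^ 2)) ≤ 1) (n : ℕ) (hn : n * τ ≤ T) :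
    Close F ε (convConst B T * (η + min (τ ^ 2 / ε ^ 2) (ε ^ 2))) (p (n * τ)) (q (n * τ))
      (w (n * τ)) (Φ n) (D n) (Ψ n) := by
  have hB0 := hB.pos
  set δ := η + min (τ ^ 2 / ε ^ 2) (ε ^ 2) with hδ
  have hδ0 : 0 ≤ δ := by positivity
  have hηδ : η ≤ δ := le_add_of_nonneg_right (by positivity)
  set a := 49 * B ^ 4
  set b := 80 * B ^ 7
  have ha : 0 ≤ a := by positivity
  have hb : 0 ≤ b := by positivity
  -- Discrete Gronwall: (1 + aτ)^m ≤ e^(aT) as long as mτ ≤ T, so the bound does not depend on the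
  -- number of steps.
  have hconst : ∀ m : ℕ, m * τ ≤ T →
      (1 + a * τ) ^ m * (B * η + m * τ * (b * δ)) ≤ convConst B T * δ := by
    intro m hm
    have h1 : (1 + a * τ) ^ m ≤ Real.exp (a * T) := by
      calc (1 + a * τ) ^ m ≤ Real.exp (a * τ) ^ m := by
            gcongr; linarith [Real.add_one_le_exp (a * τ)]
        _ = Real.exp (a * (m * τ)) := by rw [← Real.exp_nat_mul]; ring_nf
        _ ≤ _ := by gcongr
    have hT0 : 0 ≤ T := le_trans (by positivity) hm
    calc (1 + a * τ) ^ m * (B * η + m * τ * (b * δ))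
        ≤ Real.exp (a * T) * (B * δ + T * (b * δ)) := by gcongr
      _ = _ := by rw [convConst]; ring
  have main : ∀ m : ℕ, m * τ ≤ T → lvlErr F ε (p (m * τ)) (q (m * τ)) (w (m * τ)) (Φ m) (D m) (Ψ m)
      ≤ (1 + a * τ) ^ m * (B * η + m * τ * (b * δ)) := by
    intro m
    induction m with
    | zero => intro _; simpa using h0
    | succ m ih =>
      intro hm
      push_cast at hm
      have hmT : m * τ ≤ T := by linarith
      have hm0 : 0 ≤ m * τ := by positivity
      have hmem : (m * τ : ℝ) ∈ Icc 0 T := ⟨hm0, hmT⟩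
      have hs := h.shift hm0
      have hc : Close F ε ((1 + a * τ) ^ m * (B * η + m * τ * (b * δ))) (p (m * τ + 0))
          (q (m * τ + 0)) (w (m * τ + 0)) (Φ m) (D m) (Ψ m) := by
        rw [add_zero]
        exact ⟨h.real_p _ hmem, h.real_q _ hmem, hN.real_Φ m, hN.real_D m, ih hmT⟩
      -- The one-step estimate needs an error of at most 1. The induction hypothesis together with
      -- `hsmall` provides it at every level.
      have key := hs.one_step hB hc hε hε1 hη hη1 hτ hτ1 (by linarith)
        ((hconst m hmT).trans hsmall)
      rw [← hN.psi, ← hN.z] at key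
      rw [show ((m + 1 : ℕ) : ℝ) * τ = m * τ + τ by push_cast; ring]
      refine key.trans ?_
      have h1 : 1 ≤ (1 + a * τ) ^ (m + 1) := one_le_pow₀ (by nlinarith [mul_nonneg ha hτ.le])
      calc (1 + a * τ) * ((1 + a * τ) ^ m * (B * η + m * τ * (b * δ))) + τ * (b * δ)
          ≤ (1 + a * τ) * ((1 + a * τ) ^ m * (B * η + m * τ * (b * δ))) +
            (1 + a * τ) ^ (m + 1) * (τ * (b * δ)) :=
            add_le_add le_rfl (le_mul_of_one_le_left (by positivity) h1)
        _ = _ := by ring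
  have hmem : (n * τ : ℝ) ∈ Icc 0 T := ⟨by positivity, hn⟩
  exact ⟨h.real_p _ hmem, h.real_q _ hmem, hN.real_Φ n, hN.real_D n,
    (main n hn).trans (hconst n hn)⟩

end stability

set_option linter.unusedSectionVars false

/-! ### The multiscale interpolation between the time levels -/

section interpolation

variable {G : Type*} [AddCommGroup G] [Fintype G] {F : Freq G} {ε T B η : ℝ}
  {w p q f g : ℝ → G → ℂ}

/-- Taylor's formula for |x| ≤ 1 and the linear bound beyond, where |x| ≤ x²; no smallness of μ²τ is
needed. -/
lemma norm_osc_neg_sub_le (x : ℝ) : ‖osc (-x) - 1 + Complex.I * x‖ ≤ 3 * x ^ 2 := by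
  rcases le_or_gt |x| 1 with h | h
  · have h1 : ‖(-(Complex.I * x) : ℂ)‖ = |x| := by simp
    have h2 := Complex.norm_exp_sub_one_sub_id_le (x := -(Complex.I * x)) (by rwa [h1])
    rw [h1, sq_abs] at h2
    have e : osc (-x) - 1 + Complex.I * x =
        Complex.exp (-(Complex.I * x)) - 1 - -(Complex.I * x) := by simp [osc]
    rw [e]
    nlinarith [sq_nonneg x]
  · have h1 : ‖osc (-x) - 1 + Complex.I * x‖ ≤ |x| + |x| :=
      (norm_add_le _ _).trans (add_le_add
        ((norm_osc_sub_one_le _).trans_eq (abs_neg x)) (by simp))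
    rw [← sq_abs]
    nlinarith

/-- The remainder `r` after one step. -/
def rOne (F : Freq G) (ε τ : ℝ) (Ψ Ψ' : G → ℂ) (l : G) : ℂ :=
  ∫ θ in (0 : ℝ)..τ, ((Real.sin (F.om ε l * (τ - θ)) / (ε ^ 2 * F.om ε l) : ℝ) : ℂ) * src Ψ Ψ' θ l

/-- A family of integrals is bounded by the integral of a bound. -/
lemma sn_integral_le {τ b : ℝ} (hτ : 0 ≤ τ) {u : ℝ → G → ℂ} (hu : ∀ l, Continuous fun s => u s l)
    (hb : ∀ s ∈ Ioo 0 τ, F.sn 1 (u s) ≤ b) :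
    F.sn 1 (fun l => ∫ s in (0 : ℝ)..τ, u s l) ≤ b * τ := by
  have hd : ∀ l t, HasDerivAt (fun t => ∫ s in (0 : ℝ)..t, u s l) (u t l) t := fun l t =>
    intervalIntegral.integral_hasDerivAt_right ((hu l).intervalIntegrable _ _)
      (hu l).stronglyMeasurable.stronglyMeasurableAtFilter (hu l).continuousAt
  have key := F.sn_sub_le_of_hasDerivAt (s := 1) (f := fun t l => ∫ s in (0 : ℝ)..t, u s l)
    (f' := u) hτ (fun l t _ => (hd l t).continuousAt.continuousWithinAt)
    (fun t _ l => hd l t) hb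
  have e : (fun l => ∫ s in (0 : ℝ)..τ, u s l) = (fun t l => ∫ s in (0 : ℝ)..t, u s l) τ -
      (fun t l => ∫ s in (0 : ℝ)..t, u s l) 0 := by
    ext l; simp
  rw [e]
  exact key

namespace ExactData

variable (h : ExactData F ε T B η w p q f g) (hB : IsAlg F B) {x : ℝ} {Φ D Ψ : G → ℂ}
  (c : Close F ε x (p 0) (q 0) (w 0) Φ D Ψ)
include h hB c

/-- The increment of `Ψ` over one step, compared with `τ i c₀ - (1 - m) w`. -/
lemma sn_stepPsi_sub_le (hε : 0 < ε) (hx : x ≤ 1) {τ b : ℝ} (hτ : 0 < τ) (hτ1 : τ ≤ 1)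
    (hT : 0 ≤ T) (c₀ w₁ : G → ℂ)
    (hw₁ : F.sn 1 ((fun l => osc (-(F.μ l ^ 2 * τ)) - 1) * w 0 + w₁) ≤ τ * b)
    (hb : ∀ s ∈ Ioo 0 τ, F.sn 1 ((fun l => osc (-(F.μ l ^ 2 * τ)) * osc (F.μ l ^ 2 * s)) *
      force ε (vInit ε (p 0) (q 0)) (w 0) (psiD F τ (p 0) (w 0)) s - c₀) ≤ b) :
    F.sn 1 (stepPsi F ε τ (vInit ε Φ D) Ψ (psiD F τ Φ Ψ) - Ψ - (τ : ℂ) • Complex.I • c₀ + w₁) ≤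
      28 * B ^ 4 * x + 2 * τ * b := by
  set V := vInit ε (p 0) (q 0)
  set v := vInit ε Φ D
  set d := psiD F τ (p 0) (w 0)
  set d' := psiD F τ Φ Ψ
  have hB0 := hB.pos
  have hx0 := c.nonneg
  let m : ℝ → G → ℂ := fun s l => osc (-(F.μ l ^ 2 * τ)) * osc (F.μ l ^ 2 * s)
  have hm : ∀ s (e : G → ℂ), F.sn 1 (m s * e) = F.sn 1 e := fun s e =>
    F.sn_eq_of_norm_eq fun l => by simp [m]
  let u : ℝ → G → ℂ := fun s => m s * force ε v Ψ d' s - c₀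
  have hcont : ∀ l, Continuous fun s => m s l * force ε v Ψ d' s l := fun l =>
    (continuous_const.mul (continuous_osc.comp (by fun_prop))).mul
      (continuous_force v Ψ d' l)
  have hu : ∀ l, Continuous fun s => u s l := fun l => (hcont l).sub continuous_const
  have hub : ∀ s ∈ Ioo 0 τ, F.sn 1 (u s) ≤ b + 26 * B ^ 4 * x := fun s hs => by
    have e : u s = (m s * force ε V (w 0) d s - c₀) -
        m s * (force ε V (w 0) d s - force ε v Ψ d' s) := by simp only [u]; ring
    rw [e]
    refine sn_sub_le_of (hb s hs) ?_
    rw [hm]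
    exact h.sn_force_sub_le hB c hε hx hτ hτ1 hT hs.1.le hs.2.le
  have hint := sn_integral_le hτ.le hu hub
  -- The three pieces are the free flow of the exact data, the action of e^(-iμ²τ) - 1 on the error
  -- (an isometry minus the identity, hence at most 2x), and the deviation of the integrand from
  -- `c₀`.
  have e : stepPsi F ε τ v Ψ d' - Ψ - (τ : ℂ) • Complex.I • c₀ + w₁ =
      ((fun l => osc (-(F.μ l ^ 2 * τ)) - 1) * w 0 + w₁) -
      ((fun l => osc (-(F.μ l ^ 2 * τ))) * (w 0 - Ψ) - (w 0 - Ψ)) +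
      Complex.I • (fun l => ∫ s in (0 : ℝ)..τ, u s l) := by
    ext l
    have e1 : ∫ s in (0 : ℝ)..τ, u s l = osc (-(F.μ l ^ 2 * τ)) *
        (∫ s in (0 : ℝ)..τ, osc (F.μ l ^ 2 * s) * force ε v Ψ d' s l) - τ * c₀ l := by
      simp only [u, Pi.sub_apply, Pi.mul_apply]
      rw [intervalIntegral.integral_sub ((hcont l).intervalIntegrable _ _)
        (continuous_const.intervalIntegrable _ _), ← intervalIntegral.integral_const_mul]
      simp [m, mul_assoc]
    simp only [Pi.add_apply, Pi.sub_apply, Pi.smul_apply, Pi.mul_apply, smul_eq_mul, e1, stepPsi]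
    ring
  have b2 : F.sn 1 ((fun l => osc (-(F.μ l ^ 2 * τ))) * (w 0 - Ψ) - (w 0 - Ψ)) ≤ x + x :=
    sn_sub_le_of ((sn_osc_mul 1 _ _).trans_le c.sn_w) c.sn_w
  rw [e]
  refine (sn_add_le_of (sn_sub_le_of hw₁ b2) (y := (b + 26 * B ^ 4 * x) * τ) ?_).trans ?_
  · rw [sn_I_smul]; exact hint
  · have : 1 ≤ B ^ 4 := one_le_pow₀ hB.one_le
    have h1 : x ≤ B ^ 4 * x := le_mul_of_one_le_left hx0 this
    have h2 : B ^ 4 * x * τ ≤ B ^ 4 * x := mul_le_of_le_one_right (by positivity) hτ1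
    nlinarith

lemma bound_conv_zero {s : ℕ} (hs : s = 1 ∨ s = 3) (hT : 0 ≤ T) :
    F.sn s (conv (p 0) (w 0)) ≤ B ^ 3 := by
  have h0 : (0 : ℝ) ∈ Icc 0 T := ⟨le_rfl, hT⟩
  rcases hs with rfl | rfl
  · exact (hB.one_le_of (h.bound_p_le (by norm_num) h0) (h.bound_w_le (by norm_num) h0)).trans_eq
      (by ring)
  · exact (hB.three_le_of (h.bound_p_le (by norm_num) h0) (h.bound_w_le (by norm_num) h0)).trans_eq
      (by ring)

lemma sn_add_smul_psiD_le {τ s : ℝ} (hτ : 0 < τ) (hT : 0 ≤ T) (hs : 0 ≤ s) (hs1 : s ≤ 1) :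
    F.sn 1 (w 0 + (s : ℂ) • psiD F τ (p 0) (w 0)) ≤ 3 * B ^ 3 := by
  have h0 : (0 : ℝ) ∈ Icc 0 T := ⟨le_rfl, hT⟩
  have b3 : F.sn 1 (w 0 + (s : ℂ) • psiD F τ (p 0) (w 0)) ≤ B + 1 * (2 * B ^ 3) := by
    refine sn_add_le_of (h.bound_w_le (by norm_num) h0) ?_
    rw [sn_real_smul _ hs]
    exact mul_le_mul hs1 ((F.sn_mono (s := 1) (by norm_num) _).trans
      (h.bound_psiD hB hτ hT)) (F.sn_nonneg _ _) zero_le_one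
  have h5 : B ≤ B ^ 3 := le_self_pow₀ hB.one_le (by norm_num)
  linarith

/-- Second order expansion of the increment of `Ψ`. -/
lemma sn_stepPsi_taylor_le (hε : 0 < ε) (hε1 : ε ≤ 1) (hx : x ≤ 1) {τ : ℝ} (hτ : 0 < τ)
    (hτ1 : τ ≤ 1) (hT : 0 ≤ T) :
    F.sn 1 (stepPsi F ε τ (vInit ε Φ D) Ψ (psiD F τ Φ Ψ) - Ψ -
      (τ : ℂ) • (-(lam F * w 0) + Complex.I • conv (p 0) (w 0))) ≤
      28 * B ^ 4 * x + 24 * B ^ 5 * (τ ^ 2 / ε ^ 2) := by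
  have h0 : (0 : ℝ) ∈ Icc 0 T := ⟨le_rfl, hT⟩
  have hB0 := hB.pos
  have hB1 := hB.one_le
  have hε2 : ε ^ 2 ≤ 1 := pow_le_one₀ hε.le hε1
  have hτε : τ ≤ τ / ε ^ 2 := le_div_self hτ.le (by positivity) hε2
  have hτε0 : 0 ≤ τ / ε ^ 2 := hτ.le.trans hτε
  have p1 : B ≤ B ^ 5 := le_self_pow₀ hB1 (by norm_num)
  have p3 : B ^ 3 ≤ B ^ 5 := pow_le_pow_right₀ hB1 (by norm_num)
  have key := h.sn_stepPsi_sub_le hB c hε hx hτ hτ1 hT (b := 12 * B ^ 5 * (τ / ε ^ 2))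
    (conv (p 0) (w 0)) ((τ : ℂ) • (lam F * w 0)) ?_ ?_
  · refine (le_of_eq ?_).trans (key.trans_eq (by ring))
    congr 1
    simp only [smul_add, smul_neg]
    abel
  · have e : (fun l => osc (-(F.μ l ^ 2 * τ)) - 1) * w 0 + (τ : ℂ) • (lam F * w 0) =
        (fun l => osc (-(F.μ l ^ 2 * τ)) - 1 + Complex.I * ((F.μ l ^ 2 * τ : ℝ) : ℂ)) * w 0 := by
      ext l; simp [lam]; ring
    rw [e]
    -- Second order in τ costs μ⁴, that is, all five available derivatives.
    refine ((F.sn_mul_le (k := 4) (B := 3 * τ ^ 2) (by positivity) (fun l => ?_) _).trans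
      (?_ : _ ≤ 3 * τ ^ 2 * B)).trans ?_
    · refine (norm_osc_neg_sub_le _).trans ?_
      have : (F.μ l ^ 2) ^ 2 ≤ (F.ρ l ^ 2) ^ 2 := pow_le_pow_left₀ (sq_nonneg _) (F.mu_sq_le l) 2
      calc 3 * (F.μ l ^ 2 * τ) ^ 2 = 3 * τ ^ 2 * (F.μ l ^ 2) ^ 2 := by ring
        _ ≤ 3 * τ ^ 2 * (F.ρ l ^ 2) ^ 2 := by gcongr
        _ = _ := by ring
    · gcongr; exact h.bound_w 0 h0
    · calc 3 * τ ^ 2 * B = τ * (3 * B * τ) := by ring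
        _ ≤ τ * (12 * B ^ 5 * (τ / ε ^ 2)) := by gcongr; norm_num
  · intro s hs
    have hV := h.bound_vInit hε (s := 1) (by norm_num) h0
    have hJV := (F.sn_J 1 _).trans_le hV
    have hy := h.sn_add_smul_psiD_le hB c hτ hT hs.1.le (hs.2.le.trans hτ1)
    have hp := vInit_add_J (ε := ε) (p 0) (q 0) (h.real_p 0 h0) (h.real_q 0 h0)
    set V := vInit ε (p 0) (q 0)
    set d := psiD F τ (p 0) (w 0)
    have hd : F.sn 1 d ≤ 2 * B ^ 3 :=
      (F.sn_mono (s := 1) (by norm_num) _).trans (h.bound_psiD hB hτ hT)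
    -- All phases are compared with 1: at s = 0 the two amplitudes add up to φ, that is, V + J V =
    -- `p 0`. The phases e^(±is/ε²) produce the factor τ/ε², the remaining terms are of size τ.
    have e : (fun l => osc (-(F.μ l ^ 2 * τ)) * osc (F.μ l ^ 2 * s)) * force ε V (w 0) d s -
        conv (p 0) (w 0) =
        (fun l => osc (-(F.μ l ^ 2 * τ)) * osc (F.μ l ^ 2 * s)) *
          (conv ((osc (1 / ε ^ 2 * s) - 1) • V + (osc (-(1 / ε ^ 2) * s) - 1) • J V)
            (w 0 + (s : ℂ) • d) + (s : ℂ) • conv (p 0) d) +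
        (fun l => osc (-(F.μ l ^ 2 * (τ - s))) - 1) * conv (p 0) (w 0) := by
      have e1 : force ε V (w 0) d s =
          (conv ((osc (1 / ε ^ 2 * s) - 1) • V + (osc (-(1 / ε ^ 2) * s) - 1) • J V)
            (w 0 + (s : ℂ) • d) + (s : ℂ) • conv (p 0) d) + conv (p 0) (w 0) := by
        rw [← conv_smul, add_assoc, ← conv_add, add_comm _ (w 0), ← add_conv, force]
        congr 1
        rw [← hp]
        simp only [sub_smul, one_smul]
        abel
      have e2 : (fun l => osc (-(F.μ l ^ 2 * (τ - s)))) =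
          fun l => osc (-(F.μ l ^ 2 * τ)) * osc (F.μ l ^ 2 * s) := by
        ext l; rw [← osc_add]; congr 1; ring
      rw [e1]
      ext l
      have e2' := congrFun e2 l
      simp only [Pi.sub_apply, Pi.mul_apply, Pi.add_apply, e2']
      ring
    have hn1 : ‖osc (1 / ε ^ 2 * s) - 1‖ ≤ τ / ε ^ 2 := by
      refine (norm_osc_sub_one_le _).trans ?_
      rw [abs_of_nonneg (by have := hs.1; positivity), one_div_mul_eq_div]
      have := hs.2.le
      gcongr
    have hn2 : ‖osc (-(1 / ε ^ 2) * s) - 1‖ ≤ τ / ε ^ 2 := by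
      refine (norm_osc_sub_one_le _).trans ?_
      rw [neg_mul, abs_neg, abs_of_nonneg (by have := hs.1; positivity), one_div_mul_eq_div]
      have := hs.2.le
      gcongr
    have b1 : F.sn 1 ((osc (1 / ε ^ 2 * s) - 1) • V + (osc (-(1 / ε ^ 2) * s) - 1) • J V) ≤
        τ / ε ^ 2 * B + τ / ε ^ 2 * B := by
      refine sn_add_le_of ?_ ?_ <;> rw [F.sn_smul]
      · exact mul_le_mul hn1 hV (F.sn_nonneg _ _) hτε0
      · exact mul_le_mul hn2 hJV (F.sn_nonneg _ _) hτε0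
    have b2 : F.sn 1 ((s : ℂ) • conv (p 0) d) ≤ τ * (B * B * (2 * B ^ 3)) := by
      rw [sn_real_smul _ hs.1.le]
      exact mul_le_mul hs.2.le (hB.one_le_of (h.bound_p_le (by norm_num) h0) hd)
        (F.sn_nonneg _ _) hτ.le
    have b3 : F.sn 1 ((fun l => osc (-(F.μ l ^ 2 * (τ - s))) - 1) * conv (p 0) (w 0)) ≤
        τ * B ^ 3 := by
      refine (F.sn_mul_le (k := 2) hτ.le (fun l => ?_) _).trans
        (mul_le_mul_of_nonneg_left (h.bound_conv_zero hB c (Or.inr rfl) hT) hτ.le)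
      refine (norm_osc_sub_one_le _).trans ?_
      have h1 : 0 ≤ τ - s := sub_nonneg.mpr hs.2.le
      rw [abs_neg, abs_of_nonneg (by positivity), mul_comm]
      exact mul_le_mul (by linarith [hs.1]) (F.mu_sq_le l) (sq_nonneg _) hτ.le
    rw [e]
    refine (sn_add_le_of (y := τ * B ^ 3) (x := B * (τ / ε ^ 2 * B + τ / ε ^ 2 * B) * (3 * B ^ 3)
      + τ * (B * B * (2 * B ^ 3))) ?_ b3).trans ?_
    · rw [F.sn_eq_of_norm_eq (d := (conv ((osc (1 / ε ^ 2 * s) - 1) • V +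
        (osc (-(1 / ε ^ 2) * s) - 1) • J V) (w 0 + (s : ℂ) • d) + (s : ℂ) • conv (p 0) d))
        fun l => by simp]
      exact sn_add_le_of (hB.one_le_of b1 hy) b2
    · calc _ = 6 * B ^ 5 * (τ / ε ^ 2) + (2 * B ^ 5 * τ + B ^ 3 * τ) := by ring
        _ ≤ 6 * B ^ 5 * (τ / ε ^ 2) + (2 * B ^ 5 * (τ / ε ^ 2) + B ^ 5 * (τ / ε ^ 2)) := by gcongr
        _ ≤ _ := by nlinarith [mul_nonneg (pow_nonneg hB0.le 5) hτε0]

/-- First order bound of the increment of `Ψ`. -/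
lemma sn_stepPsi_sub_self_le (hε : 0 < ε) (hx : x ≤ 1) {τ : ℝ} (hτ : 0 < τ)
    (hτ1 : τ ≤ 1) (hT : 0 ≤ T) :
    F.sn 1 (stepPsi F ε τ (vInit ε Φ D) Ψ (psiD F τ Φ Ψ) - Ψ) ≤
      28 * B ^ 4 * x + 12 * B ^ 5 * τ := by
  have h0 : (0 : ℝ) ∈ Icc 0 T := ⟨le_rfl, hT⟩
  have hB0 := hB.pos
  have p1 : B ≤ B ^ 5 := le_self_pow₀ hB.one_le (by norm_num)
  have key := h.sn_stepPsi_sub_le hB c hε hx hτ hτ1 hT (b := 6 * B ^ 5) 0 0 ?_ ?_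
  · simp only [smul_zero, sub_zero, add_zero] at key
    exact key.trans_eq (by ring)
  · rw [add_zero]
    refine (F.sn_mul_le (k := 2) hτ.le (fun l => ?_) _).trans
      (mul_le_mul_of_nonneg_left ((h.bound_w_le (by norm_num) h0).trans (by linarith)) hτ.le)
    refine (norm_osc_sub_one_le _).trans ?_
    rw [abs_neg, abs_of_nonneg (by positivity), mul_comm]
    exact mul_le_mul_of_nonneg_left (F.mu_sq_le l) hτ.le
  · intro s hs
    have hV := h.bound_vInit hε (s := 1) (by norm_num) h0
    have hy := h.sn_add_smul_psiD_le hB c hτ hT hs.1.le (hs.2.le.trans hτ1)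
    rw [sub_zero, F.sn_eq_of_norm_eq (d := force ε (vInit ε (p 0) (q 0)) (w 0)
      (psiD F τ (p 0) (w 0)) s) fun l => by simp]
    refine (hB.one_le_of (sn_add_le_of ((sn_osc_smul _ _ _).trans_le hV)
      ((sn_osc_smul _ _ _).trans_le ((F.sn_J _ _).trans_le hV))) hy).trans_eq (by ring)

/-- Error of the interpolation of `Ψ`. -/
lemma interp_psi (hε : 0 < ε) (hε1 : ε ≤ 1) (hη : 0 ≤ η) (hx : x ≤ 1) {τ s : ℝ} (hτ : 0 < τ)
    (hτ1 : τ ≤ 1) (hs : s ∈ Icc 0 T) (hsτ : s ≤ τ) :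
    F.sn 1 (w s - ((((τ - s) / τ : ℝ) : ℂ) • Ψ + ((s / τ : ℝ) : ℂ) •
      stepPsi F ε τ (vInit ε Φ D) Ψ (psiD F τ Φ Ψ))) ≤
      40 * B ^ 5 * (x + η + min (τ ^ 2 / ε ^ 2) τ) := by
  have hT : 0 ≤ T := hs.1.trans hs.2
  have hB0 := hB.pos
  have hB1 := hB.one_le
  have hx0 := c.nonneg
  have hτ' : (τ : ℂ) ≠ 0 := by exact_mod_cast hτ.ne'
  have hsd : 0 ≤ s / τ := div_nonneg hs.1 hτ.le
  have hsd1 : s / τ ≤ 1 := (div_le_one hτ).mpr hsτ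
  have p0 : 0 ≤ B ^ 5 := by positivity
  have p1 : B ≤ B ^ 5 := le_self_pow₀ hB1 (by norm_num)
  have p3 : B ^ 3 ≤ B ^ 5 := pow_le_pow_right₀ hB1 (by norm_num)
  have p4 : B ^ 4 * x ≤ B ^ 5 * x :=
    mul_le_mul_of_nonneg_right (pow_le_pow_right₀ hB1 (by norm_num)) hx0
  have px : x ≤ B ^ 5 * x := le_mul_of_one_le_left hx0 (one_le_pow₀ hB1)
  set Q := stepPsi F ε τ (vInit ε Φ D) Ψ (psiD F τ Φ Ψ) with hQ
  rw [← min_add_add_left, mul_min_of_nonneg _ _ (by positivity)]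
  refine le_min ?_ ?_
  · set e₀ := -(lam F * w 0) + Complex.I • conv (p 0) (w 0) with he₀
    -- The linear interpolant and the solution share the first order term s e₀, which cancels. What
    -- is left are the two second order remainders and the error at the level.
    have e : w s - ((((τ - s) / τ : ℝ) : ℂ) • Ψ + ((s / τ : ℝ) : ℂ) • Q) =
        (w s - w 0 - (s : ℂ) • e₀) + (w 0 - Ψ) - ((s / τ : ℝ) : ℂ) • (Q - Ψ - (τ : ℂ) • e₀) := by
      ext l
      simp only [Pi.sub_apply, Pi.add_apply, Pi.smul_apply, smul_eq_mul]
      push_cast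
      field_simp
      ring
    have b1 := h.taylor_w hB hε hε1 hs
    have b2 := h.sn_stepPsi_taylor_le hB c hε hε1 hx hτ hτ1 hT
    rw [← he₀, ← hQ] at b2
    rw [← he₀] at b1
    have b3 : F.sn 1 (((s / τ : ℝ) : ℂ) • (Q - Ψ - (τ : ℂ) • e₀)) ≤
        28 * B ^ 4 * x + 24 * B ^ 5 * (τ ^ 2 / ε ^ 2) := by
      rw [sn_real_smul _ hsd]
      exact (mul_le_of_le_one_left (F.sn_nonneg _ _) hsd1).trans b2
    rw [e]
    refine (sn_sub_le_of (sn_add_le_of b1 c.sn_w) b3).trans ?_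
    have h1 : s ^ 2 / ε ^ 2 ≤ τ ^ 2 / ε ^ 2 := by have := hs.1; gcongr
    have h2 : 0 ≤ τ ^ 2 / ε ^ 2 := by positivity
    have h3 : B * (η * s) ≤ B ^ 5 * (η * 1) := by
      have := hs.1
      gcongr
      linarith
    have h4 : B ^ 3 * (s ^ 2 / ε ^ 2) ≤ B ^ 5 * (τ ^ 2 / ε ^ 2) := by gcongr
    calc _ = 5 * (B ^ 3 * (s ^ 2 / ε ^ 2)) + B * (η * s) + x +
        (28 * (B ^ 4 * x) + 24 * B ^ 5 * (τ ^ 2 / ε ^ 2)) := by ring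
      _ ≤ _ := by nlinarith [mul_nonneg p0 hη, mul_nonneg p0 h2, mul_nonneg p0 hx0]
  -- The bound without ε: over a step both the solution and the interpolant move by at most O(τ), up
  -- to the error at the level.
  · have e : w s - ((((τ - s) / τ : ℝ) : ℂ) • Ψ + ((s / τ : ℝ) : ℂ) • Q) =
        (w s - w 0) + (w 0 - Ψ) - ((s / τ : ℝ) : ℂ) • (Q - Ψ) := by
      ext l
      simp only [Pi.sub_apply, Pi.add_apply, Pi.smul_apply, smul_eq_mul]
      push_cast
      field_simp
      ring
    have b3 : F.sn 1 (((s / τ : ℝ) : ℂ) • (Q - Ψ)) ≤ 28 * B ^ 4 * x + 12 * B ^ 5 * τ := by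
      rw [sn_real_smul _ hsd]
      exact (mul_le_of_le_one_left (F.sn_nonneg _ _) hsd1).trans
        (h.sn_stepPsi_sub_self_le hB c hε hx hτ hτ1 hT)
    rw [e]
    refine (sn_sub_le_of (sn_add_le_of (h.lip_w_one hs) c.sn_w) b3).trans ?_
    have h1 : B * s ≤ B ^ 5 * τ := by have := hs.1; gcongr
    nlinarith [mul_nonneg p0 hη, mul_nonneg p0 hτ.le, mul_nonneg p0 hx0]

/-- The kernel sin(ω(τ-θ))/(ε²ω) is at most τ/ε² because |sin x| ≤ |x|, and at most 1 because ε²ω ≥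
1. -/
lemma sn_rOne_le (hε : 0 < ε) (hx : x ≤ 1) {τ : ℝ} (hτ : 0 < τ) (hτ1 : τ ≤ 1) (hT : 0 ≤ T) :
    F.sn 1 (rOne F ε τ Ψ (psiD F τ Φ Ψ)) ≤ 28 * B ^ 5 * min (τ ^ 2 / ε ^ 2) τ := by
  have h0 : (0 : ℝ) ∈ Icc 0 T := ⟨le_rfl, hT⟩
  have hB0 := hB.pos
  have hx0 := c.nonneg
  have hw0 := h.bound_w_le (s := 1) (by norm_num) h0
  have hd := (F.sn_mono (s := 1) (by norm_num) _).trans (h.bound_psiD hB hτ hT)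
  have hsrc : ∀ s ∈ Ioo 0 τ, F.sn 1 (src Ψ (psiD F τ Φ Ψ) s) ≤ 28 * B ^ 5 := fun s hs => by
    have b1 := h.sn_src_sub_le hB c hε hx hτ hτ1 hT hs.1.le hs.2.le
    have b2 : F.sn 1 (src (w 0) (psiD F τ (p 0) (w 0)) s) ≤ B * B * B +
        1 * (B * (2 * B ^ 3) * B + B * B * (2 * B ^ 3)) := by
      refine sn_add_le_of (hB.one_le_of hw0 ((F.sn_J _ _).trans_le hw0)) ?_
      rw [sn_real_smul _ hs.1.le]
      refine mul_le_mul (hs.2.le.trans hτ1) (sn_add_le_of (hB.one_le_of hd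
        ((F.sn_J _ _).trans_le hw0)) (hB.one_le_of hw0 ((F.sn_J _ _).trans_le hd)))
        (F.sn_nonneg _ _) zero_le_one
    have b3 := sn_sub_le_of b2 b1
    rw [sub_sub_cancel] at b3
    refine b3.trans ?_
    have p3 : B ^ 3 ≤ B ^ 5 := pow_le_pow_right₀ hB.one_le (by norm_num)
    have p4 : B ^ 4 * x ≤ B ^ 5 * 1 :=
      mul_le_mul (pow_le_pow_right₀ hB.one_le (by norm_num)) hx hx0 (by positivity)
    nlinarith
  have hmul : ∀ C, 0 ≤ C → (∀ s ∈ Ioo 0 τ, ∀ l,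
      |Real.sin (F.om ε l * (τ - s)) / (ε ^ 2 * F.om ε l)| ≤ C) →
      F.sn 1 (rOne F ε τ Ψ (psiD F τ Φ Ψ)) ≤ C * (28 * B ^ 5) * τ := fun C hC hCb => by
    refine sn_integral_le hτ.le (u := fun θ => (fun l =>
      ((Real.sin (F.om ε l * (τ - θ)) / (ε ^ 2 * F.om ε l) : ℝ) : ℂ)) * src Ψ (psiD F τ Φ Ψ) θ)
      (fun l => ?_) fun s hs => ?_
    · exact (Complex.continuous_ofReal.comp (by fun_prop)).mul (continuous_src _ _ l)
    · refine (F.sn_mul_le_of_le hC (fun l => ?_) _).trans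
        (mul_le_mul_of_nonneg_left (hsrc s hs) hC)
      rw [Complex.norm_real, Real.norm_eq_abs]
      exact hCb s hs l
  rw [mul_min_of_nonneg _ _ (by positivity)]
  refine le_min ((hmul (τ / ε ^ 2) (by positivity) fun s hs l => ?_).trans_eq (by ring))
    ((hmul 1 zero_le_one fun s hs l => ?_).trans_eq (by ring))
  · have h1 := F.om_pos hε l
    have h2 : 0 ≤ τ - s := sub_nonneg.mpr hs.2.le
    rw [abs_div, abs_of_pos (by positivity : 0 < ε ^ 2 * F.om ε l)]
    calc |Real.sin (F.om ε l * (τ - s))| / (ε ^ 2 * F.om ε l)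
        ≤ (F.om ε l * (τ - s)) / (ε ^ 2 * F.om ε l) := by
          gcongr
          exact Real.abs_sin_le_abs.trans_eq (abs_of_nonneg (by positivity))
      _ = (τ - s) / ε ^ 2 := by field_simp
      _ ≤ τ / ε ^ 2 := by gcongr; linarith [hs.1]
  · have h1 := F.one_le_eps_sq_mul_om hε l
    rw [abs_div, abs_of_pos (zero_lt_one.trans_le h1), div_le_one (zero_lt_one.trans_le h1)]
    exact (Real.abs_sin_le_one _).trans h1

/-- Error of the interpolation of `Φ`. -/
lemma interp_phi (hε : 0 < ε) (hη1 : η ≤ 1) (hx : x ≤ 1) {τ s : ℝ} (hτ : 0 < τ)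
    (hτ1 : τ ≤ 1) (hs : s ∈ Icc 0 T) (hsτ : s ≤ τ) :
    F.sn 1 (p s - (osc (1 / ε ^ 2 * s) • ((((τ - s) / τ : ℝ) : ℂ) • vInit ε Φ D +
        ((s / τ : ℝ) : ℂ) • (F.amp ε τ * vInit ε Φ D)) +
      osc (-(1 / ε ^ 2) * s) • J ((((τ - s) / τ : ℝ) : ℂ) • vInit ε Φ D +
        ((s / τ : ℝ) : ℂ) • (F.amp ε τ * vInit ε Φ D)) +
      ((s / τ : ℝ) : ℂ) • rOne F ε τ Ψ (psiD F τ Φ Ψ))) ≤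
      40 * B ^ 5 * (x + min (τ ^ 2 / ε ^ 2) τ) := by
  have hT : 0 ≤ T := hs.1.trans hs.2
  have h0 : (0 : ℝ) ∈ Icc 0 T := ⟨le_rfl, hT⟩
  have hB0 := hB.pos
  have hB1 := hB.one_le
  have hx0 := c.nonneg
  have hsd : 0 ≤ s / τ := div_nonneg hs.1 hτ.le
  have hsd1 : s / τ ≤ 1 := (div_le_one hτ).mpr hsτ
  have hτ' : (τ : ℂ) ≠ 0 := by exact_mod_cast hτ.ne'
  have p0 : 0 ≤ B ^ 5 := by positivity
  have p1 : B ≤ B ^ 5 := le_self_pow₀ hB1 (by norm_num)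
  have p3 : B ^ 3 ≤ B ^ 5 := pow_le_pow_right₀ hB1 (by norm_num)
  have px : x ≤ B ^ 5 * x := le_mul_of_one_le_left hx0 (one_le_pow₀ hB1)
  set m := min (τ ^ 2 / ε ^ 2) τ with hm
  have hm0 : 0 ≤ m := by positivity
  have hV := h.bound_vInit hε (s := 3) (by norm_num) h0
  have hv := c.sn_v hε
  have hr := h.sn_rOne_le hB c hε hx hτ hτ1 hT
  have hk := h.sn_kgRem_le hB hε hη1 hs
  set V := vInit ε (p 0) (q 0) with hVd
  set v := vInit ε Φ D
  have hkm : F.sn 1 (kgRem F ε p q s) ≤ 2 * B ^ 3 * m := by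
    rw [hm, mul_min_of_nonneg _ _ (by positivity)]
    refine le_min (hk.2.trans ?_) (hk.1.trans ?_)
    · have := hs.1; gcongr
    · gcongr
  have hslow : ∀ t, 0 ≤ t → t ≤ τ → F.sn 1 (F.amp ε t * V - V) ≤ B * m := fun t ht htτ => by
    have hX : IsSlow F ε τ B _ _ := isSlow_amp_mul hε hV
    have e : F.amp ε 0 * V = V := by ext l; simp [F.amp_zero]
    have a1 := hX.sub t ⟨ht, htτ⟩
    have a2 := hX.sub' t ⟨ht, htτ⟩
    simp only [e] at a1 a2
    rw [hm, mul_min_of_nonneg _ _ hB0.le]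
    refine le_min (a1.trans ?_) (a2.trans ?_)
    · rw [mul_comm B]; gcongr
    · rw [mul_comm B]; gcongr
  set y := (((τ - s) / τ : ℝ) : ℂ) • v + ((s / τ : ℝ) : ℂ) • (F.amp ε τ * v) with hy
  have hdiff : F.sn 1 (F.amp ε s * V - y) ≤ 2 * B * m + 2 * x := by
    -- Both amplitudes stay near `V` throughout the step, so interpolating them is harmless. The
    -- fast phase is kept exactly and is not interpolated.
    have e : F.amp ε s * V - y = (F.amp ε s * V - V) - ((s / τ : ℝ) : ℂ) • (F.amp ε τ * V - V) +
        ((((τ - s) / τ : ℝ) : ℂ) • (V - v) + ((s / τ : ℝ) : ℂ) • (F.amp ε τ * (V - v))) := by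
      ext l
      simp only [hy, Pi.sub_apply, Pi.add_apply, Pi.smul_apply, Pi.mul_apply, smul_eq_mul]
      push_cast
      field_simp
      ring
    have b1 : F.sn 1 (((s / τ : ℝ) : ℂ) • (F.amp ε τ * V - V)) ≤ B * m := by
      rw [sn_real_smul _ hsd]
      exact (mul_le_of_le_one_left (F.sn_nonneg _ _) hsd1).trans (hslow τ hτ.le le_rfl)
    have b2 : F.sn 1 ((((τ - s) / τ : ℝ) : ℂ) • (V - v)) ≤ x := by
      rw [sn_real_smul _ (div_nonneg (by linarith) hτ.le)]
      exact (mul_le_of_le_one_left (F.sn_nonneg _ _)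
        ((div_le_one hτ).mpr (by linarith [hs.1]))).trans hv
    have b3 : F.sn 1 (((s / τ : ℝ) : ℂ) • (F.amp ε τ * (V - v))) ≤ x := by
      rw [sn_real_smul _ hsd]
      exact (mul_le_of_le_one_left (F.sn_nonneg _ _) hsd1).trans
        ((F.sn_mul_le_of_le_one (F.norm_amp_le hε τ) _).trans hv)
    rw [e]
    exact (sn_add_le_of (sn_sub_le_of (hslow s hs.1 hsτ) b1) (sn_add_le_of b2 b3)).trans_eq (by ring)
  have e : p s - (osc (1 / ε ^ 2 * s) • y + osc (-(1 / ε ^ 2) * s) • J y +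
      ((s / τ : ℝ) : ℂ) • rOne F ε τ Ψ (psiD F τ Φ Ψ)) =
      kgRem F ε p q s + (osc (1 / ε ^ 2 * s) • (F.amp ε s * V - y) +
        osc (-(1 / ε ^ 2) * s) • J (F.amp ε s * V - y)) -
        ((s / τ : ℝ) : ℂ) • rOne F ε τ Ψ (psiD F τ Φ Ψ) := by
    rw [kgRem, J_sub, smul_sub, smul_sub, ← hVd]
    abel
  have b4 : F.sn 1 (((s / τ : ℝ) : ℂ) • rOne F ε τ Ψ (psiD F τ Φ Ψ)) ≤ 28 * B ^ 5 * m := by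
    rw [sn_real_smul _ hsd]
    exact (mul_le_of_le_one_left (F.sn_nonneg _ _) hsd1).trans hr
  rw [e]
  refine (sn_sub_le_of (sn_add_le_of hkm (sn_add_le_of ((sn_osc_smul _ _ _).trans_le hdiff)
    ((sn_osc_smul _ _ _).trans_le ((F.sn_J _ _).trans_le hdiff)))) b4).trans ?_
  have h1 : B * m ≤ B ^ 5 * m := by gcongr
  have h2 : B ^ 3 * m ≤ B ^ 5 * m := by gcongr
  nlinarith [mul_nonneg p0 hm0, mul_nonneg p0 hx0]

end ExactData

end interpolation

/-! ### Fourier coefficients on the interval -/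

/-- The wave `x ↦ e^{iμ_l(x-a)}`. -/
def wave (a b : ℝ) (l : ℤ) (x : ℝ) : ℂ :=
  Complex.exp (Complex.I * (μ a b l : ℂ) * ((x - a : ℝ) : ℂ))

/-- The Fourier coefficients of `u` on `(a,b)`. -/
def fc (a b : ℝ) (u : ℝ → ℂ) (l : ℤ) : ℂ :=
  (1 / (b - a) : ℂ) * ∫ x in Ioo a b, wave a b (-l) x * u x

/-- The trigonometric series with coefficients `c`. -/
def series (a b : ℝ) (c : ℤ → ℂ) (x : ℝ) : ℂ := ∑' l, c l * wave a b l x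

section Wave

variable {a b : ℝ}

lemma mu_neg (l : ℤ) : μ a b (-l) = -μ a b l := by simp [μ, neg_div]

lemma mu_add (k l : ℤ) : μ a b (k + l) = μ a b k + μ a b l := by
  simp only [μ, Int.cast_add]; ring

lemma wave_eq_osc (l : ℤ) (x : ℝ) : wave a b l x = osc (μ a b l * (x - a)) := by
  simp only [wave, osc]; congr 1; push_cast; ring

lemma norm_wave (l : ℤ) (x : ℝ) : ‖wave a b l x‖ = 1 := by rw [wave_eq_osc, norm_osc]

lemma wave_zero (x : ℝ) : wave a b 0 x = 1 := by simp [wave, μ]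

lemma wave_add (k l : ℤ) (x : ℝ) : wave a b (k + l) x = wave a b k x * wave a b l x := by
  simp only [wave_eq_osc, mu_add, add_mul, osc_add]

lemma conj_wave (l : ℤ) (x : ℝ) : conj (wave a b l x) = wave a b (-l) x := by
  rw [wave_eq_osc, wave_eq_osc, mu_neg, conj_osc, neg_mul]

lemma hasDerivAt_wave (l : ℤ) (x : ℝ) :
    HasDerivAt (wave a b l) (Complex.I * (μ a b l : ℂ) * wave a b l x) x := by
  have h : HasDerivAt (fun y : ℝ => Complex.I * (μ a b l : ℂ) * ((y - a : ℝ) : ℂ))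
      (Complex.I * (μ a b l : ℂ)) x := by
    have := (((hasDerivAt_id x).sub_const a).ofReal_comp).const_mul (Complex.I * (μ a b l : ℂ))
    simpa using this
  exact h.cexp.congr_deriv (mul_comm _ _)

lemma continuous_wave (l : ℤ) : Continuous (wave a b l) := by
  unfold wave; fun_prop

lemma contDiff_wave (l : ℤ) : ContDiff ℝ ∞ (wave a b l) := by
  have : ContDiff ℝ ∞ (fun x : ℝ => ((x - a : ℝ) : ℂ)) :=
    Complex.ofRealCLM.contDiff.comp (contDiff_id.sub contDiff_const)
  exact (contDiff_const.mul this).cexp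

lemma wave_left (l : ℤ) : wave a b l a = 1 := by simp [wave]

lemma wave_right (hab : a < b) (l : ℤ) : wave a b l b = 1 := by
  rw [wave, Complex.exp_eq_one_iff]
  refine ⟨l, ?_⟩
  have : ((b - a : ℝ) : ℂ) ≠ 0 := by exact_mod_cast (sub_pos.mpr hab).ne'
  simp only [μ, Complex.ofReal_div, Complex.ofReal_mul]
  field_simp
  push_cast
  ring

lemma integrable_wave_mul {u : ℝ → ℂ} (hu : IntegrableOn u (Ioo a b)) (l : ℤ) :
    IntegrableOn (fun x => wave a b l x * u x) (Ioo a b) :=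
  hu.bdd_mul (continuous_wave l).aestronglyMeasurable.restrict
    (ae_of_all _ fun x => (norm_wave l x).le)

lemma setIntegral_Ioo (hab : a < b) (u : ℝ → ℂ) :
    ∫ x in Ioo a b, u x = ∫ x in a..b, u x := by
  rw [intervalIntegral.integral_of_le hab.le, integral_Ioc_eq_integral_Ioo]

lemma fc_add {u v : ℝ → ℂ} (hu : IntegrableOn u (Ioo a b)) (hv : IntegrableOn v (Ioo a b)) :
    fc a b (fun x => u x + v x) = fc a b u + fc a b v := by
  ext l
  simp only [fc, Pi.add_apply, mul_add]
  rw [integral_add (integrable_wave_mul hu _) (integrable_wave_mul hv _), mul_add]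

lemma fc_sub {u v : ℝ → ℂ} (hu : IntegrableOn u (Ioo a b)) (hv : IntegrableOn v (Ioo a b)) :
    fc a b (fun x => u x - v x) = fc a b u - fc a b v := by
  ext l
  simp only [fc, Pi.sub_apply, mul_sub]
  rw [integral_sub (integrable_wave_mul hu _) (integrable_wave_mul hv _), mul_sub]

lemma fc_const_mul (c : ℂ) (u : ℝ → ℂ) : fc a b (fun x => c * u x) = c • fc a b u := by
  ext l
  simp only [fc, Pi.smul_apply, smul_eq_mul, mul_left_comm _ c, integral_const_mul]

lemma fc_conj (u : ℝ → ℂ) : fc a b (fun x => conj (u x)) = J (fc a b u) := by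
  ext l
  simp only [fc, J, map_mul, map_div₀, map_one, map_sub, Complex.conj_ofReal, ← integral_conj,
    conj_wave, neg_neg]

lemma fc_congr_ae {u v : ℝ → ℂ} (h : u =ᵐ[volume.restrict (Ioo a b)] v) : fc a b u = fc a b v := by
  ext l
  simp only [fc]
  congr 1
  exact integral_congr_ae (h.mono fun x hx => by simp only [hx])

/-- Integration by parts for periodic functions. -/
lemma fc_of_hasDerivAt (hab : a < b) {u u' : ℝ → ℂ} (hu : ContinuousOn u (Icc a b))
    (hu' : ContinuousOn u' (Icc a b)) (hd : ∀ x ∈ Ioo a b, HasDerivAt u (u' x) x)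
    (hper : u a = u b) (l : ℤ) : fc a b u' l = Complex.I * (μ a b l : ℂ) * fc a b u l := by
  have h := intervalIntegral.integral_mul_deriv_eq_deriv_mul_of_hasDerivAt
    (u := wave a b (-l)) (v := u) (u' := fun x => Complex.I * (μ a b (-l) : ℂ) * wave a b (-l) x)
    (v' := u') (a := a) (b := b) (continuous_wave _).continuousOn (by rwa [uIcc_of_le hab.le])
    (fun x _ => hasDerivAt_wave _ x)
    (fun x hx => hd x (by rwa [min_eq_left hab.le, max_eq_right hab.le] at hx))
    ((continuous_const.mul (continuous_wave _)).intervalIntegrable _ _)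
    (ContinuousOn.intervalIntegrable (by rwa [uIcc_of_le hab.le]))
  simp only [fc, setIntegral_Ioo hab, h, wave_left, wave_right hab, hper, sub_self, zero_sub,
    mul_assoc, intervalIntegral.integral_const_mul, mu_neg]
  push_cast
  ring

/-- Orthogonality from integration by parts: (iμ_k - iμ_l) times the coefficient is zero, and the
frequencies of distinct modes differ. -/
lemma fc_wave (hab : a < b) (k l : ℤ) : fc a b (wave a b k) l = if l = k then 1 else 0 := by
  have hL : (b - a : ℂ) ≠ 0 := by exact_mod_cast (sub_pos.mpr hab).ne'
  split_ifs with h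
  · subst h
    simp only [fc, ← wave_add, neg_add_cancel, wave_zero, setIntegral_Ioo hab]
    simp only [intervalIntegral.integral_const, Complex.real_smul, mul_one]
    push_cast
    field_simp
  · have h1 := fc_of_hasDerivAt hab (u := wave a b k) (continuous_wave _).continuousOn
      (u' := fun x => (Complex.I * (μ a b k : ℂ)) * wave a b k x)
      (continuous_const.mul (continuous_wave _)).continuousOn (fun x _ => hasDerivAt_wave k x)
      (by rw [wave_left, wave_right hab]) l
    rw [fc_const_mul, Pi.smul_apply, smul_eq_mul] at h1
    have h2 : Complex.I * (μ a b k : ℂ) - Complex.I * (μ a b l : ℂ) ≠ 0 := by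
      rw [← mul_sub, mul_ne_zero_iff]
      refine ⟨Complex.I_ne_zero, ?_⟩
      have : μ a b k - μ a b l ≠ 0 := by
        have e : μ a b k - μ a b l = 2 * Real.pi / (b - a) * ((k - l : ℤ) : ℝ) := by
          simp only [μ]; push_cast; ring
        rw [e]
        have := (sub_pos.mpr hab).ne'
        have h3 : ((k - l : ℤ) : ℝ) ≠ 0 := by exact_mod_cast sub_ne_zero.mpr (Ne.symm h)
        have := Real.pi_ne_zero
        positivity
      exact_mod_cast this
    refine (mul_eq_zero.mp (?_ : (Complex.I * (μ a b k : ℂ) - Complex.I * (μ a b l : ℂ)) *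
      fc a b (wave a b k) l = 0)).resolve_left h2
    rw [sub_mul, h1, sub_self]

/-- Parseval's identity. -/
lemma tsum_enorm_fc (hab : a < b) {u : ℝ → ℂ} (hu : MemLp u 2 (volume.restrict (Ioo a b))) :
    eLpNorm u 2 (volume.restrict (Ioo a b)) ^ 2 = ENNReal.ofReal (b - a) * ∑' l, ‖fc a b u l‖ₑ ^ 2
    := by
  have hL : 0 < b - a := sub_pos.mpr hab
  rw [restrict_Ioo_eq_restrict_Ioc] at hu ⊢
  have h := hasSum_sq_fourierCoeffOn hab hu
  have e : ∀ l, ‖fourierCoeffOn hab u l‖ = ‖fc a b u l‖ := by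
    intro l
    rw [fourierCoeffOn_eq_integral, fc, setIntegral_Ioo hab, norm_smul, norm_mul]
    congr 1
    · rw [← Complex.ofReal_sub, norm_div, norm_div, Complex.norm_real]; simp
    -- The waves are centred at `a` and the Fourier monomials at 0. The coefficients differ by the
    -- unimodular factor e^(-iμa), which the norm does not see.
    · rw [← one_mul ‖∫ x in a..b, wave a b (-l) x * u x‖, ← norm_osc (-(μ a b l * a)), ← norm_mul,
        ← intervalIntegral.integral_const_mul]
      congr 1
      refine intervalIntegral.integral_congr fun x _ => ?_
      simp only [wave_eq_osc, fourier_coe_apply, smul_eq_mul, ← mul_assoc, ← osc_add, mu_neg]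
      congr 1
      rw [osc]
      congr 1
      simp only [μ]
      push_cast
      ring
  simp only [e] at h
  have h2 : eLpNorm u 2 (volume.restrict (Ioc a b)) ^ 2 =
      ENNReal.ofReal (∫ x in Ioc a b, ‖u x‖ ^ 2) := by
    rw [hu.eLpNorm_eq_integral_rpow_norm (by norm_num) (by norm_num), ← ENNReal.ofReal_pow
      (by positivity), ← Real.rpow_natCast, ← Real.rpow_mul (by positivity)]
    norm_num
  rw [h2, ← intervalIntegral.integral_of_le hab.le]
  have h3 : ∫ x in a..b, ‖u x‖ ^ 2 = (b - a) * ∑' l, ‖fc a b u l‖ ^ 2 := by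
    rw [h.tsum_eq, smul_eq_mul, mul_inv_cancel_left₀ hL.ne']
  rw [h3, ENNReal.ofReal_mul hL.le, ENNReal.ofReal_tsum_of_nonneg (fun _ => sq_nonneg _) h.summable]
  simp only [ENNReal.ofReal_pow (norm_nonneg _), ofReal_norm]

lemma continuous_series {c : ℤ → ℂ} (hc : Summable fun l => ‖c l‖) :
    Continuous (series a b c) :=
  continuous_tsum (fun l => continuous_const.mul (continuous_wave l)) hc
    (fun l x => by simp [norm_wave])

lemma norm_series_le {c : ℤ → ℂ} (hc : Summable fun l => ‖c l‖) (x : ℝ) :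
    ‖series a b c x‖ ≤ ∑' l, ‖c l‖ := by
  refine (norm_tsum_le_tsum_norm (by simpa [norm_wave] using hc)).trans_eq ?_
  simp [norm_wave]

/-- The coefficients of a product with an absolutely convergent trigonometric series. -/
lemma fc_series_mul {c : ℤ → ℂ} (hc : Summable fun l => ‖c l‖) {u v : ℝ → ℂ}
    (hu : ∀ x ∈ Ioo a b, u x = series a b c x) (hv : IntegrableOn v (Ioo a b)) :
    fc a b (fun x => u x * v x) = conv c (fc a b v) := by
  ext l
  have h1 : ∫ x in Ioo a b, wave a b (-l) x * (u x * v x) =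
      ∫ x in Ioo a b, ∑' k, c k * (wave a b (-(l - k)) x * v x) := by
    refine setIntegral_congr_fun measurableSet_Ioo fun x hx => ?_
    simp only [hu x hx, series, ← tsum_mul_right, ← tsum_mul_left]
    refine tsum_congr fun k => ?_
    rw [neg_sub, sub_eq_add_neg, wave_add]
    ring
  rw [fc, h1, ← integral_tsum_of_summable_integral_norm, ← tsum_mul_left, conv]
  · refine tsum_congr fun k => ?_
    rw [integral_const_mul, fc]
    ring
  · exact fun k => (integrable_wave_mul hv _).const_mul _
  · simp only [norm_mul, norm_wave, one_mul, integral_const_mul]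
    exact hc.mul_right _

/-- The product formula `fc_series_mul` with the second factor 1, which is the wave of mode 0. -/
lemma fc_series (hab : a < b) {c : ℤ → ℂ} (hc : Summable fun l => ‖c l‖) :
    fc a b (series a b c) = c := by
  have h := fc_series_mul (a := a) (b := b) hc (fun x _ => rfl) (v := fun _ => 1) (by simp)
  simp only [mul_one] at h
  rw [h]
  ext l
  have e : (fun _ : ℝ => (1 : ℂ)) = wave a b 0 := by ext x; rw [wave_zero]
  rw [conv, e]
  simp only [fc_wave hab, sub_eq_zero]
  rw [tsum_eq_single l (by intro k hk; rw [if_neg hk.symm, mul_zero])]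
  simp

/-- A continuous function with summable Fourier coefficients is the sum of its Fourier series. -/
lemma eq_series (hab : a < b) {u : ℝ → ℂ} (hu : MemLp u 2 (volume.restrict (Ioo a b)))
    (hcont : ContinuousOn u (Ioo a b)) (hc : Summable fun l => ‖fc a b u l‖) :
    ∀ x ∈ Ioo a b, u x = series a b (fc a b u) x := by
  have hS := continuous_series (a := a) (b := b) hc
  have hSm : MemLp (series a b (fc a b u)) 2 (volume.restrict (Ioo a b)) :=
    MemLp.of_bound hS.aestronglyMeasurable.restrict _ (ae_of_all _ (norm_series_le hc))
  have h0 : fc a b (fun x => u x - series a b (fc a b u) x) = 0 := by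
    rw [fc_sub (hu.integrable one_le_two) (hSm.integrable one_le_two), fc_series hab hc, sub_self]
  -- By Parseval a function with vanishing coefficients is zero almost everywhere; two continuous
  -- functions equal almost everywhere on an open set agree there.
  have h1 := tsum_enorm_fc hab (hu.sub hSm)
  have h2 : fc a b (u - series a b (fc a b u)) = 0 := h0
  simp only [h2, Pi.zero_apply, enorm_zero, ne_eq, OfNat.ofNat_ne_zero, not_false_eq_true, zero_pow,
    tsum_zero, mul_zero, pow_eq_zero_iff] at h1
  rw [eLpNorm_eq_zero_iff (hu.sub hSm).1 (by norm_num)] at h1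
  have h3 : u =ᵐ[volume.restrict (Ioo a b)] series a b (fc a b u) :=
    h1.mono fun x hx => sub_eq_zero.mp hx
  exact fun x hx => Measure.eqOn_open_of_ae_eq h3 isOpen_Ioo hcont hS.continuousOn hx

/-- Continuity carries the identity to the end points, which are grid points. -/
lemma eq_series_Icc (hab : a < b) {u : ℝ → ℂ} (hcont : ContinuousOn u (Icc a b))
    (hc : Summable fun l => ‖fc a b u l‖) : ∀ x ∈ Icc a b, u x = series a b (fc a b u) x := by
  have hS := continuous_series (a := a) (b := b) hc
  obtain ⟨C, hC⟩ := isCompact_Icc.exists_bound_of_continuousOn hcont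
  have hm : MemLp u 2 (volume.restrict (Ioo a b)) :=
    MemLp.of_bound ((hcont.mono Ioo_subset_Icc_self).aestronglyMeasurable measurableSet_Ioo) C
      ((ae_restrict_iff' measurableSet_Ioo).mpr (ae_of_all _ fun x hx =>
        hC x (Ioo_subset_Icc_self hx)))
  have h := eq_series hab hm (hcont.mono Ioo_subset_Icc_self) hc
  have h2 : EqOn u (series a b (fc a b u)) (Icc a b) :=
    Set.EqOn.of_subset_closure h hcont hS.continuousOn Ioo_subset_Icc_self
      (by rw [closure_Ioo hab.ne])
  exact h2

end Wave

/-! ### Weak derivatives and Fourier coefficients -/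

lemma exists_bound_deriv_smoothTransition : ∃ K : ℝ, ∀ x, |deriv Real.smoothTransition x| ≤ K := by
  have hc : Continuous (deriv Real.smoothTransition) :=
    (Real.smoothTransition.contDiff (n := 1)).continuous_deriv le_rfl
  have hz : ∀ x ∉ Icc (0 : ℝ) 1, deriv Real.smoothTransition x = 0 := fun x hx => by
    rw [mem_Icc, not_and_or, not_le, not_le] at hx
    rcases hx with hx | hx
    · have : Real.smoothTransition =ᶠ[𝓝 x] fun _ => 0 := by
        filter_upwards [Iio_mem_nhds hx] with y hy
        exact Real.smoothTransition.zero_of_nonpos (le_of_lt hy)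
      rw [this.deriv_eq, deriv_const]
    · have : Real.smoothTransition =ᶠ[𝓝 x] fun _ => 1 := by
        filter_upwards [Ioi_mem_nhds hx] with y hy
        exact Real.smoothTransition.one_of_one_le (le_of_lt hy)
      rw [this.deriv_eq, deriv_const]
  obtain ⟨K, hK⟩ := isCompact_Icc.exists_bound_of_continuousOn
    (hc.continuousOn (s := Icc (0 : ℝ) 1))
  refine ⟨max K 0, fun x => ?_⟩
  by_cases hx : x ∈ Icc (0 : ℝ) 1
  · exact (hK x hx).trans (le_max_left _ _)
  · rw [hz x hx, abs_zero]; exact le_max_right _ _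

/-- A smooth cutoff, equal to `1` on `[a+2/r, b-2/r]` and to `0` outside `[a+1/r, b-1/r]`. -/
def cutoff (a b r x : ℝ) : ℝ :=
  Real.smoothTransition (r * (x - a) - 1) * Real.smoothTransition (r * (b - x) - 1)

section Cutoff

variable {a b r : ℝ}

lemma contDiff_cutoff : ContDiff ℝ ∞ (cutoff a b r) := by
  have h1 : ContDiff ℝ ∞ fun x : ℝ => r * (x - a) - 1 := by fun_prop
  have h2 : ContDiff ℝ ∞ fun x : ℝ => r * (b - x) - 1 := by fun_prop
  exact (Real.smoothTransition.contDiff.comp h1).mul (Real.smoothTransition.contDiff.comp h2)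

lemma cutoff_nonneg (x : ℝ) : 0 ≤ cutoff a b r x :=
  mul_nonneg (Real.smoothTransition.nonneg _) (Real.smoothTransition.nonneg _)

lemma cutoff_le_one (x : ℝ) : cutoff a b r x ≤ 1 :=
  mul_le_one₀ (Real.smoothTransition.le_one _) (Real.smoothTransition.nonneg _)
    (Real.smoothTransition.le_one _)

lemma cutoff_eq_one (hr : 0 < r) {x : ℝ} (h1 : a + 2 / r ≤ x) (h2 : x ≤ b - 2 / r) :
    cutoff a b r x = 1 := by
  have e1 : r * (2 / r) = 2 := by field_simp
  rw [cutoff, Real.smoothTransition.one_of_one_le, Real.smoothTransition.one_of_one_le, mul_one]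
  · nlinarith [mul_le_mul_of_nonneg_left (show 2 / r ≤ b - x by linarith) hr.le]
  · nlinarith [mul_le_mul_of_nonneg_left (show 2 / r ≤ x - a by linarith) hr.le]

lemma support_cutoff_subset (hr : 0 < r) :
    Function.support (cutoff a b r) ⊆ Icc (a + 1 / r) (b - 1 / r) := by
  intro x hx
  rw [Function.mem_support, cutoff, mul_ne_zero_iff, ne_eq, ne_eq,
    Real.smoothTransition.zero_iff_nonpos, Real.smoothTransition.zero_iff_nonpos, not_le, not_le]
    at hx
  have e : ∀ y : ℝ, 0 < r * y - 1 → 1 / r ≤ y := fun y hy => by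
    rw [div_le_iff₀ hr]; nlinarith
  exact ⟨by linarith [e _ hx.1], by linarith [e _ hx.2]⟩

lemma tsupport_cutoff_subset (hr : 0 < r) : tsupport (cutoff a b r) ⊆ Ioo a b := by
  refine (closure_minimal (support_cutoff_subset hr) isClosed_Icc).trans fun x hx => ?_
  have : 0 < 1 / r := by positivity
  exact ⟨by linarith [hx.1], by linarith [hx.2]⟩

lemma hasCompactSupport_cutoff (hr : 0 < r) : HasCompactSupport (cutoff a b r) :=
  HasCompactSupport.of_support_subset_isCompact isCompact_Icc (support_cutoff_subset hr)

lemma cutoff_left : cutoff a b r a = 0 := by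
  rw [cutoff, Real.smoothTransition.zero_of_nonpos (by norm_num), zero_mul]

lemma cutoff_right : cutoff a b r b = 0 := by
  rw [cutoff, Real.smoothTransition.zero_of_nonpos (x := r * (b - b) - 1) (by norm_num), mul_zero]

lemma deriv_cutoff_eq_zero (hr : 0 < r) {x : ℝ} (h1 : a + 2 / r < x) (h2 : x < b - 2 / r) :
    deriv (cutoff a b r) x = 0 := by
  have : cutoff a b r =ᶠ[𝓝 x] fun _ => 1 := by
    filter_upwards [Ioo_mem_nhds h1 h2] with y hy
    exact cutoff_eq_one hr hy.1.le hy.2.le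
  rw [this.deriv_eq, deriv_const]

lemma abs_deriv_cutoff_le {K : ℝ} (hK : ∀ x, |deriv Real.smoothTransition x| ≤ K) (hr : 0 < r)
    (x : ℝ) : |deriv (cutoff a b r) x| ≤ 2 * r * K := by
  have hs : ∀ y, HasDerivAt Real.smoothTransition (deriv Real.smoothTransition y) y := fun y =>
    ((Real.smoothTransition.contDiff (n := 1)).differentiable one_ne_zero y).hasDerivAt
  have h1 : HasDerivAt (fun x : ℝ => r * (x - a) - 1) r x := by
    simpa using (((hasDerivAt_id x).sub_const a).const_mul r).sub_const 1
  have h2 : HasDerivAt (fun x : ℝ => r * (b - x) - 1) (-r) x := by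
    simpa using (((hasDerivAt_id x).const_sub b).const_mul r).sub_const 1
  have h3 := ((hs _).comp x h1).mul ((hs _).comp x h2)
  have e : deriv (cutoff a b r) x = _ := h3.deriv
  rw [e]
  have hK0 : 0 ≤ K := (abs_nonneg _).trans (hK 0)
  have b1 := hK (r * (x - a) - 1)
  have b2 := hK (r * (b - x) - 1)
  have c1 : |Real.smoothTransition (r * (x - a) - 1)| ≤ 1 := by
    rw [abs_of_nonneg (Real.smoothTransition.nonneg _)]; exact Real.smoothTransition.le_one _
  have c2 : |Real.smoothTransition (r * (b - x) - 1)| ≤ 1 := by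
    rw [abs_of_nonneg (Real.smoothTransition.nonneg _)]; exact Real.smoothTransition.le_one _
  refine (abs_add_le _ _).trans ?_
  simp only [abs_mul, abs_neg, abs_of_pos hr, Function.comp_apply]
  calc _ ≤ K * r * 1 + 1 * (K * r) := by gcongr
    _ = _ := by ring

/-- Against a continuous function that vanishes at the end points, the derivatives of the cutoffs
tend to zero. -/
lemma tendsto_integral_deriv_cutoff (hab : a < b) {f : ℝ → ℂ} (hf : ContinuousOn f (Icc a b))
    (ha : f a = 0) (hb : f b = 0) :
    Tendsto (fun n : ℕ => ∫ x in Ioo a b, deriv (cutoff a b n) x • f x) atTop (𝓝 0) := by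
  obtain ⟨K, hK⟩ := exists_bound_deriv_smoothTransition
  have hK0 : 0 ≤ K := (abs_nonneg _).trans (hK 0)
  rw [Metric.tendsto_atTop]
  intro δ' hδ'
  -- The derivative of the cutoff is at most 2nK and lives on a set of measure at most 4/n, where
  -- ‖f‖ ≤ δ. The integral is thus at most 8Kδ, and δ makes this less than δ'.
  set δ := δ' / (8 * K + 1) / 2 with hδ
  have hδ0 : 0 < δ := by positivity
  have e1 := Metric.continuousWithinAt_iff.mp (hf a (left_mem_Icc.mpr hab.le)) δ hδ0
  have e2 := Metric.continuousWithinAt_iff.mp (hf b (right_mem_Icc.mpr hab.le)) δ hδ0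
  obtain ⟨r1, hr1, h1⟩ := e1
  obtain ⟨r2, hr2, h2⟩ := e2
  obtain ⟨M, hM⟩ := exists_nat_gt (2 / min r1 r2)
  have hm : 0 < min r1 r2 := lt_min hr1 hr2
  refine ⟨M, fun n hn => ?_⟩
  have hn' : 2 / min r1 r2 < n := hM.trans_le (by exact_mod_cast hn)
  have hn0 : (0 : ℝ) < n := (by positivity : (0 : ℝ) < 2 / min r1 r2).trans hn'
  have hn2 : 2 / (n : ℝ) < min r1 r2 := by
    rw [div_lt_iff₀ hm] at hn'
    rw [div_lt_iff₀ hn0]; linarith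
  set A := Icc a (a + 2 / n) ∪ Icc (b - 2 / n) b with hA
  have hsub : ∫ x in Ioo a b, deriv (cutoff a b n) x • f x =
      ∫ x in A ∩ Ioo a b, deriv (cutoff a b n) x • f x := by
    refine setIntegral_eq_of_subset_of_forall_sdiff_eq_zero measurableSet_Ioo inter_subset_right
      fun x hx => ?_
    have hx1 := hx.1
    have hx2 : x ∉ A := fun h => hx.2 ⟨h, hx.1⟩
    rw [hA, mem_union, not_or, mem_Icc, mem_Icc, not_and_or, not_and_or] at hx2
    have h3 := hx2.1.resolve_left (by simpa using hx1.1.le)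
    have h4 := hx2.2.resolve_right (by simpa using hx1.2.le)
    rw [deriv_cutoff_eq_zero hn0 (not_le.mp h3) (not_le.mp h4), zero_smul]
  have hvol : volume.real (A ∩ Ioo a b) ≤ 4 / n := by
    have hAf : volume A ≠ ⊤ := by
      refine (measure_union_lt_top ?_ ?_).ne <;> simp
    calc volume.real (A ∩ Ioo a b) ≤ volume.real A := measureReal_mono inter_subset_left hAf
      _ ≤ volume.real (Icc a (a + 2 / (n : ℝ))) + volume.real (Icc (b - 2 / (n : ℝ)) b) :=
        measureReal_union_le _ _
      _ = 4 / n := by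
        have : (0 : ℝ) ≤ 2 / n := by positivity
        rw [Real.volume_real_Icc_of_le (by linarith), Real.volume_real_Icc_of_le (by linarith)]
        ring
  rw [dist_zero_right, hsub]
  have hfin : volume (A ∩ Ioo a b) < ⊤ :=
    (measure_mono inter_subset_right).trans_lt (by simp)
  refine (norm_setIntegral_le_of_norm_le_const (C := 2 * n * K * δ) hfin fun x hx => ?_).trans_lt ?_
  · rw [norm_smul, Real.norm_eq_abs]
    have hx' := Ioo_subset_Icc_self hx.2
    refine mul_le_mul (abs_deriv_cutoff_le hK hn0 x) ?_ (norm_nonneg _) (by positivity)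
    rcases hx.1 with h | h
    · have := h1 hx' (by
        rw [Real.dist_eq, abs_of_nonneg (by linarith [h.1])]
        linarith [h.2, min_le_left r1 r2])
      rw [ha, dist_zero_right] at this
      exact this.le
    · have := h2 hx' (by
        rw [Real.dist_eq, abs_of_nonpos (by linarith [h.2])]
        linarith [h.1, min_le_right r1 r2])
      rw [hb, dist_zero_right] at this
      exact this.le
  · calc 2 * n * K * δ * volume.real (A ∩ Ioo a b) ≤ 2 * n * K * δ * (4 / n) := by gcongr
      _ = 8 * K * δ := by field_simp; ring
      _ ≤ (8 * K + 1) * δ := by nlinarith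
      _ = δ' / 2 := by rw [hδ]; field_simp
      _ < δ' := by linarith

end Cutoff

/-! ### Weak derivatives of periodic functions -/

section Weak

variable {a b : ℝ}

lemma integrableOn_of_memLp {u : ℝ → ℂ} (hu : MemLp u 2 (volume.restrict (Ioo a b))) :
    IntegrableOn u (Ioo a b) := hu.integrable one_le_two

/-- The weak derivative is unique. -/
lemma IsWeakDeriv.ae_eq {u u' g g' : ℝ → ℂ} (h : IsWeakDeriv a b u g) (h' : IsWeakDeriv a b u' g')
    (hu : u =ᵐ[volume.restrict (Ioo a b)] u') (hg : IntegrableOn g (Ioo a b))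
    (hg' : IntegrableOn g' (Ioo a b)) : g =ᵐ[volume.restrict (Ioo a b)] g' := by
  have key := isOpen_Ioo.ae_eq_zero_of_integral_contDiff_smul_eq_zero (U := Ioo a b) (μ := volume)
    (f := fun x => g x - g' x) (hg.sub hg').locallyIntegrableOn fun η h1 h2 h3 => ?_
  · rw [EventuallyEq, ae_restrict_iff' measurableSet_Ioo]
    exact key.mono fun x hx hxm => sub_eq_zero.mp (hx hxm)
  · obtain ⟨K, hK⟩ := h2.exists_bound_of_continuous h1.continuous
    have hint : ∀ {v : ℝ → ℂ}, IntegrableOn v (Ioo a b) →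
        IntegrableOn (fun x => η x • v x) (Ioo a b) := fun hv =>
      hv.bdd_smul _ h1.continuous.aestronglyMeasurable.restrict (ae_of_all _ hK)
    have e : ∫ x, η x • (g x - g' x) = ∫ x in Ioo a b, η x • (g x - g' x) := by
      refine (setIntegral_eq_integral_of_forall_compl_eq_zero fun x hx => ?_).symm
      rw [image_eq_zero_of_notMem_tsupport fun hx' => hx (h3 hx'), zero_smul]
    rw [e]
    simp only [smul_sub]
    rw [integral_sub (hint hg) (hint hg')]
    have e1 := h η h1 h2 h3
    have e2 := h' η h1 h2 h3
    have e3 : ∫ x in Ioo a b, deriv η x • u x = ∫ x in Ioo a b, deriv η x • u' x :=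
      integral_congr_ae (hu.mono fun x hx => by simp only [hx])
    rw [e1, e2, neg_inj] at e3
    rw [e3, sub_self]

/-- Integration by parts against a periodic smooth function, for periodic functions with a weak
derivative. -/
lemma IsWeakDeriv.integral_deriv_smul (hab : a < b) {u g : ℝ → ℂ} (h : IsWeakDeriv a b u g)
    (hu : ContinuousOn u (Icc a b)) (hg : IntegrableOn g (Ioo a b)) (hper : u a = u b)
    {C : ℝ → ℝ} (hC : ContDiff ℝ ∞ C) (hCper : C a = C b) :
    ∫ x in Ioo a b, deriv C x • u x = -∫ x in Ioo a b, C x • g x := by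
  have hC' : Continuous (deriv C) := hC.continuous_deriv (by simp)
  have hη' : ∀ n : ℕ, Continuous (deriv (cutoff a b n)) := fun n =>
    contDiff_cutoff.continuous_deriv (by simp)
  have hint : ∀ {v : ℝ → ℂ}, ContinuousOn v (Icc a b) → IntegrableOn v (Ioo a b) := fun hv =>
    (hv.integrableOn_Icc).mono_set Ioo_subset_Icc_self
  set c := C a • u a with hc
  have hF : ContinuousOn (fun x => C x • u x - c) (Icc a b) :=
    (hC.continuous.continuousOn.smul hu).sub continuousOn_const
  have h1 := tendsto_integral_deriv_cutoff hab hF (by simp [hc]) (by simp [hc, hCper, hper])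
  have hlim : ∀ x ∈ Ioo a b, ∀ᶠ n : ℕ in atTop, cutoff a b n x = 1 := by
    intro x hx
    have hm : 0 < min (x - a) (b - x) := lt_min (sub_pos.mpr hx.1) (sub_pos.mpr hx.2)
    filter_upwards [eventually_gt_atTop ⌈2 / min (x - a) (b - x)⌉₊] with n hn
    have hn' : 2 / min (x - a) (b - x) < n := Nat.lt_of_ceil_lt hn
    have hn0 : (0 : ℝ) < n := (by positivity : (0 : ℝ) < 2 / min (x - a) (b - x)).trans hn'
    have hn2 : 2 / (n : ℝ) < min (x - a) (b - x) := by
      rw [div_lt_iff₀ hm] at hn'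
      rw [div_lt_iff₀ hn0]; linarith
    exact cutoff_eq_one hn0 (by linarith [min_le_left (x - a) (b - x)])
      (by linarith [min_le_right (x - a) (b - x)])
  have hdom : ∀ {v : ℝ → ℂ}, IntegrableOn v (Ioo a b) → Tendsto (fun n : ℕ =>
      ∫ x in Ioo a b, cutoff a b n x • v x) atTop (𝓝 (∫ x in Ioo a b, v x)) := by
    intro v hv
    refine tendsto_integral_of_dominated_convergence (fun x => ‖v x‖)
      (fun n => (contDiff_cutoff.continuous.aestronglyMeasurable.restrict).smul hv.1) hv.norm
      (fun n => ae_of_all _ fun x => ?_) ?_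
    · rw [norm_smul, Real.norm_of_nonneg (cutoff_nonneg x)]
      exact mul_le_of_le_one_left (norm_nonneg _) (cutoff_le_one x)
    · refine (ae_restrict_iff' measurableSet_Ioo).mpr (ae_of_all _ fun x hx => ?_)
      refine tendsto_const_nhds.congr' ?_
      filter_upwards [hlim x hx] with n hn
      rw [hn, one_smul]
  have hCu : ContinuousOn (fun x => deriv C x • u x) (Icc a b) := hC'.continuousOn.smul hu
  obtain ⟨K, hK⟩ := isCompact_Icc.exists_bound_of_continuousOn
    (hC.continuous.continuousOn (s := Icc a b))
  have hCg : IntegrableOn (fun x => C x • g x) (Ioo a b) :=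
    hg.bdd_smul _ hC.continuous.aestronglyMeasurable.restrict
      ((ae_restrict_iff' measurableSet_Ioo).mpr (ae_of_all _ fun x hx =>
        hK x (Ioo_subset_Icc_self hx)))
  have h2 := (h1.add (hdom (hint hCu))).add (hdom hCg)
  rw [zero_add] at h2
  refine eq_neg_of_add_eq_zero_left (tendsto_nhds_unique h2 ?_)
  refine tendsto_const_nhds.congr' ?_
  filter_upwards [eventually_gt_atTop 0] with n hn
  have hn0 : (0 : ℝ) < n := by exact_mod_cast hn
  have hd : ∀ x, deriv (fun y => cutoff a b n y * C y) x =
      deriv (cutoff a b n) x * C x + cutoff a b n x * deriv C x := fun x =>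
    deriv_fun_mul (contDiff_cutoff.differentiable (by simp) x) (hC.differentiable (by simp) x)
  -- The periodic function `C` is not an admissible test function, but its product with the cutoff
  -- is.
  have hw := h (fun y => cutoff a b n y * C y) (contDiff_cutoff.mul hC)
    (hasCompactSupport_cutoff hn0).mul_right
    ((closure_mono (Function.support_mul_subset_left _ _)).trans (tsupport_cutoff_subset hn0))
  have hz : ∫ x in Ioo a b, deriv (cutoff a b n) x • c = 0 := by
    rw [setIntegral_Ioo hab, intervalIntegral.integral_smul_const,
      intervalIntegral.integral_deriv_eq_sub (fun x _ =>
        (contDiff_cutoff.differentiable (by simp) x)) ((hη' n).intervalIntegrable _ _),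
      cutoff_left, cutoff_right, sub_self, zero_smul]
  have i1 : IntegrableOn (fun x => deriv (cutoff a b n) x • (C x • u x)) (Ioo a b) :=
    hint ((hη' n).continuousOn.smul (hC.continuous.continuousOn.smul hu))
  have i2 : IntegrableOn (fun x => deriv (cutoff a b n) x • c) (Ioo a b) :=
    hint ((hη' n).continuousOn.smul continuousOn_const)
  have i3 : IntegrableOn (fun x => cutoff a b n x • (deriv C x • u x)) (Ioo a b) :=
    hint (contDiff_cutoff.continuous.continuousOn.smul hCu)
  have e1 : ∫ x in Ioo a b, deriv (fun y => cutoff a b n y * C y) x • u x =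
      (∫ x in Ioo a b, deriv (cutoff a b n) x • (C x • u x)) +
        ∫ x in Ioo a b, cutoff a b n x • (deriv C x • u x) := by
    rw [← integral_add i1 i3]
    simp only [hd, add_smul, mul_smul]
  simp only [smul_sub]
  rw [integral_sub i1 i2, hz, sub_zero, ← e1, hw]
  simp only [mul_smul, neg_add_cancel]

/-- Periodicity removes the boundary terms. Test functions are real, so the wave is handled through
its real and imaginary parts. -/
lemma IsWeakDeriv.fc_eq (hab : a < b) {u g : ℝ → ℂ} (h : IsWeakDeriv a b u g)
    (hu : ContinuousOn u (Icc a b)) (hg : IntegrableOn g (Ioo a b)) (hper : u a = u b) (l : ℤ) :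
    fc a b g l = Complex.I * (μ a b l : ℂ) * fc a b u l := by
  have hu' : IntegrableOn u (Ioo a b) := hu.integrableOn_Icc.mono_set Ioo_subset_Icc_self
  have hre : ContDiff ℝ ∞ fun x => (wave a b (-l) x).re :=
    Complex.reCLM.contDiff.comp (contDiff_wave (-l))
  have him : ContDiff ℝ ∞ fun x => (wave a b (-l) x).im :=
    Complex.imCLM.contDiff.comp (contDiff_wave (-l))
  have h1 := h.integral_deriv_smul hab hu hg hper hre (by rw [wave_left, wave_right hab])
  have h2 := h.integral_deriv_smul hab hu hg hper him (by rw [wave_left, wave_right hab])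
  have dre : ∀ x, deriv (fun x => (wave a b (-l) x).re) x =
      (Complex.I * (μ a b (-l) : ℂ) * wave a b (-l) x).re := fun x =>
    (Complex.reCLM.hasFDerivAt.comp_hasDerivAt x (hasDerivAt_wave (-l) x)).deriv
  have dim : ∀ x, deriv (fun x => (wave a b (-l) x).im) x =
      (Complex.I * (μ a b (-l) : ℂ) * wave a b (-l) x).im := fun x =>
    (Complex.imCLM.hasFDerivAt.comp_hasDerivAt x (hasDerivAt_wave (-l) x)).deriv
  simp only [dre] at h1
  simp only [dim] at h2
  have split : ∀ {z : ℝ → ℂ} {v : ℝ → ℂ}, Continuous z → (∃ M, ∀ x, ‖z x‖ ≤ M) →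
      IntegrableOn v (Ioo a b) → ∫ x in Ioo a b, z x * v x =
      (∫ x in Ioo a b, (z x).re • v x) + Complex.I * ∫ x in Ioo a b, (z x).im • v x := by
    rintro z v hz ⟨M, hM⟩ hv
    rw [← integral_const_mul, ← integral_add]
    · refine integral_congr_ae (ae_of_all _ fun x => ?_)
      simp only [Complex.real_smul]
      conv_lhs => rw [← Complex.re_add_im (z x)]
      ring
    · exact hv.bdd_smul _ (Complex.continuous_re.comp hz).aestronglyMeasurable.restrict
        (ae_of_all _ fun x => (Complex.abs_re_le_norm _).trans (hM x))
    · exact (hv.bdd_smul _ (Complex.continuous_im.comp hz).aestronglyMeasurable.restrict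
        (ae_of_all _ fun x => (Complex.abs_im_le_norm _).trans (hM x))).const_mul _
  have hcont := continuous_wave (a := a) (b := b) (-l)
  have s1 := split (z := fun x => Complex.I * (μ a b (-l) : ℂ) * wave a b (-l) x)
    (continuous_const.mul hcont) ⟨‖Complex.I * (μ a b (-l) : ℂ)‖, fun x => by
      rw [norm_mul, norm_wave, mul_one]⟩ hu'
  have s2 := split hcont ⟨1, fun x => (norm_wave _ x).le⟩ hg
  rw [h1, h2, mul_neg, ← neg_add, ← s2] at s1
  simp only [mul_assoc, integral_const_mul, mu_neg] at s1
  rw [fc, fc, ← neg_neg (∫ x in Ioo a b, wave a b (-l) x * g x), ← s1]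
  push_cast
  ring

end Weak

/-! ### The Sobolev norm in terms of Fourier coefficients -/

/-- The frequencies `|μ_l|`, `l ∈ ℤ`. -/
def intFreq (a b : ℝ) : Freq ℤ where
  μ l := |μ a b l|
  nonneg _ := abs_nonneg _
  neg l := by rw [mu_neg, abs_neg]
  add_le k l := by rw [mu_add]; exact abs_add_le _ _

section Sobolev

variable {a b : ℝ} {m : ℕ} {u v : ℝ → ℂ}

lemma IsWeakJet.ae_eq {w w' : ℕ → ℝ → ℂ} (h : IsWeakJet a b m u w) (h' : IsWeakJet a b m u w') :
    ∀ k ≤ m, w k =ᵐ[volume.restrict (Ioo a b)] w' k := by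
  intro k
  induction k with
  | zero => intro _; rw [h.zero, h'.zero]
  | succ k ih =>
    intro hk
    exact (h.weak k hk).ae_eq (h'.weak k hk) (ih (by omega))
      (integrableOn_of_memLp (h.memLp _ hk)) (integrableOn_of_memLp (h'.memLp _ hk))

lemma IsWeakJet.hNorm_sq {w : ℕ → ℝ → ℂ} (h : IsWeakJet a b m u w) :
    hNorm a b m u ^ 2 = ∑ k ∈ Finset.range (m + 1),
      (eLpNorm (w k) 2 (volume.restrict (Ioo a b))) ^ 2 := by
  have e : hNorm a b m u = (∑ k ∈ Finset.range (m + 1),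
      (eLpNorm (w k) 2 (volume.restrict (Ioo a b))) ^ 2) ^ (1 / 2 : ℝ) := by
    refine le_antisymm (iInf₂_le w h) (le_iInf₂ fun w' h' => le_of_eq ?_)
    congr 1
    refine Finset.sum_congr rfl fun k hk => ?_
    rw [eLpNorm_congr_ae (h.ae_eq h' k (by simpa [Nat.lt_succ_iff] using hk))]
  rw [e, ← ENNReal.rpow_two, ← ENNReal.rpow_mul]
  norm_num

lemma IsWeakJet.mono {w : ℕ → ℝ → ℂ} {m' : ℕ} (h : IsWeakJet a b m u w) (hm : m' ≤ m) :
    IsWeakJet a b m' u w :=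
  ⟨h.zero, fun k hk => h.memLp k (hk.trans hm), fun k hk => h.weak k (hk.trans_le hm)⟩

lemma hNorm_mono {m' : ℕ} (hm : m' ≤ m) (u : ℝ → ℂ) : hNorm a b m' u ≤ hNorm a b m u := by
  refine le_iInf₂ fun w hw => (iInf₂_le w (hw.mono hm)).trans ?_
  gcongr

/-- The coefficients are bounded by the norm, for arbitrary functions. -/
lemma tsum_enorm_fc_le_hNorm (hab : a < b) (m : ℕ) (u : ℝ → ℂ) :
    ENNReal.ofReal (b - a) * ∑' l, ‖fc a b u l‖ₑ ^ 2 ≤ hNorm a b m u ^ 2 := by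
  by_cases h : ∃ w, IsWeakJet a b m u w
  · obtain ⟨w, hw⟩ := h
    have h0 := hw.memLp 0 (Nat.zero_le _)
    rw [hw.hNorm_sq, ← hw.zero, ← tsum_enorm_fc hab h0]
    exact Finset.single_le_sum (f := fun k => (eLpNorm (w k) 2 (volume.restrict (Ioo a b))) ^ 2)
      (fun _ _ => zero_le) (by simp)
  · have : hNorm a b m u = ⊤ := by
      refine iInf₂_eq_top.mpr fun w hw => absurd ⟨w, hw⟩ h
    simp [this]

lemma IsWeakJet.hNorm_lt_top {w : ℕ → ℝ → ℂ} (h : IsWeakJet a b m u w) : hNorm a b m u < ⊤ := by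
  have : hNorm a b m u ^ 2 < ⊤ := by
    rw [h.hNorm_sq]
    exact ENNReal.sum_lt_top.mpr fun k hk =>
      ENNReal.pow_lt_top (h.memLp k (by simpa [Nat.lt_succ_iff] using hk)).2
  by_contra h'
  simp [not_lt_top_iff.mp h'] at this

lemma MemHper.hNorm_lt_top (h : MemHper a b m u) : hNorm a b m u < ⊤ :=
  h.choose_spec.1.hNorm_lt_top

lemma MemHper.mono {m' : ℕ} (h : MemHper a b m u) (hm : m' ≤ m) : MemHper a b m' u := by
  obtain ⟨w, hw, hw'⟩ := h
  exact ⟨w, hw.mono hm, fun k hk => hw' k (hk.trans_le hm)⟩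

lemma MemHper.memLp (h : MemHper a b m u) : MemLp u 2 (volume.restrict (Ioo a b)) := by
  obtain ⟨w, hw, -⟩ := h
  rw [← hw.zero]; exact hw.memLp 0 (Nat.zero_le _)

lemma MemHper.integrableOn (h : MemHper a b m u) : IntegrableOn u (Ioo a b) :=
  integrableOn_of_memLp h.memLp

lemma MemHper.continuousOn (h : MemHper a b m u) (hm : 1 ≤ m) : ContinuousOn u (Icc a b) := by
  obtain ⟨w, hw, hw'⟩ := h
  rw [← hw.zero]; exact (hw' 0 hm).1

lemma IsWeakDeriv.sub {g g' : ℝ → ℂ} (h : IsWeakDeriv a b u g) (h' : IsWeakDeriv a b v g')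
    (hu : IntegrableOn u (Ioo a b)) (hv : IntegrableOn v (Ioo a b))
    (hg : IntegrableOn g (Ioo a b)) (hg' : IntegrableOn g' (Ioo a b)) :
    IsWeakDeriv a b (fun x => u x - v x) (fun x => g x - g' x) := by
  intro η h1 h2 h3
  have hint : ∀ {v : ℝ → ℂ} {θ : ℝ → ℝ}, Continuous θ → HasCompactSupport θ →
      IntegrableOn v (Ioo a b) → IntegrableOn (fun x => θ x • v x) (Ioo a b) := by
    intro v θ hθ hθ' hv
    obtain ⟨K, hK⟩ := hθ'.exists_bound_of_continuous hθ
    exact hv.bdd_smul _ hθ.aestronglyMeasurable.restrict (ae_of_all _ hK)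
  have hd : Continuous (deriv η) := h1.continuous_deriv (by simp)
  simp only [smul_sub]
  rw [integral_sub (hint hd h2.deriv hu) (hint hd h2.deriv hv),
    integral_sub (hint h1.continuous h2 hg) (hint h1.continuous h2 hg'), h η h1 h2 h3,
    h' η h1 h2 h3]
  ring

lemma MemHper.sub (hu : MemHper a b m u) (hv : MemHper a b m v) :
    MemHper a b m (fun x => u x - v x) := by
  obtain ⟨w, hw, hw'⟩ := hu
  obtain ⟨z, hz, hz'⟩ := hv
  refine ⟨fun k x => w k x - z k x, ⟨by simp [hw.zero, hz.zero], fun k hk =>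
    (hw.memLp k hk).sub (hz.memLp k hk), fun k hk => ?_⟩, fun k hk => ⟨(hw' k hk).1.sub (hz' k hk).1,
      by simp only [(hw' k hk).2, (hz' k hk).2]⟩⟩
  exact (hw.weak k hk).sub (hz.weak k hk) (integrableOn_of_memLp (hw.memLp k hk.le))
    (integrableOn_of_memLp (hz.memLp k hk.le)) (integrableOn_of_memLp (hw.memLp _ hk))
    (integrableOn_of_memLp (hz.memLp _ hk))

lemma isWeakDeriv_of_hasDerivAt {u' : ℝ → ℂ} (hab : a < b)
    (hu' : Continuous u') (hd : ∀ x, HasDerivAt u (u' x) x) : IsWeakDeriv a b u u' := by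
  intro η h1 h2 h3
  have hz : ∀ x ∉ Ioo a b, η x = 0 := fun x hx =>
    image_eq_zero_of_notMem_tsupport fun hx' => hx (h3 hx')
  have hη : ∀ x, HasDerivAt (fun x => (η x : ℂ)) ((deriv η x : ℝ) : ℂ) x := fun x =>
    ((h1.differentiable (by simp) x).hasDerivAt).ofReal_comp
  have h := intervalIntegral.integral_mul_deriv_eq_deriv_mul (a := a) (b := b)
    (u := fun x => (η x : ℂ)) (v := u) (u' := fun x => ((deriv η x : ℝ) : ℂ)) (v' := u')
    (fun x _ => hη x) (fun x _ => hd x)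
    ((Complex.continuous_ofReal.comp (h1.continuous_deriv (by simp))).intervalIntegrable _ _)
    (hu'.intervalIntegrable _ _)
  simp only [hz a (by simp), hz b (by simp), Complex.ofReal_zero, zero_mul, sub_self,
    zero_sub] at h
  simp only [Complex.real_smul, setIntegral_Ioo hab, h, neg_neg]

lemma memHper_finsum_wave (hab : a < b) (s : Finset ℤ) (c : ℤ → ℂ) :
    MemHper a b m (fun x => ∑ l ∈ s, c l * wave a b l x) := by
  have hcont : ∀ k : ℕ, Continuous fun x =>
      ∑ l ∈ s, (Complex.I * (μ a b l : ℂ)) ^ k * c l * wave a b l x := fun k =>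
    continuous_finsetSum _ fun l _ => continuous_const.mul (continuous_wave l)
  refine ⟨fun k x => ∑ l ∈ s, (Complex.I * (μ a b l : ℂ)) ^ k * c l * wave a b l x,
    ⟨by simp, fun k _ => ?_, fun k _ => ?_⟩, fun k _ => ⟨(hcont k).continuousOn, ?_⟩⟩
  · obtain ⟨C, hC⟩ := isCompact_Icc.exists_bound_of_continuousOn
      ((hcont k).continuousOn (s := Icc a b))
    exact MemLp.of_bound (hcont k).aestronglyMeasurable.restrict C
      ((ae_restrict_iff' measurableSet_Ioo).mpr (ae_of_all _ fun x hx =>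
        hC x (Ioo_subset_Icc_self hx)))
  · refine isWeakDeriv_of_hasDerivAt hab (hcont (k + 1)) fun x => ?_
    refine HasDerivAt.fun_sum fun l _ => ?_
    refine ((hasDerivAt_wave l x).const_mul _).congr_deriv ?_
    ring
  · simp only [wave_left, wave_right hab]

/-- Periodicity of the derivatives below order m makes each weak derivative multiply the
coefficients by iμ. Parseval is then applied to every derivative. -/
lemma MemHper.hNorm_sq (hab : a < b) (h : MemHper a b m u) :
    hNorm a b m u ^ 2 = ENNReal.ofReal (b - a) *
      ∑' l, ∑ k ∈ Finset.range (m + 1), ENNReal.ofReal ((μ a b l ^ 2) ^ k) * ‖fc a b u l‖ₑ ^ 2 := by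
  obtain ⟨w, hw, hw'⟩ := h
  have hfc : ∀ k ≤ m, ∀ l, fc a b (w k) l = (Complex.I * (μ a b l : ℂ)) ^ k * fc a b u l := by
    intro k
    induction k with
    | zero => intro _ l; rw [hw.zero, pow_zero, one_mul]
    | succ k ih =>
      intro hk l
      rw [(hw.weak k hk).fc_eq hab (hw' k hk).1 (integrableOn_of_memLp (hw.memLp _ hk))
        (hw' k hk).2, ih (by omega)]
      ring
  rw [hw.hNorm_sq, Summable.tsum_finsetSum (fun _ _ => ENNReal.summable), Finset.mul_sum]
  refine Finset.sum_congr rfl fun k hk => ?_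
  have hk' : k ≤ m := by simpa [Nat.lt_succ_iff] using hk
  rw [tsum_enorm_fc hab (hw.memLp k hk')]
  congr 1
  refine tsum_congr fun l => ?_
  rw [hfc k hk', enorm_mul, mul_pow]
  congr 1
  rw [← ofReal_norm, norm_pow, norm_mul, Complex.norm_I, one_mul, Complex.norm_real,
    ← ENNReal.ofReal_pow (by positivity), Real.norm_eq_abs, ← pow_mul, mul_comm k 2, pow_mul, sq_abs]

lemma Freq.sq_ofReal_mul {G : Type*} [AddCommGroup G] (F : Freq G) (s : ℕ) (l : G) (z : ℂ) :
    (ENNReal.ofReal (F.ρ l ^ s) * ‖z‖ₑ) ^ 2 = ENNReal.ofReal ((1 + F.μ l ^ 2) ^ s) * ‖z‖ₑ ^ 2 := by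
  rw [mul_pow, ← ENNReal.ofReal_pow (pow_nonneg (F.rho_pos l).le _), ← pow_mul, mul_comm s 2,
    pow_mul, F.sq_rho]

/-- For m = 1 the two weights agree exactly, 1 + μ² on either side, so errors are measured without a
constant. -/
lemma MemHper.hNorm_one_sq (hab : a < b) (h : MemHper a b 1 u) :
    hNorm a b 1 u ^ 2 = ENNReal.ofReal (b - a) * (intFreq a b).hs 1 (fc a b u) := by
  rw [h.hNorm_sq hab, Freq.hs]
  congr 1
  refine tsum_congr fun l => ?_
  rw [Freq.sq_ofReal_mul, ← Finset.sum_mul, ← ENNReal.ofReal_sum_of_nonneg fun _ _ => by positivity]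
  simp [intFreq, Finset.sum_range_succ]

/-- The binomial theorem: (1 + μ²)^m is at most 2^m times the sum of the powers μ^(2k). -/
lemma MemHper.hs_le (hab : a < b) (h : MemHper a b m u) :
    ENNReal.ofReal (b - a) * (intFreq a b).hs m (fc a b u) ≤ 2 ^ m * hNorm a b m u ^ 2 := by
  rw [h.hNorm_sq hab, mul_left_comm, Freq.hs]
  gcongr
  rw [← ENNReal.tsum_mul_left]
  refine ENNReal.tsum_le_tsum fun l => ?_
  rw [Freq.sq_ofReal_mul, ← Finset.sum_mul, ← ENNReal.ofReal_sum_of_nonneg fun _ _ => by positivity,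
    ← mul_assoc]
  gcongr
  have e : (2 : ℝ≥0∞) ^ m = ENNReal.ofReal (2 ^ m) := by
    rw [ENNReal.ofReal_pow (by norm_num)]; norm_num
  rw [e, ← ENNReal.ofReal_mul (by positivity)]
  refine ENNReal.ofReal_le_ofReal ?_
  simp only [intFreq, sq_abs]
  rw [add_comm, add_pow, Finset.mul_sum]
  refine Finset.sum_le_sum fun k _ => ?_
  rw [one_pow, mul_one, mul_comm]
  gcongr
  exact_mod_cast Nat.choose_le_two_pow m k

/-- The constant in the embedding of `H¹` into absolutely convergent series. -/
lemma tsum_inv_rho_sq_lt_top (hab : a < b) :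
    ∑' l, ENNReal.ofReal (((intFreq a b).ρ l)⁻¹) ^ 2 < ⊤ := by
  have hL := sub_pos.mpr hab
  set c : ℝ := 2 * Real.pi / (b - a) with hc
  have hc0 : 0 < c := by have := Real.pi_pos; positivity
  have h1 : ∀ l : ℤ, ENNReal.ofReal (((intFreq a b).ρ l)⁻¹) ^ 2 ≤
      ENNReal.ofReal ((if l = 0 then 1 else 0) + (c ^ 2)⁻¹ * (1 / (l : ℝ) ^ 2)) := by
    intro l
    rw [← ENNReal.ofReal_pow (inv_nonneg.mpr ((intFreq a b).rho_pos l).le), inv_pow, Freq.sq_rho]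
    refine ENNReal.ofReal_le_ofReal ?_
    have e : (intFreq a b).μ l ^ 2 = c ^ 2 * (l : ℝ) ^ 2 := by
      simp only [intFreq, sq_abs, μ, hc]; ring
    rw [e]
    split_ifs with h
    · simp [h]
    · have h0 : (0 : ℝ) < (l : ℝ) ^ 2 := by have : (l : ℝ) ≠ 0 := by exact_mod_cast h
                                            positivity
      rw [zero_add, ← one_div, ← one_div, div_mul_div_comm, one_mul]
      gcongr
      linarith
  refine (ENNReal.tsum_le_tsum h1).trans_lt ?_
  have hs : Summable fun l : ℤ =>
      ((if l = 0 then 1 else 0) + (c ^ 2)⁻¹ * (1 / (l : ℝ) ^ 2) : ℝ) := by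
    refine Summable.add ?_ ((Real.summable_one_div_int_pow.mpr one_lt_two).mul_left _)
    exact summable_of_ne_finset_zero (s := {0}) fun l hl => by simp_all
  rw [← ENNReal.ofReal_tsum_of_nonneg (fun l => by positivity) hs]
  exact ENNReal.ofReal_lt_top

lemma summable_norm_of_hs {c : ℤ → ℂ} (hab : a < b) (h : (intFreq a b).hs 1 c < ⊤) :
    Summable fun l => ‖c l‖ := by
  have h1 := ((intFreq a b).sq_tsum_enorm_le le_rfl c).trans_lt
    (ENNReal.mul_lt_top (tsum_inv_rho_sq_lt_top hab) h)
  have h2 : ∑' l, ‖c l‖ₑ ≠ ⊤ := fun h' => by simp [h'] at h1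
  exact tsum_enorm_ne_top_iff_summable_norm.mp h2

lemma MemHper.hs_lt_top (hab : a < b) (h : MemHper a b m u) :
    (intFreq a b).hs m (fc a b u) < ⊤ := by
  have h1 := (h.hs_le hab).trans_lt (ENNReal.mul_lt_top (by simp)
    (ENNReal.pow_lt_top h.hNorm_lt_top))
  by_contra h'
  rw [not_lt_top_iff.mp h', ENNReal.mul_top (by simpa using hab)] at h1
  exact lt_irrefl _ h1

lemma MemHper.summable (hab : a < b) (h : MemHper a b m u) (hm : 1 ≤ m) :
    Summable fun l => ‖fc a b u l‖ :=
  summable_norm_of_hs hab ((h.mono hm).hs_lt_top hab)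

lemma MemHper.eq_series (hab : a < b) (h : MemHper a b m u) (hm : 1 ≤ m) :
    ∀ x ∈ Icc a b, u x = series a b (fc a b u) x :=
  eq_series_Icc hab (h.continuousOn hm) (h.summable hab hm)

lemma MemHper.fc_mul (hab : a < b) (h : MemHper a b m u) (hm : 1 ≤ m)
    (hv : IntegrableOn v (Ioo a b)) :
    fc a b (fun x => u x * v x) = conv (fc a b u) (fc a b v) :=
  fc_series_mul (h.summable hab hm) (fun x hx => h.eq_series hab hm x (Ioo_subset_Icc_self hx)) hv

end Sobolev

/-! ### The triangle inequality in `H^m` and continuity of single coefficients -/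

section Triangle

variable {a b : ℝ} {m : ℕ} {u v : ℝ → ℂ}

lemma IsWeakJet.hNorm_eq {w : ℕ → ℝ → ℂ} (h : IsWeakJet a b m u w) :
    hNorm a b m u = (∑ k ∈ Finset.range (m + 1),
      (eLpNorm (w k) 2 (volume.restrict (Ioo a b))) ^ 2) ^ (1 / 2 : ℝ) := by
  rw [← h.hNorm_sq, ← ENNReal.rpow_two, ← ENNReal.rpow_mul]
  norm_num

/-- Minkowski's inequality twice: in L² for each derivative and in ℓ² over the orders. -/
lemma MemHper.hNorm_sub_le (hu : MemHper a b m u) (hv : MemHper a b m v) :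
    hNorm a b m (fun x => u x - v x) ≤ hNorm a b m u + hNorm a b m v := by
  obtain ⟨w, hw, -⟩ := hu
  obtain ⟨z, hz, -⟩ := hv
  have hj : IsWeakJet a b m (fun x => u x - v x) (fun k x => w k x - z k x) :=
    ⟨by simp [hw.zero, hz.zero], fun k hk => (hw.memLp k hk).sub (hz.memLp k hk), fun k hk =>
      (hw.weak k hk).sub (hz.weak k hk) (integrableOn_of_memLp (hw.memLp k hk.le))
        (integrableOn_of_memLp (hz.memLp k hk.le)) (integrableOn_of_memLp (hw.memLp _ hk))
        (integrableOn_of_memLp (hz.memLp _ hk))⟩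
  rw [hj.hNorm_eq, hw.hNorm_eq, hz.hNorm_eq]
  simp only [← ENNReal.rpow_two]
  refine le_trans ?_ (ENNReal.Lp_add_le _ _ _ one_le_two)
  gcongr with k hk
  have hk' : k ≤ m := by simpa [Nat.lt_succ_iff] using hk
  exact eLpNorm_sub_le (hw.memLp k hk').1 (hz.memLp k hk').1 one_le_two

/-- Each coefficient is a bounded functional of the H^m norm. Continuity and differentiability in
time with values in H^m therefore pass to the coefficients. -/
lemma enorm_fc_le (hab : a < b) (m : ℕ) (u : ℝ → ℂ) (l : ℤ) :
    ‖fc a b u l‖ₑ ≤ ENNReal.ofReal (1 / √(b - a)) * hNorm a b m u := by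
  have hL := sub_pos.mpr hab
  have h := tsum_enorm_fc_le_hNorm hab m u
  have h1 : ENNReal.ofReal (b - a) * ‖fc a b u l‖ₑ ^ 2 ≤ hNorm a b m u ^ 2 := by
    refine le_trans ?_ h
    gcongr
    exact ENNReal.le_tsum (f := fun l => ‖fc a b u l‖ₑ ^ 2) l
  have e : ENNReal.ofReal (b - a) = ENNReal.ofReal √(b - a) ^ 2 := by
    rw [← ENNReal.ofReal_pow (Real.sqrt_nonneg _), Real.sq_sqrt hL.le]
  rw [e, ← mul_pow] at h1
  have h2 := (ENNReal.pow_le_pow_left_iff two_ne_zero).mp h1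
  calc ‖fc a b u l‖ₑ = ENNReal.ofReal (1 / √(b - a)) * (ENNReal.ofReal √(b - a) * ‖fc a b u l‖ₑ) := by
        rw [← mul_assoc, ← ENNReal.ofReal_mul (by positivity), one_div,
          inv_mul_cancel₀ (Real.sqrt_pos.mpr hL).ne']
        simp
    _ ≤ _ := by gcongr

end Triangle

/-! ### The Fourier coefficients of the exact solution -/

section Evolution

variable {a b T : ℝ} {m : ℕ}

lemma ContHper.continuousOn_fc (hab : a < b) {u : ℝ → ℝ → ℂ} (h : ContHper a b T m u) (l : ℤ) :
    ContinuousOn (fun t => fc a b (u t) l) (Icc 0 T) := by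
  intro t ht
  have h1 : Tendsto (fun s => ENNReal.ofReal (1 / √(b - a)) *
      hNorm a b m (fun x => u s x - u t x)) (𝓝[Icc 0 T] t) (𝓝 0) := by
    have := ENNReal.Tendsto.const_mul (a := ENNReal.ofReal (1 / √(b - a))) (h t ht).2
      (Or.inr (by simp))
    rwa [mul_zero] at this
  refine tendsto_iff_edist_tendsto_0.mpr (tendsto_of_tendsto_of_tendsto_of_le_of_le'
    tendsto_const_nhds h1 (Eventually.of_forall fun _ => zero_le) ?_)
  filter_upwards [self_mem_nhdsWithin] with s hs
  have e := congrFun (fc_sub (h s hs).1.integrableOn (h t ht).1.integrableOn) l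
  rw [edist_eq_enorm_sub]
  simp only [Pi.sub_apply] at e
  rw [← e]
  exact enorm_fc_le hab m _ l

lemma ContDiffHper.hasDerivAt_fc (hab : a < b) {u u' : ℝ → ℝ → ℂ} (h : ContDiffHper a b T m u u')
    {t : ℝ} (ht : t ∈ Ioo 0 T) (l : ℤ) :
    HasDerivAt (fun t => fc a b (u t) l) (fc a b (u' t) l) t := by
  have ht' := Ioo_subset_Icc_self ht
  have key : HasDerivWithinAt (fun t => fc a b (u t) l) (fc a b (u' t) l) (Icc 0 T) t := by
    rw [hasDerivWithinAt_iff_tendsto_slope]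
    have h1 : Tendsto (fun s => ENNReal.ofReal (1 / √(b - a)) *
        hNorm a b m (fun x => (u s x - u t x) / ((s - t : ℝ) : ℂ) - u' t x))
        (𝓝[Icc 0 T \ {t}] t) (𝓝 0) := by
      have := ENNReal.Tendsto.const_mul (a := ENNReal.ofReal (1 / √(b - a))) (h.2.2 t ht')
        (Or.inr (by simp))
      rwa [mul_zero] at this
    refine tendsto_iff_edist_tendsto_0.mpr (tendsto_of_tendsto_of_tendsto_of_le_of_le'
      tendsto_const_nhds h1 (Eventually.of_forall fun _ => zero_le) ?_)
    filter_upwards [self_mem_nhdsWithin] with s hs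
    have i1 := (h.1 s hs.1).1.integrableOn
    have i2 := (h.1 t ht').1.integrableOn
    have i3 := (h.2.1 t ht').1.integrableOn
    have e := congrFun (fc_sub (u := fun x => ((s - t : ℝ) : ℂ)⁻¹ * (u s x - u t x))
      ((i1.sub i2).const_mul _) i3) l
    rw [fc_const_mul, fc_sub i1 i2] at e
    have e2 : slope (fun t => fc a b (u t) l) t s - fc a b (u' t) l =
        fc a b (fun x => (u s x - u t x) / ((s - t : ℝ) : ℂ) - u' t x) l := by
      simp only [div_eq_inv_mul, e, slope, Pi.sub_apply, Pi.smul_apply, smul_eq_mul, vsub_eq_sub,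
        Complex.real_smul, Complex.ofReal_inv]
    rw [edist_eq_enorm_sub, e2]
    exact enorm_fc_le hab m _ l
  exact key.hasDerivAt (Icc_mem_nhds ht.1 ht.2)

/-- Differentiation of Fourier coefficients under the integral sign. -/
lemma hasDerivAt_fc {u u' : ℝ → ℝ → ℂ} {C : ℝ}
    (hu : ∀ t ∈ Ioo 0 T, ContinuousOn (u t) (Icc a b))
    (hu' : ∀ t ∈ Ioo 0 T, ContinuousOn (u' t) (Ioo a b))
    (hC : ∀ t ∈ Ioo 0 T, ∀ x ∈ Ioo a b, ‖u' t x‖ ≤ C)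
    (hd : ∀ t ∈ Ioo 0 T, ∀ x ∈ Ioo a b, HasDerivAt (fun t => u t x) (u' t x) t)
    {t : ℝ} (ht : t ∈ Ioo 0 T) (l : ℤ) :
    HasDerivAt (fun t => fc a b (u t) l) (fc a b (u' t) l) t := by
  have hint : ∀ t ∈ Ioo 0 T, IntegrableOn (u t) (Ioo a b) := fun t ht =>
    (hu t ht).integrableOn_Icc.mono_set Ioo_subset_Icc_self
  have hnhds : Ioo 0 T ∈ 𝓝 t := Ioo_mem_nhds ht.1 ht.2
  refine HasDerivAt.const_mul _ ?_
  refine (hasDerivAt_integral_of_dominated_loc_of_deriv_le (μ := volume.restrict (Ioo a b))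
    (F := fun t x => wave a b (-l) x * u t x) (F' := fun t x => wave a b (-l) x * u' t x)
    (s := Ioo 0 T) (bound := fun _ => C) hnhds ?_ (integrable_wave_mul (hint t ht) _)
    ?_ ?_ (by simp) ?_).2
  · filter_upwards [hnhds] with s hs
    exact (integrable_wave_mul (hint s hs) _).1
  · exact ((continuous_wave _).continuousOn.mul (hu' t ht)).aestronglyMeasurable measurableSet_Ioo
  · refine (ae_restrict_iff' measurableSet_Ioo).mpr (ae_of_all _ fun x hx s hs => ?_)
    rw [norm_mul, norm_wave, one_mul]
    exact hC s hs x hx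
  · refine (ae_restrict_iff' measurableSet_Ioo).mpr (ae_of_all _ fun x hx s hs => ?_)
    exact (hd s hs x hx).const_mul _

/-- Fourier coefficients of second derivatives. -/
lemma fc_iteratedDerivWithin_two {E : Type*} [NormedAddCommGroup E] [NormedSpace ℝ E]
    (hab : a < b) (L : E →L[ℝ] ℂ) {u : ℝ → E} (hu : ContDiffOn ℝ 2 u (Icc a b)) (h0 : u a = u b)
    (h1 : derivWithin u (Icc a b) a = derivWithin u (Icc a b) b) (l : ℤ) :
    ContinuousOn (fun x => L (iteratedDerivWithin 2 u (Icc a b) x)) (Icc a b) ∧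
    fc a b (fun x => L (iteratedDerivWithin 2 u (Icc a b) x)) l =
      -((μ a b l : ℂ) ^ 2 * fc a b (fun x => L (u x)) l) := by
  have hU := uniqueDiffOn_Icc hab
  have hu1 : ContDiffOn ℝ 1 (derivWithin u (Icc a b)) (Icc a b) :=
    hu.derivWithin hU (by norm_num)
  have e2 : ∀ x ∈ Icc a b, iteratedDerivWithin 2 u (Icc a b) x =
      derivWithin (derivWithin u (Icc a b)) (Icc a b) x := fun x hx => by
    rw [iteratedDerivWithin_succ]
    refine derivWithin_congr (fun y hy => ?_) ?_ <;> rw [iteratedDerivWithin_one]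
  have hu2 : ContinuousOn (iteratedDerivWithin 2 u (Icc a b)) (Icc a b) :=
    hu.continuousOn_iteratedDerivWithin (by norm_num) hU
  have hc2 : ContinuousOn (fun x => L (iteratedDerivWithin 2 u (Icc a b) x)) (Icc a b) :=
    L.continuous.comp_continuousOn hu2
  have hd : ∀ {v : ℝ → E}, ContDiffOn ℝ 1 v (Icc a b) → ∀ x ∈ Ioo a b,
      HasDerivAt (fun x => L (v x)) (L (derivWithin v (Icc a b) x)) x := fun hv x hx =>
    L.hasFDerivAt.comp_hasDerivAt x (((hv.differentiableOn one_ne_zero x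
      (Ioo_subset_Icc_self hx)).hasDerivWithinAt).hasDerivAt (Icc_mem_nhds hx.1 hx.2))
  refine ⟨hc2, ?_⟩
  have hc1 := L.continuous.comp_continuousOn hu1.continuousOn
  rw [fc_of_hasDerivAt hab hc1 hc2 (fun x hx => ?_) (by simp only [Function.comp_apply, h1]) l,
    fc_of_hasDerivAt hab (L.continuous.comp_continuousOn hu.continuousOn) hc1
      (hd (hu.of_le (by norm_num))) (by simp only [Function.comp_apply, h0]) l]
  · simp only [← mul_assoc]
    rw [← neg_mul]
    congr 1
    linear_combination (μ a b l : ℂ) ^ 2 * Complex.I_mul_I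
  · rw [e2 x (Ioo_subset_Icc_self hx)]
    exact hd hu1 x hx

end Evolution


/-- The system for the Fourier coefficients `W`, `P`, `Q` of `ψ`, `φ`, `∂_t φ`. -/
structure SpectralData (a b T ε : ℝ) (m : ℕ) (M : ℝ≥0∞) (W P Q : ℝ → ℤ → ℂ) : Prop where
  cont_w : ∀ l, ContinuousOn (fun t => W t l) (Icc 0 T)
  cont_p : ∀ l, ContinuousOn (fun t => P t l) (Icc 0 T)
  cont_q : ∀ l, ContinuousOn (fun t => Q t l) (Icc 0 T)
  deriv_w : ∀ t ∈ Ioo 0 T, ∀ l, HasDerivAt (fun t => W t l)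
    (-(Complex.I * ((intFreq a b).μ l : ℂ) ^ 2 * W t l) + Complex.I * conv (P t) (W t) l) t
  deriv_p : ∀ t ∈ Ioo 0 T, ∀ l, HasDerivAt (fun t => P t l) (Q t l) t
  deriv_q : ∀ t ∈ Ioo 0 T, ∀ l, HasDerivAt (fun t => Q t l)
    (-(((intFreq a b).om ε l : ℂ) ^ 2 * P t l) + conv (W t) (J (W t)) l / (ε : ℂ) ^ 2) t
  real_p : ∀ t ∈ Icc 0 T, J (P t) = P t
  real_q : ∀ t ∈ Icc 0 T, J (Q t) = Q t
  hs_w : ∀ t ∈ Icc 0 T, (intFreq a b).hs m (W t) ≤ M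
  hs_p : ∀ t ∈ Icc 0 T, (intFreq a b).hs m (P t) ≤ M
  hs_q : ∀ t ∈ Icc 0 T, ENNReal.ofReal (ε ^ 2) ^ 2 * (intFreq a b).hs m (Q t) ≤ M

section Exact

variable {a b T ε : ℝ} {m : ℕ}

/-- One constant for all families in a ball of h¹. It gives sup bounds uniform in time, as
domination under the integral sign requires. -/
lemma exists_tsum_norm_le (hab : a < b) {M : ℝ≥0∞} (hM : M < ⊤) :
    ∃ C : ℝ, ∀ c : ℤ → ℂ, (intFreq a b).hs 1 c ≤ M →
      (Summable fun l => ‖c l‖) ∧ ∑' l, ‖c l‖ ≤ C := by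
  set κ := ∑' l, ENNReal.ofReal (((intFreq a b).ρ l)⁻¹) ^ 2
  have hκ : κ < ⊤ := tsum_inv_rho_sq_lt_top hab
  have hfin : 1 + κ * M ≠ ⊤ := by
    simp [ENNReal.mul_eq_top, hκ.ne, hM.ne]
  refine ⟨(1 + κ * M).toReal, fun c hc => ?_⟩
  have hs := summable_norm_of_hs hab (hc.trans_lt hM)
  refine ⟨hs, ?_⟩
  have h1 : (∑' l, ‖c l‖ₑ) ^ 2 ≤ κ * M :=
    ((intFreq a b).sq_tsum_enorm_le le_rfl c).trans (by gcongr)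
  have h2 : ∑' l, ‖c l‖ₑ ≤ 1 + κ * M := by
    rcases le_total (∑' l, ‖c l‖ₑ) 1 with h | h
    · exact h.trans le_self_add
    · exact (le_self_pow₀ h two_ne_zero).trans (h1.trans le_add_self)
  have e : ∑' l, ‖c l‖ₑ = ENNReal.ofReal (∑' l, ‖c l‖) := by
    rw [ENNReal.ofReal_tsum_of_nonneg (fun _ => norm_nonneg _) hs]
    simp only [ofReal_norm]
  rw [e] at h2
  exact (ENNReal.ofReal_le_iff_le_toReal hfin).mp h2

lemma Freq.hs_mul_le {G : Type*} [AddCommGroup G] (F : Freq G) {s k : ℕ} {n : G → ℂ}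
    (hn : ∀ l, ‖n l‖ ≤ F.ρ l ^ k) (c : G → ℂ) : F.hs s (fun l => n l * c l) ≤ F.hs (s + k) c := by
  refine ENNReal.tsum_le_tsum fun l => ?_
  have h : ‖n l‖ₑ ≤ ENNReal.ofReal (F.ρ l ^ k) := by
    rw [← ofReal_norm]; exact ENNReal.ofReal_le_ofReal (hn l)
  rw [pow_add, ENNReal.ofReal_mul (pow_nonneg (F.rho_pos l).le _), enorm_mul, mul_assoc]
  gcongr

lemma integrableOn_of_continuousOn {u : ℝ → ℂ} (hu : ContinuousOn u (Icc a b)) :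
    IntegrableOn u (Ioo a b) := hu.integrableOn_Icc.mono_set Ioo_subset_Icc_self

/-- Uniform bounds from bounds of the coefficients. -/
lemma norm_le_of_hs_fc (hab : a < b) {M : ℝ≥0∞} {C : ℝ}
    (hC : ∀ c : ℤ → ℂ, (intFreq a b).hs 1 c ≤ M → (Summable fun l => ‖c l‖) ∧ ∑' l, ‖c l‖ ≤ C)
    {u : ℝ → ℂ} (hu : ContinuousOn u (Icc a b)) (h : (intFreq a b).hs 1 (fc a b u) ≤ M) :
    ∀ x ∈ Icc a b, ‖u x‖ ≤ C := fun x hx => by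
  obtain ⟨h1, h2⟩ := hC _ h
  rw [eq_series_Icc hab hu h1 x hx]
  exact (norm_series_le h1 x).trans h2

/-- A second derivative multiplies the coefficients by μ², so its sup norm is controlled by the h³
norm of the function. -/
lemma norm_le_of_fc_eq_mul (hab : a < b) {M : ℝ≥0∞} {C : ℝ}
    (hC : ∀ c : ℤ → ℂ, (intFreq a b).hs 1 c ≤ M → (Summable fun l => ‖c l‖) ∧ ∑' l, ‖c l‖ ≤ C)
    {u v : ℝ → ℂ} (hu : ContinuousOn u (Icc a b))
    (huv : ∀ l, fc a b u l = -((μ a b l : ℂ) ^ 2 * fc a b v l))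
    (h : (intFreq a b).hs 3 (fc a b v) ≤ M) : ∀ x ∈ Icc a b, ‖u x‖ ≤ C := by
  refine norm_le_of_hs_fc hab hC hu ?_
  have e : fc a b u = fun l => -((μ a b l : ℂ) ^ 2) * fc a b v l := by
    ext l; rw [huv, neg_mul]
  rw [e]
  refine ((intFreq a b).hs_mul_le (k := 2) (fun l => ?_) _).trans h
  rw [norm_neg, norm_pow, Complex.norm_real, Real.norm_eq_abs]
  exact (intFreq a b).mu_sq_le l

lemma MemHper.fc_mul_conj (hab : a < b) {u : ℝ → ℂ} (h : MemHper a b m u) (hm : 1 ≤ m) :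
    fc a b (fun x => u x * conj (u x)) = conv (fc a b u) (J (fc a b u)) := by
  rw [← fc_conj]
  exact h.fc_mul hab hm (integrableOn_of_continuousOn
    (Complex.continuous_conj.comp_continuousOn (h.continuousOn hm)))

variable {ψ₀ : ℝ → ℂ} {φ₀ φ₁ : ℝ → ℝ} {ψ : ℝ → ℝ → ℂ} {φ φt : ℝ → ℝ → ℝ}

/-- The Fourier coefficients of a solution. -/
lemma IsSolution.spectralData (h : IsSolution a b T ε ψ₀ φ₀ φ₁ ψ φ φt) (hab : a < b) (hε : 0 < ε)
    (hm : 3 ≤ m) (hψ : ContHper a b T m ψ)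
    (hφ : ContDiffHper a b T m (fun t x => (φ t x : ℂ)) (fun t x => (φt t x : ℂ)))
    {M : ℝ≥0∞} (hM : M < ⊤) (bw : ∀ t ∈ Icc 0 T, (intFreq a b).hs m (fc a b (ψ t)) ≤ M)
    (bp : ∀ t ∈ Icc 0 T, (intFreq a b).hs m (fc a b fun x => (φ t x : ℂ)) ≤ M)
    (bq : ∀ t ∈ Icc 0 T,
      ENNReal.ofReal (ε ^ 2) ^ 2 * (intFreq a b).hs m (fc a b fun x => (φt t x : ℂ)) ≤ M) :
    SpectralData a b T ε m M (fun t => fc a b (ψ t)) (fun t => fc a b fun x => (φ t x : ℂ))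
      (fun t => fc a b fun x => (φt t x : ℂ)) := by
  have hreal : ∀ v : ℝ → ℝ, J (fc a b fun x => (v x : ℂ)) = fc a b fun x => (v x : ℂ) := by
    intro v
    rw [← fc_conj]
    simp only [Complex.conj_ofReal]
  have hm1 : 1 ≤ m := by omega
  obtain ⟨C, hC⟩ := exists_tsum_norm_le hab hM
  have cψ : ∀ t ∈ Icc 0 T, ContinuousOn (ψ t) (Icc a b) := fun t ht =>
    (hψ t ht).1.continuousOn hm1
  have cφ : ∀ t ∈ Icc 0 T, ContinuousOn (fun x => (φ t x : ℂ)) (Icc a b) := fun t ht =>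
    (hφ.1 t ht).1.continuousOn hm1
  have nψ : ∀ t ∈ Icc 0 T, ∀ x ∈ Icc a b, ‖ψ t x‖ ≤ C := fun t ht =>
    norm_le_of_hs_fc hab hC (cψ t ht) (((intFreq a b).hs_mono hm1 _).trans (bw t ht))
  have nφ : ∀ t ∈ Icc 0 T, ∀ x ∈ Icc a b, ‖(φ t x : ℂ)‖ ≤ C := fun t ht =>
    norm_le_of_hs_fc hab hC (cφ t ht) (((intFreq a b).hs_mono hm1 _).trans (bp t ht))
  have d2ψ := fun t (ht : t ∈ Icc 0 T) => fc_iteratedDerivWithin_two hab (ContinuousLinearMap.id ℝ ℂ)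
    (h.ψ_smooth t ht) (h.ψ_per t ht).1 (h.ψ_per t ht).2
  have d2φ := fun t (ht : t ∈ Icc 0 T) => fc_iteratedDerivWithin_two hab Complex.ofRealCLM
    (h.φ_smooth t ht) (h.φ_per t ht).1 (h.φ_per t ht).2
  simp only [ContinuousLinearMap.id_apply, Complex.ofRealCLM_apply] at d2ψ d2φ
  have c2ψ := fun t ht => (d2ψ t ht 0).1
  have c2φ := fun t ht => (d2φ t ht 0).1
  -- Through the equations this bounds the time derivatives uniformly in t and x, which provides the
  -- dominating constant below.
  have n2ψ : ∀ t ∈ Icc 0 T, ∀ x ∈ Icc a b, ‖iteratedDerivWithin 2 (ψ t) (Icc a b) x‖ ≤ C :=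
    fun t ht => norm_le_of_fc_eq_mul hab hC (c2ψ t ht) (fun l => (d2ψ t ht l).2)
      (((intFreq a b).hs_mono hm _).trans (bw t ht))
  have n2φ : ∀ t ∈ Icc 0 T, ∀ x ∈ Icc a b,
      ‖((iteratedDerivWithin 2 (φ t) (Icc a b) x : ℝ) : ℂ)‖ ≤ C :=
    fun t ht => norm_le_of_fc_eq_mul hab hC (c2φ t ht) (fun l => (d2φ t ht l).2)
      (((intFreq a b).hs_mono hm _).trans (bp t ht))
  have hI := Ioo_subset_Icc_self (a := (0 : ℝ)) (b := T)
  have hX := Ioo_subset_Icc_self (a := a) (b := b)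
  refine ⟨fun l => hψ.continuousOn_fc hab l, fun l => hφ.1.continuousOn_fc hab l,
    fun l => hφ.2.1.continuousOn_fc hab l, fun t ht l => ?_, fun t ht l => hφ.hasDerivAt_fc hab ht l,
    fun t ht l => ?_, fun t _ => hreal _, fun t _ => hreal _, bw, bp, bq⟩
  · have cf : ∀ t ∈ Icc 0 T, ContinuousOn (fun x => (φ t x : ℂ) * ψ t x) (Icc a b) := fun t ht =>
      (cφ t ht).mul (cψ t ht)
    -- The time derivative of ψ is known only pointwise, through the equation. Differentiation under
    -- the integral turns the pointwise equation into one for the coefficients; for φ itself the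
    -- assumed C¹ regularity with values in H^m does this.
    have key := hasDerivAt_fc (T := T) (u := ψ) (C := C + C * C) (u' := fun t x =>
      Complex.I * (iteratedDerivWithin 2 (ψ t) (Icc a b) x + (φ t x : ℂ) * ψ t x))
      (fun t ht => cψ t (hI ht)) (fun t ht => continuousOn_const.mul
        (((c2ψ t (hI ht)).add (cf t (hI ht))).mono hX)) (fun t ht x hx => ?_)
      (fun t ht x hx => ?_) ht l
    · refine key.congr_deriv ?_
      have ht' := hI ht
      rw [fc_const_mul, fc_add (integrableOn_of_continuousOn (c2ψ t ht')) (integrableOn_of_continuousOn (cf t ht')),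
        (hφ.1 t ht').1.fc_mul hab hm1 (integrableOn_of_continuousOn (cψ t ht')), Pi.smul_apply, Pi.add_apply,
        (d2ψ t ht' l).2, smul_eq_mul]
      simp only [intFreq, ← Complex.ofReal_pow, sq_abs]
      ring
    · have hx' := hX hx
      have ht' := hI ht
      rw [norm_mul, Complex.norm_I, one_mul]
      refine (norm_add_le _ _).trans (add_le_add (n2ψ t ht' x hx') ?_)
      rw [norm_mul]
      exact mul_le_mul (nφ t ht' x hx') (nψ t ht' x hx') (norm_nonneg _)
        ((norm_nonneg _).trans (nφ t ht' x hx'))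
    · obtain ⟨ψt, h1, h2⟩ := h.schrodinger t ht x hx
      refine h1.congr_deriv ?_
      linear_combination (-Complex.I) * h2 + ψt * Complex.I_mul_I
  · have cg : ∀ t ∈ Icc 0 T, ContinuousOn (fun x => ψ t x * conj (ψ t x)) (Icc a b) := fun t ht =>
      (cψ t ht).mul (Complex.continuous_conj.comp_continuousOn (cψ t ht))
    have hε' : (ε : ℂ) ≠ 0 := by exact_mod_cast hε.ne'
    have c3 : ∀ t ∈ Icc 0 T, ContinuousOn (fun x =>
        ((iteratedDerivWithin 2 (φ t) (Icc a b) x : ℝ) : ℂ) + -(1 / (ε : ℂ) ^ 2) * (φ t x : ℂ))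
        (Icc a b) := fun t ht => (c2φ t ht).add (continuousOn_const.mul (cφ t ht))
    have key := hasDerivAt_fc (T := T) (u := fun t x => (φt t x : ℂ))
      (C := ‖1 / (ε : ℂ) ^ 2‖ * (C + ‖-(1 / (ε : ℂ) ^ 2)‖ * C + C * C))
      (u' := fun t x => 1 / (ε : ℂ) ^ 2 *
        ((((iteratedDerivWithin 2 (φ t) (Icc a b) x : ℝ) : ℂ) + -(1 / (ε : ℂ) ^ 2) * (φ t x : ℂ)) +
          ψ t x * conj (ψ t x)))
      (fun t ht => (hφ.2.1 t (hI ht)).1.continuousOn hm1) (fun t ht => continuousOn_const.mul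
        (((c3 t (hI ht)).add (cg t (hI ht))).mono hX)) (fun t ht x hx => ?_)
      (fun t ht x hx => ?_) ht l
    · refine key.congr_deriv ?_
      have ht' := hI ht
      rw [fc_const_mul, fc_add (integrableOn_of_continuousOn (c3 t ht')) (integrableOn_of_continuousOn (cg t ht')),
        fc_add (integrableOn_of_continuousOn (c2φ t ht')) ((integrableOn_of_continuousOn (cφ t ht')).const_mul _), fc_const_mul,
        (hψ t ht').1.fc_mul_conj hab hm1, Pi.smul_apply, Pi.add_apply, Pi.add_apply, Pi.smul_apply,
        (d2φ t ht' l).2, smul_eq_mul, smul_eq_mul]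
      have e : ((intFreq a b).om ε l : ℂ) ^ 2 = 1 / (ε : ℂ) ^ 2 * ((μ a b l : ℂ) ^ 2 +
          1 / (ε : ℂ) ^ 2) := by
        rw [← Complex.ofReal_pow, Freq.sq_om _ hε]
        simp only [intFreq, sq_abs]
        push_cast
        field_simp
        ring
      rw [e]
      field_simp
      ring
    · have hx' := hX hx
      have ht' := hI ht
      rw [norm_mul]
      have h1 := n2φ t ht' x hx'
      have h2 := nφ t ht' x hx'
      have h3 := nψ t ht' x hx'
      have hC0 : 0 ≤ C := (norm_nonneg _).trans h3
      gcongr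
      refine (norm_add_le _ _).trans (add_le_add ((norm_add_le _ _).trans (add_le_add h1 ?_)) ?_)
      · rw [norm_mul]; gcongr
      · rw [norm_mul, Complex.norm_conj]; gcongr
    · obtain ⟨φtt, h1, h2⟩ := h.kleinGordon t ht x hx
      refine h1.ofReal_comp.congr_deriv ?_
      have h2' := congrArg (fun y : ℝ => (y : ℂ)) h2
      push_cast at h2'
      rw [Complex.mul_conj']
      field_simp
      field_simp at h2'
      linear_combination h2'

end Exact

/-! ### Frequencies on the grid, truncation and aliasing -/

section Grid

set_option linter.unusedSectionVars false

variable {a b : ℝ} {N : ℕ} [NeZero N]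

lemma abs_mu_eq (l : ℤ) : |μ a b l| = 2 * Real.pi / |b - a| * (l.natAbs : ℝ) := by
  rw [μ, abs_div, abs_mul, abs_of_pos (by positivity : (0 : ℝ) < 2 * Real.pi), Nat.cast_natAbs,
    Int.cast_abs]
  ring

lemma abs_mu_le_of_natAbs_le {k l : ℤ} (h : k.natAbs ≤ l.natAbs) : |μ a b k| ≤ |μ a b l| := by
  rw [abs_mu_eq, abs_mu_eq]
  have : (k.natAbs : ℝ) ≤ l.natAbs := by exact_mod_cast h
  have := Real.pi_pos
  gcongr

variable (a b N) in
/-- The frequencies on the grid with `N` points. -/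
def gridFreq : Freq (ZMod N) where
  μ k := |μ a b k.valMinAbs|
  nonneg _ := abs_nonneg _
  neg k := by rw [abs_mu_eq, abs_mu_eq, ZMod.natAbs_valMinAbs_neg]
  add_le k l := by
    have h : |μ a b (k + l).valMinAbs| ≤ |μ a b (k.valMinAbs + l.valMinAbs)| :=
      abs_mu_le_of_natAbs_le (ZMod.natAbs_valMinAbs_add_le k l)
    rw [mu_add] at h
    exact h.trans (abs_add_le _ _)

lemma gridFreq_rho (k : ZMod N) : (gridFreq a b N).ρ k = (intFreq a b).ρ k.valMinAbs := rfl

variable (N) in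
/-- Truncation to the modes `|l| < N/2`. -/
def trunc (c : ℤ → ℂ) (k : ZMod N) : ℂ :=
  if 2 * k.valMinAbs.natAbs < N then c k.valMinAbs else 0

variable (N) in
/-- The coefficients of the interpolant: the sum over all aliases of a mode. -/
def fold (c : ℤ → ℂ) (k : ZMod N) : ℂ := ∑' j : ℤ, c (k.valMinAbs + N * j)

lemma two_mul_natAbs_valMinAbs_le (k : ZMod N) : 2 * k.valMinAbs.natAbs ≤ N := by
  have := ZMod.natAbs_valMinAbs_le k
  omega

lemma hs_trunc_le (s : ℕ) (c : ℤ → ℂ) : (gridFreq a b N).hs s (trunc N c) ≤ (intFreq a b).hs s c := by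
  refine le_trans ?_ (ENNReal.tsum_comp_le_tsum_of_injective (ZMod.injective_valMinAbs (n := N))
    (fun l => (ENNReal.ofReal ((intFreq a b).ρ l ^ s) * ‖c l‖ₑ) ^ 2))
  refine ENNReal.tsum_le_tsum fun k => ?_
  rw [gridFreq_rho]
  unfold trunc
  split_ifs
  · exact le_rfl
  · simp

/-- The grid frequencies are a subset of the integer ones, so one embedding constant serves all N.
-/
lemma tsum_inv_gridRho_le : ∑' k, ENNReal.ofReal (((gridFreq a b N).ρ k)⁻¹) ^ 2 ≤
    ∑' l, ENNReal.ofReal (((intFreq a b).ρ l)⁻¹) ^ 2 :=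
  ENNReal.tsum_comp_le_tsum_of_injective (ZMod.injective_valMinAbs (n := N))
    (fun l => ENNReal.ofReal (((intFreq a b).ρ l)⁻¹) ^ 2)

lemma valMinAbs_neg_of_lt {k : ZMod N} (h : 2 * k.valMinAbs.natAbs < N) :
    (-k).valMinAbs = -k.valMinAbs := by
  refine ZMod.valMinAbs_neg_of_ne_half fun h' => ?_
  have := (ZMod.valMinAbs_mul_two_eq_iff k).mpr h'
  omega

/-- The strict cut-off drops the class of N/2, the only one where `ZMod.valMinAbs` fails to be odd.
Truncation therefore preserves reality. -/
lemma J_trunc (c : ℤ → ℂ) : J (trunc N c) = trunc N (J c) := by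
  ext k
  simp only [J, trunc, ZMod.natAbs_valMinAbs_neg]
  split_ifs with h
  · rw [valMinAbs_neg_of_lt h]
  · simp

lemma add_mul_injective : Function.Injective
    (fun x : ZMod N × ℤ => x.1.valMinAbs + (N : ℤ) * x.2) := by
  rintro ⟨k, j⟩ ⟨k', j'⟩ h
  have h1 : k = k' := by
    have := congrArg (fun z : ℤ => (z : ZMod N)) h
    simpa using this
  subst h1
  have hN : (N : ℤ) ≠ 0 := by exact_mod_cast NeZero.ne N
  simp only [add_right_inj, mul_eq_mul_left_iff, hN, or_false] at h
  rw [h]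

lemma natAbs_valMinAbs_le_add (k : ZMod N) (j : ℤ) :
    k.valMinAbs.natAbs ≤ (k.valMinAbs + N * j).natAbs :=
  ZMod.natAbs_min_of_le_div_two N _ _ (by simp) (ZMod.natAbs_valMinAbs_le k)

lemma le_two_mul_natAbs_add {k : ZMod N} {j : ℤ} (hj : j ≠ 0) :
    N ≤ 2 * (k.valMinAbs + N * j).natAbs := by
  have h1 := two_mul_natAbs_valMinAbs_le k
  have h2 : N ≤ N * j.natAbs := Nat.le_mul_of_pos_right _ (Int.natAbs_pos.mpr hj)
  have h3 : ((N : ℤ) * j).natAbs = N * j.natAbs := by rw [Int.natAbs_mul, Int.natAbs_natCast]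
  omega

lemma mesh_pos (hab : a < b) : 0 < mesh a b N :=
  div_pos (sub_pos.mpr hab) (by exact_mod_cast NeZero.pos N)

/-- High modes have frequencies at least `1/h`. -/
lemma inv_mesh_le_rho (hab : a < b) {l : ℤ} (h : N ≤ 2 * l.natAbs) :
    (mesh a b N)⁻¹ ≤ (intFreq a b).ρ l := by
  refine le_trans ?_ ((intFreq a b).mu_le l)
  have hL := sub_pos.mpr hab
  simp only [intFreq, abs_mu_eq, mesh, inv_div, abs_of_pos hL]
  rw [div_mul_eq_mul_div]
  gcongr
  have h' : (N : ℝ) ≤ 2 * l.natAbs := by exact_mod_cast h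
  nlinarith [Real.pi_gt_three, (Nat.cast_nonneg l.natAbs : (0 : ℝ) ≤ l.natAbs)]

/-- The alias k + Nj is at least N(|j|+1)/4 in modulus; for j = 0 this is the hypothesis, for other
j it follows from |k| ≤ N/2. The decay in j is square summable. -/
lemma inv_rho_alias_le (hab : a < b) {k : ZMod N} {j : ℤ}
    (h : N ≤ 2 * (k.valMinAbs + N * j).natAbs) :
    ((intFreq a b).ρ (k.valMinAbs + N * j))⁻¹ ≤ mesh a b N * (1 / ((j.natAbs : ℝ) + 1)) := by
  have hL := sub_pos.mpr hab
  have hm := mesh_pos (N := N) hab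
  have h1 := two_mul_natAbs_valMinAbs_le k
  have h3 : ((N : ℤ) * j).natAbs = N * j.natAbs := by rw [Int.natAbs_mul, Int.natAbs_natCast]
  have h4 : N * (j.natAbs + 1) ≤ 4 * (k.valMinAbs + N * j).natAbs := by
    rcases Nat.eq_zero_or_pos j.natAbs with h0 | h0
    · rw [h0]; omega
    · have : N ≤ N * j.natAbs := Nat.le_mul_of_pos_right _ h0
      rw [mul_add, mul_one]
      omega
  have h5 : (N : ℝ) * (j.natAbs + 1) ≤ 4 * ((k.valMinAbs + N * j).natAbs : ℝ) := by
    exact_mod_cast h4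
  have h6 : (mesh a b N * (1 / ((j.natAbs : ℝ) + 1)))⁻¹ ≤ (intFreq a b).ρ (k.valMinAbs + N * j) := by
    refine le_trans ?_ ((intFreq a b).mu_le _)
    simp only [intFreq, abs_mu_eq, mesh, abs_of_pos hL]
    rw [one_div, mul_inv, inv_inv, inv_div, div_mul_eq_mul_div, div_mul_eq_mul_div]
    refine div_le_div_of_nonneg_right ?_ hL.le
    nlinarith [Real.pi_gt_three, (Nat.cast_nonneg (k.valMinAbs + N * j).natAbs : (0 : ℝ) ≤ _)]
  rw [← inv_inv (mesh a b N * (1 / ((j.natAbs : ℝ) + 1)))]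
  exact inv_anti₀ (by positivity) h6

/-- The constant in the aliasing estimate. -/
def foldConst : ℝ≥0∞ := ∑' j : ℤ, ENNReal.ofReal (1 / ((j.natAbs : ℝ) + 1)) ^ 2

lemma foldConst_lt_top : foldConst < ⊤ := by
  have hs : Summable fun j : ℤ => ((if j = 0 then 1 else 0) + 1 / (j : ℝ) ^ 2 : ℝ) := by
    refine Summable.add ?_ (Real.summable_one_div_int_pow.mpr one_lt_two)
    exact summable_of_ne_finset_zero (s := {0}) fun l hl => by simp_all
  have h1 : ∀ j : ℤ, ENNReal.ofReal (1 / ((j.natAbs : ℝ) + 1)) ^ 2 ≤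
      ENNReal.ofReal ((if j = 0 then 1 else 0) + 1 / (j : ℝ) ^ 2) := by
    intro j
    rw [← ENNReal.ofReal_pow (by positivity)]
    refine ENNReal.ofReal_le_ofReal ?_
    split_ifs with h
    · simp [h]
    · have h0 : (0 : ℝ) < (j.natAbs : ℝ) := by exact_mod_cast Int.natAbs_pos.mpr h
      have e : (j : ℝ) ^ 2 = (j.natAbs : ℝ) ^ 2 := by
        rw [Nat.cast_natAbs, Int.cast_abs, sq_abs]
      rw [zero_add, e, div_pow, one_pow]
      gcongr
      linarith
  refine (ENNReal.tsum_le_tsum h1).trans_lt ?_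
  rw [← ENNReal.ofReal_tsum_of_nonneg (fun l => by positivity) hs]
  exact ENNReal.ofReal_lt_top

/-- A single condition covers both sources of error: all true aliases, and the term j = 0 exactly
when the truncation has dropped the mode. -/
lemma fold_sub_trunc {c : ℤ → ℂ} (hc : Summable c) (k : ZMod N) : fold N c k - trunc N c k =
    ∑' j : ℤ, if N ≤ 2 * (k.valMinAbs + N * j).natAbs then c (k.valMinAbs + N * j) else 0 := by
  have hinj : Function.Injective (fun j : ℤ => k.valMinAbs + (N : ℤ) * j) := fun j j' h => by
    have := add_mul_injective (N := N) (a₁ := (k, j)) (a₂ := (k, j')) h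
    exact (Prod.mk.inj this).2
  have hs : Summable fun j : ℤ => c (k.valMinAbs + N * j) := hc.comp_injective hinj
  have hz : trunc N c k = ∑' j : ℤ, if j = 0 then trunc N c k else 0 := by rw [tsum_ite_eq]
  rw [hz, fold, ← hs.tsum_sub (summable_of_ne_finset_zero (s := {0}) fun l hl => by simp_all)]
  refine tsum_congr fun j => ?_
  by_cases hj : j = 0
  · subst hj
    simp only [if_true, mul_zero, add_zero, trunc]
    by_cases h : 2 * k.valMinAbs.natAbs < N
    · rw [if_pos h, if_neg (by omega), sub_self]
    · rw [if_neg h, if_pos (by omega), sub_zero]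
  · rw [if_neg hj, if_pos (le_two_mul_natAbs_add hj), sub_zero]

/-- The aliasing error. -/
lemma hs_fold_sub_trunc_le (hab : a < b) {s m : ℕ} (hsm : s < m) {c : ℤ → ℂ} (hc : Summable c) :
    (gridFreq a b N).hs s (fold N c - trunc N c) ≤
      ENNReal.ofReal (mesh a b N ^ (m - s)) ^ 2 * foldConst * (intFreq a b).hs m c := by
  have hm := mesh_pos (N := N) hab
  set F := intFreq a b
  have hpt : ∀ k : ZMod N, (ENNReal.ofReal ((gridFreq a b N).ρ k ^ s) *
      ‖(fold N c - trunc N c) k‖ₑ) ^ 2 ≤ ENNReal.ofReal (mesh a b N ^ (m - s)) ^ 2 * foldConst *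
        ∑' j : ℤ, (ENNReal.ofReal (F.ρ (k.valMinAbs + N * j) ^ m) *
          ‖c (k.valMinAbs + N * j)‖ₑ) ^ 2 := by
    intro k
    have h1 : ENNReal.ofReal ((gridFreq a b N).ρ k ^ s) * ‖(fold N c - trunc N c) k‖ₑ ≤
        ∑' j : ℤ, ENNReal.ofReal (mesh a b N ^ (m - s)) * ENNReal.ofReal (1 / ((j.natAbs : ℝ) + 1)) *
          (ENNReal.ofReal (F.ρ (k.valMinAbs + N * j) ^ m) * ‖c (k.valMinAbs + N * j)‖ₑ) := by
      rw [Pi.sub_apply, fold_sub_trunc hc]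
      refine (mul_le_mul_right enorm_tsum_le_tsum_enorm _).trans ?_
      rw [← ENNReal.tsum_mul_left]
      refine ENNReal.tsum_le_tsum fun j => ?_
      split_ifs with h
      · rw [← mul_assoc]
        gcongr
        have hρ := F.rho_pos (k.valMinAbs + N * j)
        rw [← ENNReal.ofReal_mul (by positivity), ← ENNReal.ofReal_mul (by positivity)]
        refine ENNReal.ofReal_le_ofReal ?_
        have h2 := inv_rho_alias_le hab h
        have h3 : (gridFreq a b N).ρ k ≤ F.ρ (k.valMinAbs + N * j) :=
          Real.sqrt_le_sqrt (by
            have := abs_mu_le_of_natAbs_le (a := a) (b := b) (natAbs_valMinAbs_le_add k j)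
            have h0 : 0 ≤ (gridFreq a b N).μ k := (gridFreq a b N).nonneg k
            have : (gridFreq a b N).μ k ≤ F.μ (k.valMinAbs + N * j) := this
            gcongr)
        -- One power of the decay suffices for the Cauchy–Schwarz inequality in j. At least one is
        -- available because s < m.
        have h4 : (1 / ((j.natAbs : ℝ) + 1)) ^ (m - s) ≤ 1 / ((j.natAbs : ℝ) + 1) := by
          refine pow_le_of_le_one (by positivity) ?_ (by omega)
          rw [div_le_one (by positivity)]
          linarith [(Nat.cast_nonneg j.natAbs : (0 : ℝ) ≤ _)]
        calc (gridFreq a b N).ρ k ^ s ≤ F.ρ (k.valMinAbs + N * j) ^ s := by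
              gcongr; exact ((gridFreq a b N).rho_pos k).le
          _ = (F.ρ (k.valMinAbs + N * j))⁻¹ ^ (m - s) * F.ρ (k.valMinAbs + N * j) ^ m := by
              rw [inv_pow, eq_inv_mul_iff_mul_eq₀ (by positivity), ← pow_add]
              congr 1; omega
          _ ≤ (mesh a b N * (1 / ((j.natAbs : ℝ) + 1))) ^ (m - s) *
              F.ρ (k.valMinAbs + N * j) ^ m := by gcongr
          _ ≤ _ := by rw [mul_pow]; gcongr
      · simp
    refine (pow_le_pow_left' h1 2).trans ?_
    simp only [mul_assoc (ENNReal.ofReal (mesh a b N ^ (m - s)))]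
    rw [ENNReal.tsum_mul_left, mul_pow, mul_assoc]
    gcongr
    exact ENNReal.sq_tsum_mul_le _ _
  calc _ ≤ ∑' k : ZMod N, ENNReal.ofReal (mesh a b N ^ (m - s)) ^ 2 * foldConst *
        ∑' j : ℤ, (ENNReal.ofReal (F.ρ (k.valMinAbs + N * j) ^ m) *
          ‖c (k.valMinAbs + N * j)‖ₑ) ^ 2 := ENNReal.tsum_le_tsum hpt
    _ = ENNReal.ofReal (mesh a b N ^ (m - s)) ^ 2 * foldConst * ∑' x : ZMod N × ℤ,
        (ENNReal.ofReal (F.ρ (x.1.valMinAbs + N * x.2) ^ m) *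
          ‖c (x.1.valMinAbs + N * x.2)‖ₑ) ^ 2 := by
      rw [ENNReal.tsum_mul_left, ENNReal.tsum_prod (f := fun (k : ZMod N) (j : ℤ) =>
        (ENNReal.ofReal (F.ρ (k.valMinAbs + N * j) ^ m) * ‖c (k.valMinAbs + N * j)‖ₑ) ^ 2)]
    _ ≤ _ := by
      gcongr
      -- An integer is an alias of one class only, so the double sum does not count any mode twice.
      exact ENNReal.tsum_comp_le_tsum_of_injective add_mul_injective
        (fun l => (ENNReal.ofReal (F.ρ l ^ m) * ‖c l‖ₑ) ^ 2)

/-- The error of truncation. -/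
lemma tsum_high_le (hab : a < b) {s m : ℕ} (hsm : s ≤ m) (c : ℤ → ℂ) :
    ∑' l : ℤ, (if N ≤ 2 * l.natAbs then (ENNReal.ofReal ((intFreq a b).ρ l ^ s) * ‖c l‖ₑ) ^ 2
      else 0) ≤ ENNReal.ofReal (mesh a b N ^ (m - s)) ^ 2 * (intFreq a b).hs m c := by
  have hm := mesh_pos (N := N) hab
  rw [Freq.hs, ← ENNReal.tsum_mul_left]
  refine ENNReal.tsum_le_tsum fun l => ?_
  split_ifs with h
  · rw [← mul_pow, ← mul_assoc]
    gcongr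
    have hρ := (intFreq a b).rho_pos l
    rw [← ENNReal.ofReal_mul (by positivity)]
    refine ENNReal.ofReal_le_ofReal ?_
    have h1 := inv_mesh_le_rho hab h
    have h2 : 1 ≤ mesh a b N * (intFreq a b).ρ l := by
      rw [inv_le_iff_one_le_mul₀ hm] at h1
      linarith
    calc (intFreq a b).ρ l ^ s ≤ (mesh a b N * (intFreq a b).ρ l) ^ (m - s) *
          (intFreq a b).ρ l ^ s := le_mul_of_one_le_left (by positivity) (one_le_pow₀ h2)
      _ = mesh a b N ^ (m - s) * (intFreq a b).ρ l ^ (m - s + s) := by ring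
      _ = _ := by rw [Nat.sub_add_cancel hsm]
  · exact zero_le

end Grid

/-! ### The discrete Fourier transform -/

section Transform

set_option linter.unusedSectionVars false

variable {a b : ℝ} {N : ℕ} [NeZero N]

/-- The normalised discrete Fourier transform. -/
def gridDft (U : ZMod N → ℂ) (k : ZMod N) : ℂ :=
  (1 / N : ℂ) * ∑ j, U j * ZMod.stdAddChar (-(k * j))

/-- Restriction of a grid vector to the first `N` points. -/
def restr (v : Fin (N + 1) → ℂ) (j : ZMod N) : ℂ := v (Fin.castSucc ⟨j.val, j.val_lt⟩)

/-- The discrete Fourier coefficients of a grid vector, as a function on `ZMod N`. -/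
def gridCoeff (v : Fin (N + 1) → ℂ) : ZMod N → ℂ := gridDft (restr v)

lemma sum_stdAddChar (k l : ZMod N) :
    ∑ j, ZMod.stdAddChar (k * j) * ZMod.stdAddChar (-(l * j)) = if k = l then (N : ℂ) else 0 := by
  have h := AddChar.sum_mulShift (R := ZMod N) (R' := ℂ) (k - l) (ZMod.isPrimitive_stdAddChar N)
  simp only [ZMod.card, sub_eq_zero] at h
  push_cast at h
  rw [← h]
  refine Finset.sum_congr rfl fun j _ => ?_
  rw [← AddChar.map_add_eq_mul]
  congr 1
  ring

lemma gridDft_sum (C : ZMod N → ℂ) :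
    gridDft (fun j => ∑ k, C k * ZMod.stdAddChar (k * j)) = C := by
  have hN : (N : ℂ) ≠ 0 := by exact_mod_cast NeZero.ne N
  ext l
  simp only [gridDft, Finset.sum_mul]
  rw [Finset.sum_comm]
  simp only [mul_assoc, ← Finset.mul_sum, sum_stdAddChar, mul_ite, mul_zero]
  rw [Finset.sum_ite_eq' Finset.univ l]
  simp [field]

lemma sum_gridDft (U : ZMod N → ℂ) (j : ZMod N) :
    ∑ k, gridDft U k * ZMod.stdAddChar (k * j) = U j := by
  have hN : (N : ℂ) ≠ 0 := by exact_mod_cast NeZero.ne N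
  simp only [gridDft, mul_assoc, Finset.sum_mul, ← Finset.mul_sum]
  rw [Finset.sum_comm]
  have : ∀ i : ZMod N, ∑ k, U i * (ZMod.stdAddChar (-(k * i)) * ZMod.stdAddChar (k * j)) =
      U i * if j = i then (N : ℂ) else 0 := by
    intro i
    rw [← Finset.mul_sum, ← sum_stdAddChar]
    simp only [mul_comm]
  simp only [this, mul_ite, mul_zero]
  rw [Finset.sum_ite_eq Finset.univ j]
  simp [field]

lemma gridDft_injective {U V : ZMod N → ℂ} (h : gridDft U = gridDft V) : U = V := by
  ext j
  rw [← sum_gridDft U j, h, sum_gridDft]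

/-- On the grid there is no remainder: aliasing is built into the group law of `ZMod N`. -/
lemma gridDft_mul (U V : ZMod N → ℂ) : gridDft (U * V) = conv (gridDft U) (gridDft V) := by
  ext l
  rw [conv_apply, gridDft]
  have : ∀ j, (U * V) j = ∑ k, gridDft U k * ZMod.stdAddChar (k * j) * V j := fun j => by
    rw [← Finset.sum_mul, sum_gridDft, Pi.mul_apply]
  simp only [this, Finset.sum_mul]
  rw [Finset.sum_comm, Finset.mul_sum]
  refine Finset.sum_congr rfl fun k _ => ?_
  have hV : gridDft V (l - k) = (1 / N : ℂ) * ∑ j, V j * ZMod.stdAddChar (-((l - k) * j)) := rfl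
  rw [hV, mul_left_comm]
  congr 1
  rw [Finset.mul_sum]
  refine Finset.sum_congr rfl fun j _ => ?_
  have e : -((l - k) * j) = k * j + -(l * j) := by ring
  rw [e, AddChar.map_add_eq_mul]
  ring

lemma conj_stdAddChar (x : ZMod N) :
    conj (ZMod.stdAddChar x : ℂ) = ZMod.stdAddChar (-x) := by
  rw [AddChar.map_neg_eq_conj]

lemma gridDft_conj (U : ZMod N → ℂ) : gridDft (fun j => conj (U j)) = J (gridDft U) := by
  ext k
  simp only [gridDft, J, map_mul, map_div₀, map_one, map_sum, conj_stdAddChar, Complex.conj_natCast,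
    neg_neg, neg_mul]

lemma gridDft_add (U V : ZMod N → ℂ) : gridDft (U + V) = gridDft U + gridDft V := by
  ext k; simp [gridDft, add_mul, Finset.sum_add_distrib, mul_add]

lemma gridDft_smul (c : ℂ) (U : ZMod N → ℂ) : gridDft (c • U) = c • gridDft U := by
  ext k
  simp only [gridDft, Pi.smul_apply, smul_eq_mul, mul_assoc, ← Finset.mul_sum]
  ring

lemma gridCoeff_mul (v w : Fin (N + 1) → ℂ) :
    gridCoeff (fun j => v j * w j) = conv (gridCoeff v) (gridCoeff w) :=
  gridDft_mul (restr v) (restr w)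

lemma gridCoeff_conj (v : Fin (N + 1) → ℂ) :
    gridCoeff (fun j => conj (v j)) = J (gridCoeff v) := gridDft_conj (restr v)

lemma gridCoeff_add (v w : Fin (N + 1) → ℂ) :
    gridCoeff (fun j => v j + w j) = gridCoeff v + gridCoeff w := gridDft_add (restr v) (restr w)

lemma gridCoeff_const_mul (c : ℂ) (v : Fin (N + 1) → ℂ) :
    gridCoeff (fun j => c * v j) = c • gridCoeff v := gridDft_smul c (restr v)

lemma wave_gridPt (hab : a < b) (l : ℤ) (j : ℕ) :
    wave a b l (a + j * mesh a b N) = ZMod.stdAddChar ((l : ZMod N) * (j : ZMod N)) := by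
  have hN : (N : ℂ) ≠ 0 := by exact_mod_cast NeZero.ne N
  have hL : (b - a : ℂ) ≠ 0 := by exact_mod_cast (sub_pos.mpr hab).ne'
  have e : ((l : ZMod N) * (j : ZMod N)) = ((l * j : ℤ) : ZMod N) := by push_cast; rfl
  rw [e, ZMod.stdAddChar_coe, wave]
  congr 1
  simp only [μ, mesh]
  push_cast
  field_simp
  ring

lemma dft_eq (hab : a < b) (v : Fin (N + 1) → ℂ) (l : ℤ) :
    dft a b N v l = gridCoeff v (l : ZMod N) := by
  rw [dft, gridCoeff, gridDft]
  congr 1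
  refine Finset.sum_bij' (fun j _ => ((j : ℕ) : ZMod N)) (fun j _ => ⟨j.val, j.val_lt⟩)
    (by simp) (by simp) (fun j _ => ?_) (fun j _ => ?_) (fun j _ => ?_)
  · ext; simp [ZMod.val_natCast, Nat.mod_eq_of_lt j.2]
  · simp
  · have e1 : restr v ((j : ℕ) : ZMod N) = v j.castSucc := by
      rw [restr]
      congr 2
      ext; simp [ZMod.val_natCast, Nat.mod_eq_of_lt j.2]
    have e2 : -((l : ZMod N) * ((j : ℕ) : ZMod N)) = ((-l : ℤ) : ZMod N) * ((j : ℕ) : ZMod N) := by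
      push_cast; ring
    rw [e1, e2, ← wave_gridPt hab]
    congr 1
    simp only [wave, gridPt, mu_neg, Fin.val_castSucc]
    congr 1
    push_cast
    ring

lemma injOn_modes (hN : Even N) : Set.InjOn (fun l : ℤ => (l : ZMod N)) (modes N) := by
  intro l hl l' hl' h
  simp only [modes, Finset.coe_Ico, mem_Ico] at hl hl'
  rw [ZMod.intCast_eq_intCast_iff, Int.modEq_iff_dvd] at h
  have hN0 := NeZero.pos N
  obtain ⟨r, hr⟩ := hN
  have h1 : |l' - l| < (N : ℤ) := by rw [abs_lt]; constructor <;> omega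
  have := Int.eq_zero_of_abs_lt_dvd h h1
  omega

/-- For even N the modes from -N/2 to N/2 - 1 form a complete system of residues. -/
lemma sum_modes {A : Type*} [AddCommMonoid A] (hN : Even N) (f : ZMod N → A) :
    ∑ l ∈ modes N, f (l : ZMod N) = ∑ k, f k := by
  have himg : (modes N).image (fun l : ℤ => (l : ZMod N)) = Finset.univ := by
    rw [← Finset.card_eq_iff_eq_univ, Finset.card_image_of_injOn (injOn_modes hN), ZMod.card]
    obtain ⟨r, hr⟩ := hN
    simp only [modes, Int.card_Ico]
    omega
  rw [← himg, Finset.sum_image (injOn_modes hN)]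

lemma trigPoly_eq (c : ℤ → ℂ) (x : ℝ) : trigPoly a b N c x = ∑ l ∈ modes N, c l * wave a b l x := rfl

lemma restr_ofCoeff (hab : a < b) (hN : Even N) {c : ℤ → ℂ} {C : ZMod N → ℂ}
    (h : ∀ l ∈ modes N, c l = C l) (j : ZMod N) :
    restr (ofCoeff a b N c) j = ∑ k, C k * ZMod.stdAddChar (k * j) := by
  rw [restr, ofCoeff, trigPoly_eq, ← sum_modes hN]
  refine Finset.sum_congr rfl fun l hl => ?_
  rw [h l hl, gridPt, Fin.val_castSucc, wave_gridPt hab]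
  simp

lemma gridCoeff_ofCoeff (hab : a < b) (hN : Even N) {c : ℤ → ℂ} {C : ZMod N → ℂ}
    (h : ∀ l ∈ modes N, c l = C l) : gridCoeff (ofCoeff a b N c) = C := by
  rw [gridCoeff, ← gridDft_sum C]
  congr 1
  ext j
  exact restr_ofCoeff hab hN h j

lemma ofCoeff_last (hab : a < b) (c : ℤ → ℂ) :
    ofCoeff a b N c (Fin.last N) = ofCoeff a b N c 0 := by
  have hN : (N : ℝ) ≠ 0 := by exact_mod_cast NeZero.ne N
  have e1 : gridPt a b N (Fin.last N) = b := by
    simp only [gridPt, mesh, Fin.val_last]; field_simp; ring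
  have e2 : gridPt a b N 0 = a := by simp [gridPt]
  simp only [ofCoeff, trigPoly_eq, e1, e2, wave_left, wave_right hab]

/-- Grid vectors have N + 1 entries, of which the transform sees the first N; the last point is
treated apart. -/
lemma eq_of_restr {v : Fin (N + 1) → ℂ} {P : ℂ → Prop} (h : ∀ j, P (restr v j))
    (h' : P (v (Fin.last N))) (j : Fin (N + 1)) : P (v j) := by
  induction j using Fin.lastCases with
  | last => exact h'
  | cast i =>
    have := h ((i : ℕ) : ZMod N)
    rw [restr] at this
    convert this
    simp [ZMod.val_natCast, Nat.mod_eq_of_lt i.2]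

lemma restr_conj_eq_of_J {v : Fin (N + 1) → ℂ} (h : J (gridCoeff v) = gridCoeff v) (j : ZMod N) :
    conj (restr v j) = restr v j := by
  have : gridDft (fun j => conj (restr v j)) = gridDft (restr v) := by
    rw [gridDft_conj]; exact h
  exact congrFun (gridDft_injective this) j

/-- A grid vector with symmetric coefficients is real. -/
lemma conj_ofCoeff (hab : a < b) {c : ℤ → ℂ}
    (h : J (gridCoeff (ofCoeff a b N c)) = gridCoeff (ofCoeff a b N c)) (j : Fin (N + 1)) :
    conj (ofCoeff a b N c j) = ofCoeff a b N c j := by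
  have h1 := restr_conj_eq_of_J h
  refine eq_of_restr (P := fun z => conj z = z) h1 ?_ j
  rw [ofCoeff_last hab]
  have := h1 0
  simpa [restr] using this

lemma interpN_eq (hab : a < b) (v : Fin (N + 1) → ℂ) (x : ℝ) :
    interpN a b N v x = ∑ l ∈ modes N, gridCoeff v (l : ZMod N) * wave a b l x := by
  rw [interpN, trigPoly_eq]
  simp only [dft_eq hab]

lemma memHper_interpN (hab : a < b) (m : ℕ) (v : Fin (N + 1) → ℂ) :
    MemHper a b m (interpN a b N v) := by
  have : interpN a b N v = fun x => ∑ l ∈ modes N, gridCoeff v (l : ZMod N) * wave a b l x := by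
    ext x; exact interpN_eq hab v x
  rw [this]
  exact memHper_finsum_wave hab _ _

lemma fc_interpN (hab : a < b) (v : Fin (N + 1) → ℂ) (l : ℤ) :
    fc a b (interpN a b N v) l = if l ∈ modes N then gridCoeff v (l : ZMod N) else 0 := by
  have e : interpN a b N v =
      series a b (fun l => if l ∈ modes N then gridCoeff v (l : ZMod N) else 0) := by
    ext x
    rw [interpN_eq hab, series, tsum_eq_sum (s := modes N) fun l hl => by rw [if_neg hl, zero_mul]]
    exact Finset.sum_congr rfl fun l hl => by rw [if_pos hl]
  rw [e, fc_series hab (summable_of_ne_finset_zero (s := modes N) fun l hl => by simp [hl])]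

/-- The coefficients of the samples of an absolutely convergent series. -/
lemma gridCoeff_samples (hab : a < b) {c : ℤ → ℂ} (hc : Summable fun l => ‖c l‖) {u : ℝ → ℂ}
    (hu : ∀ x ∈ Icc a b, u x = series a b c x) :
    gridCoeff (fun j => u (gridPt a b N j)) = fold N c := by
  have hN : (N : ℂ) ≠ 0 := by exact_mod_cast NeZero.ne N
  have hN' : (N : ℝ) ≠ 0 := by exact_mod_cast NeZero.ne N
  have hm := mesh_pos (N := N) hab
  have hc' : ∀ k : ZMod N, Summable fun j : ℤ => c (k.valMinAbs + N * j) := fun k =>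
    Summable.comp_injective (f := c) hc.of_norm fun j j' h =>
      (Prod.mk.inj (add_mul_injective (N := N) (a₁ := (k, j)) (a₂ := (k, j')) h)).2
  have h1 : restr (fun j => u (gridPt a b N j)) =
      fun j : ZMod N => ∑ k, fold N c k * ZMod.stdAddChar (k * j) := by
    ext j
    have hx : a + (j.val : ℝ) * mesh a b N ∈ Icc a b := by
      have h1 : (j.val : ℝ) * mesh a b N ≤ N * mesh a b N := by
        have : (j.val : ℝ) ≤ N := by exact_mod_cast j.val_lt.le
        gcongr
      have h2 : N * mesh a b N = b - a := by rw [mesh]; field_simp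
      have h3 : 0 ≤ (j.val : ℝ) * mesh a b N := by positivity
      constructor <;> linarith
    simp only [restr, gridPt, Fin.val_castSucc]
    rw [hu _ hx, series]
    simp only [wave_gridPt hab]
    have hsum : Summable fun l : ℤ => c l * (ZMod.stdAddChar ((l : ZMod N) * (j.val : ZMod N)) : ℂ) := by
      refine .of_norm ?_
      simpa using hc
    -- Every integer is an alias of exactly one class, so the series at a grid point can be summed
    -- class by class, and all aliases of a class share the same character value.
    have hsurj : Function.Surjective (fun x : ZMod N × ℤ => x.1.valMinAbs + (N : ℤ) * x.2) := by
      intro l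
      have hd : (N : ℤ) ∣ l - ((l : ZMod N)).valMinAbs := by
        rw [← Int.modEq_iff_dvd, ← ZMod.intCast_eq_intCast_iff]
        simp
      obtain ⟨i, hi⟩ := hd
      exact ⟨((l : ZMod N), i), by simp only [← hi]; ring⟩
    set e := Equiv.ofBijective _ ⟨add_mul_injective (N := N), hsurj⟩ with he
    have hval : ∀ x, e x = x.1.valMinAbs + (N : ℤ) * x.2 := fun x => rfl
    have hsum' := hsum.comp_injective e.injective
    rw [← e.tsum_eq, Summable.tsum_prod (f := fun x => c (e x) *
      (ZMod.stdAddChar (((e x : ℤ) : ZMod N) * (j.val : ZMod N)) : ℂ)) hsum', tsum_fintype]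
    refine Finset.sum_congr rfl fun k _ => ?_
    rw [fold, ← tsum_mul_right]
    refine tsum_congr fun i => ?_
    simp [hval]
  rw [gridCoeff, h1, gridDft_sum]

end Transform

/-! ### The scheme on the discrete Fourier coefficients -/

section Scheme

set_option linter.unusedSectionVars false

variable {a b ε τ : ℝ} {N : ℕ} [NeZero N]

/-- The mode -N/2 is represented by +N/2, so only absolute values agree. This is enough, because the
multipliers of the scheme depend on μ² alone. -/
lemma natAbs_modes {l : ℤ} (hl : l ∈ modes N) : (l : ZMod N).valMinAbs.natAbs = l.natAbs := by
  simp only [modes, Finset.mem_Ico] at hl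
  have h1 : l.natAbs ≤ (l : ZMod N).valMinAbs.natAbs :=
    ZMod.natAbs_min_of_le_div_two N _ _ (by simp) (by omega)
  have h2 : (l : ZMod N).valMinAbs.natAbs ≤ l.natAbs :=
    ZMod.natAbs_min_of_le_div_two N _ _ (by simp) (ZMod.natAbs_valMinAbs_le _)
  exact le_antisymm h2 h1

lemma abs_mu_modes {l : ℤ} (hl : l ∈ modes N) : |μ a b l| = (gridFreq a b N).μ (l : ZMod N) :=
  le_antisymm (abs_mu_le_of_natAbs_le (natAbs_modes hl).ge)
    (abs_mu_le_of_natAbs_le (natAbs_modes hl).le)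

lemma sq_mu_modes {l : ℤ} (hl : l ∈ modes N) :
    μ a b l ^ 2 = (gridFreq a b N).μ (l : ZMod N) ^ 2 := by
  rw [← sq_abs, abs_mu_modes hl]

lemma freq_modes {l : ℤ} (hl : l ∈ modes N) :
    freq a b ε l = (gridFreq a b N).om ε (l : ZMod N) := by
  rw [freq, Freq.om, sq_mu_modes hl]

lemma lamP_eq {l : ℤ} : lamP a b ε l = -(1 / ε ^ 2) - freq a b ε l := by rw [lamP, freq]; ring

lemma lamM_eq {l : ℤ} : lamM a b ε l = -(1 / ε ^ 2) + freq a b ε l := by rw [lamM, freq]; ring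

lemma exp_lamP (l : ℤ) (s : ℝ) : Complex.exp (Complex.I * s * lamP a b ε l) =
    osc (-(1 / ε ^ 2) * s) * osc (-(freq a b ε l * s)) := by
  rw [← osc_add, osc, lamP_eq]; congr 1; push_cast; ring

lemma exp_lamM (l : ℤ) (s : ℝ) : Complex.exp (Complex.I * s * lamM a b ε l) =
    osc (-(1 / ε ^ 2) * s) * osc (freq a b ε l * s) := by
  rw [← osc_add, osc, lamM_eq]; congr 1; push_cast; ring

/-- Since λ± = -ε⁻² ∓ ω, the common phase e^(-is/ε²) factors out and a combination of cosine and
sine remains. -/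
lemma coefA_modes (hε : 0 < ε) {l : ℤ} (hl : l ∈ modes N) (s : ℝ) :
    coefA a b ε l s = (gridFreq a b N).amp ε s (l : ZMod N) := by
  have hω : ((gridFreq a b N).om ε (l : ZMod N) : ℂ) ≠ 0 := by
    exact_mod_cast ((gridFreq a b N).om_pos hε _).ne'
  have hε' : (ε : ℂ) ≠ 0 := by exact_mod_cast hε.ne'
  rw [coefA, exp_lamP, exp_lamM, lamP_eq, lamM_eq, freq_modes hl, Freq.amp,
    osc_neg_eq ((gridFreq a b N).om ε (l : ZMod N) * s),
    osc_eq ((gridFreq a b N).om ε (l : ZMod N) * s)]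
  push_cast
  rw [div_eq_iff (by
    have : (-(1 / (ε : ℂ) ^ 2) - (gridFreq a b N).om ε (l : ZMod N) -
      (-(1 / (ε : ℂ) ^ 2) + (gridFreq a b N).om ε (l : ZMod N))) =
      -2 * ((gridFreq a b N).om ε (l : ZMod N) : ℂ) := by ring
    rw [this]; exact mul_ne_zero (by norm_num) hω)]
  field_simp
  ring

/-- The multiplier of the free Klein–Gordon flow for the time derivative. -/
lemma osc_mul_coefA'_modes (hε : 0 < ε) {l : ℤ} (hl : l ∈ modes N) (s : ℝ) :
    osc (1 / ε ^ 2 * s) * (coefA' a b ε l s + Complex.I / (ε : ℂ) ^ 2 * coefA a b ε l s) =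
      -(((gridFreq a b N).om ε (l : ZMod N) *
        Real.sin ((gridFreq a b N).om ε (l : ZMod N) * s) : ℝ) : ℂ) +
      Complex.I * ((1 / ε ^ 2 * Real.cos ((gridFreq a b N).om ε (l : ZMod N) * s) : ℝ) : ℂ) := by
  have hω : ((gridFreq a b N).om ε (l : ZMod N) : ℂ) ≠ 0 := by
    exact_mod_cast ((gridFreq a b N).om_pos hε _).ne'
  have hε' : (ε : ℂ) ≠ 0 := by exact_mod_cast hε.ne'
  have h1 := osc_mul_osc_neg (1 / ε ^ 2 * s)
  rw [← neg_mul] at h1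
  have h2 : coefA' a b ε l s + Complex.I / (ε : ℂ) ^ 2 * coefA a b ε l s =
      osc (-(1 / ε ^ 2) * s) * (-(((gridFreq a b N).om ε (l : ZMod N) *
        Real.sin ((gridFreq a b N).om ε (l : ZMod N) * s) : ℝ) : ℂ) +
      Complex.I * ((1 / ε ^ 2 * Real.cos ((gridFreq a b N).om ε (l : ZMod N) * s) : ℝ) : ℂ)) := by
    rw [coefA', coefA, exp_lamP, exp_lamM, lamP_eq, lamM_eq, freq_modes hl,
      osc_neg_eq ((gridFreq a b N).om ε (l : ZMod N) * s),
      osc_eq ((gridFreq a b N).om ε (l : ZMod N) * s)]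
    push_cast
    have e : (-(1 / (ε : ℂ) ^ 2) - (gridFreq a b N).om ε (l : ZMod N) -
      (-(1 / (ε : ℂ) ^ 2) + (gridFreq a b N).om ε (l : ZMod N))) =
      -2 * ((gridFreq a b N).om ε (l : ZMod N) : ℂ) := by ring
    rw [e]
    field_simp
    ring_nf
    simp only [Complex.I_sq]
    ring
  rw [h2, ← mul_assoc, h1, one_mul]

variable (L : Level N)

lemma gridCoeff_v0 : gridCoeff (v0 ε N L) = vInit ε (gridCoeff L.Φ) (gridCoeff L.Φdot) := by
  have e : v0 ε N L = fun j => (1 / 2 : ℂ) * (L.Φ j + -(Complex.I * (ε : ℂ) ^ 2) * L.Φdot j) := by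
    ext j; rw [v0]; ring
  rw [e, gridCoeff_const_mul, gridCoeff_add, gridCoeff_const_mul, vInit, neg_smul, sub_eq_add_neg]

lemma gridCoeff_psiDot (hab : a < b) (hN : Even N) : gridCoeff (psiDot a b τ N L) =
    psiD (gridFreq a b N) τ (gridCoeff L.Φ) (gridCoeff L.Ψ) := by
  refine gridCoeff_ofCoeff hab hN fun l hl => ?_
  simp only [dft_eq hab, gridCoeff_mul, psiD, sq_mu_modes hl]

lemma gridCoeff_v1 (hab : a < b) (hN : Even N) (hε : 0 < ε) : gridCoeff (v1 a b ε τ N L) =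
    (gridFreq a b N).amp ε τ * vInit ε (gridCoeff L.Φ) (gridCoeff L.Φdot) := by
  refine gridCoeff_ofCoeff hab hN fun l hl => ?_
  rw [dft_eq hab, gridCoeff_v0, coefA_modes hε hl, Pi.mul_apply]

lemma gridCoeff_rho : gridCoeff (rho N L) = conv (gridCoeff L.Ψ) (J (gridCoeff L.Ψ)) := by
  have e : rho N L = fun j => L.Ψ j * conj (L.Ψ j) := by
    ext j; rw [rho, Complex.mul_conj']; push_cast; rfl
  rw [e, gridCoeff_mul, gridCoeff_conj]

lemma two_smul_gridCoeff_rhoDot (hab : a < b) (hN : Even N) :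
    (2 : ℂ) • gridCoeff (rhoDot a b τ N L) =
      conv (psiD (gridFreq a b N) τ (gridCoeff L.Φ) (gridCoeff L.Ψ)) (J (gridCoeff L.Ψ)) +
      conv (gridCoeff L.Ψ) (J (psiD (gridFreq a b N) τ (gridCoeff L.Φ) (gridCoeff L.Ψ))) := by
  have e : (fun j => 2 * rhoDot a b τ N L j) = fun j =>
      psiDot a b τ N L j * conj (L.Ψ j) + L.Ψ j * conj (psiDot a b τ N L j) := by
    ext j
    rw [rhoDot, Complex.re_eq_add_conj]
    simp only [map_mul, Complex.conj_conj]
    ring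
  rw [← gridCoeff_const_mul, e, gridCoeff_add, gridCoeff_mul, gridCoeff_mul, gridCoeff_conj,
    gridCoeff_conj, gridCoeff_psiDot L hab hN]

/-- An integral of the source against a real kernel. -/
lemma integral_mul_src {G : Type*} [AddCommGroup G] [Fintype G] {k : ℝ → ℝ} (hk : Continuous k)
    (τ : ℝ) (Ψ Ψ' : G → ℂ) (l : G) :
    ∫ θ in (0 : ℝ)..τ, (k θ : ℂ) * src Ψ Ψ' θ l =
      ((∫ θ in (0 : ℝ)..τ, k θ : ℝ) : ℂ) * conv Ψ (J Ψ) l +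
      ((∫ θ in (0 : ℝ)..τ, θ * k θ : ℝ) : ℂ) * (conv Ψ' (J Ψ) + conv Ψ (J Ψ')) l := by
  have hk' : Continuous fun θ => (k θ : ℂ) := Complex.continuous_ofReal.comp hk
  rw [← intervalIntegral.integral_ofReal, ← intervalIntegral.integral_ofReal,
    ← intervalIntegral.integral_mul_const, ← intervalIntegral.integral_mul_const,
    ← intervalIntegral.integral_add]
  · refine intervalIntegral.integral_congr fun θ _ => ?_
    simp only [src, Pi.add_apply, Pi.smul_apply, smul_eq_mul]
    push_cast
    ring
  · exact (hk'.mul continuous_const).intervalIntegrable _ _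
  · refine Continuous.intervalIntegrable ?_ _ _
    push_cast
    fun_prop

lemma J_src {G : Type*} [AddCommGroup G] [Fintype G] (Ψ Ψ' : G → ℂ) (s : ℝ) :
    J (src Ψ Ψ' s) = src Ψ Ψ' s := by
  simp only [src, J_add, J_smul, J_conv, J_J, Complex.conj_ofReal]
  rw [conv_comm (J Ψ) Ψ, conv_comm (J Ψ') Ψ, conv_comm (J Ψ) Ψ', add_comm (conv Ψ (J Ψ'))]

/-- The source represents a real function and the kernels are real and even in the frequency. -/
lemma J_integral_src {G : Type*} [AddCommGroup G] [Fintype G] {k : G → ℝ → ℝ}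
    (hk : ∀ l, k (-l) = k l) (τ : ℝ) (Ψ Ψ' : G → ℂ) :
    J (fun l => ∫ θ in (0 : ℝ)..τ, (k l θ : ℂ) * src Ψ Ψ' θ l) =
      fun l => ∫ θ in (0 : ℝ)..τ, (k l θ : ℂ) * src Ψ Ψ' θ l := by
  ext l
  have h : ∀ θ, conj (src Ψ Ψ' θ (-l)) = src Ψ Ψ' θ l := fun θ => congrFun (J_src Ψ Ψ' θ) l
  simp only [J, intervalIntegral, map_sub, ← integral_conj, map_mul, Complex.conj_ofReal, h, hk]

lemma gridCoeff_r1 (hab : a < b) (hN : Even N) : gridCoeff (r1 a b ε τ N L) =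
    rOne (gridFreq a b N) ε τ (gridCoeff L.Ψ)
      (psiD (gridFreq a b N) τ (gridCoeff L.Φ) (gridCoeff L.Ψ)) := by
  refine gridCoeff_ofCoeff hab hN fun l hl => ?_
  have h := congrFun (two_smul_gridCoeff_rhoDot (τ := τ) L hab hN) (l : ZMod N)
  rw [rOne, integral_mul_src (k := fun θ => Real.sin ((gridFreq a b N).om ε (l : ZMod N) * (τ - θ)) /
    (ε ^ 2 * (gridFreq a b N).om ε (l : ZMod N))) (by fun_prop), ← h]
  simp only [dft_eq hab, gridCoeff_rho, coefP, coefQ, freq_modes hl, Pi.smul_apply, smul_eq_mul]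
  ring

lemma gridCoeff_r1dot (hab : a < b) (hN : Even N) : gridCoeff (r1dot a b ε τ N L) = fun l =>
    ∫ θ in (0 : ℝ)..τ, ((Real.cos ((gridFreq a b N).om ε l * (τ - θ)) / ε ^ 2 : ℝ) : ℂ) *
      src (gridCoeff L.Ψ) (psiD (gridFreq a b N) τ (gridCoeff L.Φ) (gridCoeff L.Ψ)) θ l := by
  refine gridCoeff_ofCoeff hab hN fun l hl => ?_
  have h := congrFun (two_smul_gridCoeff_rhoDot (τ := τ) L hab hN) (l : ZMod N)
  rw [integral_mul_src (k := fun θ => Real.cos ((gridFreq a b N).om ε (l : ZMod N) * (τ - θ)) /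
    ε ^ 2) (by fun_prop), ← h]
  simp only [dft_eq hab, gridCoeff_rho, coefP', coefQ', freq_modes hl, Pi.smul_apply, smul_eq_mul]
  ring

/-- Reality of the remainder is what keeps Φ real. Reality of the data is needed in turn to recover
Φ from the sum of v and its conjugate. -/
lemma conj_r1 (hab : a < b) (hN : Even N) (j : Fin (N + 1)) :
    conj (r1 a b ε τ N L j) = r1 a b ε τ N L j := by
  refine conj_ofCoeff hab ?_ j
  have h := gridCoeff_r1 (ε := ε) (τ := τ) L hab hN
  rw [r1] at h
  rw [h]
  exact J_integral_src (k := fun l θ => Real.sin ((gridFreq a b N).om ε l * (τ - θ)) /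
    (ε ^ 2 * (gridFreq a b N).om ε l)) (fun l => by simp only [Freq.om_neg]) _ _ _

lemma conj_r1dot (hab : a < b) (hN : Even N) (j : Fin (N + 1)) :
    conj (r1dot a b ε τ N L j) = r1dot a b ε τ N L j := by
  refine conj_ofCoeff hab ?_ j
  have h := gridCoeff_r1dot (ε := ε) (τ := τ) L hab hN
  rw [r1dot] at h
  rw [h]
  exact J_integral_src (k := fun l θ => Real.cos ((gridFreq a b N).om ε l * (τ - θ)) / ε ^ 2)
    (fun l => by simp only [Freq.om_neg]) _ _ _

lemma coefC_eq (σ : ℝ) (l : ℤ) : coefC a b ε σ l τ = Complex.I * osc (-(μ a b l ^ 2 * τ)) *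
    ∫ θ in (0 : ℝ)..τ, osc (μ a b l ^ 2 * θ) * osc (σ * (1 / ε ^ 2) * θ) := by
  rw [coefC]
  congr 1
  · rw [osc]; congr 2; push_cast; ring
  · refine intervalIntegral.integral_congr fun θ _ => ?_
    simp only [← osc_add]
    rw [osc]; congr 2; push_cast; ring

lemma coefD_eq (σ : ℝ) (l : ℤ) : coefD a b ε σ l τ = Complex.I * osc (-(μ a b l ^ 2 * τ)) *
    ∫ θ in (0 : ℝ)..τ, (θ : ℂ) * (osc (μ a b l ^ 2 * θ) * osc (σ * (1 / ε ^ 2) * θ)) := by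
  rw [coefD]
  congr 1
  · rw [osc]; congr 2; push_cast; ring
  · refine intervalIntegral.integral_congr fun θ _ => ?_
    simp only [← osc_add]
    congr 1
    rw [osc]; congr 2; push_cast; ring

/-- The coefficients c and d are the zeroth and first moments of the combined phases, so the step is
Duhamel's formula for `force` with no quadrature error. -/
lemma gridCoeff_psiNext (hab : a < b) (hN : Even N) : gridCoeff (psiNext a b ε τ N L) =
    stepPsi (gridFreq a b N) ε τ (vInit ε (gridCoeff L.Φ) (gridCoeff L.Φdot)) (gridCoeff L.Ψ)
      (psiD (gridFreq a b N) τ (gridCoeff L.Φ) (gridCoeff L.Ψ)) := by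
  refine gridCoeff_ofCoeff hab hN fun l hl => ?_
  have e0 : ∀ x : ℝ, Complex.exp (-(Complex.I * (x : ℂ))) = osc (-x) := by
    intro x
    rw [osc]; congr 1; push_cast; ring
  simp only [dft_eq hab, gridCoeff_mul, gridCoeff_conj, gridCoeff_v0, gridCoeff_psiDot L hab hN,
    coefC_eq, coefD_eq, e0, sq_mu_modes hl, one_mul, neg_mul]
  rw [stepPsi]
  generalize psiD (gridFreq a b N) τ (gridCoeff L.Φ) (gridCoeff L.Ψ) = Ψ'
  generalize vInit ε (gridCoeff L.Φ) (gridCoeff L.Φdot) = v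
  generalize gridCoeff L.Ψ = Ψ
  generalize (gridFreq a b N).μ (l : ZMod N) ^ 2 = κ
  have hc := continuous_osc
  have e1 : ∀ s : ℝ, osc (κ * s) * force ε v Ψ Ψ' s l =
      osc (κ * s) * osc (1 / ε ^ 2 * s) * conv v Ψ l +
      (s : ℂ) * (osc (κ * s) * osc (1 / ε ^ 2 * s)) * conv v Ψ' l +
      osc (κ * s) * osc (-(1 / ε ^ 2 * s)) * conv (J v) Ψ l +
      (s : ℂ) * (osc (κ * s) * osc (-(1 / ε ^ 2 * s))) * conv (J v) Ψ' l := by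
    intro s
    simp only [force, add_conv, conv_add, smul_conv, conv_smul, Pi.add_apply, Pi.smul_apply,
      smul_eq_mul, neg_mul]
    ring
  simp only [e1]
  rw [intervalIntegral.integral_add, intervalIntegral.integral_add, intervalIntegral.integral_add,
    intervalIntegral.integral_mul_const, intervalIntegral.integral_mul_const,
    intervalIntegral.integral_mul_const, intervalIntegral.integral_mul_const]
  · ring
  all_goals exact Continuous.intervalIntegrable (by fun_prop) _ _

variable {L}

lemma conj_step_Φ (hab : a < b) (hN : Even N) (j : Fin (N + 1)) :
    conj ((step a b ε τ N L).Φ j) = (step a b ε τ N L).Φ j := by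
  simp only [step, map_add, map_mul, Complex.conj_conj, conj_r1 L hab hN]
  ring

lemma conj_step_Φdot (hab : a < b) (hN : Even N) (j : Fin (N + 1)) :
    conj ((step a b ε τ N L).Φdot j) = (step a b ε τ N L).Φdot j := by
  simp only [step, map_add, map_sub, map_mul, map_div₀, map_pow, Complex.conj_conj, Complex.conj_I,
    Complex.conj_ofReal, conj_r1dot L hab hN]
  ring

lemma J_gridCoeff {v : Fin (N + 1) → ℂ} (h : ∀ j, conj (v j) = v j) :
    J (gridCoeff v) = gridCoeff v := by
  rw [← gridCoeff_conj]
  simp only [h]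

lemma gridCoeff_step_Φ (hab : a < b) (hN : Even N) (hε : 0 < ε)
    (h1 : J (gridCoeff L.Φ) = gridCoeff L.Φ) (h2 : J (gridCoeff L.Φdot) = gridCoeff L.Φdot)
    (l : ZMod N) : gridCoeff (step a b ε τ N L).Φ l =
      (Real.cos ((gridFreq a b N).om ε l * τ) : ℂ) * gridCoeff L.Φ l +
      (Real.sin ((gridFreq a b N).om ε l * τ) : ℂ) * (((gridFreq a b N).om ε l)⁻¹ : ℝ) *
        gridCoeff L.Φdot l + rOne (gridFreq a b N) ε τ (gridCoeff L.Ψ)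
          (psiD (gridFreq a b N) τ (gridCoeff L.Φ) (gridCoeff L.Ψ)) l := by
  have e1 : phase ε τ = osc (1 / ε ^ 2 * τ) := by rw [phase_eq, one_div_mul_eq_div]
  rw [← free_eq hε h1 h2, step]
  simp only [e1, conj_osc, gridCoeff_add, gridCoeff_const_mul, gridCoeff_conj,
    gridCoeff_v1 L hab hN hε, gridCoeff_r1 L hab hN, Pi.add_apply, neg_mul]

lemma gridCoeff_step_Φdot (hab : a < b) (hN : Even N) (hε : 0 < ε)
    (h1 : J (gridCoeff L.Φ) = gridCoeff L.Φ) (h2 : J (gridCoeff L.Φdot) = gridCoeff L.Φdot)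
    (l : ZMod N) : gridCoeff (step a b ε τ N L).Φdot l =
      -(((gridFreq a b N).om ε l * Real.sin ((gridFreq a b N).om ε l * τ) : ℝ) : ℂ) *
        gridCoeff L.Φ l + (Real.cos ((gridFreq a b N).om ε l * τ) : ℂ) * gridCoeff L.Φdot l +
      ∫ θ in (0 : ℝ)..τ, ((Real.cos ((gridFreq a b N).om ε l * (τ - θ)) / ε ^ 2 : ℝ) : ℂ) *
      src (gridCoeff L.Ψ) (psiD (gridFreq a b N) τ (gridCoeff L.Φ) (gridCoeff L.Ψ)) θ l := by
  have hε' : (ε : ℂ) ≠ 0 := by exact_mod_cast hε.ne'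
  have e1 : phase ε τ = osc (1 / ε ^ 2 * τ) := by rw [phase_eq, one_div_mul_eq_div]
  -- Both terms of the update carry the same data, so they merge into one multiplier, from which the
  -- phase e^(iτ/ε²) disappears.
  set X : Fin (N + 1) → ℂ := ofCoeff a b N fun l => osc (1 / ε ^ 2 * τ) *
    (coefA' a b ε l τ + Complex.I / (ε : ℂ) ^ 2 * coefA a b ε l τ) * dft a b N (v0 ε N L) l with hX
  have hXj : ∀ j, phase ε τ * (v1dot a b ε τ N L j + Complex.I / (ε : ℂ) ^ 2 * v1 a b ε τ N L j) =
      X j := by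
    intro j
    rw [e1, hX]
    simp only [v1dot, v1, ofCoeff, trigPoly, Finset.mul_sum, ← Finset.sum_add_distrib]
    refine Finset.sum_congr rfl fun l _ => ?_
    ring
  set n : ZMod N → ℂ := fun l => -(((gridFreq a b N).om ε l *
    Real.sin ((gridFreq a b N).om ε l * τ) : ℝ) : ℂ) +
      Complex.I * ((1 / ε ^ 2 * Real.cos ((gridFreq a b N).om ε l * τ) : ℝ) : ℂ) with hn
  have hXc : gridCoeff X = n * vInit ε (gridCoeff L.Φ) (gridCoeff L.Φdot) := by
    refine gridCoeff_ofCoeff hab hN fun l hl => ?_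
    rw [dft_eq hab, gridCoeff_v0, osc_mul_coefA'_modes hε hl, Pi.mul_apply]
  have hD : (step a b ε τ N L).Φdot = fun j => X j + conj (X j) + r1dot a b ε τ N L j := by
    ext j
    simp only [step, hXj]
    congr 2
    rw [← hXj]
    simp only [map_mul, map_add, map_div₀, map_pow, Complex.conj_I, Complex.conj_ofReal]
    ring
  rw [hD, gridCoeff_add, gridCoeff_add, gridCoeff_conj, hXc, gridCoeff_r1dot L hab hN]
  simp only [Pi.add_apply, Pi.mul_apply]
  congr 1
  have e3 : J (n * vInit ε (gridCoeff L.Φ) (gridCoeff L.Φdot)) l =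
      conj (n l) * J (vInit ε (gridCoeff L.Φ) (gridCoeff L.Φdot)) l := by
    simp [J, hn, Freq.om_neg]
  rw [e3, J_vInit _ _ h1 h2, vInit, hn]
  simp only [Pi.smul_apply, Pi.sub_apply, Pi.add_apply, smul_eq_mul, map_add, map_neg, map_mul,
    Complex.conj_I, Complex.conj_ofReal]
  push_cast
  field_simp
  ring_nf
  simp only [Complex.I_sq]
  ring

/-- The cosine and sine propagators of Φ and Φ̇ are the two parts of one rotation e^(iωτ), and
likewise the kernels of the two remainders combine to e^(iω(τ-θ)). -/
lemma zed_step (hab : a < b) (hN : Even N) (hε : 0 < ε)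
    (h1 : J (gridCoeff L.Φ) = gridCoeff L.Φ) (h2 : J (gridCoeff L.Φdot) = gridCoeff L.Φdot) :
    zed (gridFreq a b N) ε (gridCoeff (step a b ε τ N L).Φ) (gridCoeff (step a b ε τ N L).Φdot) =
      stepZ (gridFreq a b N) ε τ (zed (gridFreq a b N) ε (gridCoeff L.Φ) (gridCoeff L.Φdot))
        (gridCoeff L.Ψ) (psiD (gridFreq a b N) τ (gridCoeff L.Φ) (gridCoeff L.Ψ)) := by
  ext l
  have hε' : (ε : ℂ) ≠ 0 := by exact_mod_cast hε.ne'
  have hω : ((gridFreq a b N).om ε l : ℂ) ≠ 0 := by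
    exact_mod_cast ((gridFreq a b N).om_pos hε _).ne'
  rw [zed, gridCoeff_step_Φ hab hN hε h1 h2, gridCoeff_step_Φdot hab hN hε h1 h2, stepZ, zed]
  set o := (gridFreq a b N).om ε l with ho
  set S := src (gridCoeff L.Ψ) (psiD (gridFreq a b N) τ (gridCoeff L.Φ) (gridCoeff L.Ψ))
  have hS : Continuous fun θ => S θ l := ExactData.continuous_src _ _ l
  have hc := continuous_osc
  have e : ((ε ^ 2 * o : ℝ) : ℂ) * rOne (gridFreq a b N) ε τ (gridCoeff L.Ψ)
      (psiD (gridFreq a b N) τ (gridCoeff L.Φ) (gridCoeff L.Ψ)) l - Complex.I * (ε : ℂ) ^ 2 *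
      (∫ θ in (0 : ℝ)..τ, ((Real.cos (o * (τ - θ)) / ε ^ 2 : ℝ) : ℂ) * S θ l) =
      osc (o * τ) * (-(Complex.I * ∫ s in (0 : ℝ)..τ, osc (-o * s) * S s l)) := by
    rw [rOne, ← ho, show ∀ x : ℂ, osc (o * τ) * (-(Complex.I * x)) =
      (osc (o * τ) * -Complex.I) * x from fun x => by ring,
      ← intervalIntegral.integral_const_mul, ← intervalIntegral.integral_const_mul,
      ← intervalIntegral.integral_const_mul, ← intervalIntegral.integral_sub]
    · refine intervalIntegral.integral_congr fun θ _ => ?_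
      have e2 : osc (o * τ) * osc (-o * θ) = (Real.cos (o * (τ - θ)) : ℂ) +
          Complex.I * (Real.sin (o * (τ - θ)) : ℂ) := by
        rw [← osc_add, ← osc_eq]; congr 1; ring
      change ((ε ^ 2 * o : ℝ) : ℂ) * (((Real.sin (o * (τ - θ)) / (ε ^ 2 * o) : ℝ) : ℂ) * S θ l) -
        Complex.I * (ε : ℂ) ^ 2 * (((Real.cos (o * (τ - θ)) / ε ^ 2 : ℝ) : ℂ) * S θ l) =
        osc (o * τ) * -Complex.I * (osc (-o * θ) * S θ l)
      rw [show osc (o * τ) * -Complex.I * (osc (-o * θ) * S θ l) =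
        (osc (o * τ) * osc (-o * θ)) * (-Complex.I * S θ l) by ring, e2]
      push_cast
      field_simp
      ring_nf
      simp only [Complex.I_sq]
      ring
    all_goals
      refine Continuous.intervalIntegrable ?_ _ _
      refine continuous_const.mul (Continuous.mul (Complex.continuous_ofReal.comp ?_) hS)
      fun_prop
  have e4 : ((ε ^ 2 * o : ℝ) : ℂ) * ((Real.cos (o * τ) : ℂ) * gridCoeff L.Φ l +
      (Real.sin (o * τ) : ℂ) * ((o⁻¹ : ℝ) : ℂ) * gridCoeff L.Φdot l) - Complex.I * (ε : ℂ) ^ 2 *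
      (-((o * Real.sin (o * τ) : ℝ) : ℂ) * gridCoeff L.Φ l +
        (Real.cos (o * τ) : ℂ) * gridCoeff L.Φdot l) =
      osc (o * τ) * (((ε ^ 2 * o : ℝ) : ℂ) * gridCoeff L.Φ l -
        Complex.I * (ε : ℂ) ^ 2 * gridCoeff L.Φdot l) := by
    rw [osc_eq]
    push_cast
    field_simp
    ring_nf
    simp only [Complex.I_sq]
    ring
  linear_combination e + e4

end Scheme

/-! ### The numerical solution as a sequence of coefficients -/

section NumSeq

set_option linter.unusedSectionVars false

variable {a b ε τ : ℝ} {N : ℕ} [NeZero N] {ψ₀ : ℝ → ℂ} {φ₀ φ₁ : ℝ → ℝ}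

lemma rho_modes {l : ℤ} (hl : l ∈ modes N) :
    (intFreq a b).ρ l = (gridFreq a b N).ρ (l : ZMod N) := by
  rw [Freq.ρ, Freq.ρ, ← abs_mu_modes hl]; rfl

lemma conj_num (hab : a < b) (hN : Even N) (n : ℕ) (j : Fin (N + 1)) :
    conj ((num a b ε τ N ψ₀ φ₀ φ₁ n).Φ j) = (num a b ε τ N ψ₀ φ₀ φ₁ n).Φ j ∧
      conj ((num a b ε τ N ψ₀ φ₀ φ₁ n).Φdot j) = (num a b ε τ N ψ₀ φ₀ φ₁ n).Φdot j := by
  cases n with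
  | zero => exact ⟨Complex.conj_ofReal _, Complex.conj_ofReal _⟩
  | succ n => exact ⟨conj_step_Φ hab hN j, conj_step_Φdot hab hN j⟩

lemma numSeq_num (hab : a < b) (hN : Even N) (hε : 0 < ε) : NumSeq (gridFreq a b N) ε τ
    (fun n => gridCoeff (num a b ε τ N ψ₀ φ₀ φ₁ n).Φ)
    (fun n => gridCoeff (num a b ε τ N ψ₀ φ₀ φ₁ n).Φdot)
    (fun n => gridCoeff (num a b ε τ N ψ₀ φ₀ φ₁ n).Ψ) where
  real_Φ n := J_gridCoeff fun j => (conj_num hab hN n j).1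
  real_D n := J_gridCoeff fun j => (conj_num hab hN n j).2
  psi _ := gridCoeff_psiNext _ hab hN
  z n := zed_step hab hN hε (J_gridCoeff fun j => (conj_num hab hN n j).1)
    (J_gridCoeff fun j => (conj_num hab hN n j).2)

lemma phase_eq_osc (s : ℝ) : phase ε s = osc (1 / ε ^ 2 * s) := by
  rw [phase_eq, one_div_mul_eq_div]

lemma gridCoeff_localPsi (hab : a < b) (hN : Even N) (L : Level N) (s : ℝ) :
    gridCoeff (localPsi a b ε τ N L s) = (((τ - s) / τ : ℝ) : ℂ) • gridCoeff L.Ψ +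
      ((s / τ : ℝ) : ℂ) • stepPsi (gridFreq a b N) ε τ
        (vInit ε (gridCoeff L.Φ) (gridCoeff L.Φdot)) (gridCoeff L.Ψ)
        (psiD (gridFreq a b N) τ (gridCoeff L.Φ) (gridCoeff L.Ψ)) := by
  unfold localPsi
  rw [gridCoeff_add, gridCoeff_const_mul, gridCoeff_const_mul, gridCoeff_psiNext L hab hN]

lemma gridCoeff_localPhi (hab : a < b) (hN : Even N) (hε : 0 < ε) (L : Level N) (s : ℝ) :
    gridCoeff (localPhi a b ε τ N L s) =
      osc (1 / ε ^ 2 * s) • ((((τ - s) / τ : ℝ) : ℂ) • vInit ε (gridCoeff L.Φ) (gridCoeff L.Φdot) +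
        ((s / τ : ℝ) : ℂ) • ((gridFreq a b N).amp ε τ *
          vInit ε (gridCoeff L.Φ) (gridCoeff L.Φdot))) +
      osc (-(1 / ε ^ 2) * s) •
        J ((((τ - s) / τ : ℝ) : ℂ) • vInit ε (gridCoeff L.Φ) (gridCoeff L.Φdot) +
        ((s / τ : ℝ) : ℂ) • ((gridFreq a b N).amp ε τ *
          vInit ε (gridCoeff L.Φ) (gridCoeff L.Φdot))) +
      ((s / τ : ℝ) : ℂ) • rOne (gridFreq a b N) ε τ (gridCoeff L.Ψ)
        (psiD (gridFreq a b N) τ (gridCoeff L.Φ) (gridCoeff L.Ψ)) := by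
  have hV : gridCoeff (localV a b ε τ N L s) =
      (((τ - s) / τ : ℝ) : ℂ) • vInit ε (gridCoeff L.Φ) (gridCoeff L.Φdot) +
        ((s / τ : ℝ) : ℂ) • ((gridFreq a b N).amp ε τ *
          vInit ε (gridCoeff L.Φ) (gridCoeff L.Φdot)) := by
    unfold localV
    rw [gridCoeff_add, gridCoeff_const_mul, gridCoeff_const_mul, gridCoeff_v0,
      gridCoeff_v1 L hab hN hε]
  have hR : gridCoeff (localR a b ε τ N L s) = ((s / τ : ℝ) : ℂ) •
      rOne (gridFreq a b N) ε τ (gridCoeff L.Ψ)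
        (psiD (gridFreq a b N) τ (gridCoeff L.Φ) (gridCoeff L.Ψ)) := by
    unfold localR
    rw [gridCoeff_const_mul, gridCoeff_r1 L hab hN]
  have e : localPhi a b ε τ N L s = fun j => (phase ε s * localV a b ε τ N L s j +
      conj (phase ε s) * conj (localV a b ε τ N L s j)) + localR a b ε τ N L s j := by
    ext j; rw [localPhi, map_mul]
  rw [e, gridCoeff_add, gridCoeff_add, gridCoeff_const_mul, gridCoeff_const_mul, gridCoeff_conj, hV,
    hR, phase_eq_osc, conj_osc, neg_mul]

/-! ### The multiscale interpolation is well defined -/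

lemma localPsi_zero (hτ : 0 < τ) (L : Level N) : localPsi a b ε τ N L 0 = L.Ψ := by
  ext j; simp [localPsi, hτ.ne']

lemma localPsi_self (hτ : 0 < τ) (L : Level N) :
    localPsi a b ε τ N L τ = (step a b ε τ N L).Ψ := by
  ext j; simp [localPsi, hτ.ne', step]

lemma localPhi_zero (hτ : 0 < τ) (L : Level N) (h1 : ∀ j, conj (L.Φ j) = L.Φ j)
    (h2 : ∀ j, conj (L.Φdot j) = L.Φdot j) : localPhi a b ε τ N L 0 = L.Φ := by
  ext j
  simp only [localPhi, localV, localR, v0, phase_eq_osc, sub_zero, div_self hτ.ne', mul_zero,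
    osc_zero, zero_div, Complex.ofReal_one, Complex.ofReal_zero, zero_mul, add_zero, one_mul,
    map_mul, map_sub, map_div₀, map_one, map_ofNat, map_pow, Complex.conj_I, Complex.conj_ofReal,
    h1, h2]
  ring

lemma localPhi_self (hτ : 0 < τ) (L : Level N) :
    localPhi a b ε τ N L τ = (step a b ε τ N L).Φ := by
  ext j
  simp only [localPhi, localV, localR, step, sub_self, div_self hτ.ne', zero_div,
    Complex.ofReal_one, Complex.ofReal_zero, zero_mul, zero_add, one_mul, map_mul]

/-- Only s = τ needs an argument: there the floor jumps to n + 1, and the end of one step has to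
match the beginning of the next. For Φ this uses that the data are real. -/
lemma interp_eq_local (hab : a < b) (hN : Even N) (hτ : 0 < τ) (n : ℕ) {s : ℝ} (hs : s ∈ Icc 0 τ) :
    Psi a b ε τ N ψ₀ φ₀ φ₁ (n * τ + s) = localPsi a b ε τ N (num a b ε τ N ψ₀ φ₀ φ₁ n) s ∧
      Phi a b ε τ N ψ₀ φ₀ φ₁ (n * τ + s) =
        localPhi a b ε τ N (num a b ε τ N ψ₀ φ₀ φ₁ n) s := by
  have hdiv : (n * τ + s) / τ = n + s / τ := by field_simp
  rcases hs.2.eq_or_lt with rfl | hlt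
  · have hfl : ⌊(n * s + s) / s⌋₊ = n + 1 := by
      rw [hdiv, div_self hτ.ne']
      exact_mod_cast Nat.floor_natCast (n + 1)
    have h0 : (n * s + s) - ((n + 1 : ℕ) : ℝ) * s = 0 := by push_cast; ring
    unfold Psi Phi
    rw [hfl, h0, localPsi_zero hτ, localPsi_self hτ, localPhi_self hτ,
      localPhi_zero hτ _ (fun j => (conj_num hab hN (n + 1) j).1)
        fun j => (conj_num hab hN (n + 1) j).2]
    exact ⟨rfl, rfl⟩
  · have hfl : ⌊(n * τ + s) / τ⌋₊ = n := by
      rw [hdiv, add_comm, Nat.floor_add_natCast (div_nonneg hs.1 hτ.le),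
        Nat.floor_eq_zero.mpr ((div_lt_one hτ).mpr hlt), zero_add]
    unfold Psi Phi
    rw [hfl, add_sub_cancel_left]
    exact ⟨rfl, rfl⟩

/-! ### The error in `H¹` -/

/-- Parseval, mode by mode: high modes are the tail of `u`, the others compare coefficients. The
factor 2 is needed only for the mode -N/2, which belongs to both groups. -/
lemma hNorm_sub_interpN_sq_le (hab : a < b) (hN : Even N) {u : ℝ → ℂ} (hu : MemHper a b 1 u)
    (v : Fin (N + 1) → ℂ) : hNorm a b 1 (fun x => u x - interpN a b N v x) ^ 2 ≤
      ENNReal.ofReal (b - a) * (2 * ((∑' l : ℤ, if N ≤ 2 * l.natAbs then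
        (ENNReal.ofReal ((intFreq a b).ρ l ^ 1) * ‖fc a b u l‖ₑ) ^ 2 else 0) +
        (gridFreq a b N).hs 1 (trunc N (fc a b u) - gridCoeff v))) := by
  have hv := memHper_interpN (N := N) hab 1 v
  rw [(hu.sub hv).hNorm_one_sq hab]
  have e1 : (gridFreq a b N).hs 1 (trunc N (fc a b u) - gridCoeff v) =
      ∑' l : ℤ, if l ∈ modes N then (ENNReal.ofReal ((intFreq a b).ρ l ^ 1) *
        ‖(trunc N (fc a b u) - gridCoeff v) (l : ZMod N)‖ₑ) ^ 2 else 0 := by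
    rw [tsum_eq_sum (s := modes N) fun l hl => by rw [if_neg hl], Freq.hs, tsum_fintype,
      ← sum_modes hN]
    exact Finset.sum_congr rfl fun l hl => by rw [if_pos hl, rho_modes hl]
  rw [e1, ← ENNReal.tsum_add, ← ENNReal.tsum_mul_left]
  refine mul_le_mul_right (ENNReal.tsum_le_tsum fun l => ?_) _
  rw [fc_sub hu.integrableOn hv.integrableOn, Pi.sub_apply, fc_interpN hab]
  by_cases hl : l ∈ modes N
  · rw [if_pos hl, if_pos hl]
    by_cases h2 : N ≤ 2 * l.natAbs
    -- The mode -N/2: the truncation vanishes there, so the coefficient of `u` is counted in the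
    -- tail and that of the interpolant in the grid norm.
    · rw [if_pos h2, Pi.sub_apply, trunc, natAbs_modes hl, if_neg (by omega), zero_sub]
      refine le_trans ?_ (ENNReal.add_sq_le _ _)
      rw [← mul_add]
      gcongr
      rw [sub_eq_add_neg]
      exact enorm_add_le _ _
    · have hv : (l : ZMod N).valMinAbs = l := by
        rw [ZMod.valMinAbs_spec]
        exact ⟨rfl, by constructor <;> omega⟩
      rw [if_neg h2, Pi.sub_apply, trunc, hv, if_pos (by omega), zero_add]
      exact le_mul_of_one_le_left zero_le (by norm_num)
  · have h2 : N ≤ 2 * l.natAbs := by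
      simp only [modes, Finset.mem_Ico] at hl
      obtain ⟨r, hr⟩ := hN
      omega
    rw [if_neg hl, if_neg hl, if_pos h2, sub_zero, add_zero]
    exact le_mul_of_one_le_left zero_le (by norm_num)

lemma hNorm_sub_interpN_le (hab : a < b) (hN : Even N) {m : ℕ} (hm : 1 ≤ m) {u : ℝ → ℂ}
    (hu : MemHper a b m u) {B x : ℝ} (hB : 0 ≤ B)
    (hM : (intFreq a b).hs m (fc a b u) ≤ ENNReal.ofReal (B ^ 2)) (v : Fin (N + 1) → ℂ)
    (hx : (gridFreq a b N).sn 1 (trunc N (fc a b u) - gridCoeff v) ≤ x) :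
    hNorm a b 1 (fun x => u x - interpN a b N v x) ≤
      ENNReal.ofReal (√(2 * (b - a)) * (B * mesh a b N ^ (m - 1) + x)) := by
  have hL := sub_pos.mpr hab
  have hh := mesh_pos (N := N) hab
  have hx0 : 0 ≤ x := (Freq.sn_nonneg _ _ _).trans hx
  rw [← ENNReal.pow_le_pow_left_iff two_ne_zero, ← ENNReal.ofReal_pow (by positivity), mul_pow,
    Real.sq_sqrt (by positivity)]
  refine (hNorm_sub_interpN_sq_le hab hN (hu.mono hm) v).trans ?_
  have h1 := (tsum_high_le (N := N) hab hm (fc a b u)).trans (mul_le_mul_right hM _)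
  have h2 : (gridFreq a b N).hs 1 (trunc N (fc a b u) - gridCoeff v) ≤ ENNReal.ofReal (x ^ 2) := by
    rw [Freq.hs_eq_ofReal]
    exact ENNReal.ofReal_le_ofReal (pow_le_pow_left₀ (Freq.sn_nonneg _ _ _) hx 2)
  refine (mul_le_mul_right (mul_le_mul_right (add_le_add h1 h2) _) _).trans ?_
  rw [← ENNReal.ofReal_pow (by positivity), ← ENNReal.ofReal_mul (by positivity),
    ← ENNReal.ofReal_add (by positivity) (by positivity),
    show (2 : ℝ≥0∞) = ENNReal.ofReal 2 by simp, ← ENNReal.ofReal_mul (by positivity),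
    ← ENNReal.ofReal_mul hL.le]
  refine ENNReal.ofReal_le_ofReal ?_
  have h3 : 0 ≤ (b - a) * (B * mesh a b N ^ (m - 1) * x) := by positivity
  nlinarith [h3]

end NumSeq

lemma isAlg_gridFreq {a b κ B : ℝ} (hκ : 0 ≤ κ)
    (h : ∑' l, ENNReal.ofReal (((intFreq a b).ρ l)⁻¹) ^ 2 ≤ ENNReal.ofReal κ) (hB : 1 ≤ B)
    (hB' : √(4 * 4 ^ 3 * κ) ≤ B) (N : ℕ) [NeZero N] : IsAlg (gridFreq a b N) B := by
  have h' := (tsum_inv_gridRho_le (a := a) (b := b) (N := N)).trans h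
  have h1 : √(4 * 4 ^ 1 * κ) ≤ B := (Real.sqrt_le_sqrt (by linarith)).trans hB'
  have key : ∀ s : ℕ, 1 ≤ s → √(4 * 4 ^ s * κ) ≤ B → ∀ c d, (gridFreq a b N).sn s (conv c d) ≤
      B * (gridFreq a b N).sn s c * (gridFreq a b N).sn s d := by
    intro s hs hs' c d
    refine ((gridFreq a b N).sn_conv_le hκ h' hs c d).trans ?_
    have := (gridFreq a b N).sn_nonneg s c
    have := (gridFreq a b N).sn_nonneg s d
    gcongr
  exact ⟨hB, key 1 le_rfl h1, key 3 (by norm_num) hB'⟩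

/-! ### The projected exact solution -/

/-- A constant for the algebra property of `h^m` and for aliasing. -/
structure AlgConst (a b : ℝ) (m : ℕ) (K : ℝ) : Prop where
  one_le : 1 ≤ K
  alg : ∑' l, ENNReal.ofReal (((intFreq a b).ρ l)⁻¹) ^ 2 ≤ ENNReal.ofReal (K ^ 2 / (4 * 4 ^ m))
  fold : foldConst ≤ ENNReal.ofReal (K ^ 2)

lemma exists_algConst {a b : ℝ} (hab : a < b) (m : ℕ) : ∃ K, AlgConst a b m K := by
  set κ := (∑' l, ENNReal.ofReal (((intFreq a b).ρ l)⁻¹) ^ 2).toReal with hκ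
  set A := foldConst.toReal with hA
  have h1 : 0 ≤ κ := ENNReal.toReal_nonneg
  have h2 : 0 ≤ A := ENNReal.toReal_nonneg
  have hp : (1 : ℝ) ≤ 4 ^ m := one_le_pow₀ (by norm_num)
  have h3 : 1 ≤ 1 + A + κ * (4 * 4 ^ m) := by
    have := mul_nonneg h1 (by positivity : (0 : ℝ) ≤ 4 * 4 ^ m)
    linarith
  -- A number that is at least 1 is below its square, so a single K meets all three demands.
  have h4 : 1 + A + κ * (4 * 4 ^ m) ≤ (1 + A + κ * (4 * 4 ^ m)) ^ 2 := by nlinarith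
  refine ⟨1 + A + κ * (4 * 4 ^ m), h3, ?_, ?_⟩
  · rw [← ENNReal.ofReal_toReal (tsum_inv_rho_sq_lt_top hab).ne, ← hκ]
    refine ENNReal.ofReal_le_ofReal ?_
    rw [le_div_iff₀ (by positivity)]
    linarith
  · rw [← ENNReal.ofReal_toReal foldConst_lt_top.ne, ← hA]
    refine ENNReal.ofReal_le_ofReal ?_
    have := mul_nonneg h1 (by positivity : (0 : ℝ) ≤ 4 * 4 ^ m)
    linarith

lemma Freq.hs_J {G : Type*} [AddCommGroup G] (F : Freq G) (s : ℕ) (c : G → ℂ) :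
    F.hs s (J c) = F.hs s c := by
  unfold Freq.hs
  rw [← (Equiv.neg G).tsum_eq fun l => (ENNReal.ofReal (F.ρ l ^ s) * ‖c l‖ₑ) ^ 2]
  refine tsum_congr fun l => ?_
  rw [Equiv.neg_apply, F.rho_neg, J, RCLike.enorm_conj]

section Project

variable {a b T ε K : ℝ} {m N : ℕ} [NeZero N]

lemma AlgConst.pos (hK : AlgConst a b m K) : 0 < K := one_pos.trans_le hK.one_le

lemma AlgConst.isAlg (hK : AlgConst a b m K) (hm : 3 ≤ m) {B : ℝ} (hB : K ≤ B) (N : ℕ) [NeZero N] :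
    IsAlg (gridFreq a b N) B := by
  have hK0 := hK.pos
  refine isAlg_gridFreq (by positivity) hK.alg (hK.one_le.trans hB) (le_trans ?_ hB) N
  refine Real.sqrt_le_iff.mpr ⟨hK0.le, ?_⟩
  have h : (4 : ℝ) ^ 3 ≤ 4 ^ m := pow_le_pow_right₀ (by norm_num) hm
  rw [← mul_div_assoc, div_le_iff₀ (by positivity)]
  nlinarith [sq_nonneg K]

lemma AlgConst.hs_conv_le (hK : AlgConst a b m K) (hm : 1 ≤ m) {c d : ℤ → ℂ} {x y : ℝ}
    (hc : (intFreq a b).hs m c ≤ ENNReal.ofReal (x ^ 2))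
    (hd : (intFreq a b).hs m d ≤ ENNReal.ofReal (y ^ 2)) :
    (intFreq a b).hs m (conv c d) ≤ ENNReal.ofReal ((K * x * y) ^ 2) := by
  have hK0 := hK.pos
  refine ((intFreq a b).hs_conv_le hK.alg hm c d).trans ?_
  have e : 4 * 4 ^ m * ENNReal.ofReal (K ^ 2 / (4 * 4 ^ m)) = ENNReal.ofReal (K ^ 2) := by
    have : (4 * 4 ^ m : ℝ≥0∞) = ENNReal.ofReal (4 * 4 ^ m) := by
      rw [ENNReal.ofReal_mul (by norm_num), ENNReal.ofReal_pow (by norm_num)]; simp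
    rw [this, ← ENNReal.ofReal_mul (by positivity), mul_div_cancel₀ _ (by positivity)]
  rw [e, mul_pow, mul_pow, ENNReal.ofReal_mul (by positivity), ENNReal.ofReal_mul (by positivity)]
  gcongr

lemma Freq.sn_le_of_hs {G : Type*} [AddCommGroup G] [Fintype G] (F : Freq G) {s : ℕ} {c : G → ℂ}
    {x : ℝ} (hx : 0 ≤ x) (h : F.hs s c ≤ ENNReal.ofReal (x ^ 2)) : F.sn s c ≤ x := by
  rw [F.hs_eq_ofReal, ENNReal.ofReal_le_ofReal_iff (by positivity)] at h
  exact (pow_le_pow_iff_left₀ (F.sn_nonneg s c) hx two_ne_zero).mp h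

lemma sn_trunc_le {s : ℕ} (hs : s ≤ m) {c : ℤ → ℂ} {x : ℝ} (hx : 0 ≤ x)
    (hc : (intFreq a b).hs m c ≤ ENNReal.ofReal (x ^ 2)) :
    (gridFreq a b N).sn s (trunc N c) ≤ x :=
  Freq.sn_le_of_hs _ hx ((hs_trunc_le s c).trans (((intFreq a b).hs_mono hs c).trans hc))

lemma summable_norm_of_hs_le (hab : a < b) (hm : 1 ≤ m) {c : ℤ → ℂ} {x : ℝ}
    (hc : (intFreq a b).hs m c ≤ ENNReal.ofReal x) : Summable fun l => ‖c l‖ :=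
  summable_norm_of_hs hab ((((intFreq a b).hs_mono hm c).trans hc).trans_lt ENNReal.ofReal_lt_top)

lemma sn_trunc_sub_fold_le (hab : a < b) (hF : foldConst ≤ ENNReal.ofReal (K ^ 2)) (hK0 : 0 ≤ K)
    {s : ℕ} (hs : s < m) {c : ℤ → ℂ} {x : ℝ} (hx : 0 ≤ x)
    (hc : (intFreq a b).hs m c ≤ ENNReal.ofReal (x ^ 2)) :
    (gridFreq a b N).sn s (trunc N c - fold N c) ≤ K * x * mesh a b N ^ (m - s) := by
  have hh := mesh_pos (N := N) hab
  rw [Freq.sn_sub_comm]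
  refine Freq.sn_le_of_hs _ (by positivity) ?_
  refine (hs_fold_sub_trunc_le hab hs
    (summable_norm_of_hs_le hab (by omega) hc).of_norm).trans ?_
  rw [show (K * x * mesh a b N ^ (m - s)) ^ 2 = (mesh a b N ^ (m - s)) ^ 2 * K ^ 2 * x ^ 2 by ring,
    ENNReal.ofReal_mul (by positivity), ENNReal.ofReal_mul (by positivity),
    ENNReal.ofReal_pow (by positivity) 2]
  gcongr

/-- Folding is sampling, and the samples of a product are the products of the samples. Summability
of the convolution is needed for the product to be the sum of its Fourier series. -/
lemma fold_conv (hab : a < b) {c d : ℤ → ℂ} (hc : Summable fun l => ‖c l‖)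
    (hd : Summable fun l => ‖d l‖) (hcd : Summable fun l => ‖conv c d l‖) :
    fold N (conv c d) = conv (fold N c) (fold N d) := by
  have h1 := gridCoeff_samples (N := N) hab hc (fun x _ => rfl)
  have h2 := gridCoeff_samples (N := N) hab hd (fun x _ => rfl)
  have hS := (continuous_series (a := a) (b := b) hc)
  have hS' := (continuous_series (a := a) (b := b) hd)
  have e : fc a b (fun x => series a b c x * series a b d x) = conv c d := by
    rw [fc_series_mul hc (fun _ _ => rfl) (integrableOn_of_continuousOn hS'.continuousOn),
      fc_series hab hd]
  have h3 := eq_series_Icc hab (u := fun x => series a b c x * series a b d x)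
    (hS.mul hS').continuousOn (by rw [e]; exact hcd)
  rw [e] at h3
  rw [← gridCoeff_samples (N := N) hab hcd h3, gridCoeff_mul, h1, h2]

/-- The aliasing error of a product. -/
lemma sn_trunc_conv_sub_le (hab : a < b) (hK : AlgConst a b m K) (hm : 3 ≤ m)
    (hh : mesh a b N ≤ 1) {c d : ℤ → ℂ} {x : ℝ} (hx : 1 ≤ x)
    (hc : (intFreq a b).hs m c ≤ ENNReal.ofReal (x ^ 2))
    (hd : (intFreq a b).hs m d ≤ ENNReal.ofReal (x ^ 2)) :
    (gridFreq a b N).sn 1 (trunc N (conv c d) - conv (trunc N c) (trunc N d)) ≤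
      4 * K ^ 3 * x ^ 2 * mesh a b N ^ (m - 1) := by
  have hK0 := hK.pos
  have hK1 := hK.one_le
  have hx0 : 0 ≤ x := zero_le_one.trans hx
  have hh0 := mesh_pos (N := N) hab
  set η := mesh a b N ^ (m - 1) with hη
  have hη0 : 0 < η := by positivity
  have hη1 : η ≤ 1 := pow_le_one₀ hh0.le hh
  have hcd := hK.hs_conv_le (by omega) hc hd
  have hA := hK.isAlg hm le_rfl N
  -- Since folding is multiplicative, passing through it leaves only differences of truncation and
  -- folding, each of size h^(m-1).
  have e : trunc N (conv c d) - conv (trunc N c) (trunc N d) =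
      (trunc N (conv c d) - fold N (conv c d)) - (conv (trunc N c - fold N c) (fold N d) +
        conv (trunc N c) (trunc N d - fold N d)) := by
    rw [fold_conv hab (summable_norm_of_hs_le hab (by omega) hc)
      (summable_norm_of_hs_le hab (by omega) hd) (summable_norm_of_hs_le hab (by omega) hcd)]
    simp only [sub_conv, conv_sub]
    abel
  have h1 := sn_trunc_sub_fold_le (N := N) hab hK.fold hK0.le (s := 1) (by omega) (by positivity) hcd
  have h2 := sn_trunc_sub_fold_le (N := N) hab hK.fold hK0.le (s := 1) (by omega) hx0 hc
  have h3 := sn_trunc_sub_fold_le (N := N) hab hK.fold hK0.le (s := 1) (by omega) hx0 hd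
  have h4 : (gridFreq a b N).sn 1 (trunc N c) ≤ x := sn_trunc_le (by omega) hx0 hc
  have h5 : (gridFreq a b N).sn 1 (trunc N d) ≤ x := sn_trunc_le (by omega) hx0 hd
  rw [← hη] at h1 h2 h3
  have h6 : (gridFreq a b N).sn 1 (fold N d) ≤ x + K * x := by
    have e6 : fold N d = trunc N d - (trunc N d - fold N d) := by abel
    rw [e6]
    exact (sn_sub_le_of h5 h3).trans (by nlinarith [mul_nonneg hK0.le hx0])
  have n1 := (gridFreq a b N).sn_nonneg 1 (trunc N c)
  have n2 := (gridFreq a b N).sn_nonneg 1 (fold N d)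
  have n3 := (gridFreq a b N).sn_nonneg 1 (trunc N c - fold N c)
  have n4 := (gridFreq a b N).sn_nonneg 1 (trunc N d - fold N d)
  have h7 : (gridFreq a b N).sn 1 (conv (trunc N c - fold N c) (fold N d)) ≤
      K * (K * x * η) * (x + K * x) := (hA.one _ _).trans (by gcongr)
  have h8 : (gridFreq a b N).sn 1 (conv (trunc N c) (trunc N d - fold N d)) ≤
      K * x * (K * x * η) := (hA.one _ _).trans (by gcongr)
  rw [e]
  refine (sn_sub_le_of h1 (sn_add_le_of h7 h8)).trans ?_
  have h9 : K ^ 2 * (x ^ 2 * η) ≤ K ^ 3 * (x ^ 2 * η) := by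
    gcongr
    norm_num
  nlinarith [h9]

variable (N) in
/-- The truncated Fourier coefficients of a solution satisfy the hypotheses of the error
analysis. -/
lemma SpectralData.exactData {W P Q : ℝ → ℤ → ℂ} {R : ℝ}
    (h : SpectralData a b T ε m (ENNReal.ofReal (R ^ 2)) W P Q) (hab : a < b) (hK : AlgConst a b m K)
    (hm : 5 ≤ m) (hh : mesh a b N ≤ 1) (hR : 1 ≤ R) :
    ExactData (gridFreq a b N) ε T (4 * K ^ 3 * R ^ 2) (mesh a b N ^ (m - 1))
      (fun t => trunc N (W t)) (fun t => trunc N (P t)) (fun t => trunc N (Q t))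
      (fun t => trunc N (conv (P t) (W t))) (fun t => trunc N (conv (W t) (J (W t)))) := by
  have hK0 := hK.pos
  have hK1 := hK.one_le
  have hR0 : 0 ≤ R := zero_le_one.trans hR
  have hK3 : 1 ≤ K ^ 3 := one_le_pow₀ hK1
  -- The largest requirement on the common constant is the aliasing bound of a product; the a priori
  -- bounds follow because K and R are at least 1.
  have hRB : R ≤ 4 * K ^ 3 * R ^ 2 := by nlinarith
  have hI : ∀ t ∈ Ioo 0 T, t ∈ Icc 0 T := fun t ht => Ioo_subset_Icc_self ht
  have hcont : ∀ {X : ℝ → ℤ → ℂ}, (∀ l, ContinuousOn (fun t => X t l) (Icc 0 T)) →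
      ∀ k : ZMod N, ContinuousOn (fun t => trunc N (X t) k) (Icc 0 T) := by
    intro X hX k
    unfold trunc
    split_ifs
    · exact hX _
    · exact continuousOn_const
  refine ⟨hcont h.cont_w, hcont h.cont_p, hcont h.cont_q, ?_, ?_, ?_, ?_, ?_, ?_, ?_, ?_, ?_, ?_, ?_⟩
  · intro t ht k
    unfold trunc
    split_ifs
    · exact h.deriv_w t ht _
    · simpa using hasDerivAt_const t (0 : ℂ)
  · intro t ht k
    unfold trunc
    split_ifs
    · exact h.deriv_p t ht _
    · simpa using hasDerivAt_const t (0 : ℂ)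
  · intro t ht k
    unfold trunc
    split_ifs
    · exact h.deriv_q t ht _
    · simpa using hasDerivAt_const t (0 : ℂ)
  · intro t ht
    rw [J_trunc, h.real_p t ht]
  · intro t ht
    rw [J_trunc, h.real_q t ht]
  · exact fun t ht => (sn_trunc_le hm hR0 (h.hs_w t ht)).trans hRB
  · exact fun t ht => (sn_trunc_le hm hR0 (h.hs_p t ht)).trans hRB
  · intro t ht
    refine le_trans ?_ hRB
    rw [← sn_real_smul _ (sq_nonneg ε)]
    refine Freq.sn_le_of_hs _ hR0 (le_trans ?_ (h.hs_q t ht))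
    refine le_trans (le_of_eq ?_) (mul_le_mul_right
      ((hs_trunc_le (N := N) 5 (Q t)).trans ((intFreq a b).hs_mono hm (Q t))) _)
    rw [Freq.hs_eq_ofReal, Freq.hs_eq_ofReal, sn_real_smul _ (sq_nonneg ε), mul_pow,
      ENNReal.ofReal_mul (by positivity), ENNReal.ofReal_pow (by positivity)]
  · intro t ht
    have := hK.hs_conv_le (by omega) (h.hs_p t (hI t ht)) (h.hs_w t (hI t ht))
    refine (sn_trunc_le (by omega) (by positivity) this).trans ?_
    have : K ≤ K ^ 3 := le_self_pow₀ hK1 (by norm_num)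
    nlinarith [mul_le_mul_of_nonneg_right this (sq_nonneg R), mul_nonneg hK0.le (sq_nonneg R)]
  · intro t ht
    exact sn_trunc_conv_sub_le hab hK (by omega) hh hR (h.hs_p t (hI t ht)) (h.hs_w t (hI t ht))
  · intro t ht
    have hW := h.hs_w t (hI t ht)
    simp only [J_trunc]
    exact sn_trunc_conv_sub_le hab hK (by omega) hh hR hW (by rw [Freq.hs_J]; exact hW)

end Project

/-! ### Additional regularity of the initial data -/

section Regularity

variable {a b T : ℝ} {m : ℕ}

/-- Any finite set of modes lies strictly below the cut-off for large N, so bounds uniform over the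
grids pass to the full family. -/
lemma hs_le_of_trunc {s : ℕ} {c : ℤ → ℂ} {C : ℝ≥0∞}
    (h : ∀ N : ℕ, [NeZero N] → (gridFreq a b N).hs s (trunc N c) ≤ C) :
    (intFreq a b).hs s c ≤ C := by
  rw [Freq.hs, ENNReal.tsum_eq_iSup_sum]
  refine iSup_le fun A => ?_
  set N := 2 * A.sup Int.natAbs + 1 with hN
  have : NeZero N := ⟨by omega⟩
  have hA : ∀ l ∈ A, 2 * l.natAbs < N := fun l hl => by
    have := Finset.le_sup (f := Int.natAbs) hl
    omega
  have hv : ∀ l ∈ A, (l : ZMod N).valMinAbs = l := fun l hl => by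
    have := hA l hl
    rw [ZMod.valMinAbs_spec]
    exact ⟨rfl, by constructor <;> omega⟩
  refine le_trans ?_ (h N)
  rw [Freq.hs, tsum_fintype]
  calc _ = ∑ l ∈ A, (ENNReal.ofReal ((gridFreq a b N).ρ (l : ZMod N) ^ s) *
        ‖trunc N c (l : ZMod N)‖ₑ) ^ 2 := by
        refine Finset.sum_congr rfl fun l hl => ?_
        rw [gridFreq_rho, trunc, hv l hl, if_pos (hA l hl)]
    _ = ∑ k ∈ A.image (fun l : ℤ => (l : ZMod N)), (ENNReal.ofReal ((gridFreq a b N).ρ k ^ s) *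
        ‖trunc N c k‖ₑ) ^ 2 := by
        refine (Finset.sum_image (g := fun l : ℤ => (l : ZMod N)) (f := fun k : ZMod N =>
          (ENNReal.ofReal ((gridFreq a b N).ρ k ^ s) * ‖trunc N c k‖ₑ) ^ 2)
          fun l hl l' hl' e => ?_).symm
        rw [← hv l hl, ← hv l' hl']
        exact congrArg _ e
    _ ≤ _ := Finset.sum_le_univ_sum_of_nonneg fun _ => zero_le

lemma Freq.om_one {G : Type*} [AddCommGroup G] (F : Freq G) (l : G) : F.om 1 l = F.ρ l := by
  simp [Freq.om, Freq.ρ]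

/-- One derivative is gained at the initial time, since the kinetic and the potential energy of
every mode have almost the same mean over `[0,T]`. -/
lemma SpectralData.hs_succ_lt_top {W P Q : ℝ → ℤ → ℂ} {R : ℝ} (hab : a < b) (hT : 0 < T)
    (h : SpectralData a b T 1 m (ENNReal.ofReal (R ^ 2)) W P Q) (hm : 1 ≤ m) (hR : 0 ≤ R) :
    (intFreq a b).hs (m + 1) (P 0) < ⊤ := by
  obtain ⟨K, hK⟩ := exists_algConst hab m
  have hK0 := hK.pos
  set C : ℝ := (R + (2 * R + T * (K * R * R)) * T) / T with hC
  have hC0 : 0 ≤ C := by positivity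
  refine lt_of_le_of_lt (hs_le_of_trunc (C := ENNReal.ofReal (C ^ 2)) fun N _ => ?_)
    ENNReal.ofReal_lt_top
  set F := gridFreq a b N
  rw [F.hs_eq_ofReal]
  refine ENNReal.ofReal_le_ofReal (pow_le_pow_left₀ (F.sn_nonneg _ _) ?_ 2)
  have h0 : (0 : ℝ) ∈ Icc 0 T := ⟨le_rfl, hT.le⟩
  have h1 : T ∈ Icc 0 T := ⟨hT.le, le_rfl⟩
  let p : ℝ → ZMod N → ℂ := fun t => trunc N (P t)
  let q : ℝ → ZMod N → ℂ := fun t => trunc N (Q t)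
  let g : ℝ → ZMod N → ℂ := fun t => trunc N (conv (W t) (J (W t)))
  have hcont : ∀ {X : ℝ → ℤ → ℂ}, (∀ l, ContinuousOn (fun t => X t l) (Icc 0 T)) →
      ∀ k : ZMod N, ContinuousOn (fun t => trunc N (X t) k) (Icc 0 T) := by
    intro X hX k
    unfold trunc
    split_ifs
    · exact hX _
    · exact continuousOn_const
  have dp : ∀ t ∈ Ioo 0 T, ∀ k, HasDerivAt (fun t => p t k) (q t k) t := by
    intro t ht k
    simp only [p, q, trunc]
    split_ifs
    · exact h.deriv_p t ht _
    · exact hasDerivAt_const t (0 : ℂ)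
  have dq : ∀ t ∈ Ioo 0 T, ∀ k, HasDerivAt (fun t => q t k)
      (-((F.ρ k : ℂ) ^ 2 * p t k) + g t k) t := by
    intro t ht k
    simp only [p, q, g, trunc]
    split_ifs
    · refine (h.deriv_q t ht _).congr_deriv ?_
      rw [Freq.om_one]
      simp [F, gridFreq_rho]
    · simpa using hasDerivAt_const t (0 : ℂ)
  -- The bracket ρ cos(ρt) p - sin(ρt) q has derivative -sin(ρt) g, without a factor ρ. Weighted by
  -- T - t it still leaves -ρ cos(ρt) p, which the last term cancels. Hence Y(0) = Tρ p(0), whereas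
  -- Y' and Y(T) involve only p, q and g, all bounded in h^m.
  let Y : ℝ → ZMod N → ℂ := fun t k =>
    ((T - t : ℝ) : ℂ) * ((Real.cos (F.ρ k * t) : ℂ) * (F.ρ k * p t k) -
      (Real.sin (F.ρ k * t) : ℂ) * q t k) + (Real.sin (F.ρ k * t) : ℂ) * p t k
  let Y' : ℝ → ZMod N → ℂ := fun t =>
    (2 : ℂ) • ((fun k => (Real.sin (F.ρ k * t) : ℂ)) * q t) -
      ((T - t : ℝ) : ℂ) • ((fun k => (Real.sin (F.ρ k * t) : ℂ)) * g t)
  have cY : ∀ k, ContinuousOn (fun t => Y t k) (Icc 0 T) := by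
    intro k
    have c1 := hcont h.cont_p k
    have c2 := hcont h.cont_q k
    have c3 : Continuous fun t : ℝ => (Real.sin (F.ρ k * t) : ℂ) := by fun_prop
    have c4 : Continuous fun t : ℝ => (Real.cos (F.ρ k * t) : ℂ) := by fun_prop
    have c5 : Continuous fun t : ℝ => ((T - t : ℝ) : ℂ) := by fun_prop
    exact (c5.continuousOn.mul ((c4.continuousOn.mul (continuousOn_const.mul c1)).sub
      (c3.continuousOn.mul c2))).add (c3.continuousOn.mul c1)
  have dY : ∀ t ∈ Ioo 0 T, ∀ k, HasDerivAt (fun t => Y t k) (Y' t k) t := by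
    intro t ht k
    have hl : HasDerivAt (fun t : ℝ => F.ρ k * t) (F.ρ k) t := by
      simpa using (hasDerivAt_id t).const_mul (F.ρ k)
    have d3 := hl.sin.ofReal_comp
    have d4 := hl.cos.ofReal_comp
    have d5 := ((hasDerivAt_id t).const_sub T).ofReal_comp
    have d1 := dp t ht k
    have d2 := dq t ht k
    refine ((d5.mul ((d4.mul (d1.const_mul (F.ρ k : ℂ))).sub (d3.mul d2))).add
      (d3.mul d1)).congr_deriv ?_
    simp only [Y', Pi.sub_apply, Pi.smul_apply, Pi.mul_apply, smul_eq_mul, id]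
    push_cast
    ring
  have bQ : ∀ t ∈ Icc 0 T, F.sn m (q t) ≤ R := fun t ht =>
    sn_trunc_le le_rfl hR (by simpa using h.hs_q t ht)
  have bg : ∀ t ∈ Icc 0 T, F.sn m (g t) ≤ K * R * R := fun t ht =>
    sn_trunc_le le_rfl (by positivity)
      (hK.hs_conv_le hm (h.hs_w t ht) (by rw [Freq.hs_J]; exact h.hs_w t ht))
  have hsin : ∀ (t : ℝ) (c : ZMod N → ℂ),
      F.sn m ((fun k => (Real.sin (F.ρ k * t) : ℂ)) * c) ≤ F.sn m c := fun t c =>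
    F.sn_mul_le_of_le_one (fun k => by
      rw [Complex.norm_real, Real.norm_eq_abs]; exact Real.abs_sin_le_one _) c
  have bY : ∀ t ∈ Ioo 0 T, F.sn m (Y' t) ≤ 2 * R + T * (K * R * R) := by
    intro t ht
    have ht' := Ioo_subset_Icc_self ht
    refine sn_sub_le_of ?_ ?_
    · rw [F.sn_smul]
      have := (hsin t (q t)).trans (bQ t ht')
      simp only [Complex.norm_ofNat]
      linarith
    · rw [sn_real_smul _ (by linarith [ht.2])]
      have h2 := (hsin t (g t)).trans (bg t ht')
      have h3 : T - t ≤ T := by linarith [ht.1]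
      have h4 := F.sn_nonneg m ((fun k => (Real.sin (F.ρ k * t) : ℂ)) * g t)
      exact mul_le_mul h3 h2 h4 hT.le
  have hY := F.sn_sub_le_of_hasDerivAt hT.le cY dY bY
  have eY : (T : ℂ) • (fun k => (F.ρ k : ℂ) * p 0 k) =
      (fun k => (Real.sin (F.ρ k * T) : ℂ)) * p T - (Y T - Y 0) := by
    ext k
    simp [Y]
  have key : F.sn m ((T : ℂ) • (fun k => (F.ρ k : ℂ) * p 0 k)) ≤
      R + (2 * R + T * (K * R * R)) * T := by
    rw [eY]
    exact sn_sub_le_of ((hsin T (p T)).trans (sn_trunc_le le_rfl hR (h.hs_p T h1))) hY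
  rw [sn_real_smul _ hT.le] at key
  have e1 : F.sn (m + 1) (p 0) ≤ F.sn m (fun k => (F.ρ k : ℂ) * p 0 k) :=
    F.sn_le_of_le fun k => by
      rw [norm_mul, Complex.norm_real, Real.norm_eq_abs, abs_of_pos (F.rho_pos k), pow_succ, mul_assoc]
  rw [hC, le_div_iff₀ hT]
  nlinarith [e1, key]

end Regularity

/-! ### Bounds that are uniform in `ε` -/

section Uniform

variable {a b T ε K R : ℝ} {m N : ℕ}

lemma SpectralData.mono {M M' : ℝ≥0∞} {W P Q : ℝ → ℤ → ℂ} (h : SpectralData a b T ε m M W P Q)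
    (hM : M ≤ M') : SpectralData a b T ε m M' W P Q :=
  { h with
    hs_w := fun t ht => (h.hs_w t ht).trans hM
    hs_p := fun t ht => (h.hs_p t ht).trans hM
    hs_q := fun t ht => (h.hs_q t ht).trans hM }

lemma MemHper.hs_le_div (hab : a < b) {u : ℝ → ℂ} (h : MemHper a b m u) {X : ℝ≥0∞}
    (hX : hNorm a b m u ≤ X) :
    (intFreq a b).hs m (fc a b u) ≤ 2 ^ m * X ^ 2 / ENNReal.ofReal (b - a) := by
  rw [ENNReal.le_div_iff_mul_le (Or.inl (ENNReal.ofReal_pos.mpr (sub_pos.mpr hab)).ne')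
    (Or.inl ENNReal.ofReal_ne_top), mul_comm]
  exact (h.hs_le hab).trans (by gcongr)

variable {ψ₀ : ℝ → ℂ} {φ₀ φ₁ : ℝ → ℝ} {ψ : ℝ → ℝ → ℝ → ℂ} {φ φt : ℝ → ℝ → ℝ → ℝ}

lemma hNorm_le_Cψ (hε : ε ∈ Ioc (0 : ℝ) 1) {t : ℝ} (ht : t ∈ Icc 0 T) :
    hNorm a b m (ψ ε t) ≤ Cψ a b T m ψ :=
  le_iSup₂_of_le ε hε (le_iSup₂_of_le t ht le_rfl)

lemma hNorm_le_Cφ (hε : ε ∈ Ioc (0 : ℝ) 1) {t : ℝ} (ht : t ∈ Icc 0 T) :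
    hNorm a b m (fun x => (φ ε t x : ℂ)) ≤ Cφ a b T m φ φt :=
  le_iSup₂_of_le ε hε (le_iSup₂_of_le t ht (le_max_left _ _))

lemma mul_hNorm_le_Cφ (hε : ε ∈ Ioc (0 : ℝ) 1) {t : ℝ} (ht : t ∈ Icc 0 T) :
    ENNReal.ofReal (ε ^ 2) * hNorm a b m (fun x => (φt ε t x : ℂ)) ≤ Cφ a b T m φ φt :=
  le_iSup₂_of_le ε hε (le_iSup₂_of_le t ht (le_max_right _ _))

lemma exists_spectralData (hab : a < b) (hm : 3 ≤ m)
    (hsol : ∀ ε ∈ Ioc (0 : ℝ) 1, IsSolution a b T ε ψ₀ φ₀ φ₁ (ψ ε) (φ ε) (φt ε))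
    (hA : AssumptionA a b T m ψ φ φt) : ∃ R : ℝ, 1 ≤ R ∧ ∀ ε ∈ Ioc (0 : ℝ) 1,
      SpectralData a b T ε m (ENNReal.ofReal (R ^ 2)) (fun t => fc a b (ψ ε t))
        (fun t => fc a b fun x => (φ ε t x : ℂ)) (fun t => fc a b fun x => (φt ε t x : ℂ)) := by
  set X := max (Cψ a b T m ψ) (Cφ a b T m φ φt)
  have hX : X < ⊤ := max_lt hA.ψ_bound hA.φ_bound
  set M := 2 ^ m * X ^ 2 / ENNReal.ofReal (b - a)
  have hM : M < ⊤ := ENNReal.div_lt_top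
    (ENNReal.mul_ne_top (by simp) (ENNReal.pow_ne_top hX.ne))
    (ENNReal.ofReal_pos.mpr (sub_pos.mpr hab)).ne'
  refine ⟨1 + M.toReal, by linarith [M.toReal_nonneg], fun ε hε => ?_⟩
  have h1 := hA.ψ_reg ε hε
  have h2 := hA.φ_reg ε hε
  have hMR : M ≤ ENNReal.ofReal ((1 + M.toReal) ^ 2) := by
    rw [← ENNReal.ofReal_toReal hM.ne]
    refine ENNReal.ofReal_le_ofReal ?_
    rw [ENNReal.toReal_ofReal ENNReal.toReal_nonneg]
    nlinarith [M.toReal_nonneg]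
  refine ((hsol ε hε).spectralData hab hε.1 hm h1 h2 hM (fun t ht => ?_) (fun t ht => ?_)
    fun t ht => ?_).mono hMR
  · exact (h1 t ht).1.hs_le_div hab ((hNorm_le_Cψ hε ht).trans (le_max_left _ _))
  · exact (h2.1 t ht).1.hs_le_div hab ((hNorm_le_Cφ hε ht).trans (le_max_right _ _))
  · refine (mul_le_mul_right ((h2.2.1 t ht).1.hs_le_div hab le_rfl) _).trans ?_
    rw [← mul_div_assoc, mul_left_comm, ← mul_pow]
    refine ENNReal.div_le_div_right (mul_le_mul_right (pow_le_pow_left₀ zero_le ?_ 2) _) _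
    exact (mul_hNorm_le_Cφ hε ht).trans (le_max_right _ _)

/-- The extra derivative is available for ε = 1. As the initial value φ₀ is common to all ε, the
bound transfers to every ε with the same constant. -/
lemma exists_spectralData_init (hab : a < b) (hT : 0 < T) (hm : 3 ≤ m)
    (hsol : ∀ ε ∈ Ioc (0 : ℝ) 1, IsSolution a b T ε ψ₀ φ₀ φ₁ (ψ ε) (φ ε) (φt ε))
    (hA : AssumptionA a b T m ψ φ φt) : ∃ R : ℝ, 1 ≤ R ∧ ∀ ε ∈ Ioc (0 : ℝ) 1,
      SpectralData a b T ε m (ENNReal.ofReal (R ^ 2)) (fun t => fc a b (ψ ε t))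
        (fun t => fc a b fun x => (φ ε t x : ℂ)) (fun t => fc a b fun x => (φt ε t x : ℂ)) ∧
      (intFreq a b).hs (m + 1) (fc a b fun x => (φ ε 0 x : ℂ)) ≤ ENNReal.ofReal (R ^ 2) := by
  obtain ⟨R, hR, h⟩ := exists_spectralData hab hm hsol hA
  have h1 : (1 : ℝ) ∈ Ioc (0 : ℝ) 1 := ⟨one_pos, le_rfl⟩
  have hMt : (intFreq a b).hs (m + 1) (fc a b fun x => (φ 1 0 x : ℂ)) < ⊤ := by
    have hs := h 1 h1
    have := hs.hs_succ_lt_top hab hT (le_trans (by norm_num) hm) (zero_le_one.trans hR)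
    exact this
  obtain ⟨M, hM0, hM⟩ : ∃ M : ℝ, 0 ≤ M ∧
      (intFreq a b).hs (m + 1) (fc a b fun x => (φ 1 0 x : ℂ)) ≤ ENNReal.ofReal M :=
    ⟨_, ENNReal.toReal_nonneg, (ENNReal.ofReal_toReal hMt.ne).ge⟩
  refine ⟨R + M, by linarith, fun ε hε => ⟨(h ε hε).mono
    (ENNReal.ofReal_le_ofReal ?_), ?_⟩⟩
  · clear hM hMt h hsol hA
    nlinarith
  have e : (fc a b fun x => (φ ε 0 x : ℂ)) = fc a b fun x => (φ 1 0 x : ℂ) :=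
    fc_congr_ae ((ae_restrict_iff' measurableSet_Ioo).mpr (ae_of_all _ fun x hx => by
      have hx' := Ioo_subset_Icc_self hx
      simp only [(hsol ε hε).φ_init x hx', (hsol 1 h1).φ_init x hx']))
  rw [e]
  refine hM.trans (ENNReal.ofReal_le_ofReal ?_)
  clear e hM hMt h hsol hA
  nlinarith

/-- The error of the initial values. -/
lemma SpectralData.lvlErr_fold_le [NeZero N] {W P Q : ℝ → ℤ → ℂ} (hab : a < b)
    (h : SpectralData a b T ε m (ENNReal.ofReal (R ^ 2)) W P Q) (hε : ε ∈ Ioc (0 : ℝ) 1)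
    (hT : 0 < T) (hK : AlgConst a b m K) (hm : 2 ≤ m) (hR : 1 ≤ R)
    (h0 : (intFreq a b).hs (m + 1) (P 0) ≤ ENNReal.ofReal (R ^ 2)) :
    lvlErr (gridFreq a b N) ε (trunc N (P 0)) (trunc N (Q 0)) (trunc N (W 0)) (fold N (P 0))
      (fold N (Q 0)) (fold N (W 0)) ≤ 4 * K ^ 3 * R ^ 2 * mesh a b N ^ (m - 1) := by
  have hK0 := hK.pos
  have hK1 := hK.one_le
  have hR0 : 0 ≤ R := zero_le_one.trans hR
  have hh := mesh_pos (N := N) hab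
  have ht : (0 : ℝ) ∈ Icc 0 T := ⟨le_rfl, hT.le⟩
  have hε2 : 0 < ε ^ 2 := pow_pos hε.1 2
  have a1 := sn_trunc_sub_fold_le (N := N) hab hK.fold hK0.le (s := 1) (by omega) hR0 (h.hs_w 0 ht)
  have a2 := sn_trunc_sub_fold_le (N := N) hab hK.fold hK0.le (s := 2) (by omega) hR0 h0
  have hQ : (intFreq a b).hs m (Q 0) ≤ ENNReal.ofReal ((R / ε ^ 2) ^ 2) := by
    rw [div_pow, ENNReal.ofReal_div_of_pos (by positivity), ENNReal.le_div_iff_mul_le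
      (Or.inl (ENNReal.ofReal_pos.mpr (by positivity)).ne') (Or.inl ENNReal.ofReal_ne_top),
      mul_comm, ENNReal.ofReal_pow hε2.le]
    exact h.hs_q 0 ht
  have a3 := sn_trunc_sub_fold_le (N := N) hab hK.fold hK0.le (s := 1) (by omega)
    (by positivity) hQ
  rw [show m + 1 - 2 = m - 1 by omega] at a2
  set F := gridFreq a b N
  -- The factor ε²ω ≤ ρ costs one derivative of φ at time 0. The additional regularity there
  -- restores the full order, (m + 1) - 2 = m - 1.
  have a4 : F.sn 1 (zed F ε (trunc N (P 0) - fold N (P 0)) (trunc N (Q 0) - fold N (Q 0))) ≤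
      F.sn 2 (trunc N (P 0) - fold N (P 0)) + ε ^ 2 * F.sn 1 (trunc N (Q 0) - fold N (Q 0)) := by
    generalize trunc N (P 0) - fold N (P 0) = c
    generalize trunc N (Q 0) - fold N (Q 0) = d
    have e : zed F ε c d = (fun l => ((ε ^ 2 * F.om ε l : ℝ) : ℂ)) * c -
        Complex.I • ((ε ^ 2 : ℝ) : ℂ) • d := by
      ext l
      simp only [zed, Pi.sub_apply, Pi.mul_apply, Pi.smul_apply, smul_eq_mul]
      push_cast
      ring
    rw [e]
    refine sn_sub_le_of ?_ ?_
    · have := F.sn_mul_le (s := 1) (k := 1) zero_le_one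
        (m := fun l => ((ε ^ 2 * F.om ε l : ℝ) : ℂ)) (fun l => by
          rw [Complex.norm_real, Real.norm_eq_abs,
            abs_of_nonneg (mul_nonneg hε2.le (F.om_pos hε.1 l).le), one_mul, pow_one]
          exact F.eps_sq_mul_om_le hε.1 hε.2 l) c
      simpa using this
    · rw [sn_I_smul, sn_real_smul _ hε2.le]
  have a5 : ε ^ 2 * F.sn 1 (trunc N (Q 0) - fold N (Q 0)) ≤ K * R * mesh a b N ^ (m - 1) := by
    have := mul_le_mul_of_nonneg_left a3 hε2.le
    refine this.trans (le_of_eq ?_)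
    have := hε.1.ne'
    field_simp
  rw [lvlErr, zed_sub]
  have h3 : K * R ≤ K ^ 3 * R ^ 2 :=
    mul_le_mul (le_self_pow₀ hK1 (by norm_num)) (le_self_pow₀ hR (by norm_num)) hR0 (by positivity)
  have h4 := mul_le_mul_of_nonneg_right h3 (pow_nonneg hh.le (m - 1))
  have h5 : 0 ≤ K ^ 3 * R ^ 2 * mesh a b N ^ (m - 1) := by positivity
  linarith

lemma gridCoeff_initLevel [NeZero N] (hab : a < b) (hm : 1 ≤ m) {ψ : ℝ → ℝ → ℂ} {φ φt : ℝ → ℝ → ℝ}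
    (h : IsSolution a b T ε ψ₀ φ₀ φ₁ ψ φ φt) (h1 : MemHper a b m (ψ 0))
    (h2 : MemHper a b m fun x => (φ 0 x : ℂ)) (h3 : MemHper a b m fun x => (φt 0 x : ℂ)) :
    gridCoeff (initLevel a b ε N ψ₀ φ₀ φ₁).Φ = fold N (fc a b fun x => (φ 0 x : ℂ)) ∧
    gridCoeff (initLevel a b ε N ψ₀ φ₀ φ₁).Φdot = fold N (fc a b fun x => (φt 0 x : ℂ)) ∧
    gridCoeff (initLevel a b ε N ψ₀ φ₀ φ₁).Ψ = fold N (fc a b (ψ 0)) := by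
  refine ⟨gridCoeff_samples (u := fun x => (φ₀ x : ℂ)) hab (h2.summable hab hm) fun x hx => ?_,
    gridCoeff_samples (u := fun x => ((1 / ε ^ 2 * φ₁ x : ℝ) : ℂ)) hab (h3.summable hab hm)
      fun x hx => ?_, gridCoeff_samples (u := ψ₀) hab (h1.summable hab hm) fun x hx => ?_⟩
  · rw [← h2.eq_series hab hm x hx, h.φ_init x hx]
  · rw [← h3.eq_series hab hm x hx, h.φt_init x hx]
  · rw [← h1.eq_series hab hm x hx, h.ψ_init x hx]

end Uniform

/-! ### Errors of the scheme in `H¹` -/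

/-- The properties of a solution for one `ε` which enter the error analysis, with constants `K`
and `R` that will not depend on `ε`. -/
structure RegularSolution (a b T ε : ℝ) (m : ℕ) (K R : ℝ) (ψ₀ : ℝ → ℂ) (φ₀ φ₁ : ℝ → ℝ)
    (ψ : ℝ → ℝ → ℂ) (φ φt : ℝ → ℝ → ℝ) : Prop where
  lt : a < b
  T_pos : 0 < T
  eps_mem : ε ∈ Ioc (0 : ℝ) 1
  five_le : 5 ≤ m
  algConst : AlgConst a b m K
  one_le : 1 ≤ R
  sol : IsSolution a b T ε ψ₀ φ₀ φ₁ ψ φ φt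
  mem_ψ : ∀ t ∈ Icc 0 T, MemHper a b m (ψ t)
  mem_φ : ∀ t ∈ Icc 0 T, MemHper a b m fun x => (φ t x : ℂ)
  mem_φt : ∀ t ∈ Icc 0 T, MemHper a b m fun x => (φt t x : ℂ)
  data : SpectralData a b T ε m (ENNReal.ofReal (R ^ 2)) (fun t => fc a b (ψ t))
    (fun t => fc a b fun x => (φ t x : ℂ)) (fun t => fc a b fun x => (φt t x : ℂ))
  init : (intFreq a b).hs (m + 1) (fc a b fun x => (φ 0 x : ℂ)) ≤ ENNReal.ofReal (R ^ 2)

namespace RegularSolution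

variable {a b T ε K R τ : ℝ} {m N : ℕ} {ψ₀ : ℝ → ℂ} {φ₀ φ₁ : ℝ → ℝ}
  {ψ : ℝ → ℝ → ℂ} {φ φt : ℝ → ℝ → ℝ} [NeZero N]
  (h : RegularSolution a b T ε m K R ψ₀ φ₀ φ₁ ψ φ φt)
include h

lemma isAlg : IsAlg (gridFreq a b N) (4 * K ^ 3 * R ^ 2) := by
  have hK := h.algConst.one_le
  have hR := h.one_le
  refine h.algConst.isAlg (le_trans (by norm_num) h.five_le) ?_ N
  have h1 : K ≤ K ^ 3 := le_self_pow₀ hK (by norm_num)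
  have h2 : 1 ≤ R ^ 2 := one_le_pow₀ hR
  nlinarith [mul_le_mul h1 h2 zero_le_one (by positivity : (0 : ℝ) ≤ K ^ 3)]

/-- The error bound at the time levels for the coefficients. -/
lemma close_num (hN : Even N) (hh : mesh a b N ≤ 1) (hτ : 0 < τ) (hτ1 : τ ≤ 1)
    (hsmall : convConst (4 * K ^ 3 * R ^ 2) T *
      (mesh a b N ^ (m - 1) + min (τ ^ 2 / ε ^ 2) (ε ^ 2)) ≤ 1) {n : ℕ} (hn : n * τ ≤ T) :
    Close (gridFreq a b N) ε (convConst (4 * K ^ 3 * R ^ 2) T *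
      (mesh a b N ^ (m - 1) + min (τ ^ 2 / ε ^ 2) (ε ^ 2)))
      (trunc N (fc a b fun x => (φ (n * τ) x : ℂ))) (trunc N (fc a b fun x => (φt (n * τ) x : ℂ)))
      (trunc N (fc a b (ψ (n * τ)))) (gridCoeff (num a b ε τ N ψ₀ φ₀ φ₁ n).Φ)
      (gridCoeff (num a b ε τ N ψ₀ φ₀ φ₁ n).Φdot) (gridCoeff (num a b ε τ N ψ₀ φ₀ φ₁ n).Ψ) := by
  have hm := h.five_le
  have hh0 := mesh_pos (N := N) h.lt
  have ht : (0 : ℝ) ∈ Icc 0 T := ⟨le_rfl, h.T_pos.le⟩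
  have hE := h.data.exactData N h.lt h.algConst hm hh h.one_le
  have hi := h.data.lvlErr_fold_le (N := N) h.lt h.eps_mem h.T_pos h.algConst (by omega) h.one_le
    h.init
  obtain ⟨e1, e2, e3⟩ := gridCoeff_initLevel (N := N) h.lt (by omega) h.sol (h.mem_ψ 0 ht)
    (h.mem_φ 0 ht) (h.mem_φt 0 ht)
  rw [← e1, ← e2, ← e3] at hi
  have := hE.close_of_numSeq h.isAlg h.eps_mem.1 h.eps_mem.2 (by positivity)
    (pow_le_one₀ hh0.le hh) hτ hτ1 (numSeq_num h.lt hN h.eps_mem.1) hi hsmall n hn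
  exact this

lemma hs_φt_le {t : ℝ} (ht : t ∈ Icc 0 T) :
    (intFreq a b).hs m (fc a b fun x => (φt t x : ℂ)) ≤ ENNReal.ofReal ((R / ε ^ 2) ^ 2) := by
  have hε2 : 0 < ε ^ 2 := pow_pos h.eps_mem.1 2
  rw [div_pow, ENNReal.ofReal_div_of_pos (by positivity), ENNReal.le_div_iff_mul_le
    (Or.inl (ENNReal.ofReal_pos.mpr (by positivity)).ne') (Or.inl ENNReal.ofReal_ne_top),
    mul_comm, ENNReal.ofReal_pow hε2.le]
  exact h.data.hs_q t ht

variable {x : ℝ} {Φ D Ψ : Fin (N + 1) → ℂ} {t : ℝ}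

lemma hNorm_ψ_le (hN : Even N) (ht : t ∈ Icc 0 T)
    (hx : (gridFreq a b N).sn 1 (trunc N (fc a b (ψ t)) - gridCoeff Ψ) ≤ x) :
    hNorm a b 1 (fun x => ψ t x - interpN a b N Ψ x) ≤
      ENNReal.ofReal (√(2 * (b - a)) * (R * mesh a b N ^ (m - 1) + x)) :=
  hNorm_sub_interpN_le h.lt hN (le_trans (by norm_num) h.five_le) (h.mem_ψ t ht)
    (zero_le_one.trans h.one_le) (h.data.hs_w t ht) Ψ hx

lemma hNorm_φ_le (hN : Even N) (ht : t ∈ Icc 0 T)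
    (hx : (gridFreq a b N).sn 1 (trunc N (fc a b fun x => (φ t x : ℂ)) - gridCoeff Φ) ≤ x) :
    hNorm a b 1 (fun x => (φ t x : ℂ) - interpN a b N Φ x) ≤
      ENNReal.ofReal (√(2 * (b - a)) * (R * mesh a b N ^ (m - 1) + x)) :=
  hNorm_sub_interpN_le h.lt hN (le_trans (by norm_num) h.five_le) (h.mem_φ t ht)
    (zero_le_one.trans h.one_le) (h.data.hs_p t ht) Φ hx

lemma mul_hNorm_φt_le (hN : Even N) (ht : t ∈ Icc 0 T) (hx : ε ^ 2 *
      (gridFreq a b N).sn 1 (trunc N (fc a b fun x => (φt t x : ℂ)) - gridCoeff D) ≤ x) :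
    ENNReal.ofReal (ε ^ 2) * hNorm a b 1 (fun x => (φt t x : ℂ) - interpN a b N D x) ≤
      ENNReal.ofReal (√(2 * (b - a)) * (R * mesh a b N ^ (m - 1) + x)) := by
  have hε2 : 0 < ε ^ 2 := pow_pos h.eps_mem.1 2
  have hR := zero_le_one.trans h.one_le
  have := hNorm_sub_interpN_le h.lt hN (le_trans (by norm_num) h.five_le) (h.mem_φt t ht)
    (by positivity) (h.hs_φt_le ht) D (x := x / ε ^ 2) (by rwa [le_div_iff₀ hε2, mul_comm])
  refine (mul_le_mul_right this _).trans ?_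
  rw [← ENNReal.ofReal_mul hε2.le]
  refine ENNReal.ofReal_le_ofReal (le_of_eq ?_)
  have := h.eps_mem.1.ne'
  field_simp

/-- The errors at the time levels. -/
lemma level_bounds (hN : Even N) (hh : mesh a b N ≤ 1) (hτ : 0 < τ) (hτ1 : τ ≤ 1)
    (hsmall : convConst (4 * K ^ 3 * R ^ 2) T *
      (mesh a b N ^ (m - 1) + min (τ ^ 2 / ε ^ 2) (ε ^ 2)) ≤ 1) {n : ℕ} (hn : n * τ ≤ T) {e : ℝ}
    (he : √(2 * (b - a)) * ((R + convConst (4 * K ^ 3 * R ^ 2) T) *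
      (mesh a b N ^ (m - 1) + min (τ ^ 2 / ε ^ 2) (ε ^ 2))) ≤ e) :
    hNorm a b 1 (fun x => ψ (n * τ) x - interpN a b N (num a b ε τ N ψ₀ φ₀ φ₁ n).Ψ x) ≤
      ENNReal.ofReal e ∧
    hNorm a b 1 (fun x => (φ (n * τ) x : ℂ) - interpN a b N (num a b ε τ N ψ₀ φ₀ φ₁ n).Φ x) ≤
      ENNReal.ofReal e ∧
    ENNReal.ofReal (ε ^ 2) * hNorm a b 1 (fun x => (φt (n * τ) x : ℂ) -
      interpN a b N (num a b ε τ N ψ₀ φ₀ φ₁ n).Φdot x) ≤ ENNReal.ofReal e := by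
  have hc := h.close_num hN hh hτ hτ1 hsmall hn
  have ht : (n * τ : ℝ) ∈ Icc 0 T := ⟨by positivity, hn⟩
  have hR := zero_le_one.trans h.one_le
  have hδ : 0 ≤ min (τ ^ 2 / ε ^ 2) (ε ^ 2) := by positivity
  have he' : √(2 * (b - a)) * (R * mesh a b N ^ (m - 1) + convConst (4 * K ^ 3 * R ^ 2) T *
      (mesh a b N ^ (m - 1) + min (τ ^ 2 / ε ^ 2) (ε ^ 2))) ≤ e := by
    refine le_trans (mul_le_mul_of_nonneg_left ?_ (Real.sqrt_nonneg _)) he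
    nlinarith [mul_nonneg hR hδ]
  exact ⟨(h.hNorm_ψ_le hN ht hc.sn_w).trans (ENNReal.ofReal_le_ofReal he'),
    (h.hNorm_φ_le hN ht (hc.sn_p h.eps_mem.1)).trans (ENNReal.ofReal_le_ofReal he'),
    (h.mul_hNorm_φt_le hN ht hc.sn_q).trans (ENNReal.ofReal_le_ofReal he')⟩

/-- The errors of the interpolation in time. -/
lemma interp_bounds (hN : Even N) (hh : mesh a b N ≤ 1) (hτ : 0 < τ) (hτ1 : τ ≤ 1)
    (hsmall : convConst (4 * K ^ 3 * R ^ 2) T *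
      (mesh a b N ^ (m - 1) + min (τ ^ 2 / ε ^ 2) (ε ^ 2)) ≤ 1) (ht : t ∈ Icc 0 T) {e : ℝ}
    (he : √(2 * (b - a)) * ((R + 40 * (4 * K ^ 3 * R ^ 2) ^ 5 *
      (convConst (4 * K ^ 3 * R ^ 2) T + 1)) * (mesh a b N ^ (m - 1) +
        min (τ ^ 2 / ε ^ 2) (ε ^ 2) + min (τ ^ 2 / ε ^ 2) τ)) ≤ e)
    (hconv : 0 ≤ convConst (4 * K ^ 3 * R ^ 2) T) :
    errPsi a b ε τ N ψ₀ φ₀ φ₁ ψ t ≤ ENNReal.ofReal e ∧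
      errPhi a b ε τ N ψ₀ φ₀ φ₁ φ t ≤ ENNReal.ofReal e := by
  -- The level in the definition of `Psi` and `Phi`. After a shift by nτ the estimates on a single
  -- step apply, on a time interval of length T - nτ.
  set n := ⌊t / τ⌋₊ with hn
  have hdiv : 0 ≤ t / τ := div_nonneg ht.1 hτ.le
  have h1 : n * τ ≤ t := by
    rw [← le_div_iff₀ hτ]; exact Nat.floor_le hdiv
  have h2 : t - n * τ ≤ τ := by
    have := Nat.lt_floor_add_one (t / τ)
    rw [div_lt_iff₀ hτ] at this
    linarith
  have hn0 : (0 : ℝ) ≤ n * τ := by positivity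
  have hnT : n * τ ≤ T := h1.trans ht.2
  have hh0 := mesh_pos (N := N) h.lt
  have hR := zero_le_one.trans h.one_le
  set B := 4 * K ^ 3 * R ^ 2 with hB
  have hA := h.isAlg (N := N)
  rw [← hB] at hA
  have hB0 : 0 ≤ B := zero_le_one.trans hA.one_le
  set η := mesh a b N ^ (m - 1)
  set δ := min (τ ^ 2 / ε ^ 2) (ε ^ 2)
  set δ' := min (τ ^ 2 / ε ^ 2) τ
  have hη0 : 0 ≤ η := by positivity
  have hδ0 : 0 ≤ δ := by positivity
  have hδ0' : 0 ≤ δ' := by positivity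
  have hE := (h.data.exactData N h.lt h.algConst h.five_le hh h.one_le).shift hn0
  have hc := h.close_num hN hh hτ hτ1 hsmall hnT
  rw [← add_zero ((n : ℝ) * τ)] at hc
  have hs : t - n * τ ∈ Icc 0 (T - n * τ) := ⟨by linarith, by linarith [ht.2]⟩
  have k1 := hE.interp_psi hA hc h.eps_mem.1 h.eps_mem.2 hη0 hsmall hτ hτ1 hs h2
  have k2 := hE.interp_phi hA hc h.eps_mem.1 (pow_le_one₀ hh0.le hh) hsmall hτ hτ1 hs h2
  rw [← gridCoeff_localPsi h.lt hN, add_sub_cancel] at k1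
  rw [← gridCoeff_localPhi h.lt hN h.eps_mem.1, add_sub_cancel] at k2
  have hp : 0 ≤ 40 * B ^ 5 := by positivity
  have he1 : √(2 * (b - a)) * (R * η + 40 * B ^ 5 * (convConst B T * (η + δ) + η + δ')) ≤ e := by
    refine le_trans (mul_le_mul_of_nonneg_left ?_ (Real.sqrt_nonneg _)) he
    have q1 : R * η ≤ R * (η + δ + δ') := by gcongr; linarith
    have q2 : 40 * B ^ 5 * (convConst B T * (η + δ) + η + δ') ≤
        40 * B ^ 5 * ((convConst B T + 1) * (η + δ + δ')) := by
      gcongr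
      nlinarith [mul_nonneg hconv hδ0']
    linarith
  have he2 : √(2 * (b - a)) * (R * η + 40 * B ^ 5 * (convConst B T * (η + δ) + δ')) ≤ e := by
    refine le_trans (mul_le_mul_of_nonneg_left ?_ (Real.sqrt_nonneg _)) he1
    gcongr
    linarith
  exact ⟨(h.hNorm_ψ_le hN ht k1).trans (ENNReal.ofReal_le_ofReal he1),
    (h.hNorm_φ_le hN ht k2).trans (ENNReal.ofReal_le_ofReal he2)⟩

end RegularSolution

/-! ### Choice of the constants -/

section Constants

variable {a b T ε τ : ℝ} {m N : ℕ}

lemma convConst_nonneg {B : ℝ} (hB : 0 ≤ B) (hT : 0 ≤ T) : 0 ≤ convConst B T := by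
  unfold convConst; positivity

/-- The two quantities have the product τ², so the smaller one is at most τ. This makes the error
bound uniform in ε. -/
lemma min_sq_div_sq_le (hε : 0 < ε) (hτ : 0 < τ) : min (τ ^ 2 / ε ^ 2) (ε ^ 2) ≤ τ := by
  rcases le_total (ε ^ 2) τ with h | h
  · exact (min_le_right _ _).trans h
  · refine (min_le_left _ _).trans ?_
    rw [div_le_iff₀ (by positivity)]
    nlinarith

lemma min_le_maxMin (hε : ε ∈ Ioc (0 : ℝ) 1) : min (τ ^ 2 / ε ^ 2) (ε ^ 2) ≤ maxMin τ := by
  refine le_csSup ⟨1, ?_⟩ ⟨ε, hε, rfl⟩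
  rintro _ ⟨e, he, rfl⟩
  exact (min_le_right _ _).trans (pow_le_one₀ he.1.le he.2)

/-- The triangle inequality for the interpolant. -/
lemma hNorm_interpN_le {u : ℝ → ℂ} [NeZero N] (hab : a < b) (hm : 1 ≤ m) (hu : MemHper a b m u)
    (v : Fin (N + 1) → ℂ) : hNorm a b 1 (interpN a b N v) ≤
      hNorm a b m u + hNorm a b 1 (fun x => u x - interpN a b N v x) := by
  have hu1 := hu.mono hm
  have h := hu1.hNorm_sub_le (hu1.sub (memHper_interpN (N := N) hab 1 v))
  simp only [sub_sub_cancel] at h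
  exact h.trans (by gcongr; exact hNorm_mono hm u)

/-- The weight `r` is 1 for ψ and φ and ε² for ∂ₜφ, where only the weighted norm is uniformly
bounded. -/
lemma hNorm_interpN_le_add_one {u : ℝ → ℂ} [NeZero N] (hab : a < b) (hm : 1 ≤ m)
    (hu : MemHper a b m u) {v : Fin (N + 1) → ℂ} {X : ℝ≥0∞} {e r : ℝ} (hr : 0 < r) (he : e ≤ 1)
    (hX : ENNReal.ofReal r * hNorm a b m u ≤ X)
    (h : ENNReal.ofReal r * hNorm a b 1 (fun x => u x - interpN a b N v x) ≤ ENNReal.ofReal e) :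
    hNorm a b 1 (interpN a b N v) ≤ ENNReal.ofReal (1 / r) * (X + 1) := by
  have h1 : ENNReal.ofReal (1 / r) * ENNReal.ofReal r = 1 := by
    rw [← ENNReal.ofReal_mul (by positivity), one_div_mul_cancel hr.ne', ENNReal.ofReal_one]
  calc _ = ENNReal.ofReal (1 / r) * (ENNReal.ofReal r * hNorm a b 1 (interpN a b N v)) := by
        rw [← mul_assoc, h1, one_mul]
    _ ≤ ENNReal.ofReal (1 / r) * (X + 1) := by
        refine mul_le_mul_right ((mul_le_mul_right (hNorm_interpN_le hab hm hu v) _).trans ?_) _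
        rw [mul_add]
        refine add_le_add hX (h.trans ?_)
        rw [← ENNReal.ofReal_one]
        exact ENNReal.ofReal_le_ofReal he

/-- The number serves as bound for both h and τ; the two summands stand for h^(m₀-1) ≤ h and
min(τ²/ε², ε²) ≤ τ. -/
lemma exists_small {C : ℝ} (hC : 0 ≤ C) : ∃ h₀ : ℝ, 0 < h₀ ∧ h₀ < 1 ∧ (C + 1) * (h₀ + h₀) ≤ 1 := by
  refine ⟨1 / (2 * (C + 1)), by positivity, ?_, le_of_eq ?_⟩
  · rw [div_lt_one (by positivity)]
    linarith
  · have : C + 1 ≠ 0 := by positivity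
    field_simp
    norm_num

lemma three_mul_le_add_mul {A A' x y : ℝ} (hA : 0 ≤ A) (hA' : 0 ≤ A') (hy : 0 ≤ y) (h : x ≤ y) :
    3 * (A * x) ≤ (3 * A + 2 * A' + 1) * y := by
  nlinarith [mul_le_mul_of_nonneg_left h hA, mul_nonneg hA' hy]

lemma mul_le_add_mul {A A' x y : ℝ} (hA : 0 ≤ A) (hA' : 0 ≤ A') (hy : 0 ≤ y) (h : x ≤ 2 * y) :
    A' * x ≤ (3 * A + 2 * A' + 1) * y := by
  nlinarith [mul_le_mul_of_nonneg_left h hA', mul_nonneg hA hy]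

end Constants

end KGS

end

/-! ### The theorem -/

theorem theorem2 (a b T : ℝ) (hab : a < b) (hT : 0 < T) (m₀ : ℕ) (hm₀ : 5 ≤ m₀)
    (ψ₀ : ℝ → ℂ) (φ₀ φ₁ : ℝ → ℝ) (ψ : ℝ → ℝ → ℝ → ℂ) (φ φt : ℝ → ℝ → ℝ → ℝ)
    (hsol : ∀ ε ∈ Ioc (0 : ℝ) 1, KGS.IsSolution a b T ε ψ₀ φ₀ φ₁ (ψ ε) (φ ε) (φt ε))
    (hA : KGS.AssumptionA a b T m₀ ψ φ φt) :
    ∃ h₀ τ₀ C : ℝ, 0 < h₀ ∧ h₀ < 1 ∧ 0 < τ₀ ∧ τ₀ < 1 ∧ 0 < C ∧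
      ∀ ε ∈ Ioc (0 : ℝ) 1, ∀ N : ℕ, 0 < N → Even N → KGS.mesh a b N ≤ h₀ →
      ∀ τ : ℝ, 0 < τ → τ ≤ τ₀ →
        -- the bounds at the time levels that `h₀`, `τ₀` come from
        (∀ n : ℕ, n * τ ≤ T →
          KGS.levelErr a b ε τ N n (ψ ε) (φ ε) (φt ε) (KGS.num a b ε τ N ψ₀ φ₀ φ₁ n)
              ≤ ENNReal.ofReal (C * (KGS.mesh a b N ^ (m₀ - 1) + τ ^ 2 / ε ^ 2)) ∧
          KGS.levelErr a b ε τ N n (ψ ε) (φ ε) (φt ε) (KGS.num a b ε τ N ψ₀ φ₀ φ₁ n)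
              ≤ ENNReal.ofReal (C * (KGS.mesh a b N ^ (m₀ - 1) + ε ^ 2)) ∧
          KGS.hNorm a b 1 (KGS.interpN a b N (KGS.num a b ε τ N ψ₀ φ₀ φ₁ n).Ψ)
              ≤ KGS.Cψ a b T m₀ ψ + 1 ∧
          KGS.hNorm a b 1 (KGS.interpN a b N (KGS.num a b ε τ N ψ₀ φ₀ φ₁ n).Φ)
              ≤ KGS.Cφ a b T m₀ φ φt + 1 ∧
          KGS.hNorm a b 1 (KGS.interpN a b N (KGS.num a b ε τ N ψ₀ φ₀ φ₁ n).Φdot)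
              ≤ ENNReal.ofReal (1 / ε ^ 2) * (KGS.Cφ a b T m₀ φ φt + 1)) ∧
        -- the interpolation is well defined, also at the time levels
        (∀ n : ℕ, ∀ s ∈ Icc 0 τ,
          KGS.Psi a b ε τ N ψ₀ φ₀ φ₁ (n * τ + s)
              = KGS.localPsi a b ε τ N (KGS.num a b ε τ N ψ₀ φ₀ φ₁ n) s ∧
          KGS.Phi a b ε τ N ψ₀ φ₀ φ₁ (n * τ + s)
              = KGS.localPhi a b ε τ N (KGS.num a b ε τ N ψ₀ φ₀ φ₁ n) s) ∧
        -- the error bounds for all times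
        (∀ t ∈ Icc 0 T,
          (KGS.errPsi a b ε τ N ψ₀ φ₀ φ₁ (ψ ε) t
              ≤ ENNReal.ofReal (C * (KGS.mesh a b N ^ (m₀ - 1) + τ ^ 2 / ε ^ 2)) ∧
            KGS.errPsi a b ε τ N ψ₀ φ₀ φ₁ (ψ ε) t
              ≤ ENNReal.ofReal (C * (KGS.mesh a b N ^ (m₀ - 1) + τ + ε ^ 2))) ∧
          (KGS.errPhi a b ε τ N ψ₀ φ₀ φ₁ (φ ε) t
              ≤ ENNReal.ofReal (C * (KGS.mesh a b N ^ (m₀ - 1) + τ ^ 2 / ε ^ 2)) ∧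
            KGS.errPhi a b ε τ N ψ₀ φ₀ φ₁ (φ ε) t
              ≤ ENNReal.ofReal (C * (KGS.mesh a b N ^ (m₀ - 1) + τ + ε ^ 2))) ∧
          (KGS.errPsi a b ε τ N ψ₀ φ₀ φ₁ (ψ ε) t
              ≤ ENNReal.ofReal (C * (KGS.mesh a b N ^ (m₀ - 1) + τ + KGS.maxMin τ)) ∧
            KGS.errPsi a b ε τ N ψ₀ φ₀ φ₁ (ψ ε) t
              ≤ ENNReal.ofReal (C * (KGS.mesh a b N ^ (m₀ - 1) + τ))) ∧
          (KGS.errPhi a b ε τ N ψ₀ φ₀ φ₁ (φ ε) t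
              ≤ ENNReal.ofReal (C * (KGS.mesh a b N ^ (m₀ - 1) + τ + KGS.maxMin τ)) ∧
            KGS.errPhi a b ε τ N ψ₀ φ₀ φ₁ (φ ε) t
              ≤ ENNReal.ofReal (C * (KGS.mesh a b N ^ (m₀ - 1) + τ)))) := by
  obtain ⟨R, hR, hdata⟩ := KGS.exists_spectralData_init hab hT (le_trans (by norm_num) hm₀) hsol hA
  obtain ⟨K, hK⟩ := KGS.exists_algConst hab m₀
  have hreg : ∀ ε ∈ Ioc (0 : ℝ) 1,
      KGS.RegularSolution a b T ε m₀ K R ψ₀ φ₀ φ₁ (ψ ε) (φ ε) (φt ε) := fun ε hε =>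
    { lt := hab
      T_pos := hT
      eps_mem := hε
      five_le := hm₀
      algConst := hK
      one_le := hR
      sol := hsol ε hε
      mem_ψ := fun t ht => (hA.ψ_reg ε hε t ht).1
      mem_φ := fun t ht => ((hA.φ_reg ε hε).1 t ht).1
      mem_φt := fun t ht => ((hA.φ_reg ε hε).2.1 t ht).1
      data := (hdata ε hε).1
      init := (hdata ε hε).2 }
  have hK0 := hK.pos
  have hR0 : 0 < R := zero_lt_one.trans_le hR
  have hm1 : 1 ≤ m₀ := le_trans (by norm_num) hm₀
  obtain ⟨B, hB⟩ : ∃ B, B = 4 * K ^ 3 * R ^ 2 := ⟨_, rfl⟩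
  have hB0 : 0 ≤ B := by rw [hB]; positivity
  obtain ⟨C₁, hC₁⟩ : ∃ C₁, C₁ = KGS.convConst B T := ⟨_, rfl⟩
  have hC₁0 : 0 ≤ C₁ := hC₁ ▸ KGS.convConst_nonneg hB0 hT.le
  obtain ⟨A₁, hA₁⟩ : ∃ A₁, A₁ = √(2 * (b - a)) * (R + C₁) := ⟨_, rfl⟩
  have hA₁0 : 0 ≤ A₁ := by rw [hA₁]; positivity
  obtain ⟨A₂, hA₂⟩ : ∃ A₂, A₂ = √(2 * (b - a)) * (R + 40 * B ^ 5 * (C₁ + 1)) := ⟨_, rfl⟩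
  have hA₂0 : 0 ≤ A₂ := by rw [hA₂]; positivity
  -- Smallness is used twice: with C₁ to keep the coefficients within distance 1 in the induction,
  -- and with A₁ to have H¹ errors of at most 1, which give the bounds with C_ψ + 1 and C_φ + 1.
  obtain ⟨h₀, hh₀, hh₀', hh₀''⟩ := KGS.exists_small (add_nonneg hC₁0 hA₁0)
  -- 3A₁ covers the three terms of the level error, 2A₂ the two minima in the interpolation error,
  -- and 1 makes the constant positive.
  refine ⟨h₀, h₀, 3 * A₁ + 2 * A₂ + 1, hh₀, hh₀', hh₀, hh₀', by positivity,
    fun ε hε N hN0 hN hmesh τ hτ hττ => ?_⟩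
  have : NeZero N := ⟨hN0.ne'⟩
  have hmesh0 := KGS.mesh_pos (N := N) hab
  have hmesh1 : KGS.mesh a b N ≤ 1 := hmesh.trans hh₀'.le
  have hτ1 : τ ≤ 1 := hττ.trans hh₀'.le
  have r := hreg ε hε
  obtain ⟨η, hη⟩ : ∃ η, η = KGS.mesh a b N ^ (m₀ - 1) := ⟨_, rfl⟩
  have hη0 : 0 ≤ η := by rw [hη]; positivity
  have hηh : η ≤ h₀ := by
    rw [hη]
    exact (pow_le_of_le_one hmesh0.le hmesh1 (by omega)).trans hmesh
  obtain ⟨δ, hδ⟩ : ∃ δ, δ = min (τ ^ 2 / ε ^ 2) (ε ^ 2) := ⟨_, rfl⟩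
  have hδ0 : 0 ≤ δ := by rw [hδ]; positivity
  have hδ1 : δ ≤ τ ^ 2 / ε ^ 2 := hδ ▸ min_le_left _ _
  have hδ2 : δ ≤ ε ^ 2 := hδ ▸ min_le_right _ _
  have hδ3 : δ ≤ τ := hδ ▸ KGS.min_sq_div_sq_le hε.1 hτ
  have hδ4 : δ ≤ KGS.maxMin τ := hδ ▸ KGS.min_le_maxMin hε
  obtain ⟨δ', hδ'⟩ : ∃ δ', δ' = min (τ ^ 2 / ε ^ 2) τ := ⟨_, rfl⟩
  have hδ'0 : 0 ≤ δ' := by rw [hδ']; positivity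
  have hδ'1 : δ' ≤ τ ^ 2 / ε ^ 2 := hδ' ▸ min_le_left _ _
  have hδ'2 : δ' ≤ τ := hδ' ▸ min_le_right _ _
  have hsum : (C₁ + A₁ + 1) * (η + δ) ≤ 1 :=
    le_trans (mul_le_mul_of_nonneg_left (by linarith) (by positivity)) hh₀''
  have hsmall : C₁ * (η + δ) ≤ 1 := by
    nlinarith [mul_nonneg hA₁0 (add_nonneg hη0 hδ0)]
  have hA₁small : A₁ * (η + δ) ≤ 1 := by
    nlinarith [mul_nonneg hC₁0 (add_nonneg hη0 hδ0)]
  have hsmall' := hsmall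
  rw [hC₁, hB, hη, hδ] at hsmall'
  rw [← hη]
  refine ⟨fun n hn => ?_, fun n s hs => KGS.interp_eq_local hab hN hτ n hs, fun t ht => ?_⟩
  · obtain ⟨b1, b2, b3⟩ := r.level_bounds hN hmesh1 hτ hτ1 hsmall' hn (e := A₁ * (η + δ))
      (by rw [← hη, ← hδ, ← hB, ← hC₁, hA₁, mul_assoc])
    have ht : (n * τ : ℝ) ∈ Icc 0 T := ⟨by positivity, hn⟩
    have hlev : KGS.levelErr a b ε τ N n (ψ ε) (φ ε) (φt ε) (KGS.num a b ε τ N ψ₀ φ₀ φ₁ n) ≤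
        ENNReal.ofReal (3 * (A₁ * (η + δ))) := by
      refine (add_le_add (add_le_add b1 b2) b3).trans (le_of_eq ?_)
      rw [← ENNReal.ofReal_add (by positivity) (by positivity),
        ← ENNReal.ofReal_add (by positivity) (by positivity)]
      congr 1
      ring
    have hbd : ∀ y, δ ≤ y → 3 * (A₁ * (η + δ)) ≤ (3 * A₁ + 2 * A₂ + 1) * (η + y) := fun y hy =>
      KGS.three_mul_le_add_mul hA₁0 hA₂0 (add_nonneg hη0 (hδ0.trans hy)) (add_le_add_right hy η)
    refine ⟨hlev.trans (ENNReal.ofReal_le_ofReal (hbd _ hδ1)),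
      hlev.trans (ENNReal.ofReal_le_ofReal (hbd _ hδ2)), ?_, ?_, ?_⟩
    · simpa using KGS.hNorm_interpN_le_add_one hab hm1 (r.mem_ψ _ ht) one_pos hA₁small
        (by simpa using KGS.hNorm_le_Cψ hε ht) (by simpa using b1)
    · simpa using KGS.hNorm_interpN_le_add_one hab hm1 (r.mem_φ _ ht) one_pos hA₁small
        (by simpa using KGS.hNorm_le_Cφ (φt := φt) hε ht) (by simpa using b2)
    · exact KGS.hNorm_interpN_le_add_one hab hm1 (r.mem_φt _ ht) (pow_pos hε.1 2) hA₁small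
        (KGS.mul_hNorm_le_Cφ hε ht) b3
  -- All four bounds come from one estimate with δ + δ'. Both minima are at most τ²/ε² and at most
  -- τ, while δ alone is also at most ε² and at most `maxMin`.
  · have hbd : ∀ y, δ + δ' ≤ 2 * y → ENNReal.ofReal (A₂ * (η + δ + δ')) ≤
        ENNReal.ofReal ((3 * A₁ + 2 * A₂ + 1) * (η + y)) := fun y hy => by
      exact ENNReal.ofReal_le_ofReal
        (KGS.mul_le_add_mul hA₁0 hA₂0 (by linarith) (by linarith))
    have c1 := hbd (τ ^ 2 / ε ^ 2) (by linarith)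
    have c2 := hbd (τ + ε ^ 2) (by linarith)
    have c3 := hbd (τ + KGS.maxMin τ) (by linarith)
    have c4 := hbd τ (by linarith)
    rw [← add_assoc] at c2 c3
    obtain ⟨b1, b2⟩ := r.interp_bounds hN hmesh1 hτ hτ1 hsmall' ht (e := A₂ * (η + δ + δ'))
      (by rw [← hη, ← hδ, ← hδ', ← hB, ← hC₁, hA₂]; exact (mul_assoc _ _ _).ge)
      (by rw [← hB, ← hC₁]; exact hC₁0)
    exact ⟨⟨b1.trans c1, b1.trans c2⟩, ⟨b2.trans c1, b2.trans c2⟩, ⟨b1.trans c3, b1.trans c4⟩,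
      ⟨b2.trans c3, b2.trans c4⟩⟩
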